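/- Let $\mathbb K$ be a field of characteristic $0$. All categories below are $\mathbb Z$-graded and $\mathbb K$-linear: morphisms form vector spaces $\operatorname{Hom}^d(X,Y)$, $d\in\mathbb Z$, composition and tensor products are bilinear and add degrees, and there are no signs in the interchange law. **The dotted Temperley–Lieb category.** Let $\mathsf{dTL}$ be the graded monoidal category generated by one symmetrically self-dual object $c$, with cup $\mathrm{cup}\colon 1\to c\otimes c$ and cap $\mathrm{cap}\colon c\otimes c\to 1$ of degree $0$, and a "dot" $x\in\operatorname{End}^2(c)$ that is compatible with the duality (it slides through cups and caps), subject to $$\mathrm{cap}\circ\mathrm{cup}=2,\qquad x\circ x=0,\qquad x\otimes 1+1\otimes x=\mathrm{cup}\circ\mathrm{cap}\circ(x\otimes 1)+(x\otimes 1)\circ\mathrm{cup}\circ\mathrm{cap}.$$ Write $\mathrm{cup}^{\bullet}=(x\otimes 1)\circ\mathrm{cup}$ for the dotted cup, $x_i\in\operatorname{End}^2(c^{\otimes n})$ for the dot on the $i$-th strand, $z_n=x_1-x_2+\cdots+(-1)^{n-1}x_n$, and $P_n\in\operatorname{End}^0(c^{\otimes n})$ for the $n$-th Jones–Wenzl projector,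 given by $P_0=1$, $P_1=1$, $P_{n+1}=P_n\otimes 1-\frac{n}{n+1}(P_n\otimes 1)\circ(1_{n-1}\otimes(\mathrm{cup}\circ\mathrm{cap}))\circ(P_n\otimes 1)$ for $n\ge 1$; it is idempotent. **The ambient category.** Let $\overline{\mathsf{dTL}}=\operatorname{Ind}(\operatorname{Mat}(\operatorname{Kar}(\mathsf{dTL})))$, where $\operatorname{Kar}$ is the (degree $0$) idempotent completion, $\operatorname{Mat}$ adjoins finite formal direct sums and grading shifts (a degree $d$ morphism $q^kX\to q^lY$ is a morphism $X\to Y$ of degree $d+k-l$), and $\operatorname{Ind}$ adjoins formal filtered colimits along degree $0$ maps, $\operatorname{Hom}^d((X_i),(Y_j))=\lim_i\operatorname{colim}_j\operatorname{Hom}^d(X_i,Y_j)$. The tensor product on $\mathsf{dTL}$ extends to $\overline{\mathsf{dTL}}$. For $i\in\mathbb Z/2=\{0,1\}$ the Kirby object $\kappa_i\in\overline{\mathsf{dTL}}$ is the directed system $$q^{-i}P_i\to q^{-i-2}P_{i+2}\to q^{-i-4}P_{i+4}\to\cdots$$ with transition maps $U_n=P_{n+2}\circ(1_n\otimes\mathrm{cup}^{\bullet})\circ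 P_n$. **The category $\mathsf{KdTL}'$.** It is the graded monoidal category obtained from $\mathsf{dTL}$ by adjoining two objects $\kappa_0',\kappa_1'$ (indexed by $\mathbb Z/2$) and morphisms $\iota_n\in\operatorname{Hom}^{-n}(c^{\otimes n},\kappa'_{n})$ for $n\ge 0$, $\mu_{i,j}\in\operatorname{Hom}^0(\kappa_i'\otimes\kappa_j',\kappa'_{i+j})$ and $y_i\in\operatorname{End}^2(\kappa_i')$, subject to the relations $$\mu_{0,i}\circ(\iota_0\otimes 1)=1=\mu_{i,0}\circ(1\otimes\iota_0),\qquad \mu_{i+j,k}\circ(\mu_{i,j}\otimes 1)=\mu_{i,j+k}\circ(1\otimes\mu_{j,k}),$$ $$y_{i+j}\circ\mu_{i,j}=\mu_{i,j}\circ(y_i\otimes 1)+(-1)^i\mu_{i,j}\circ(1\otimes y_j),\qquad y_n\circ\iota_n=\iota_n\circ z_n,$$ $$\iota_{i+j+2}\circ(1_i\otimes\mathrm{cup}\otimes 1_j)=0,\qquad \iota_{i+j+2}\circ(1_i\otimes\mathrm{cup}^{\bullet}\otimes 1_j)=\iota_{i+j},\qquad \mu_{m,n}\circ(\iota_m\otimes\iota_n)=\iota_{m+n}.$$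 **The functor $\phi$.** Let $\phi\colon\mathsf{KdTL}'\to\overline{\mathsf{dTL}}$ be the monoidal functor that extends the embedding of $\mathsf{dTL}$, sends $\kappa_i'$ to $\kappa_i$, and sends $\iota_m$ to the class $[P_m]$, $\mu_{i,j}$ to the family of classes $\{[P_{i+j+4n}\circ(P_{i+2n}\otimes P_{j+2n})]\}_{n\in\mathbb N}$ and $y_i$ to $\{[z_{i+2n}]\}_{n\in\mathbb N}$. **The completion $\mathsf{KdTL}$.** The canonical inclusions into an object $S$ of $\mathsf{KdTL}'$ (a tensor product of copies of $c$, $\kappa_0'$, $\kappa_1'$) are the tensor products of identities of the factors $c$ with morphisms $\iota_n$, $n\equiv i \pmod 2$, into the factors $\kappa_i'$. The category $\mathsf{KdTL}$ has the same objects as $\mathsf{KdTL}'$; a morphism of degree $d$ from $S$ to $T$ is an equivalence class of formal sums $\sum_{i\in I}D_i$ with $I$ an arbitrary set and $D_i\in\operatorname{Hom}^d_{\mathsf{KdTL}'}(S,T)$, such that for every canonical inclusion $\iota$ into $S$ one has $D_i\circ\iota=0$ for all but finitely many $i$. Two formal sums $\sum_i D_i$, $\sum_j E_j$ are equivalent if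 the finite sums $\sum_i D_i\circ\iota$ and $\sum_j E_j\circ\iota$ agree for every canonical inclusion $\iota$ into $S$. Composition and tensor product are formal, $\big(\sum_jE_j\big)\circ\big(\sum_iD_i\big)=\sum_{(j,i)}E_j\circ D_i$ and $\big(\sum_iD_i\big)\otimes\big(\sum_jE_j\big)=\sum_{(i,j)}D_i\otimes E_j$, and $\mathsf{KdTL}'$ maps to $\mathsf{KdTL}$ by viewing a morphism as a sum with one term. **Theorem.** The functor $\phi$ exists and is uniquely determined by the properties above, and it extends along $\mathsf{KdTL}'\to\mathsf{KdTL}$ to a $\mathbb K$-linear, degree preserving functor $\phi\colon\mathsf{KdTL}\to\overline{\mathsf{dTL}}$ that is compatible with tensor products and fully faithful: for all objects $S,T$ and all $d\in\mathbb Z$ the map $$\phi\colon\operatorname{Hom}^d_{\mathsf{KdTL}}(S,T)\longrightarrow\operatorname{Hom}^d_{\overline{\mathsf{dTL}}}(\phi(S),\phi(T))$$ is bijective. In this way $\mathsf{KdTL}$ is a diagrammatic presentation of the full monoidal subcategory of $\overline{\mathsf{dTL}}$ generated by $\mathsf{dTL}$ and the Kirby objects $\kappa_0,\kappa_1$. 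-/

import Mathlib

open CategoryTheory

set_option linter.unusedVariables false

universe w v v' u u'

/-! ## Graded linear categories

A `ℤ`-graded `K`-linear category: for objects `X`, `Y` a `ℤ`-indexed collection of vector spaces
`Hom X Y d`.  Composition adds degrees; it takes the equation between the degrees as an argument,
so that no transport along equalities of integers is needed.  No Koszul signs appear. -/

class GrCat (K : Type u') [Field K] (C : Type u) where
  Hom : C → C → ℤ → Type v
  [addCommGroup : ∀ X Y d, AddCommGroup (Hom X Y d)]
  [module : ∀ X Y d, Module K (Hom X Y d)]
  idm : ∀ X, Hom X X 0
  comp : ∀ {X Y Z : C} {k l m : ℤ}, Hom X Y k → Hom Y Z l → k + l = m → Hom X Z m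
  add_comp : ∀ {X Y Z : C} {k l m : ℤ} (f f' : Hom X Y k) (g : Hom Y Z l) (h : k + l = m),
    comp (f + f') g h = comp f g h + comp f' g h
  smul_comp : ∀ {X Y Z : C} {k l m : ℤ} (a : K) (f : Hom X Y k) (g : Hom Y Z l) (h : k + l = m),
    comp (a • f) g h = a • comp f g h
  comp_add : ∀ {X Y Z : C} {k l m : ℤ} (f : Hom X Y k) (g g' : Hom Y Z l) (h : k + l = m),
    comp f (g + g') h = comp f g h + comp f g' h
  comp_smul : ∀ {X Y Z : C} {k l m : ℤ} (a : K) (f : Hom X Y k) (g : Hom Y Z l) (h : k + l = m),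
    comp f (a • g) h = a • comp f g h
  id_comp : ∀ {X Y : C} {k : ℤ} (f : Hom X Y k) (h : 0 + k = k), comp (idm X) f h = f
  comp_id : ∀ {X Y : C} {k : ℤ} (f : Hom X Y k) (h : k + 0 = k), comp f (idm Y) h = f
  assoc : ∀ {W X Y Z : C} {a b c ab bc d : ℤ} (f : Hom W X a) (g : Hom X Y b) (p : Hom Y Z c)
    (h₁ : a + b = ab) (h₂ : ab + c = d) (h₃ : b + c = bc) (h₄ : a + bc = d),
    comp (comp f g h₁) p h₂ = comp f (comp g p h₃) h₄

attribute [reducible, instance] GrCat.addCommGroup GrCat.module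

namespace GrCat

variable {K : Type u'} [Field K] {C : Type u} [GrCat.{v} K C]

/-- Composition as a bilinear map. -/
def compL {X Y Z : C} {k l m : ℤ} (h : k + l = m) :
    Hom K X Y k →ₗ[K] Hom K Y Z l →ₗ[K] Hom K X Z m :=
  LinearMap.mk₂ K (fun f g => comp f g h) (fun f f' g => add_comp f f' g h)
    (fun a f g => smul_comp a f g h) (fun f g g' => comp_add f g g' h)
    (fun a f g => comp_smul a f g h)

theorem compL_apply {X Y Z : C} {k l m : ℤ} (h : k + l = m) (f : Hom K X Y k) (g : Hom K Y Z l) :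
    compL h f g = comp f g h := rfl

@[simp] theorem zero_comp {X Y Z : C} {k l m : ℤ} (g : Hom K Y Z l) (h : k + l = m) :
    comp (0 : Hom K X Y k) g h = 0 := by
  rw [← compL_apply]; simp

@[simp] theorem comp_zero {X Y Z : C} {k l m : ℤ} (f : Hom K X Y k) (h : k + l = m) :
    comp f (0 : Hom K Y Z l) h = 0 := by
  rw [← compL_apply]; simp

theorem comp_sum {ι : Type*} (s : Finset ι) {X Y Z : C} {k l m : ℤ} (f : Hom K X Y k)
    (g : ι → Hom K Y Z l) (h : k + l = m) :
    comp f (∑ i ∈ s, g i) h = ∑ i ∈ s, comp f (g i) h := by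
  simp only [← compL_apply, map_sum]

theorem sum_comp {ι : Type*} (s : Finset ι) {X Y Z : C} {k l m : ℤ} (f : ι → Hom K X Y k)
    (g : Hom K Y Z l) (h : k + l = m) :
    comp (∑ i ∈ s, f i) g h = ∑ i ∈ s, comp (f i) g h := by
  simp only [← compL_apply, map_sum, LinearMap.sum_apply]

/-- The same morphism, with its degree rewritten along an equality. -/
def dcast {X Y : C} {k l : ℤ} (h : k = l) (f : Hom K X Y k) : Hom K X Y l := h ▸ f

@[simp] theorem cast_rfl {X Y : C} {k : ℤ} (h : k = k) (f : Hom K X Y k) : dcast h f = f := rfl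

@[simp] theorem cast_cast {X Y : C} {k l m : ℤ} (h : k = l) (h' : l = m) (f : Hom K X Y k) :
    dcast h' (dcast h f) = dcast (h.trans h') f := by subst h h'; rfl

theorem cast_comp {X Y Z : C} {k k' l m : ℤ} (f : Hom K X Y k) (g : Hom K Y Z l) (e : k = k')
    (h : k' + l = m) : comp (dcast e f) g h = comp f g (by omega) := by subst e; rfl

theorem comp_cast {X Y Z : C} {k l' l m : ℤ} (f : Hom K X Y k) (g : Hom K Y Z l) (e : l = l')
    (h : k + l' = m) : comp f (dcast e g) h = comp f g (by omega) := by subst e; rfl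

theorem cast_comp_eq {X Y Z : C} {k l m m' : ℤ} (f : Hom K X Y k) (g : Hom K Y Z l) (e : m = m')
    (h : k + l = m) : dcast e (comp f g h) = comp f g (h.trans e) := by subst e; rfl

theorem id_comp' {X Y : C} {k m : ℤ} (f : Hom K X Y k) (h : 0 + k = m) :
    comp (idm X) f h = dcast (by omega) f := by
  obtain rfl : k = m := by omega
  exact id_comp f h

theorem comp_id' {X Y : C} {k m : ℤ} (f : Hom K X Y k) (h : k + 0 = m) :
    comp f (idm Y) h = dcast (by omega) f := by
  obtain rfl : k = m := by omega
  exact comp_id f h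

end GrCat

/-- A monoidal graded linear category: the tensor product of morphisms is bilinear and adds
degrees, the associator and the unitors are invertible of degree zero. -/
class GrMonCat (K : Type u') [Field K] (C : Type u) extends GrCat.{v} K C where
  unit : C
  tObj : C → C → C
  tHom : ∀ {X Y X' Y' : C} {k l m : ℤ}, Hom X Y k → Hom X' Y' l → k + l = m →
    Hom (tObj X X') (tObj Y Y') m
  add_tHom : ∀ {X Y X' Y' : C} {k l m : ℤ} (f f' : Hom X Y k) (g : Hom X' Y' l) (h : k + l = m),
    tHom (f + f') g h = tHom f g h + tHom f' g h
  smul_tHom : ∀ {X Y X' Y' : C} {k l m : ℤ} (a : K) (f : Hom X Y k) (g : Hom X' Y' l)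
    (h : k + l = m), tHom (a • f) g h = a • tHom f g h
  tHom_add : ∀ {X Y X' Y' : C} {k l m : ℤ} (f : Hom X Y k) (g g' : Hom X' Y' l) (h : k + l = m),
    tHom f (g + g') h = tHom f g h + tHom f g' h
  tHom_smul : ∀ {X Y X' Y' : C} {k l m : ℤ} (a : K) (f : Hom X Y k) (g : Hom X' Y' l)
    (h : k + l = m), tHom f (a • g) h = a • tHom f g h
  tHom_id : ∀ (X Y : C) (h : (0 : ℤ) + 0 = 0), tHom (idm X) (idm Y) h = idm (tObj X Y)
  tHom_comp : ∀ {X Y Z X' Y' Z' : C} {a b c a' b' c' aa bb d : ℤ}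
    (f : Hom X Y a) (g : Hom Y Z b) (f' : Hom X' Y' a') (g' : Hom Y' Z' b')
    (h : a + b = c) (h' : a' + b' = c') (h₁ : c + c' = d)
    (h₂ : a + a' = aa) (h₃ : b + b' = bb) (h₄ : aa + bb = d),
    tHom (comp f g h) (comp f' g' h') h₁ = comp (tHom f f' h₂) (tHom g g' h₃) h₄
  aHom : ∀ X Y Z : C, Hom (tObj (tObj X Y) Z) (tObj X (tObj Y Z)) 0
  aInv : ∀ X Y Z : C, Hom (tObj X (tObj Y Z)) (tObj (tObj X Y) Z) 0
  lHom : ∀ X : C, Hom (tObj unit X) X 0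
  lInv : ∀ X : C, Hom X (tObj unit X) 0
  rHom : ∀ X : C, Hom (tObj X unit) X 0
  rInv : ∀ X : C, Hom X (tObj X unit) 0
  aHom_aInv : ∀ (X Y Z : C) (h : (0 : ℤ) + 0 = 0), comp (aHom X Y Z) (aInv X Y Z) h = idm _
  aInv_aHom : ∀ (X Y Z : C) (h : (0 : ℤ) + 0 = 0), comp (aInv X Y Z) (aHom X Y Z) h = idm _
  lHom_lInv : ∀ (X : C) (h : (0 : ℤ) + 0 = 0), comp (lHom X) (lInv X) h = idm _
  lInv_lHom : ∀ (X : C) (h : (0 : ℤ) + 0 = 0), comp (lInv X) (lHom X) h = idm _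
  rHom_rInv : ∀ (X : C) (h : (0 : ℤ) + 0 = 0), comp (rHom X) (rInv X) h = idm _
  rInv_rHom : ∀ (X : C) (h : (0 : ℤ) + 0 = 0), comp (rInv X) (rHom X) h = idm _
  aHom_nat : ∀ {X Y Z X' Y' Z' : C} {a b c ab bc d : ℤ} (f : Hom X X' a) (g : Hom Y Y' b)
    (p : Hom Z Z' c) (h₁ : a + b = ab) (h₂ : ab + c = d) (h₃ : b + c = bc) (h₄ : a + bc = d)
    (h₅ : d + 0 = d) (h₆ : 0 + d = d),
    comp (tHom (tHom f g h₁) p h₂) (aHom X' Y' Z') h₅ =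
      comp (aHom X Y Z) (tHom f (tHom g p h₃) h₄) h₆
  lHom_nat : ∀ {X Y : C} {k : ℤ} (f : Hom X Y k) (h₁ : 0 + k = k) (h₂ : k + 0 = k),
    comp (tHom (idm unit) f h₁) (lHom Y) h₂ = comp (lHom X) f h₁
  rHom_nat : ∀ {X Y : C} {k : ℤ} (f : Hom X Y k) (h₁ : k + 0 = k) (h₂ : 0 + k = k),
    comp (tHom f (idm unit) h₁) (rHom Y) h₁ = comp (rHom X) f h₂
  pentagon : ∀ (W X Y Z : C) (h : (0 : ℤ) + 0 = 0),
    comp (tHom (aHom W X Y) (idm Z) h) (comp (aHom W (tObj X Y) Z) (tHom (idm W) (aHom X Y Z) h) h)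
      h = comp (aHom (tObj W X) Y Z) (aHom W X (tObj Y Z)) h
  triangle : ∀ (X Y : C) (h : (0 : ℤ) + 0 = 0),
    comp (aHom X unit Y) (tHom (idm X) (lHom Y) h) h = tHom (rHom X) (idm Y) h

namespace GrMonCat

open GrCat

variable {K : Type u'} [Field K] {C : Type u} [GrMonCat.{v} K C]

/-- The tensor product of morphisms as a bilinear map. -/
def tHomL {X Y X' Y' : C} {k l m : ℤ} (h : k + l = m) :
    Hom K X Y k →ₗ[K] Hom K X' Y' l →ₗ[K] Hom K (tObj K X X') (tObj K Y Y') m :=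
  LinearMap.mk₂ K (fun f g => tHom f g h) (fun f f' g => add_tHom f f' g h)
    (fun a f g => smul_tHom a f g h) (fun f g g' => tHom_add f g g' h)
    (fun a f g => tHom_smul a f g h)

theorem tHomL_apply {X Y X' Y' : C} {k l m : ℤ} (h : k + l = m) (f : Hom K X Y k)
    (g : Hom K X' Y' l) : tHomL h f g = tHom f g h := rfl

@[simp] theorem zero_tHom {X Y X' Y' : C} {k l m : ℤ} (g : Hom K X' Y' l) (h : k + l = m) :
    tHom (0 : Hom K X Y k) g h = 0 := by
  rw [← tHomL_apply]; simp

@[simp] theorem tHom_zero {X Y X' Y' : C} {k l m : ℤ} (f : Hom K X Y k) (h : k + l = m) :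
    tHom f (0 : Hom K X' Y' l) h = 0 := by
  rw [← tHomL_apply]; simp

theorem sum_tHom_sum {ι κ : Type*} (s : Finset ι) (t : Finset κ) {X Y X' Y' : C} {k l m : ℤ}
    (f : ι → Hom K X Y k) (g : κ → Hom K X' Y' l) (h : k + l = m) :
    tHom (∑ i ∈ s, f i) (∑ j ∈ t, g j) h = ∑ p ∈ s ×ˢ t, tHom (f p.1) (g p.2) h := by
  simp only [← tHomL_apply, map_sum, LinearMap.sum_apply, Finset.sum_product]
  exact Finset.sum_comm

theorem cast_tHom {X Y X' Y' : C} {k k' l m : ℤ} (f : Hom K X Y k) (g : Hom K X' Y' l)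
    (e : k = k') (h : k' + l = m) : tHom (dcast e f) g h = tHom f g (by omega) := by subst e; rfl

theorem tHom_cast {X Y X' Y' : C} {k l l' m : ℤ} (f : Hom K X Y k) (g : Hom K X' Y' l)
    (e : l = l') (h : k + l' = m) : tHom f (dcast e g) h = tHom f g (by omega) := by subst e; rfl

theorem cast_tHom_eq {X Y X' Y' : C} {k l m m' : ℤ} (f : Hom K X Y k) (g : Hom K X' Y' l)
    (e : m = m') (h : k + l = m) : dcast e (tHom f g h) = tHom f g (h.trans e) := by subst e; rfl

end GrMonCat

/-- The degree zero subcategory of a graded linear category. -/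
def Deg0 (K : Type u') (C : Type u) [Field K] [GrCat.{v} K C] : Type u := C

namespace Deg0

open GrCat GrMonCat

variable {K : Type u'} [Field K] {C : Type u}

instance [GrCat.{v} K C] : Category.{v} (Deg0 K C) where
  Hom X Y := Hom K (C := C) X Y 0
  id X := GrCat.idm (K := K) (C := C) X
  comp f g := GrCat.comp (K := K) (C := C) f g (add_zero 0)
  id_comp f := GrCat.id_comp (K := K) (C := C) f (add_zero 0)
  comp_id f := GrCat.comp_id (K := K) (C := C) f (add_zero 0)
  assoc f g h := GrCat.assoc (K := K) (C := C) f g h _ _ _ _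

instance [GrCat.{v} K C] : Preadditive (Deg0 K C) where
  homGroup X Y := GrCat.addCommGroup (K := K) (C := C) X Y 0
  add_comp _ _ _ f f' g := GrCat.add_comp (K := K) (C := C) f f' g _
  comp_add _ _ _ f g g' := GrCat.comp_add (K := K) (C := C) f g g' _

instance [GrCat.{v} K C] : Linear K (Deg0 K C) where
  homModule X Y := GrCat.module (K := K) (C := C) X Y 0
  smul_comp _ _ _ a f g := GrCat.smul_comp (K := K) (C := C) a f g _
  comp_smul _ _ _ f a g := GrCat.comp_smul (K := K) (C := C) a f g _

instance [GrMonCat.{v} K C] : MonoidalCategoryStruct (Deg0 K C) where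
  tensorObj X Y := tObj K (C := C) X Y
  tensorUnit := GrMonCat.unit K (C := C)
  tensorHom f g := tHom (K := K) (C := C) f g (add_zero 0)
  whiskerLeft X _ _ f := tHom (K := K) (C := C) (GrCat.idm (K := K) (C := C) X) f (add_zero 0)
  whiskerRight f X := tHom (K := K) (C := C) f (GrCat.idm (K := K) (C := C) X) (add_zero 0)
  associator X Y Z :=
    { hom := aHom (K := K) (C := C) X Y Z
      inv := aInv (K := K) (C := C) X Y Z
      hom_inv_id := aHom_aInv (K := K) (C := C) X Y Z _
      inv_hom_id := aInv_aHom (K := K) (C := C) X Y Z _ }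
  leftUnitor X :=
    { hom := lHom (K := K) (C := C) X
      inv := lInv (K := K) (C := C) X
      hom_inv_id := lHom_lInv (K := K) (C := C) X _
      inv_hom_id := lInv_lHom (K := K) (C := C) X _ }
  rightUnitor X :=
    { hom := rHom (K := K) (C := C) X
      inv := rInv (K := K) (C := C) X
      hom_inv_id := rHom_rInv (K := K) (C := C) X _
      inv_hom_id := rInv_rHom (K := K) (C := C) X _ }

instance [GrMonCat.{v} K C] : MonoidalCategory (Deg0 K C) :=
  MonoidalCategory.ofTensorHom
    (id_tensorHom_id := fun X Y => GrMonCat.tHom_id (K := K) (C := C) X Y _)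
    (id_tensorHom := fun _ _ _ _ => rfl)
    (tensorHom_id := fun _ _ => rfl)
    (tensorHom_comp_tensorHom := fun f f' g g' =>
      (GrMonCat.tHom_comp (K := K) (C := C) f g f' g' _ _ _ _ _ _).symm)
    (associator_naturality := fun f g h =>
      GrMonCat.aHom_nat (K := K) (C := C) f g h _ _ _ _ _ _)
    (leftUnitor_naturality := fun f => GrMonCat.lHom_nat (K := K) (C := C) f _ _)
    (rightUnitor_naturality := fun f => GrMonCat.rHom_nat (K := K) (C := C) f _ _)
    (pentagon := fun W X Y Z => GrMonCat.pentagon (K := K) (C := C) W X Y Z _)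
    (triangle := fun X Y => GrMonCat.triangle (K := K) (C := C) X Y _)

instance [GrMonCat.{v} K C] : MonoidalPreadditive (Deg0 K C) where
  whiskerLeft_zero := by intros; exact GrMonCat.tHom_zero (K := K) (C := C) _ _
  zero_whiskerRight := by intros; exact GrMonCat.zero_tHom (K := K) (C := C) _ _
  whiskerLeft_add _ _ := GrMonCat.tHom_add (K := K) (C := C) _ _ _ _
  add_whiskerRight _ _ := GrMonCat.add_tHom (K := K) (C := C) _ _ _ _

instance [GrMonCat.{v} K C] : MonoidalLinear K (Deg0 K C) where
  whiskerLeft_smul _ _ _ a f := GrMonCat.tHom_smul (K := K) (C := C) a _ f _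
  smul_whiskerRight a _ _ f _ := GrMonCat.smul_tHom (K := K) (C := C) a f _ _

end Deg0

/-! ## Presentations of monoidal graded linear categories -/

/-- Bracketed words: the objects of the monoidal category freely generated by a set of objects. -/
inductive BWord (O : Type) : Type
  | unit : BWord O
  | of : O → BWord O
  | tensor : BWord O → BWord O → BWord O

namespace BWord

/-- The bracketed tensor power `((1 ⊗ a) ⊗ a) ⊗ ⋯ ⊗ a` of a generating object. -/
def pow {O : Type} (a : O) : ℕ → BWord O
  | 0 => unit
  | n + 1 => tensor (pow a n) (of a)

def map {O O' : Type} (F : O → O') : BWord O → BWord O'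
  | unit => unit
  | of a => of (F a)
  | tensor X Y => tensor (map F X) (map F Y)

@[simp] theorem map_pow {O O' : Type} (F : O → O') (a : O) (n : ℕ) :
    map F (pow a n) = pow (F a) n := by
  induction n with
  | zero => rfl
  | succ n ih => simp [pow, map, ih]

end BWord

/-- Formal expressions for morphisms in generators `G X Y d` of degree `d`. -/
inductive Tm (K : Type u) {O : Type} (G : BWord O → BWord O → ℤ → Type) :
    BWord O → BWord O → ℤ → Type u
  | gen {X Y : BWord O} {d : ℤ} (g : G X Y d) : Tm K G X Y d
  | idm (X : BWord O) : Tm K G X X 0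
  | comp {X Y Z : BWord O} {k l m : ℤ} (f : Tm K G X Y k) (g : Tm K G Y Z l) (h : k + l = m) : Tm K G X Z m
  | tHom {X Y X' Y' : BWord O} {k l m : ℤ} (f : Tm K G X Y k) (g : Tm K G X' Y' l) (h : k + l = m) :
      Tm K G (X.tensor X') (Y.tensor Y') m
  | aHom (X Y Z : BWord O) : Tm K G ((X.tensor Y).tensor Z) (X.tensor (Y.tensor Z)) 0
  | aInv (X Y Z : BWord O) : Tm K G (X.tensor (Y.tensor Z)) ((X.tensor Y).tensor Z) 0
  | lHom (X : BWord O) : Tm K G (BWord.unit.tensor X) X 0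
  | lInv (X : BWord O) : Tm K G X (BWord.unit.tensor X) 0
  | rHom (X : BWord O) : Tm K G (X.tensor BWord.unit) X 0
  | rInv (X : BWord O) : Tm K G X (X.tensor BWord.unit) 0
  | zero (X Y : BWord O) (d : ℤ) : Tm K G X Y d
  | add {X Y : BWord O} {d : ℤ} (f g : Tm K G X Y d) : Tm K G X Y d
  | smul {X Y : BWord O} {d : ℤ} (a : K) (f : Tm K G X Y d) : Tm K G X Y d

/-- The smallest congruence on formal expressions that contains the given relations `R` and makes
the quotient a monoidal graded `K`-linear category. -/
inductive TmRel {K : Type u} [Field K] {O : Type} {G : BWord O → BWord O → ℤ → Type}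
    (R : ∀ {X Y d}, Tm K G X Y d → Tm K G X Y d → Prop) :
    ∀ {X Y d}, Tm K G X Y d → Tm K G X Y d → Prop
  | rel {X Y : BWord O} {d : ℤ} {f g : Tm K G X Y d} : R f g → TmRel R f g
  | refl {X Y : BWord O} {d : ℤ} (f : Tm K G X Y d) : TmRel R f f
  | symm {X Y : BWord O} {d : ℤ} {f g : Tm K G X Y d} : TmRel R f g → TmRel R g f
  | trans {X Y : BWord O} {d : ℤ} {f g p : Tm K G X Y d} : TmRel R f g → TmRel R g p → TmRel R f p
  | comp_congr {X Y Z : BWord O} {k l m : ℤ} {f f' : Tm K G X Y k} {g g' : Tm K G Y Z l} (h : k + l = m) :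
      TmRel R f f' → TmRel R g g' → TmRel R (.comp f g h) (.comp f' g' h)
  | tHom_congr {X Y X' Y' : BWord O} {k l m : ℤ} {f f' : Tm K G X Y k} {g g' : Tm K G X' Y' l} (h : k + l = m) :
      TmRel R f f' → TmRel R g g' → TmRel R (.tHom f g h) (.tHom f' g' h)
  | add_congr {X Y : BWord O} {d : ℤ} {f f' g g' : Tm K G X Y d} :
      TmRel R f f' → TmRel R g g' → TmRel R (.add f g) (.add f' g')
  | smul_congr {X Y : BWord O} {d : ℤ} (a : K) {f f' : Tm K G X Y d} :
      TmRel R f f' → TmRel R (.smul a f) (.smul a f')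
  -- vector space axioms
  | add_assoc {X Y : BWord O} {d : ℤ} (f g p : Tm K G X Y d) : TmRel R (.add (.add f g) p) (.add f (.add g p))
  | add_comm {X Y : BWord O} {d : ℤ} (f g : Tm K G X Y d) : TmRel R (.add f g) (.add g f)
  | zero_add {X Y : BWord O} {d : ℤ} (f : Tm K G X Y d) : TmRel R (.add (.zero X Y d) f) f
  | neg_add {X Y : BWord O} {d : ℤ} (f : Tm K G X Y d) : TmRel R (.add (.smul (-1) f) f) (.zero X Y d)
  | smul_add {X Y : BWord O} {d : ℤ} (a : K) (f g : Tm K G X Y d) :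
      TmRel R (.smul a (.add f g)) (.add (.smul a f) (.smul a g))
  | add_smul {X Y : BWord O} {d : ℤ} (a b : K) (f : Tm K G X Y d) :
      TmRel R (.smul (a + b) f) (.add (.smul a f) (.smul b f))
  | mul_smul {X Y : BWord O} {d : ℤ} (a b : K) (f : Tm K G X Y d) :
      TmRel R (.smul (a * b) f) (.smul a (.smul b f))
  | one_smul {X Y : BWord O} {d : ℤ} (f : Tm K G X Y d) : TmRel R (.smul 1 f) f
  -- bilinearity of composition and tensor product
  | add_comp {X Y Z : BWord O} {k l m : ℤ} (f f' : Tm K G X Y k) (g : Tm K G Y Z l) (h : k + l = m) :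
      TmRel R (.comp (.add f f') g h) (.add (.comp f g h) (.comp f' g h))
  | smul_comp {X Y Z : BWord O} {k l m : ℤ} (a : K) (f : Tm K G X Y k) (g : Tm K G Y Z l) (h : k + l = m) :
      TmRel R (.comp (.smul a f) g h) (.smul a (.comp f g h))
  | comp_add {X Y Z : BWord O} {k l m : ℤ} (f : Tm K G X Y k) (g g' : Tm K G Y Z l) (h : k + l = m) :
      TmRel R (.comp f (.add g g') h) (.add (.comp f g h) (.comp f g' h))
  | comp_smul {X Y Z : BWord O} {k l m : ℤ} (a : K) (f : Tm K G X Y k) (g : Tm K G Y Z l) (h : k + l = m) :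
      TmRel R (.comp f (.smul a g) h) (.smul a (.comp f g h))
  | add_tHom {X Y X' Y' : BWord O} {k l m : ℤ} (f f' : Tm K G X Y k) (g : Tm K G X' Y' l) (h : k + l = m) :
      TmRel R (.tHom (.add f f') g h) (.add (.tHom f g h) (.tHom f' g h))
  | smul_tHom {X Y X' Y' : BWord O} {k l m : ℤ} (a : K) (f : Tm K G X Y k) (g : Tm K G X' Y' l) (h : k + l = m) :
      TmRel R (.tHom (.smul a f) g h) (.smul a (.tHom f g h))
  | tHom_add {X Y X' Y' : BWord O} {k l m : ℤ} (f : Tm K G X Y k) (g g' : Tm K G X' Y' l) (h : k + l = m) :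
      TmRel R (.tHom f (.add g g') h) (.add (.tHom f g h) (.tHom f g' h))
  | tHom_smul {X Y X' Y' : BWord O} {k l m : ℤ} (a : K) (f : Tm K G X Y k) (g : Tm K G X' Y' l) (h : k + l = m) :
      TmRel R (.tHom f (.smul a g) h) (.smul a (.tHom f g h))
  -- category and monoidal category axioms
  | id_comp {X Y : BWord O} {k : ℤ} (f : Tm K G X Y k) (h : 0 + k = k) : TmRel R (.comp (.idm X) f h) f
  | comp_id {X Y : BWord O} {k : ℤ} (f : Tm K G X Y k) (h : k + 0 = k) : TmRel R (.comp f (.idm Y) h) f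
  | assoc {W X Y Z : BWord O} {a b c ab bc d : ℤ} (f : Tm K G W X a) (g : Tm K G X Y b) (p : Tm K G Y Z c)
      (h₁ : a + b = ab) (h₂ : ab + c = d) (h₃ : b + c = bc) (h₄ : a + bc = d) :
      TmRel R (.comp (.comp f g h₁) p h₂) (.comp f (.comp g p h₃) h₄)
  | tHom_id (X Y : BWord O) (h : (0 : ℤ) + 0 = 0) :
      TmRel R (.tHom (.idm X) (.idm Y) h) (.idm (X.tensor Y))
  | tHom_comp {X Y Z X' Y' Z' : BWord O} {a b c a' b' c' aa bb d : ℤ}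
      (f : Tm K G X Y a) (g : Tm K G Y Z b) (f' : Tm K G X' Y' a') (g' : Tm K G Y' Z' b')
      (h : a + b = c) (h' : a' + b' = c') (h₁ : c + c' = d)
      (h₂ : a + a' = aa) (h₃ : b + b' = bb) (h₄ : aa + bb = d) :
      TmRel R (.tHom (.comp f g h) (.comp f' g' h') h₁)
        (.comp (.tHom f f' h₂) (.tHom g g' h₃) h₄)
  | aHom_aInv (X Y Z : BWord O) (h : (0 : ℤ) + 0 = 0) :
      TmRel R (.comp (.aHom X Y Z) (.aInv X Y Z) h) (.idm _)
  | aInv_aHom (X Y Z : BWord O) (h : (0 : ℤ) + 0 = 0) :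
      TmRel R (.comp (.aInv X Y Z) (.aHom X Y Z) h) (.idm _)
  | lHom_lInv (X : BWord O) (h : (0 : ℤ) + 0 = 0) : TmRel R (.comp (.lHom X) (.lInv X) h) (.idm _)
  | lInv_lHom (X : BWord O) (h : (0 : ℤ) + 0 = 0) : TmRel R (.comp (.lInv X) (.lHom X) h) (.idm _)
  | rHom_rInv (X : BWord O) (h : (0 : ℤ) + 0 = 0) : TmRel R (.comp (.rHom X) (.rInv X) h) (.idm _)
  | rInv_rHom (X : BWord O) (h : (0 : ℤ) + 0 = 0) : TmRel R (.comp (.rInv X) (.rHom X) h) (.idm _)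
  | aHom_nat {X Y Z X' Y' Z' : BWord O} {a b c ab bc d : ℤ} (f : Tm K G X X' a) (g : Tm K G Y Y' b)
      (p : Tm K G Z Z' c) (h₁ : a + b = ab) (h₂ : ab + c = d) (h₃ : b + c = bc) (h₄ : a + bc = d)
      (h₅ : d + 0 = d) (h₆ : 0 + d = d) :
      TmRel R (.comp (.tHom (.tHom f g h₁) p h₂) (.aHom X' Y' Z') h₅)
        (.comp (.aHom X Y Z) (.tHom f (.tHom g p h₃) h₄) h₆)
  | lHom_nat {X Y : BWord O} {k : ℤ} (f : Tm K G X Y k) (h₁ : 0 + k = k) (h₂ : k + 0 = k) :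
      TmRel R (.comp (.tHom (.idm .unit) f h₁) (.lHom Y) h₂) (.comp (.lHom X) f h₁)
  | rHom_nat {X Y : BWord O} {k : ℤ} (f : Tm K G X Y k) (h₁ : k + 0 = k) (h₂ : 0 + k = k) :
      TmRel R (.comp (.tHom f (.idm .unit) h₁) (.rHom Y) h₁) (.comp (.rHom X) f h₂)
  | pentagon (W X Y Z : BWord O) (h : (0 : ℤ) + 0 = 0) :
      TmRel R (.comp (.tHom (.aHom W X Y) (.idm Z) h)
          (.comp (.aHom W (X.tensor Y) Z) (.tHom (.idm W) (.aHom X Y Z) h) h) h)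
        (.comp (.aHom (W.tensor X) Y Z) (.aHom W X (Y.tensor Z)) h)
  | triangle (X Y : BWord O) (h : (0 : ℤ) + 0 = 0) :
      TmRel R (.comp (.aHom X .unit Y) (.tHom (.idm X) (.lHom Y) h) h)
        (.tHom (.rHom X) (.idm Y) h)

section Presented

variable {K : Type u} [Field K] {O : Type} {G : BWord O → BWord O → ℤ → Type}

/-- Morphisms of the presented category: expressions modulo the congruence. -/
def PHom (R : ∀ {X Y d}, Tm K G X Y d → Tm K G X Y d → Prop) (X Y : BWord O) (d : ℤ) : Type u :=
  Quot (TmRel R (X := X) (Y := Y) (d := d))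

namespace PHom

variable {R : ∀ {X Y d}, Tm K G X Y d → Tm K G X Y d → Prop}

/-- The morphism represented by an expression. -/
def mk (R : ∀ {X Y d}, Tm K G X Y d → Tm K G X Y d → Prop) {X Y : BWord O} {d : ℤ}
    (f : Tm K G X Y d) : PHom R X Y d := Quot.mk _ f

theorem sound {X Y : BWord O} {d : ℤ} {f g : Tm K G X Y d} (h : TmRel R f g) : mk R f = mk R g :=
  Quot.sound h

theorem ind {X Y : BWord O} {d : ℤ} {P : PHom R X Y d → Prop} (h : ∀ f, P (mk R f)) (x) : P x :=
  Quot.ind h x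

instance (X Y : BWord O) (d : ℤ) : Add (PHom R X Y d) :=
  ⟨Quot.map₂ Tm.add (fun f _ _ h => .add_congr (.refl f) h)
    (fun _ _ g h => .add_congr h (.refl g))⟩

instance (X Y : BWord O) (d : ℤ) : Zero (PHom R X Y d) := ⟨mk R (.zero X Y d)⟩

instance (X Y : BWord O) (d : ℤ) : Neg (PHom R X Y d) :=
  ⟨Quot.map (Tm.smul (-1)) (fun _ _ h => .smul_congr _ h)⟩

instance (X Y : BWord O) (d : ℤ) : AddCommGroup (PHom R X Y d) where
  nsmul := nsmulRec
  zsmul := zsmulRec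
  add_assoc := by
    rintro ⟨f⟩ ⟨g⟩ ⟨p⟩
    exact sound (.add_assoc f g p)
  add_comm := by
    rintro ⟨f⟩ ⟨g⟩
    exact sound (.add_comm f g)
  zero_add := by
    rintro ⟨f⟩
    exact sound (.zero_add f)
  add_zero := by
    rintro ⟨f⟩
    exact sound (.trans (.add_comm f _) (.zero_add f))
  neg_add_cancel := by
    rintro ⟨f⟩
    exact sound (.neg_add f)

instance (X Y : BWord O) (d : ℤ) : SMul K (PHom R X Y d) :=
  ⟨fun a => Quot.map (Tm.smul a) (fun _ _ h => .smul_congr a h)⟩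

theorem mk_add {X Y : BWord O} {d : ℤ} (f g : Tm K G X Y d) :
    mk R (.add f g) = mk R f + mk R g := rfl

theorem mk_smul {X Y : BWord O} {d : ℤ} (a : K) (f : Tm K G X Y d) :
    mk R (.smul a f) = a • mk R f := rfl

theorem mk_zero (X Y : BWord O) (d : ℤ) : mk R (.zero X Y d) = 0 := rfl

instance (X Y : BWord O) (d : ℤ) : Module K (PHom R X Y d) :=
  Module.ofMinimalAxioms
    (by
      rintro a ⟨f⟩ ⟨g⟩
      exact sound (.smul_add a f g))
    (by
      rintro a b ⟨f⟩
      exact sound (.add_smul a b f))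
    (by
      rintro a b ⟨f⟩
      exact sound (.mul_smul a b f))
    (by
      rintro ⟨f⟩
      exact sound (.one_smul f))

end PHom

/-- The monoidal graded `K`-linear category presented by the generators `G` and relations `R`;
its objects are the bracketed words. -/
@[reducible] def presented (R : ∀ {X Y d}, Tm K G X Y d → Tm K G X Y d → Prop) :
    GrMonCat.{u} K (BWord O) where
  Hom := PHom R
  idm X := PHom.mk R (.idm X)
  comp f g h := Quot.map₂ (fun f g => Tm.comp f g h) (fun f _ _ e => .comp_congr h (.refl f) e)
    (fun _ _ g e => .comp_congr h e (.refl g)) f g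
  add_comp := by
    rintro _ _ _ _ _ _ ⟨f⟩ ⟨f'⟩ ⟨g⟩ h
    exact PHom.sound (.add_comp f f' g h)
  smul_comp := by
    rintro _ _ _ _ _ _ a ⟨f⟩ ⟨g⟩ h
    exact PHom.sound (.smul_comp a f g h)
  comp_add := by
    rintro _ _ _ _ _ _ ⟨f⟩ ⟨g⟩ ⟨g'⟩ h
    exact PHom.sound (.comp_add f g g' h)
  comp_smul := by
    rintro _ _ _ _ _ _ a ⟨f⟩ ⟨g⟩ h
    exact PHom.sound (.comp_smul a f g h)
  id_comp := by
    rintro _ _ _ ⟨f⟩ h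
    exact PHom.sound (.id_comp f h)
  comp_id := by
    rintro _ _ _ ⟨f⟩ h
    exact PHom.sound (.comp_id f h)
  assoc := by
    rintro _ _ _ _ _ _ _ _ _ _ ⟨f⟩ ⟨g⟩ ⟨p⟩ h₁ h₂ h₃ h₄
    exact PHom.sound (.assoc f g p h₁ h₂ h₃ h₄)
  unit := .unit
  tObj := .tensor
  tHom f g h := Quot.map₂ (fun f g => Tm.tHom f g h) (fun f _ _ e => .tHom_congr h (.refl f) e)
    (fun _ _ g e => .tHom_congr h e (.refl g)) f g
  add_tHom := by
    rintro _ _ _ _ _ _ _ ⟨f⟩ ⟨f'⟩ ⟨g⟩ h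
    exact PHom.sound (.add_tHom f f' g h)
  smul_tHom := by
    rintro _ _ _ _ _ _ _ a ⟨f⟩ ⟨g⟩ h
    exact PHom.sound (.smul_tHom a f g h)
  tHom_add := by
    rintro _ _ _ _ _ _ _ ⟨f⟩ ⟨g⟩ ⟨g'⟩ h
    exact PHom.sound (.tHom_add f g g' h)
  tHom_smul := by
    rintro _ _ _ _ _ _ _ a ⟨f⟩ ⟨g⟩ h
    exact PHom.sound (.tHom_smul a f g h)
  tHom_id X Y h := PHom.sound (.tHom_id X Y h)
  tHom_comp := by
    rintro _ _ _ _ _ _ _ _ _ _ _ _ _ _ _ ⟨f⟩ ⟨g⟩ ⟨f'⟩ ⟨g'⟩ h h' h₁ h₂ h₃ h₄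
    exact PHom.sound (.tHom_comp f g f' g' h h' h₁ h₂ h₃ h₄)
  aHom X Y Z := PHom.mk R (.aHom X Y Z)
  aInv X Y Z := PHom.mk R (.aInv X Y Z)
  lHom X := PHom.mk R (.lHom X)
  lInv X := PHom.mk R (.lInv X)
  rHom X := PHom.mk R (.rHom X)
  rInv X := PHom.mk R (.rInv X)
  aHom_aInv X Y Z h := PHom.sound (.aHom_aInv X Y Z h)
  aInv_aHom X Y Z h := PHom.sound (.aInv_aHom X Y Z h)
  lHom_lInv X h := PHom.sound (.lHom_lInv X h)
  lInv_lHom X h := PHom.sound (.lInv_lHom X h)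
  rHom_rInv X h := PHom.sound (.rHom_rInv X h)
  rInv_rHom X h := PHom.sound (.rInv_rHom X h)
  aHom_nat := by
    rintro _ _ _ _ _ _ _ _ _ _ _ _ ⟨f⟩ ⟨g⟩ ⟨p⟩ h₁ h₂ h₃ h₄ h₅ h₆
    exact PHom.sound (.aHom_nat f g p h₁ h₂ h₃ h₄ h₅ h₆)
  lHom_nat := by
    rintro _ _ _ ⟨f⟩ h₁ h₂
    exact PHom.sound (.lHom_nat f h₁ h₂)
  rHom_nat := by
    rintro _ _ _ ⟨f⟩ h₁ h₂
    exact PHom.sound (.rHom_nat f h₁ h₂)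
  pentagon W X Y Z h := PHom.sound (.pentagon W X Y Z h)
  triangle X Y h := PHom.sound (.triangle X Y h)

end Presented

/-! ## Temperley-Lieb recursion in a monoidal linear category -/

namespace TLGen

open MonoidalCategory

variable {K : Type u'} [Field K] {M : Type u} [Category.{v} M] [MonoidalCategory M] {c : M}
  (cap : c ⊗ c ⟶ 𝟙_ M) (cup : 𝟙_ M ⟶ c ⊗ c)

/-- The cap, the cup and the Temperley-Lieb generator on the last two strands. -/
def lastCap (X : M) : (X ⊗ c) ⊗ c ⟶ X := (α_ X c c).hom ≫ X ◁ cap ≫ (ρ_ X).hom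

def lastCup (X : M) : X ⟶ (X ⊗ c) ⊗ c := (ρ_ X).inv ≫ X ◁ cup ≫ (α_ X c c).inv

def e (X : M) : (X ⊗ c) ⊗ c ⟶ (X ⊗ c) ⊗ c := lastCap cap X ≫ lastCup cup X

theorem lastCap_natural {X Y : M} (p : X ⟶ Y) :
    p ▷ c ▷ c ≫ lastCap cap Y = lastCap cap X ≫ p := by
  simp only [lastCap, Category.assoc]
  rw [associator_naturality_left_assoc, ← whisker_exchange_assoc, rightUnitor_naturality]

theorem lastCup_natural {X Y : M} (p : X ⟶ Y) :
    lastCup cup X ≫ p ▷ c ▷ c = p ≫ lastCup cup Y := by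
  simp only [lastCup, Category.assoc]
  rw [← associator_inv_naturality_left, whisker_exchange_assoc, rightUnitor_inv_naturality_assoc]

theorem e_natural {X : M} (p : X ⟶ X) : p ▷ c ▷ c ≫ e cap cup X = e cap cup X ≫ p ▷ c ▷ c := by
  simp only [e, Category.assoc, lastCup_natural]
  rw [← Category.assoc, lastCap_natural, Category.assoc]

theorem snakeL
    (zigL : (ρ_ c).inv ≫ c ◁ cup ≫ (α_ _ _ _).inv ≫ cap ▷ c ≫ (λ_ c).hom = 𝟙 c)
    (X : M) : lastCup cup (X ⊗ c) ≫ lastCap cap X ▷ c = 𝟙 (X ⊗ c) := by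
  have : lastCup cup (X ⊗ c) ≫ lastCap cap X ▷ c = X ◁ ((ρ_ c).inv ≫ c ◁ cup ≫
      (α_ _ _ _).inv ≫ cap ▷ c ≫ (λ_ _).hom) := by
    simp only [lastCup, lastCap]
    monoidal
  rw [this, zigL, whiskerLeft_id]

theorem snakeR
    (zigR : (λ_ c).inv ≫ cup ▷ c ≫ (α_ _ _ _).hom ≫ c ◁ cap ≫ (ρ_ c).hom = 𝟙 c)
    (X : M) : lastCup cup X ▷ c ≫ lastCap cap (X ⊗ c) = 𝟙 (X ⊗ c) := by
  have : lastCup cup X ▷ c ≫ lastCap cap (X ⊗ c) = X ◁ ((λ_ c).inv ≫ cup ▷ c ≫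
      (α_ _ _ _).hom ≫ c ◁ cap ≫ (ρ_ _).hom) := by
    simp only [lastCup, lastCap]
    monoidal
  rw [this, zigR, whiskerLeft_id]

theorem e_tl
    (zigL : (ρ_ c).inv ≫ c ◁ cup ≫ (α_ _ _ _).inv ≫ cap ▷ c ≫ (λ_ c).hom = 𝟙 c)
    (zigR : (λ_ c).inv ≫ cup ▷ c ≫ (α_ _ _ _).hom ≫ c ◁ cap ≫ (ρ_ c).hom = 𝟙 c)
    (X : M) : e cap cup (X ⊗ c) ≫ e cap cup X ▷ c ≫ e cap cup (X ⊗ c) =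
    e cap cup (X ⊗ c) := by
  have h1 := snakeL cap cup zigL X
  have h2 := snakeR cap cup zigR X
  simp only [e, comp_whiskerRight, Category.assoc]
  rw [reassoc_of% h1, reassoc_of% h2]

variable [Preadditive M] [Linear K M] [MonoidalPreadditive M] [MonoidalLinear K M]

/-- One step of the Wenzl recursion. -/
def step {X : M} (a : K) (P : X ⊗ c ⟶ X ⊗ c) : (X ⊗ c) ⊗ c ⟶ (X ⊗ c) ⊗ c :=
  P ▷ c - a • (P ▷ c ≫ e cap cup X ≫ P ▷ c)

/-- The invariant of the recursion. -/
structure Inv (X : M) (Q : X ⟶ X) (P : X ⊗ c ⟶ X ⊗ c) (b : K) : Prop where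
  idem : P ≫ P = P
  left : Q ▷ c ≫ P = P
  right : P ≫ Q ▷ c = P
  ePe : e cap cup X ≫ P ▷ c ≫ e cap cup X = b • (Q ▷ c ▷ c ≫ e cap cup X)

theorem e_sq (circle : cup ≫ cap = (2 : K) • 𝟙 _) (X : M) : e cap cup X ≫ e cap cup X = (2 : K) • e cap cup X := by
  have h : lastCup cup X ≫ lastCap cap X = (2 : K) • 𝟙 _ := by
    have : lastCup cup X ≫ lastCap cap X = (ρ_ X).inv ≫ X ◁ (cup ≫ cap) ≫ (ρ_ X).hom := by
      simp [lastCup, lastCap]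
    rw [this, circle]
    simp
  have h' := h =≫ lastCup cup X
  simp only [e, Category.assoc] at h' ⊢
  rw [h']
  simp

theorem inv_zero (circle : cup ≫ cap = (2 : K) • 𝟙 _) : Inv (K := K) cap cup (𝟙_ M) (𝟙 _) (𝟙 _) 2 := by
  refine ⟨by simp, by simp, by simp, ?_⟩
  have := e_sq cap cup circle (𝟙_ M)
  simpa using this

theorem inv_step
    (zigL : (ρ_ c).inv ≫ c ◁ cup ≫ (α_ _ _ _).inv ≫ cap ▷ c ≫ (λ_ c).hom = 𝟙 c)
    (zigR : (λ_ c).inv ≫ cup ▷ c ≫ (α_ _ _ _).hom ≫ c ◁ cap ≫ (ρ_ c).hom = 𝟙 c)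
    (circle : cup ≫ cap = (2 : K) • 𝟙 _)
    {X : M} {Q : X ⟶ X} {P : X ⊗ c ⟶ X ⊗ c} {a b : K} (hab : a * b = 1)
    (h : Inv cap cup X Q P b) : Inv cap cup (X ⊗ c) P (step cap cup a P) (2 - a) := by
  have hp : P ▷ c ≫ P ▷ c = P ▷ c := by rw [← comp_whiskerRight, h.idem]
  have hp' {Z : M} (g : (X ⊗ c) ⊗ c ⟶ Z) : P ▷ c ≫ P ▷ c ≫ g = P ▷ c ≫ g := by
    rw [← Category.assoc, hp]
  have hq {Z : M} (g : (X ⊗ c) ⊗ c ⟶ Z) : P ▷ c ≫ Q ▷ c ▷ c ≫ g = P ▷ c ≫ g := by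
    rw [← Category.assoc, ← comp_whiskerRight, h.right]
  have hE {Z : M} (g : (X ⊗ c) ⊗ c ⟶ Z) : e cap cup X ≫ P ▷ c ≫ e cap cup X ≫ g =
      b • (Q ▷ c ▷ c ≫ e cap cup X ≫ g) := by
    have := h.ePe =≫ g
    simpa using this
  have hn := e_natural cap cup P
  have ht := e_tl cap cup zigL zigR X
  have hs := e_sq cap cup circle (X ⊗ c)
  have hPP : P ▷ c ▷ c ≫ P ▷ c ▷ c = P ▷ c ▷ c := by
    rw [← comp_whiskerRight, hp]
  refine ⟨?_, ?_, ?_, ?_⟩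
  · simp only [step, Preadditive.sub_comp, Preadditive.comp_sub, Linear.smul_comp,
      Linear.comp_smul, Category.assoc, hp, hp', hE, hq, smul_smul]
    rw [hab, one_smul, sub_self, smul_zero, sub_zero]
  · simp only [step, Preadditive.comp_sub, Linear.comp_smul, hp, hp']
  · simp only [step, Preadditive.sub_comp, Linear.smul_comp, Category.assoc, hp]
  · have h1 : e cap cup (X ⊗ c) ≫ P ▷ c ▷ c ≫ e cap cup (X ⊗ c) =
        (2 : K) • (P ▷ c ▷ c ≫ e cap cup (X ⊗ c)) := by
      rw [hn, ← Category.assoc, hs, Linear.smul_comp, ← hn]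
    have h2 : e cap cup (X ⊗ c) ≫ (P ▷ c ≫ e cap cup X ≫ P ▷ c) ▷ c ≫ e cap cup (X ⊗ c) =
        P ▷ c ▷ c ≫ e cap cup (X ⊗ c) := by
      simp only [comp_whiskerRight, Category.assoc]
      rw [hn, ← Category.assoc, ← hn, Category.assoc]
      have := ht =≫ P ▷ c ▷ c
      simp only [Category.assoc] at this
      rw [← hn] at this
      rw [this, ← Category.assoc, hPP]
    have h3 : step cap cup a P ▷ c = P ▷ c ▷ c - a • ((P ▷ c ≫ e cap cup X ≫ P ▷ c) ▷ c) := by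
      rw [step, sub_eq_add_neg, ← neg_smul, MonoidalPreadditive.add_whiskerRight,
        MonoidalLinear.smul_whiskerRight, neg_smul, ← sub_eq_add_neg]
    rw [h3, Preadditive.sub_comp, Preadditive.comp_sub, Linear.smul_comp, Linear.comp_smul, h1,
      h2, ← sub_smul]

end TLGen

/-! ## The dotted Temperley-Lieb category -/

/-- Generating morphisms: cup, cap and dot on one self-dual object. -/
inductive DGen : BWord Unit → BWord Unit → ℤ → Type
  | cup : DGen .unit (.tensor (.of ()) (.of ())) 0
  | cap : DGen (.tensor (.of ()) (.of ())) .unit 0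
  | dot : DGen (.of ()) (.of ()) 2

namespace DTm

/-- Expressions in the generators of the dotted Temperley-Lieb category. -/
abbrev E (K : Type u) (X Y : BWord Unit) (d : ℤ) : Type u := Tm K DGen X Y d

variable {K : Type u}

/-- The generating object. -/
abbrev c : BWord Unit := .of ()

abbrev cup : E K .unit (.tensor c c) 0 := .gen .cup
abbrev cap : E K (.tensor c c) .unit 0 := .gen .cap
abbrev dot : E K c c 2 := .gen .dot

/-- A dot on the left, respectively right, one of two strands. -/
abbrev dotL : E K (.tensor c c) (.tensor c c) 2 := .tHom dot (.idm c) (add_zero 2)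
abbrev dotR : E K (.tensor c c) (.tensor c c) 2 := .tHom (.idm c) dot (zero_add 2)

/-- The two zigzags. -/
abbrev zigL : E K c c 0 :=
  .comp (.rInv c) (.comp (.tHom (.idm c) cup (add_zero 0)) (.comp (.aInv c c c)
    (.comp (.tHom cap (.idm c) (add_zero 0)) (.lHom c) (add_zero 0)) (add_zero 0)) (add_zero 0))
    (add_zero 0)
abbrev zigR : E K c c 0 :=
  .comp (.lInv c) (.comp (.tHom cup (.idm c) (add_zero 0)) (.comp (.aHom c c c)
    (.comp (.tHom (.idm c) cap (add_zero 0)) (.rHom c) (add_zero 0)) (add_zero 0)) (add_zero 0))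
    (add_zero 0)

end DTm

open DTm in
/-- Defining relations: duality and cyclicity of the dot (planar isotopy), circle value `2`,
`dot ∘ dot = 0`, and the relation expressing the sum of the two dots on two strands. -/
inductive DRel (K : Type u) [Field K] :
    ∀ {X Y : BWord Unit} {d : ℤ}, Tm K DGen X Y d → Tm K DGen X Y d → Prop
  | zigL : DRel K zigL (.idm c)
  | zigR : DRel K zigR (.idm c)
  | dot_cup : DRel K (.comp cup dotL (zero_add 2)) (.comp cup dotR (zero_add 2))
  | dot_cap : DRel K (.comp dotL cap (add_zero 2)) (.comp dotR cap (add_zero 2))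
  | circle : DRel K (.comp cup cap (add_zero 0)) (.smul 2 (.idm .unit))
  | dot_dot : DRel K (.comp dot dot (two_add_two_eq_four : (2 : ℤ) + 2 = 4)) (.zero c c 4)
  | dot_sum : DRel K (.add dotL dotR)
      (.add (.comp (.comp dotL cap (add_zero 2)) cup (add_zero 2))
        (.comp cap (.comp cup dotL (zero_add 2)) (zero_add 2)))

/-- The objects of the dotted Temperley-Lieb category: tensor products of copies of `c`. -/
def DTL : Type := BWord Unit

instance DTL.grMonCat (K : Type u) [Field K] : GrMonCat.{u} K DTL := presented (K := K) (DRel K)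

namespace DTL

open GrCat GrMonCat CategoryTheory.MonoidalCategory

variable (K : Type u) [Field K]

/-- `cpow n` is the `n`-th tensor power of `c`. -/
def cpow (n : ℕ) : DTL := BWord.pow () n

/-- The generating object. -/
def c : DTL := BWord.of ()

/-- The morphism represented by an expression. -/
def mk {X Y : BWord Unit} {d : ℤ} (f : Tm K DGen X Y d) : Hom K (C := DTL) X Y d :=
  PHom.mk (DRel K) f

section JW

/-- The objects regarded as objects of the degree zero subcategory. -/
abbrev c0 : Deg0 K DTL := c
abbrev cp (n : ℕ) : Deg0 K DTL := cpow n

def cup : 𝟙_ (Deg0 K DTL) ⟶ c0 K ⊗ c0 K := mk K DTm.cup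
def cap : c0 K ⊗ c0 K ⟶ 𝟙_ (Deg0 K DTL) := mk K DTm.cap

theorem zigL : (ρ_ (c0 K)).inv ≫ c0 K ◁ cup K ≫ (α_ _ _ _).inv ≫ cap K ▷ c0 K ≫ (λ_ _).hom = 𝟙 _ :=
  PHom.sound (.rel .zigL)

theorem zigR : (λ_ (c0 K)).inv ≫ cup K ▷ c0 K ≫ (α_ _ _ _).hom ≫ c0 K ◁ cap K ≫ (ρ_ _).hom = 𝟙 _ :=
  PHom.sound (.rel .zigR)

theorem circle : cup K ≫ cap K = (2 : K) • 𝟙 _ := PHom.sound (.rel .circle)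

/-- The Jones-Wenzl projectors (at circle value `2`), by the Wenzl recursion
`P (n + 2) = P (n + 1) ⊗ 1 - ((n + 1) / (n + 2)) (P (n + 1) ⊗ 1) e (P (n + 1) ⊗ 1)`. -/
def jw : ∀ n : ℕ, cp K n ⟶ cp K n
  | 0 => 𝟙 _
  | 1 => 𝟙 _
  | n + 2 => TLGen.step (X := cp K n) (cap K) (cup K) (((n : K) + 1) / (n + 2)) (jw (n + 1))

theorem jw_inv [CharZero K] (n : ℕ) : TLGen.Inv (cap K) (cup K) (cp K n) (jw K n) (jw K (n + 1))
    (((n : K) + 2) / (n + 1)) := by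
  induction n with
  | zero =>
    have := TLGen.inv_zero (K := K) (cap K) (cup K) (circle K)
    have h2 : (2 : K) = ((0 : ℕ) + 2) / ((0 : ℕ) + 1) := by simp
    rw [h2] at this
    exact this
  | succ n ih =>
    have h1 : (n : K) + 1 ≠ 0 := by exact_mod_cast n.succ_ne_zero
    have h2 : (n : K) + 2 ≠ 0 := by exact_mod_cast (n + 1).succ_ne_zero
    have := TLGen.inv_step (cap K) (cup K) (zigL K) (zigR K) (circle K)
      (a := ((n : K) + 1) / (n + 2)) (by field_simp) ih
    have h3 : (2 : K) - (n + 1) / (n + 2) = (((n + 1 : ℕ) : K) + 2) / (((n + 1 : ℕ) : K) + 1) := by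
      have h2' : (n : K) + 1 + 1 ≠ 0 := by rwa [add_assoc, one_add_one_eq_two]
      push_cast
      field_simp
      ring
    rw [h3] at this
    exact this

theorem jw_idem [CharZero K] (n : ℕ) : jw K n ≫ jw K n = jw K n := by
  cases n with
  | zero => exact Category.id_comp _
  | succ n => exact (jw_inv K n).idem

end JW

end DTL

/-! ## The Karoubi envelope -/

/-- Objects of the Karoubi envelope: an object with a degree zero idempotent. -/
structure Kar (K : Type u') (C : Type u) [Field K] [GrCat.{v} K C] where
  X : C
  p : GrCat.Hom K X X 0
  idem : GrCat.comp p p (add_zero 0) = p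

namespace Kar

open GrCat GrMonCat

variable {K : Type u'} [Field K] {C : Type u}

section Cat

variable [GrCat.{v} K C]

/-- Morphisms are the morphisms `f` with `f = q ∘ f ∘ p`. -/
def sub (A B : Kar K C) (d : ℤ) : Submodule K (GrCat.Hom K A.X B.X d) where
  carrier := {f | comp A.p f (zero_add d) = f ∧ comp f B.p (add_zero d) = f}
  add_mem' := by
    rintro f g ⟨h1, h2⟩ ⟨h3, h4⟩
    exact ⟨by rw [comp_add, h1, h3], by rw [add_comp, h2, h4]⟩
  zero_mem' := ⟨comp_zero _ _, zero_comp _ _⟩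
  smul_mem' := by
    rintro a f ⟨h1, h2⟩
    exact ⟨by rw [comp_smul, h1], by rw [smul_comp, h2]⟩

instance grCat : GrCat.{v} K (Kar K C) where
  Hom A B d := sub A B d
  idm A := ⟨A.p, A.idem, A.idem⟩
  comp {A B D k l m} f g h := ⟨comp f.1 g.1 h, by
    rw [← assoc A.p f.1 g.1 (zero_add k) h h (zero_add m), f.2.1], by
    rw [assoc f.1 g.1 D.p h (add_zero m) (add_zero l) h, g.2.2]⟩
  add_comp f f' g h := Subtype.ext (add_comp _ _ _ _)
  smul_comp a f g h := Subtype.ext (smul_comp _ _ _ _)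
  comp_add f g g' h := Subtype.ext (comp_add _ _ _ _)
  comp_smul a f g h := Subtype.ext (comp_smul _ _ _ _)
  id_comp f h := Subtype.ext f.2.1
  comp_id f h := Subtype.ext f.2.2
  assoc f g p h₁ h₂ h₃ h₄ := Subtype.ext (assoc _ _ _ _ _ _ _)

@[ext] theorem hom_ext {A B : Kar K C} {d : ℤ} {f g : Hom K A B d} (h : f.1 = g.1) : f = g :=
  Subtype.ext h

/-- The embedding on objects. -/
abbrev of (K : Type u') [Field K] {C : Type u} [GrCat.{v} K C] (X : C) : Kar K C :=
  ⟨X, GrCat.idm X, id_comp _ _⟩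

/-- The morphism `q ∘ f ∘ p` of the Karoubi envelope. -/
def trunc {A B : Kar K C} {d : ℤ} (f : Hom K A.X B.X d) : Hom K A B d :=
  ⟨comp (comp A.p f (zero_add d)) B.p (add_zero d), by
    rw [← assoc _ _ _ (zero_add d) (add_zero d) (add_zero d) (zero_add d),
      ← assoc _ _ _ (add_zero 0) (zero_add d) (zero_add d) (zero_add d), A.idem], by
    rw [assoc _ _ _ (add_zero d) (add_zero d) (add_zero 0) (add_zero d), B.idem]⟩

/-- A degree zero morphism commuting with the idempotents induces a morphism. -/
def struct {A B : Kar K C} (t : Hom K A.X B.X 0)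
    (h : comp A.p t (add_zero 0) = comp t B.p (add_zero 0)) : Hom K A B 0 :=
  ⟨comp A.p t (add_zero 0), by
    rw [← assoc _ _ _ (add_zero 0) (add_zero 0) (add_zero 0) (add_zero 0), A.idem], by
    rw [assoc _ _ _ (add_zero 0) (add_zero 0) (add_zero 0) (add_zero 0), ← h,
      ← assoc _ _ _ (add_zero 0) (add_zero 0) (add_zero 0) (add_zero 0), A.idem]⟩

theorem struct_comp_struct {A B : Kar K C} (t : Hom K A.X B.X 0) (s : Hom K B.X A.X 0)
    (ht : comp A.p t (add_zero 0) = comp t B.p (add_zero 0))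
    (hs : comp B.p s (add_zero 0) = comp s A.p (add_zero 0))
    (h : comp t s (add_zero 0) = GrCat.idm A.X) (h0 : (0 : ℤ) + 0 = 0) :
    comp (struct t ht) (struct s hs) h0 = GrCat.idm (K := K) A := by
  apply hom_ext
  change comp (comp A.p t _) (comp B.p s _) _ = A.p
  rw [hs, assoc _ _ _ (add_zero 0) (add_zero 0) (add_zero 0) (add_zero 0),
    ← assoc t s _ (add_zero 0) (add_zero 0) (add_zero 0) (add_zero 0), h, id_comp, A.idem]

end Cat

variable [GrMonCat.{v} K C]

theorem tHom_comp_idem {A B A' B' : Kar K C} {k l m : ℤ} {f : Hom K A.X B.X k}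
    {g : Hom K A'.X B'.X l} (hf : comp A.p f (zero_add k) = f) (hg : comp A'.p g (zero_add l) = g)
    (h : k + l = m) :
    comp (GrMonCat.tHom A.p A'.p (add_zero 0)) (GrMonCat.tHom f g h) (zero_add m) =
      GrMonCat.tHom f g h := by
  rw [← tHom_comp A.p f A'.p g (zero_add k) (zero_add l) h, hf, hg]

theorem comp_tHom_idem {A B A' B' : Kar K C} {k l m : ℤ} {f : Hom K A.X B.X k}
    {g : Hom K A'.X B'.X l} (hf : comp f B.p (add_zero k) = f) (hg : comp g B'.p (add_zero l) = g)
    (h : k + l = m) :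
    comp (GrMonCat.tHom f g h) (GrMonCat.tHom B.p B'.p (add_zero 0)) (add_zero m) =
      GrMonCat.tHom f g h := by
  rw [← tHom_comp f B.p g B'.p (add_zero k) (add_zero l) h, hf, hg]

theorem struct_nat {A B A' B' : Kar K C} {d : ℤ} (t : Hom K A.X B.X 0) (t' : Hom K A'.X B'.X 0)
    (ht : comp A.p t (add_zero 0) = comp t B.p (add_zero 0))
    (ht' : comp A'.p t' (add_zero 0) = comp t' B'.p (add_zero 0))
    (f : Hom K A A' d) (g : Hom K B B' d) (h₁ : d + 0 = d) (h₂ : 0 + d = d)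
    (h : comp f.1 t' h₁ = comp t g.1 h₂) :
    comp f (struct t' ht') h₁ = comp (struct t ht) g h₂ := by
  apply hom_ext
  change comp f.1 (comp A'.p t' _) _ = comp (comp A.p t _) g.1 _
  rw [← assoc f.1 _ _ (add_zero d) (add_zero d) (add_zero 0) (add_zero d), f.2.2, h,
    assoc A.p _ _ (add_zero 0) (zero_add d) (zero_add d) (zero_add d), ← h,
    ← assoc _ f.1 _ (zero_add d) (add_zero d) (add_zero d) (zero_add d), f.2.1]

/-- The tensor product of objects. -/
abbrev tObj (A B : Kar K C) : Kar K C :=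
  ⟨GrMonCat.tObj K A.X B.X, tHom A.p B.p (add_zero 0), by
    rw [← tHom_comp A.p A.p B.p B.p (add_zero 0) (add_zero 0) (add_zero 0), A.idem, B.idem]⟩

theorem inv_comm {A B : Kar K C} {t : Hom K A.X B.X 0} {s : Hom K B.X A.X 0}
    (ht : comp A.p t (add_zero 0) = comp t B.p (add_zero 0))
    (h : comp t s (add_zero 0) = GrCat.idm A.X) (h' : comp s t (add_zero 0) = GrCat.idm B.X) :
    comp B.p s (add_zero 0) = comp s A.p (add_zero 0) := by
  have e1 : comp s (comp (comp A.p t (add_zero 0)) s (add_zero 0)) (add_zero 0) =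
      comp s A.p (add_zero 0) := by
    rw [assoc A.p _ _ (add_zero 0) (add_zero 0) (add_zero 0) (add_zero 0), h, comp_id]
  rw [← e1, ht, assoc t _ _ (add_zero 0) (add_zero 0) (add_zero 0) (add_zero 0),
    ← assoc s t _ (add_zero 0) (add_zero 0) (add_zero 0) (add_zero 0), h', id_comp]

theorem aComm (A B D : Kar K C) :
    comp (tObj (tObj A B) D).p (aHom A.X B.X D.X) (add_zero 0) =
      comp (aHom A.X B.X D.X) (tObj A (tObj B D)).p (add_zero 0) :=
  aHom_nat A.p B.p D.p _ _ _ _ _ _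

theorem lComm (A : Kar K C) :
    comp (tObj (of K (GrMonCat.unit K)) A).p (lHom A.X) (add_zero 0) =
      comp (lHom A.X) A.p (add_zero 0) :=
  lHom_nat A.p _ _

theorem rComm (A : Kar K C) :
    comp (tObj A (of K (GrMonCat.unit K))).p (rHom A.X) (add_zero 0) =
      comp (rHom A.X) A.p (add_zero 0) :=
  rHom_nat A.p _ _

theorem struct_comp {A B D : Kar K C} (t : Hom K A.X B.X 0) (s : Hom K B.X D.X 0)
    (ht : comp A.p t (add_zero 0) = comp t B.p (add_zero 0))
    (hs : comp B.p s (add_zero 0) = comp s D.p (add_zero 0)) (h : (0 : ℤ) + 0 = 0) :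
    comp (struct t ht) (struct s hs) h = struct (comp t s h) (by
      rw [← assoc A.p _ _ (add_zero 0) (add_zero 0) (add_zero 0) (add_zero 0), ht,
        assoc t _ _ (add_zero 0) (add_zero 0) (add_zero 0) (add_zero 0), hs,
        ← assoc t _ _ (add_zero 0) (add_zero 0) (add_zero 0) (add_zero 0)]) := by
  apply hom_ext
  change comp (comp A.p t _) (comp B.p s _) _ = comp A.p (comp t s _) _
  rw [ht, assoc t _ _ (add_zero 0) (add_zero 0) (add_zero 0) (add_zero 0),
    ← assoc B.p _ _ (add_zero 0) (add_zero 0) (add_zero 0) (add_zero 0), B.idem,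
    ← assoc t _ _ (add_zero 0) (add_zero 0) (add_zero 0) (add_zero 0), ← ht,
    assoc A.p _ _ (add_zero 0) (add_zero 0) (add_zero 0) (add_zero 0)]

/-- The tensor product of morphisms. -/
def tHom {A B A' B' : Kar K C} {k l m : ℤ} (f : Hom K A B k) (g : Hom K A' B' l) (h : k + l = m) :
    Hom K (tObj A A') (tObj B B') m :=
  ⟨GrMonCat.tHom f.1 g.1 h, tHom_comp_idem f.2.1 g.2.1 h, comp_tHom_idem f.2.2 g.2.2 h⟩

theorem tHom_struct {A B A' B' : Kar K C} (t : Hom K A.X B.X 0) (s : Hom K A'.X B'.X 0)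
    (ht : comp A.p t (add_zero 0) = comp t B.p (add_zero 0))
    (hs : comp A'.p s (add_zero 0) = comp s B'.p (add_zero 0)) (h : (0 : ℤ) + 0 = 0) :
    tHom (struct t ht) (struct s hs) h =
      struct (A := tObj A A') (B := tObj B B') (GrMonCat.tHom t s h) (by
        change comp (GrMonCat.tHom A.p A'.p _) _ _ = comp _ (GrMonCat.tHom B.p B'.p _) _
        rw [← tHom_comp _ _ _ _ (add_zero 0) (add_zero 0) (add_zero 0), ht, hs,
          tHom_comp _ _ _ _ (add_zero 0) (add_zero 0) (add_zero 0)]) := by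
  apply hom_ext
  exact tHom_comp _ _ _ _ _ _ _ _ _ _

theorem id_eq_struct (A : Kar K C) :
    GrCat.idm (K := K) A = struct (GrCat.idm A.X) (by rw [id_comp, comp_id]) := by
  apply hom_ext
  exact (comp_id _ _).symm

theorem struct_congr {A B : Kar K C} {t s : Hom K A.X B.X 0}
    (ht : comp A.p t (add_zero 0) = comp t B.p (add_zero 0))
    (hs : comp A.p s (add_zero 0) = comp s B.p (add_zero 0)) (h : t = s) :
    struct t ht = struct s hs := by subst h; rfl

/-- The associator and the unitors. -/
def aM (A B D : Kar K C) : Hom K (tObj (tObj A B) D) (tObj A (tObj B D)) 0 :=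
  struct (aHom A.X B.X D.X) (aComm A B D)

def lM (A : Kar K C) : Hom K (tObj (of K (GrMonCat.unit K)) A) A 0 := struct (lHom A.X) (lComm A)

def rM (A : Kar K C) : Hom K (tObj A (of K (GrMonCat.unit K))) A 0 := struct (rHom A.X) (rComm A)

theorem pentagon' (W X Y Z : Kar K C) (h : (0 : ℤ) + 0 = 0) :
    comp (tHom (aM W X Y) (GrCat.idm Z) h)
      (comp (aM W (tObj X Y) Z) (tHom (GrCat.idm W) (aM X Y Z) h) h) h =
      comp (aM (tObj W X) Y Z) (aM W X (tObj Y Z)) h := by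
  simp only [aM, id_eq_struct, tHom_struct, struct_comp]
  exact struct_congr (A := tObj (tObj (tObj W X) Y) Z) (B := tObj W (tObj X (tObj Y Z))) _ _
    (pentagon W.X X.X Y.X Z.X h)

theorem triangle' (X Y : Kar K C) (h : (0 : ℤ) + 0 = 0) :
    comp (aM X (of K (GrMonCat.unit K)) Y) (tHom (GrCat.idm X) (lM Y) h) h =
      tHom (rM X) (GrCat.idm Y) h := by
  simp only [aM, lM, rM, id_eq_struct, tHom_struct, struct_comp]
  exact struct_congr (A := tObj (tObj X (of K (GrMonCat.unit K))) Y) (B := tObj X Y) _ _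
    (triangle X.X Y.X h)

instance grMonCat : GrMonCat.{v} K (Kar K C) where
  toGrCat := grCat
  unit := of K (GrMonCat.unit K)
  tObj := tObj
  tHom := tHom
  add_tHom f f' g h := Subtype.ext (add_tHom _ _ _ _)
  smul_tHom a f g h := Subtype.ext (smul_tHom _ _ _ _)
  tHom_add f g g' h := Subtype.ext (tHom_add _ _ _ _)
  tHom_smul a f g h := Subtype.ext (tHom_smul _ _ _ _)
  tHom_id A B h := rfl
  tHom_comp f g f' g' h h' h₁ h₂ h₃ h₄ := Subtype.ext (tHom_comp _ _ _ _ _ _ _ _ _ _)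
  aHom := aM
  aInv A B D := struct (A := tObj A (tObj B D)) (B := tObj (tObj A B) D) (aInv A.X B.X D.X)
    (inv_comm (A := tObj (tObj A B) D) (B := tObj A (tObj B D)) (aComm A B D) (aHom_aInv _ _ _ _) (aInv_aHom _ _ _ _))
  lHom := lM
  lInv A := struct (A := A) (B := tObj (of K (GrMonCat.unit K)) A) (lInv A.X) (inv_comm (A := tObj (of K (GrMonCat.unit K)) A) (B := A) (lComm A) (lHom_lInv _ _) (lInv_lHom _ _))
  rHom := rM
  rInv A := struct (A := A) (B := tObj A (of K (GrMonCat.unit K))) (rInv A.X) (inv_comm (A := tObj A (of K (GrMonCat.unit K))) (B := A) (rComm A) (rHom_rInv _ _) (rInv_rHom _ _))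
  aHom_aInv A B D h := struct_comp_struct _ _ _ _ (aHom_aInv _ _ _ _) h
  aInv_aHom A B D h := struct_comp_struct _ _ _ _ (aInv_aHom _ _ _ _) h
  lHom_lInv A h := struct_comp_struct _ _ _ _ (lHom_lInv _ _) h
  lInv_lHom A h := struct_comp_struct _ _ _ _ (lInv_lHom _ _) h
  rHom_rInv A h := struct_comp_struct _ _ _ _ (rHom_rInv _ _) h
  rInv_rHom A h := struct_comp_struct _ _ _ _ (rInv_rHom _ _) h
  aHom_nat f g p h₁ h₂ h₃ h₄ h₅ h₆ :=
    struct_nat _ _ _ _ _ _ h₅ h₆ (aHom_nat f.1 g.1 p.1 h₁ h₂ h₃ h₄ h₅ h₆)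
  lHom_nat {A B k} f h₁ h₂ := struct_nat _ _ _ _ _ _ h₂ h₁ (lHom_nat f.1 h₁ h₂)
  rHom_nat {A B k} f h₁ h₂ := struct_nat _ _ _ _ _ _ h₁ h₂ (rHom_nat f.1 h₁ h₂)
  pentagon := pentagon'
  triangle := triangle'

end Kar

/-! ## The additive and shift completion -/

namespace GrCat

variable {K : Type u'} [Field K] {C : Type u} [GrCat.{v} K C]

theorem cast_id_comp {X Y : C} {a k : ℤ} (e : 0 = a) (f : Hom K X Y k) (h : a + k = k) :
    comp (dcast e (idm X)) f h = f := by
  subst e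
  exact id_comp f h

theorem comp_cast_id {X Y : C} {a k : ℤ} (e : 0 = a) (f : Hom K X Y k) (h : k + a = k) :
    comp f (dcast e (idm Y)) h = f := by
  subst e
  exact comp_id f h

end GrCat

namespace GrMonCat

open GrCat

variable {K : Type u'} [Field K] {C : Type u} [GrMonCat.{v} K C]

theorem tHom_id' (X Y : C) {a b d : ℤ} (ea : 0 = a) (eb : 0 = b) (ed : 0 = d) (h : a + b = d) :
    tHom (dcast ea (GrCat.idm (K := K) X)) (dcast eb (GrCat.idm Y)) h =
      dcast ed (GrCat.idm (tObj K X Y)) := by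
  subst ea eb ed
  exact tHom_id X Y h

theorem aHom_aInv' (X Y Z : C) {a b d : ℤ} (ea : 0 = a) (eb : 0 = b) (ed : 0 = d)
    (h : a + b = d) :
    comp (dcast ea (aHom (K := K) X Y Z)) (dcast eb (aInv X Y Z)) h = dcast ed (GrCat.idm _) := by
  subst ea eb ed
  exact aHom_aInv X Y Z h

theorem aInv_aHom' (X Y Z : C) {a b d : ℤ} (ea : 0 = a) (eb : 0 = b) (ed : 0 = d)
    (h : a + b = d) :
    comp (dcast ea (aInv (K := K) X Y Z)) (dcast eb (aHom X Y Z)) h = dcast ed (GrCat.idm _) := by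
  subst ea eb ed
  exact aInv_aHom X Y Z h

theorem lHom_lInv' (X : C) {a b d : ℤ} (ea : 0 = a) (eb : 0 = b) (ed : 0 = d)
    (h : a + b = d) :
    comp (dcast ea (lHom (K := K) X)) (dcast eb (lInv X)) h = dcast ed (GrCat.idm _) := by
  subst ea eb ed
  exact lHom_lInv X h

theorem lInv_lHom' (X : C) {a b d : ℤ} (ea : 0 = a) (eb : 0 = b) (ed : 0 = d)
    (h : a + b = d) :
    comp (dcast ea (lInv (K := K) X)) (dcast eb (lHom X)) h = dcast ed (GrCat.idm _) := by
  subst ea eb ed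
  exact lInv_lHom X h

theorem rHom_rInv' (X : C) {a b d : ℤ} (ea : 0 = a) (eb : 0 = b) (ed : 0 = d)
    (h : a + b = d) :
    comp (dcast ea (rHom (K := K) X)) (dcast eb (rInv X)) h = dcast ed (GrCat.idm _) := by
  subst ea eb ed
  exact rHom_rInv X h

theorem rInv_rHom' (X : C) {a b d : ℤ} (ea : 0 = a) (eb : 0 = b) (ed : 0 = d)
    (h : a + b = d) :
    comp (dcast ea (rInv (K := K) X)) (dcast eb (rHom X)) h = dcast ed (GrCat.idm _) := by
  subst ea eb ed
  exact rInv_rHom X h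

theorem aHom_nat' {X Y Z X' Y' Z' : C} {a b c ab bc d d' e z z' : ℤ} (ez : 0 = z) (ez' : 0 = z')
    (f : Hom K X X' a)
    (g : Hom K Y Y' b) (p : Hom K Z Z' c) (h₁ : a + b = ab) (h₂ : ab + c = d) (h₃ : b + c = bc)
    (h₄ : a + bc = d') (h₅ : d + z = e) (h₆ : z' + d' = e) :
    comp (tHom (tHom f g h₁) p h₂) (dcast ez (aHom X' Y' Z')) h₅ =
      comp (dcast ez' (aHom X Y Z)) (tHom f (tHom g p h₃) h₄) h₆ := by
  subst ez ez'
  obtain rfl : d' = d := by omega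
  obtain rfl : e = d' := by omega
  exact aHom_nat f g p h₁ h₂ h₃ h₄ h₅ h₆

theorem lHom_nat' {X Y : C} {a k d e z z' : ℤ} (ez : 0 = z) (ez' : 0 = z') (ea : 0 = a)
    (f : Hom K X Y k) (h₁ : a + k = d) (h₂ : d + z = e) (h₃ : z' + k = e) :
    comp (tHom (dcast ea (GrCat.idm (unit K))) f h₁) (dcast ez (lHom Y)) h₂ =
      comp (dcast ez' (lHom X)) f h₃ := by
  subst ez ez' ea
  obtain rfl : d = k := by omega
  obtain rfl : e = d := by omega
  exact lHom_nat f h₁ h₂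

theorem rHom_nat' {X Y : C} {a k d e z z' : ℤ} (ez : 0 = z) (ez' : 0 = z') (ea : 0 = a)
    (f : Hom K X Y k) (h₁ : k + a = d) (h₂ : d + z = e) (h₃ : z' + k = e) :
    comp (tHom f (dcast ea (GrCat.idm (unit K))) h₁) (dcast ez (rHom Y)) h₂ =
      comp (dcast ez' (rHom X)) f h₃ := by
  subst ez ez' ea
  obtain rfl : d = k := by omega
  obtain rfl : e = d := by omega
  exact rHom_nat f h₁ h₃

theorem pentagon' (W X Y Z : C) {z₁ z₂ z₃ z₄ z₅ z₆ z₇ a b c d : ℤ} (e₁ : 0 = z₁) (e₂ : 0 = z₂)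
    (e₃ : 0 = z₃) (e₄ : 0 = z₄) (e₅ : 0 = z₅) (e₆ : 0 = z₆) (e₇ : 0 = z₇)
    (h₁ : z₁ + z₂ = a) (h₂ : z₄ + z₅ = b) (h₃ : z₃ + b = c) (h₄ : a + c = d) (h₅ : z₆ + z₇ = d) :
    comp (tHom (dcast e₁ (aHom W X Y)) (dcast e₂ (GrCat.idm Z)) h₁)
      (comp (dcast e₃ (aHom W (tObj K X Y) Z))
        (tHom (dcast e₄ (GrCat.idm W)) (dcast e₅ (aHom X Y Z)) h₂) h₃) h₄ =
      comp (dcast e₆ (aHom (tObj K W X) Y Z)) (dcast e₇ (aHom (K := K) W X (tObj K Y Z))) h₅ := by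
  subst e₁ e₂ e₃ e₄ e₅ e₆ e₇
  obtain rfl : a = 0 := by omega
  obtain rfl : b = 0 := by omega
  obtain rfl : c = 0 := by omega
  obtain rfl : d = 0 := by omega
  exact pentagon W X Y Z h₁

theorem triangle' (X Y : C) {z₁ z₂ z₃ z₄ z₅ a d : ℤ} (e₁ : 0 = z₁) (e₂ : 0 = z₂)
    (e₃ : 0 = z₃) (e₄ : 0 = z₄) (e₅ : 0 = z₅) (h₁ : z₂ + z₃ = a) (h₂ : z₁ + a = d)
    (h₃ : z₄ + z₅ = d) :
    comp (dcast e₁ (aHom X (unit K) Y)) (tHom (dcast e₂ (GrCat.idm X)) (dcast e₃ (lHom Y)) h₁) h₂ =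
      tHom (K := K) (dcast e₄ (rHom X)) (dcast e₅ (GrCat.idm Y)) h₃ := by
  subst e₁ e₂ e₃ e₄ e₅
  obtain rfl : a = 0 := by omega
  obtain rfl : d = 0 := by omega
  exact triangle X Y h₁

end GrMonCat

/-- Objects of the additive and shift completion: finite formal direct sums of shifts
`⨁ q ^ k i • X i`. -/
structure MatCat (C : Type u) where
  ι : Type
  [fin : Fintype ι]
  [dec : DecidableEq ι]
  k : ι → ℤ
  X : ι → C

attribute [instance] MatCat.fin MatCat.dec

namespace MatCat

open GrCat GrMonCat

variable {K : Type u'} [Field K] {C : Type u}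

section Cat

variable [GrCat.{v} K C]

/-- Morphisms are matrices; a degree `d` morphism from `q ^ k X` to `q ^ l Y` is a morphism from
`X` to `Y` of degree `d + k - l`. -/
abbrev MHom (K : Type u') [Field K] [GrCat.{v} K C] (A B : MatCat C) (d : ℤ) : Type v :=
  ∀ i j, Hom K (A.X i) (B.X j) (d + A.k i - B.k j)

/-- A matrix supported on the graph of a bijection of the index sets. -/
def mono {A B : MatCat C} {d : ℤ} (e : A.ι ≃ B.ι)
    (f : ∀ i, Hom K (A.X i) (B.X (e i)) (d + A.k i - B.k (e i))) : MHom K A B d :=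
  fun i j => if h : e i = j then h ▸ f i else 0

theorem mono_apply {A B : MatCat C} {d : ℤ} (e : A.ι ≃ B.ι)
    (f : ∀ i, Hom K (A.X i) (B.X (e i)) (d + A.k i - B.k (e i))) (i : A.ι) :
    mono e f i (e i) = f i := by simp [mono]

theorem mono_apply_ne {A B : MatCat C} {d : ℤ} (e : A.ι ≃ B.ι)
    (f : ∀ i, Hom K (A.X i) (B.X (e i)) (d + A.k i - B.k (e i))) {i : A.ι} {j : B.ι}
    (h : e i ≠ j) : mono e f i j = 0 := by simp [mono, h]

theorem mono_congr {A B : MatCat C} {d : ℤ} {e e' : A.ι ≃ B.ι}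
    {f : ∀ i, Hom K (A.X i) (B.X (e i)) (d + A.k i - B.k (e i))}
    {f' : ∀ i, Hom K (A.X i) (B.X (e' i)) (d + A.k i - B.k (e' i))} (he : ∀ i, e i = e' i)
    (hf : ∀ i, HEq (f i) (f' i)) : mono e f = mono e' f' := by
  obtain rfl : e = e' := Equiv.ext he
  obtain rfl : f = f' := funext fun i => eq_of_heq (hf i)
  rfl

def mId (A : MatCat C) : MHom K A A 0 :=
  mono (Equiv.refl _) fun i => dcast (by simp) (GrCat.idm (A.X i))

def mComp {A B D : MatCat C} {k l m : ℤ} (f : MHom K A B k) (g : MHom K B D l) (h : k + l = m) :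
    MHom K A D m :=
  fun i j => ∑ x, comp (f i x) (g x j) (by omega)

theorem mono_comp {A B D : MatCat C} {k l m : ℤ} (e : A.ι ≃ B.ι)
    (f : ∀ i, Hom K (A.X i) (B.X (e i)) (k + A.k i - B.k (e i))) (g : MHom K B D l)
    (h : k + l = m) (i : A.ι) (j : D.ι) :
    mComp (mono e f) g h i j = comp (f i) (g (e i) j) (by omega) := by
  rw [mComp, Finset.sum_eq_single (e i), mono_apply]
  · intro x _ hx
    rw [mono_apply_ne e f hx.symm, zero_comp]
  · simp

theorem comp_mono {A B D : MatCat C} {k l m : ℤ} (f : MHom K A B k) (e : B.ι ≃ D.ι)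
    (g : ∀ i, Hom K (B.X i) (D.X (e i)) (l + B.k i - D.k (e i)))
    (h : k + l = m) (i : A.ι) (j : B.ι) :
    mComp f (mono e g) h i (e j) = comp (f i j) (g j) (by omega) := by
  rw [mComp, Finset.sum_eq_single j, mono_apply]
  · intro x _ hx
    rw [mono_apply_ne e g (fun h => hx (e.injective h)), comp_zero]
  · simp

instance grCat : GrCat.{v} K (MatCat C) where
  Hom := MHom K
  idm := mId
  comp := mComp
  add_comp f f' g h := by
    funext i j
    simp [mComp, add_comp, Finset.sum_add_distrib]
  smul_comp a f g h := by
    funext i j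
    simp [mComp, smul_comp, Finset.smul_sum]
  comp_add f g g' h := by
    funext i j
    simp [mComp, comp_add, Finset.sum_add_distrib]
  comp_smul a f g h := by
    funext i j
    simp [mComp, comp_smul, Finset.smul_sum]
  id_comp f h := by
    funext i j
    rw [mId, mono_comp]
    exact cast_id_comp _ _ _
  comp_id {A B k} f h := by
    funext i j
    refine (comp_mono f (Equiv.refl _) _ h i j).trans ?_
    exact comp_cast_id _ _ _
  assoc f g p h₁ h₂ h₃ h₄ := by
    funext i j
    simp only [mComp, sum_comp, comp_sum]
    rw [Finset.sum_comm]
    refine Finset.sum_congr rfl fun x _ => Finset.sum_congr rfl fun y _ => ?_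
    exact assoc _ _ _ _ _ _ _

/-- The one-term formal sum `q ^ k X`. -/
abbrev single (k : ℤ) (X : C) : MatCat C where
  ι := Unit
  k := fun _ => k
  X := fun _ => X

/-- A morphism between one-term formal sums. -/
def singleHom {k l d : ℤ} {X Y : C} {m : ℤ} (f : Hom K X Y m) (h : m = d + k - l) :
    Hom K (single k X) (single l Y) d :=
  fun _ _ => dcast h f

end Cat

variable [GrMonCat.{v} K C]

/-- The tensor product of objects. -/
abbrev tObj (K : Type u') [Field K] [GrMonCat.{v} K C] (A B : MatCat C) : MatCat C where
  ι := A.ι × B.ι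
  k := fun i => A.k i.1 + B.k i.2
  X := fun i => GrMonCat.tObj K (A.X i.1) (B.X i.2)

/-- The Kronecker product of matrices. -/
def tHom {A B A' B' : MatCat C} {k l m : ℤ} (f : MHom K A B k) (g : MHom K A' B' l)
    (h : k + l = m) : MHom K (tObj K A A') (tObj K B B') m :=
  fun i j => GrMonCat.tHom (f i.1 j.1) (g i.2 j.2) (by dsimp only; omega)

theorem tHom_mono {A B A' B' : MatCat C} {k l m : ℤ} (e : A.ι ≃ B.ι)
    (f : ∀ i, Hom K (A.X i) (B.X (e i)) (k + A.k i - B.k (e i))) (e' : A'.ι ≃ B'.ι)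
    (f' : ∀ i, Hom K (A'.X i) (B'.X (e' i)) (l + A'.k i - B'.k (e' i))) (h : k + l = m) :
    tHom (mono e f) (mono e' f') h = mono (A := tObj K A A') (B := tObj K B B')
      (e.prodCongr e') (fun i => GrMonCat.tHom (f i.1) (f' i.2) (by simp only [Equiv.prodCongr_apply, Prod.map]; omega)) := by
  funext i j
  obtain ⟨j, rfl⟩ := (e.prodCongr e').surjective j
  by_cases hij : i = j
  · subst hij
    rw [mono_apply]
    exact congrArg₂ (GrMonCat.tHom · · _) (mono_apply e f i.1) (mono_apply e' f' i.2)
  · rw [mono_apply_ne _ _ (fun h => hij ((e.prodCongr e').injective h))]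
    have : i.1 ≠ j.1 ∨ i.2 ≠ j.2 := by
      by_contra hc
      push Not at hc
      exact hij (Prod.ext hc.1 hc.2)
    rcases this with h1 | h1
    · have := mono_apply_ne e f (fun h => h1 (e.injective h))
      refine (congrArg (GrMonCat.tHom · _ _) this).trans (zero_tHom _ _)
    · have := mono_apply_ne e' f' (fun h => h1 (e'.injective h))
      refine (congrArg (GrMonCat.tHom _ · _) this).trans (tHom_zero _ _)

theorem mono_comp_mono {A B D : MatCat C} {k l m : ℤ} (e : A.ι ≃ B.ι)
    (f : ∀ i, Hom K (A.X i) (B.X (e i)) (k + A.k i - B.k (e i))) (e' : B.ι ≃ D.ι)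
    (g : ∀ i, Hom K (B.X i) (D.X (e' i)) (l + B.k i - D.k (e' i))) (h : k + l = m) :
    mComp (mono e f) (mono e' g) h = mono (e.trans e') (fun i => comp (f i) (g (e i))
      (by simp only [Equiv.trans_apply]; omega)) := by
  funext i j
  rw [mono_comp]
  obtain ⟨j, rfl⟩ := (e.trans e').surjective j
  by_cases hij : i = j
  · subst hij
    rw [mono_apply]
    exact congrArg (comp _ · _) (mono_apply e' g (e i))
  · rw [mono_apply_ne _ _ (fun h => hij ((e.trans e').injective h))]
    exact (congrArg (comp _ · _) (mono_apply_ne e' g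
      (fun h => hij (e.injective (e'.injective h))))).trans (comp_zero _ _)

/-- The unit object. -/
abbrev mUnit (K : Type u') [Field K] (C : Type u) [GrMonCat.{v} K C] : MatCat C :=
  single 0 (GrMonCat.unit K)

def aM (A B D : MatCat C) : MHom K (tObj K (tObj K A B) D) (tObj K A (tObj K B D)) 0 :=
  mono (Equiv.prodAssoc _ _ _) fun i =>
    dcast (by simp only [Equiv.prodAssoc_apply]; omega) (aHom (A.X i.1.1) (B.X i.1.2) (D.X i.2))

def aI (A B D : MatCat C) : MHom K (tObj K A (tObj K B D)) (tObj K (tObj K A B) D) 0 :=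
  mono (Equiv.prodAssoc _ _ _).symm fun i =>
    dcast (by simp only [Equiv.prodAssoc_symm_apply]; omega) (aInv (A.X i.1) (B.X i.2.1) (D.X i.2.2))

def lM (A : MatCat C) : MHom K (tObj K (mUnit K C) A) A 0 :=
  mono (Equiv.punitProd _) fun i =>
    dcast (by simp only [Equiv.punitProd_apply]; omega) (lHom (A.X i.2))

def lI (A : MatCat C) : MHom K A (tObj K (mUnit K C) A) 0 :=
  mono (Equiv.punitProd _).symm fun i =>
    dcast (by simp only [Equiv.punitProd_symm_apply]; omega) (lInv (A.X i))

def rM (A : MatCat C) : MHom K (tObj K A (mUnit K C)) A 0 :=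
  mono (Equiv.prodPUnit _) fun i =>
    dcast (by simp only [Equiv.prodPUnit_apply]; omega) (rHom (A.X i.1))

def rI (A : MatCat C) : MHom K A (tObj K A (mUnit K C)) 0 :=
  mono (Equiv.prodPUnit _).symm fun i =>
    dcast (by simp only [Equiv.prodPUnit_symm_apply]; omega) (rInv (A.X i))

theorem tHom_mId (A B : MatCat C) (h : (0 : ℤ) + 0 = 0) :
    tHom (mId (K := K) A) (mId B) h = mId (tObj K A B) := by
  rw [mId, mId, tHom_mono, mId]
  refine mono_congr (fun i => rfl) fun i => heq_of_eq ?_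
  exact tHom_id' _ _ _ _ _ _

theorem mInv {A B : MatCat C} {e : A.ι ≃ B.ι} {e' : B.ι ≃ A.ι}
    {f : ∀ i, Hom K (A.X i) (B.X (e i)) (0 + A.k i - B.k (e i))}
    {g : ∀ i, Hom K (B.X i) (A.X (e' i)) (0 + B.k i - A.k (e' i))} (he : ∀ i, e' (e i) = i)
    (h : ∀ i, HEq (comp (m := 0 + A.k i - A.k (e' (e i))) (f i) (g (e i)) (by omega))
      (dcast (l := 0 + A.k i - A.k i) (by omega) (GrCat.idm (K := K) (A.X i)))) (h0 : (0 : ℤ) + 0 = 0) :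
    mComp (mono e f) (mono e' g) h0 = mId A := by
  rw [mono_comp_mono, mId]
  exact mono_congr he h

theorem aM_nat {A B D A' B' D' : MatCat C} {a b c ab bc d : ℤ} (f : MHom K A A' a)
    (g : MHom K B B' b) (p : MHom K D D' c) (h₁ : a + b = ab) (h₂ : ab + c = d) (h₃ : b + c = bc)
    (h₄ : a + bc = d) (h₅ : d + 0 = d) (h₆ : 0 + d = d) :
    mComp (tHom (tHom f g h₁) p h₂) (aM A' B' D') h₅ =
      mComp (aM A B D) (tHom f (tHom g p h₃) h₄) h₆ := by
  funext i j
  obtain ⟨j, rfl⟩ := (Equiv.prodAssoc _ _ _).surjective j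
  refine (comp_mono _ _ _ _ _ _).trans ((mono_comp _ _ _ _ _ _).trans ?_).symm
  exact (aHom_nat' _ _ _ _ _ _ _ _ _ _ _).symm

theorem lM_nat {A B : MatCat C} {k : ℤ} (f : MHom K A B k) (h₁ : 0 + k = k) (h₂ : k + 0 = k) :
    mComp (tHom (mId (mUnit K C)) f h₁) (lM B) h₂ = mComp (lM A) f h₁ := by
  funext i j
  obtain ⟨j, rfl⟩ := (Equiv.punitProd _).surjective j
  refine (comp_mono _ _ _ _ _ _).trans ((mono_comp _ _ _ _ _ _).trans ?_).symm
  exact (lHom_nat' _ _ (by simp) _ _ _ _).symm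

theorem rM_nat {A B : MatCat C} {k : ℤ} (f : MHom K A B k) (h₁ : k + 0 = k) (h₂ : 0 + k = k) :
    mComp (tHom f (mId (mUnit K C)) h₁) (rM B) h₁ = mComp (rM A) f h₂ := by
  funext i j
  obtain ⟨j, rfl⟩ := (Equiv.prodPUnit _).surjective j
  refine (comp_mono _ _ _ _ _ _).trans ((mono_comp _ _ _ _ _ _).trans ?_).symm
  exact (rHom_nat' _ _ (by simp) _ _ _ _).symm

theorem mPentagon (W X Y Z : MatCat C) (h : (0 : ℤ) + 0 = 0) :
    mComp (tHom (aM W X Y) (mId Z) h) (mComp (aM W (tObj K X Y) Z)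
      (tHom (mId W) (aM X Y Z) h) h) h =
      mComp (aM (tObj K W X) Y Z) (aM (K := K) W X (tObj K Y Z)) h := by
  simp only [aM, mId, tHom_mono, mono_comp_mono]
  refine mono_congr (fun i => rfl) fun i => heq_of_eq ?_
  exact pentagon' _ _ _ _ _ _ _ _ _ _ _ _ _ _ _ _

theorem mTriangle (X Y : MatCat C) (h : (0 : ℤ) + 0 = 0) :
    mComp (aM X (mUnit K C) Y) (tHom (mId X) (lM Y) h) h = tHom (rM (K := K) X) (mId Y) h := by
  simp only [aM, lM, rM, mId, tHom_mono, mono_comp_mono]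
  refine mono_congr (fun i => rfl) fun i => heq_of_eq ?_
  exact triangle' _ _ _ _ _ _ _ _ _ _

instance grMonCat : GrMonCat.{v} K (MatCat C) where
  toGrCat := grCat
  unit := mUnit K C
  tObj := tObj K
  tHom := tHom
  add_tHom f f' g h := by
    funext i j
    exact add_tHom _ _ _ _
  smul_tHom a f g h := by
    funext i j
    exact smul_tHom _ _ _ _
  tHom_add f g g' h := by
    funext i j
    exact tHom_add _ _ _ _
  tHom_smul a f g h := by
    funext i j
    exact tHom_smul _ _ _ _
  tHom_id := tHom_mId
  tHom_comp f g f' g' h h' h₁ h₂ h₃ h₄ := by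
    funext i j
    change GrMonCat.tHom (∑ x, _) (∑ x, _) _ = ∑ x, _
    rw [sum_tHom_sum, Finset.univ_product_univ]
    exact Finset.sum_congr rfl fun x _ => tHom_comp _ _ _ _ _ _ _ _ _ _
  aHom := aM
  aInv := aI
  lHom := lM
  lInv := lI
  rHom := rM
  rInv := rI
  aHom_aInv A B D h := mInv (fun i => rfl) (fun i => heq_of_eq (aHom_aInv' _ _ _ _ _ _ _)) h
  aInv_aHom A B D h := mInv (fun i => rfl) (fun i => heq_of_eq (aInv_aHom' _ _ _ _ _ _ _)) h
  lHom_lInv A h := mInv (fun i => rfl) (fun i => heq_of_eq (lHom_lInv' _ _ _ _ _)) h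
  lInv_lHom A h := mInv (fun i => rfl) (fun i => heq_of_eq (lInv_lHom' _ _ _ _ _)) h
  rHom_rInv A h := mInv (fun i => rfl) (fun i => heq_of_eq (rHom_rInv' _ _ _ _ _)) h
  rInv_rHom A h := mInv (fun i => rfl) (fun i => heq_of_eq (rInv_rHom' _ _ _ _ _)) h
  aHom_nat := aM_nat
  lHom_nat := lM_nat
  rHom_nat := rM_nat
  pentagon := mPentagon
  triangle := mTriangle

end MatCat

/-! ## The ind-completion -/

/-- Objects of the ind-completion: small filtered systems of objects and degree zero morphisms. -/
structure IndC (K : Type u') (C : Type u) [Field K] [GrCat.{v} K C] where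
  I : Type
  [cat : SmallCategory I]
  [filt : IsFiltered I]
  F : I ⥤ Deg0 K C

attribute [instance] IndC.cat IndC.filt

noncomputable section

namespace IndC

open GrCat GrMonCat

variable {K : Type u'} [Field K] {C : Type u}

section Cat

variable [GrCat.{v} K C]

/-- The object with index `j` of a system. -/
abbrev obj (β : IndC K C) (j : β.I) : C := β.F.obj j

/-- The transition morphism along `φ` of a system. -/
abbrev tr (β : IndC K C) {j j' : β.I} (φ : j ⟶ j') : Hom K (β.obj j) (β.obj j') 0 := β.F.map φ

theorem tr_id (β : IndC K C) (j : β.I) : β.tr (𝟙 j) = GrCat.idm (β.obj j) := β.F.map_id j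

theorem tr_comp (β : IndC K C) {i j k : β.I} (φ : i ⟶ j) (ψ : j ⟶ k) :
    β.tr (φ ≫ ψ) = comp (β.tr φ) (β.tr ψ) (add_zero 0) := β.F.map_comp φ ψ

/-- The directed system `j ↦ Hom (A, β j)` of degree `d` morphisms. -/
def homFun (A : C) (β : IndC K C) (d : ℤ) : β.I ⥤ ModuleCat.{v} K where
  obj j := ModuleCat.of K (Hom K A (β.obj j) d)
  map φ := ModuleCat.ofHom ((compL (add_zero d)).flip (β.tr φ))
  map_id j := by
    ext x
    change comp x (β.tr (𝟙 j)) _ = x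
    rw [tr_id, comp_id]
  map_comp φ ψ := by
    ext x
    change comp x (β.tr (φ ≫ ψ)) _ = comp (comp x (β.tr φ) _) (β.tr ψ) _
    rw [tr_comp, assoc]

/-- The filtered colimit `colim_j Hom (A, β j)`. -/
def Colim (A : C) (β : IndC K C) (d : ℤ) : Type v := ↥(Limits.colimit (homFun A β d))

namespace Colim

instance (A : C) (β : IndC K C) (d : ℤ) : AddCommGroup (Colim A β d) :=
  inferInstanceAs (AddCommGroup ↥(Limits.colimit (homFun A β d)))

instance (A : C) (β : IndC K C) (d : ℤ) : Module K (Colim A β d) :=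
  inferInstanceAs (Module K ↥(Limits.colimit (homFun A β d)))

variable {A A' A'' : C} {β γ : IndC K C} {k l m d : ℤ}

/-- The class of a morphism to the object with index `j`. -/
def of (j : β.I) : Hom K A (β.obj j) d →ₗ[K] Colim A β d :=
  (Limits.colimit.ι (homFun A β d) j).hom

theorem of_tr {j j' : β.I} (φ : j ⟶ j') (x : Hom K A (β.obj j) d) (h : d + 0 = d) :
    of j' (comp x (β.tr φ) h) = of j x :=
  congrArg (fun t => t.hom x) (Limits.colimit.w (homFun A β d) φ)

theorem exists_rep (x : Colim A β d) : ∃ (j : β.I) (y : Hom K A (β.obj j) d), of j y = x := by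
  let S : Submodule K (Limits.colimit (homFun A β d) : ModuleCat.{v} K) :=
    { carrier := {x | ∃ (j : β.I) (y : Hom K A (β.obj j) d), of j y = x}
      add_mem' := by
        rintro _ _ ⟨j, y, rfl⟩ ⟨j', y', rfl⟩
        refine ⟨IsFiltered.max j j', comp y (β.tr (IsFiltered.leftToMax j j')) (add_zero d) +
          comp y' (β.tr (IsFiltered.rightToMax j j')) (add_zero d), ?_⟩
        rw [map_add, of_tr, of_tr]
        rfl
      zero_mem' := ⟨(IsFiltered.nonempty (C := β.I)).some, 0, map_zero _⟩
      smul_mem' := by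
        rintro a _ ⟨j, y, rfl⟩
        exact ⟨j, a • y, map_smul _ _ _⟩ }
  have h : ModuleCat.ofHom S.mkQ = 0 := by
    apply Limits.colimit.hom_ext
    intro j
    ext y
    exact (Submodule.Quotient.mk_eq_zero S).2 ⟨j, y, rfl⟩
  have h' : S.mkQ x = 0 := congrArg (fun t => t.hom x) h
  exact (Submodule.Quotient.mk_eq_zero S).1 h'

/-- The cocone of a compatible family of linear maps. -/
def liftCocone {M : Type v} [AddCommGroup M] [Module K M]
    (f : ∀ j : β.I, Hom K A (β.obj j) d →ₗ[K] M)
    (h : ∀ (j j' : β.I) (φ : j ⟶ j') x, f j' (comp x (β.tr φ) (add_zero d)) = f j x) :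
    Limits.Cocone (homFun A β d) where
  pt := ModuleCat.of K M
  ι :=
    { app := fun j => ModuleCat.ofHom (f j)
      naturality := by
        intro j j' φ
        ext x
        exact h _ _ φ x }

/-- The universal property. -/
def lift {M : Type v} [AddCommGroup M] [Module K M] (f : ∀ j : β.I, Hom K A (β.obj j) d →ₗ[K] M)
    (h : ∀ (j j' : β.I) (φ : j ⟶ j') x, f j' (comp x (β.tr φ) (add_zero d)) = f j x) :
    Colim A β d →ₗ[K] M :=
  (Limits.colimit.desc (homFun A β d) (liftCocone f h)).hom

@[simp] theorem lift_of {M : Type v} [AddCommGroup M] [Module K M]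
    (f : ∀ j : β.I, Hom K A (β.obj j) d →ₗ[K] M)
    (h : ∀ (j j' : β.I) (φ : j ⟶ j') x, f j' (comp x (β.tr φ) (add_zero d)) = f j x)
    (j : β.I) (x : Hom K A (β.obj j) d) : lift f h (of j x) = f j x :=
  congrArg (fun t => t.hom x) (Limits.colimit.ι_desc (liftCocone f h) j)

/-- Precomposition. -/
def pre (h : k + l = m) (f : Hom K A A' k) : Colim A' β l →ₗ[K] Colim A β m :=
  lift (fun j => (of j).comp (compL h f)) (by
    intro j j' φ x
    change of j' (comp f (comp x (β.tr φ) _) h) = of j (comp f x h)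
    rw [← assoc f x _ h (add_zero m) _ _, of_tr])

@[simp] theorem pre_of (h : k + l = m) (f : Hom K A A' k) (j : β.I) (x : Hom K A' (β.obj j) l) :
    pre h f (of j x) = of j (comp f x h) := lift_of _ _ _ _

theorem pre_pre {a ab : ℤ} (h₁ : k + l = m) (h₂ : a + m = d) (h₃ : a + k = ab) (h₄ : ab + l = d)
    (f : Hom K A A' a) (g : Hom K A' A'' k) (x : Colim A'' β l) :
    pre h₂ f (pre h₁ g x) = pre h₄ (comp f g h₃) x := by
  obtain ⟨j, x, rfl⟩ := exists_rep x
  simp only [pre_of]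
  rw [assoc f g x h₃ h₄ h₁ h₂]

theorem pre_id (h : 0 + l = l) (x : Colim A β l) : pre h (GrCat.idm A) x = x := by
  obtain ⟨j, x, rfl⟩ := exists_rep x
  rw [pre_of, id_comp]

theorem pre_add (h : k + l = m) (f f' : Hom K A A' k) (x : Colim A' β l) :
    pre h (f + f') x = pre h f x + pre h f' x := by
  obtain ⟨j, x, rfl⟩ := exists_rep x
  simp only [pre_of, add_comp, map_add]

theorem pre_smul (h : k + l = m) (a : K) (f : Hom K A A' k) (x : Colim A' β l) :
    pre h (a • f) x = a • pre h f x := by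
  obtain ⟨j, x, rfl⟩ := exists_rep x
  simp only [pre_of, smul_comp, map_smul]

end Colim

open Colim

/-- Morphisms of degree `d` from `α` to `β`: elements of `lim_i colim_j Hom (α i, β j)`. -/
def IHom (α β : IndC K C) (d : ℤ) : Submodule K (∀ i : α.I, Colim (α.obj i) β d) where
  carrier := {f | ∀ (i i' : α.I) (φ : i ⟶ i'), pre (zero_add d) (α.tr φ) (f i') = f i}
  add_mem' hf hg i i' φ := by
    rw [Pi.add_apply, map_add, hf, hg]
    rfl
  zero_mem' i i' φ := map_zero _
  smul_mem' a f hf i i' φ := by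
    rw [Pi.smul_apply, map_smul, hf]
    rfl

variable {k l m d : ℤ}

/-- Postcomposition. -/
def post {A : C} {β γ : IndC K C} (h : k + l = m) (g : IHom β γ l) :
    Colim A β k →ₗ[K] Colim A γ m :=
  Colim.lift (fun j => (LinearMap.mk (AddHom.mk (fun x => pre h x (g.1 j))
      (fun x y => pre_add h x y _)) (fun a x => pre_smul h a x _))) (by
    intro j j' φ x
    change pre h (comp x (β.tr φ) _) (g.1 j') = pre h x (g.1 j)
    rw [← pre_pre (zero_add l) h, g.2 _ _ φ])

@[simp] theorem post_of {A : C} {β γ : IndC K C} (h : k + l = m) (g : IHom β γ l) (j : β.I)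
    (x : Hom K A (β.obj j) k) : post h g (of j x) = pre h x (g.1 j) :=
  lift_of _ _ _ _

theorem pre_post {A A' : C} {β γ : IndC K C} {a b : ℤ} (g : IHom β γ l) (f : Hom K A A' a)
    (x : Colim A' β k) (h₁ : k + l = m) (h₂ : a + m = d) (h₃ : a + k = b) (h₄ : b + l = d) :
    pre h₂ f (post h₁ g x) = post h₄ g (pre h₃ f x) := by
  obtain ⟨j, x, rfl⟩ := exists_rep x
  rw [post_of, pre_of, post_of, pre_pre]

/-- Composition of morphisms. -/
def iComp {α β γ : IndC K C} (f : IHom α β k) (g : IHom β γ l) (h : k + l = m) : IHom α γ m :=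
  ⟨fun i => post h g (f.1 i), fun i i' φ => by
    rw [pre_post g _ _ h (zero_add m) (zero_add k) h, f.2 _ _ φ]⟩

theorem post_post {A : C} {α β γ : IndC K C} {a b : ℤ} (f : IHom α β k) (g : IHom β γ l)
    (x : Colim A α a) (h₁ : a + k = b) (h₂ : b + l = d) (h₃ : k + l = m) (h₄ : a + m = d) :
    post h₂ g (post h₁ f x) = post h₄ (iComp f g h₃) x := by
  obtain ⟨i, x, rfl⟩ := exists_rep x
  rw [post_of, post_of, ← pre_post g x _ h₃ h₄ h₁ h₂]
  rfl

/-- A functor of index categories together with a compatible family of morphisms of the objects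
of the systems induces a morphism of systems. -/
def ofFunctor {α β : IndC K C} (E : α.I ⥤ β.I) (η : α.F ⟶ E ⋙ β.F) : IHom α β 0 :=
  ⟨fun i => of (E.obj i) (η.app i), fun i i' φ => by
    refine (pre_of _ _ _ _).trans (Eq.trans ?_ (of_tr (E.map φ) (η.app i) (zero_add 0)))
    exact congrArg _ (η.naturality φ)⟩

/-- The identity morphism. -/
def iId (α : IndC K C) : IHom α α 0 := ofFunctor (𝟭 _) (𝟙 _)

theorem post_id {A : C} {β : IndC K C} (x : Colim A β k) (h : k + 0 = k) :
    post h (iId β) x = x := by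
  obtain ⟨i, x, rfl⟩ := exists_rep x
  rw [post_of]
  refine (pre_of _ _ _ _).trans (congrArg _ ?_)
  exact comp_id x h

instance grCat : GrCat.{v} K (IndC K C) where
  Hom α β d := IHom α β d
  idm := iId
  comp := iComp
  add_comp f f' g h := Subtype.ext (funext fun i => map_add _ _ _)
  smul_comp a f g h := Subtype.ext (funext fun i => map_smul _ _ _)
  comp_add {α β γ k l m} f g g' h := Subtype.ext (funext fun i => by
    change post h (g + g') (f.1 i) = post h g (f.1 i) + post h g' (f.1 i)
    obtain ⟨j, x, hx⟩ := exists_rep (f.1 i)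
    rw [← hx, post_of, post_of, post_of]
    exact map_add _ _ _)
  comp_smul {α β γ k l m} a f g h := Subtype.ext (funext fun i => by
    change post h (a • g) (f.1 i) = a • post h g (f.1 i)
    obtain ⟨j, x, hx⟩ := exists_rep (f.1 i)
    rw [← hx, post_of, post_of]
    exact map_smul _ _ _)
  id_comp {α β k} f h := Subtype.ext (funext fun i => by
    refine (post_of h f i (GrCat.idm (α.obj i))).trans ?_
    exact pre_id _ _)
  comp_id f h := Subtype.ext (funext fun i => post_id _ _)
  assoc f g p h₁ h₂ h₃ h₄ := Subtype.ext (funext fun i => post_post _ _ _ _ _ _ _)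

@[ext] theorem hom_ext {α β : IndC K C} {f g : Hom K α β d} (h : ∀ i, f.1 i = g.1 i) : f = g :=
  Subtype.ext (funext h)

/-- The constant system on one object. -/
abbrev const (X : C) : IndC K C where
  I := Discrete Unit
  F := Discrete.functor fun _ => X

/-- The embedding of morphisms as morphisms of constant systems. -/
def constHom {X Y : C} (f : Hom K X Y d) : Hom K (const (K := K) X) (const Y) d :=
  ⟨fun _ => of (β := const Y) ⟨()⟩ f, by
    rintro ⟨⟨⟩⟩ ⟨⟨⟩⟩ ⟨⟨⟨⟩⟩⟩
    refine (pre_of (β := const Y) _ _ _ _).trans (congrArg _ ?_)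
    exact id_comp f _⟩

end Cat

variable [GrMonCat.{v} K C] {k l m d : ℤ}

open MonoidalCategory in
/-- The tensor product of systems, indexed by the product of the index categories. -/
abbrev tObj (α β : IndC K C) : IndC K C where
  I := α.I × β.I
  F := α.F.prod β.F ⋙ MonoidalCategory.tensor (Deg0 K C)

open Colim

theorem tObj_tr (α β : IndC K C) {i j : (tObj α β).I} (φ : i ⟶ j) (h : (0 : ℤ) + 0 = 0) :
    (tObj α β).tr φ = tHom (α.tr φ.1) (β.tr φ.2) h := rfl

theorem of_tHom_tr {A A' : C} {β β' : IndC K C} (h : k + l = m) {i j : β.I} {i' j' : β'.I}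
    (φ : i ⟶ j) (φ' : i' ⟶ j') (x : Hom K A (β.obj i) k) (x' : Hom K A' (β'.obj i') l) :
    of (β := tObj β β') (j, j') (tHom (comp x (β.tr φ) (add_zero k))
      (comp x' (β'.tr φ') (add_zero l)) h) = of (β := tObj β β') (i, i') (tHom x x' h) := by
  have h1 := of_tr (β := tObj β β') (j := (i, i')) (j' := (j, j')) (φ, φ') (tHom x x' h)
    (add_zero m)
  rw [← h1, tHom_comp x (β.tr φ) x' (β'.tr φ') (add_zero k) (add_zero l) h h (add_zero 0)
    (add_zero m)]
  rfl

theorem of_tHom_tr_left {A A' : C} {β β' : IndC K C} (h : k + l = m) {i j : β.I} {i' : β'.I}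
    (φ : i ⟶ j) (x : Hom K A (β.obj i) k) (x' : Hom K A' (β'.obj i') l) :
    of (β := tObj β β') (j, i') (tHom (comp x (β.tr φ) (add_zero k)) x' h) =
      of (β := tObj β β') (i, i') (tHom x x' h) := by
  have h1 := of_tHom_tr h φ (𝟙 i') x x'
  rwa [tr_id, comp_id] at h1

theorem of_tHom_tr_right {A A' : C} {β β' : IndC K C} (h : k + l = m) {i : β.I} {i' j' : β'.I}
    (φ' : i' ⟶ j') (x : Hom K A (β.obj i) k) (x' : Hom K A' (β'.obj i') l) :
    of (β := tObj β β') (i, j') (tHom x (comp x' (β'.tr φ') (add_zero l)) h) =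
      of (β := tObj β β') (i, i') (tHom x x' h) := by
  have h1 := of_tHom_tr h (𝟙 i) φ' x x'
  rwa [tr_id, comp_id] at h1

/-- The tensor product of a morphism and a class. -/
def tensAux {A A' : C} {β β' : IndC K C} (h : k + l = m) (j : β.I) (x : Hom K A (β.obj j) k) :
    Colim A' β' l →ₗ[K] Colim (GrMonCat.tObj K A A') (tObj β β') m :=
  Colim.lift (fun j' => (of (β := tObj β β') (j, j')).comp (tHomL h x))
    (fun _ _ φ y => of_tHom_tr_right h φ x y)

theorem tensAux_of {A A' : C} {β β' : IndC K C} (h : k + l = m) (j : β.I) (j' : β'.I)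
    (x : Hom K A (β.obj j) k) (y : Hom K A' (β'.obj j') l) :
    tensAux h j x (of j' y) = of (β := tObj β β') (j, j') (tHom x y h) :=
  lift_of _ _ _ _

/-- The same map, linear in both variables. -/
def tensL {A A' : C} {β β' : IndC K C} (h : k + l = m) (j : β.I) : Hom K A (β.obj j) k →ₗ[K]
    Colim A' β' l →ₗ[K] Colim (GrMonCat.tObj K A A') (tObj β β') m where
  toFun := tensAux h j
  map_add' x y := by
    ext z
    obtain ⟨j', z, rfl⟩ := exists_rep z
    rw [LinearMap.add_apply, tensAux_of, tensAux_of, tensAux_of]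
    exact (congrArg _ (add_tHom x y z h)).trans (map_add _ _ _)
  map_smul' a x := by
    ext z
    obtain ⟨j', z, rfl⟩ := exists_rep z
    rw [LinearMap.smul_apply, tensAux_of, tensAux_of]
    exact (congrArg _ (smul_tHom a x z h)).trans (map_smul _ _ _)

/-- The tensor product of classes. -/
def tens {A A' : C} {β β' : IndC K C} (h : k + l = m) :
    Colim A β k →ₗ[K] Colim A' β' l →ₗ[K] Colim (GrMonCat.tObj K A A') (tObj β β') m :=
  Colim.lift (tensL h) (by
    intro j j' φ x
    ext z
    obtain ⟨i, z, rfl⟩ := exists_rep z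
    exact (tensAux_of _ _ _ _ _).trans ((of_tHom_tr_left h φ x z).trans
      (tensAux_of _ _ _ _ _).symm))

@[simp] theorem tens_of {A A' : C} {β β' : IndC K C} (h : k + l = m) (j : β.I) (j' : β'.I)
    (x : Hom K A (β.obj j) k) (y : Hom K A' (β'.obj j') l) :
    tens h (of j x) (of j' y) = of (β := tObj β β') (j, j') (tHom x y h) := by
  rw [tens, lift_of]
  exact tensAux_of _ _ _ _ _

theorem pre_tens {A A' B B' : C} {β β' : IndC K C} {a b c a' b' c' : ℤ} (f : Hom K A B a)
    (f' : Hom K A' B' a') (x : Colim B β b) (x' : Colim B' β' b') {aa bb d : ℤ}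
    (h : a + b = c) (h' : a' + b' = c') (h₁ : c + c' = d)
    (h₂ : a + a' = aa) (h₃ : b + b' = bb) (h₄ : aa + bb = d) :
    pre h₄ (tHom f f' h₂) (tens h₃ x x') = tens h₁ (pre h f x) (pre h' f' x') := by
  obtain ⟨j, x, rfl⟩ := exists_rep x
  obtain ⟨j', x', rfl⟩ := exists_rep x'
  simp only [tens_of, pre_of]
  refine congrArg _ ?_
  exact (tHom_comp _ _ _ _ _ _ _ _ _ _).symm

/-- The tensor product of morphisms. -/
def iTens {α β α' β' : IndC K C} (f : IHom α β k) (g : IHom α' β' l) (h : k + l = m) :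
    IHom (tObj α α') (tObj β β') m :=
  ⟨fun i => tens h (f.1 i.1) (g.1 i.2), by
    rintro ⟨i, i'⟩ ⟨j, j'⟩ φ
    refine (pre_tens (α.tr φ.1) (α'.tr φ.2) (f.1 j) (g.1 j') (zero_add k) (zero_add l) h
      (zero_add 0) h (zero_add m)).trans ?_
    rw [f.2 _ _ φ.1, g.2 _ _ φ.2]⟩

theorem post_tens {A A' : C} {α β α' β' : IndC K C} {a b c a' b' c' : ℤ} (f : IHom α β b)
    (f' : IHom α' β' b') (x : Colim A α a) (x' : Colim A' α' a') {aa bb d : ℤ}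
    (h : a + b = c) (h' : a' + b' = c') (h₁ : c + c' = d)
    (h₂ : a + a' = aa) (h₃ : b + b' = bb) (h₄ : aa + bb = d) :
    tens h₁ (post h f x) (post h' f' x') = post h₄ (iTens f f' h₃) (tens h₂ x x') := by
  obtain ⟨i, x, rfl⟩ := exists_rep x
  obtain ⟨i', x', rfl⟩ := exists_rep x'
  rw [post_of, post_of, tens_of, ← pre_tens x x' _ _ h h' h₁ h₂ h₃ h₄]
  exact (post_of (β := tObj α α') h₄ (iTens f f' h₃) (i, i') (tHom x x' h₂)).symm

/-- Comparison of the composites of two pairs of morphisms of systems. -/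
theorem ofFunctor_comp {α β γ : IndC K C} (E : α.I ⥤ β.I) (η : α.F ⟶ E ⋙ β.F) (E' : β.I ⥤ γ.I)
    (η' : β.F ⟶ E' ⋙ γ.F) (h : (0 : ℤ) + 0 = 0) (i : α.I) :
    (iComp (ofFunctor E η) (ofFunctor E' η') h).1 i =
      of (E'.obj (E.obj i)) (comp (η.app i) (η'.app (E.obj i)) h) :=
  (post_of _ _ _ _).trans (pre_of _ _ _ _)

/-- The unit object. -/
abbrev iUnit (K : Type u') [Field K] (C : Type u) [GrMonCat.{v} K C] : IndC K C :=
  const (GrMonCat.unit K)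

section Structure

open MonoidalCategory

variable (α β γ : IndC K C)

def aM : IHom (tObj (tObj α β) γ) (tObj α (tObj β γ)) 0 :=
  ofFunctor (prod.associator α.I β.I γ.I)
    { app := fun (i : (α.I × β.I) × γ.I) => (α_ (α.F.obj i.1.1) (β.F.obj i.1.2) (γ.F.obj i.2)).hom
      naturality := fun i j φ => associator_naturality _ _ _ }

def aI : IHom (tObj α (tObj β γ)) (tObj (tObj α β) γ) 0 :=
  ofFunctor (prod.inverseAssociator α.I β.I γ.I)
    { app := fun (i : α.I × β.I × γ.I) => (α_ (α.F.obj i.1) (β.F.obj i.2.1) (γ.F.obj i.2.2)).inv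
      naturality := fun i j φ => associator_inv_naturality _ _ _ }

def lM : IHom (tObj (iUnit K C) α) α 0 :=
  ofFunctor (CategoryTheory.Prod.snd (Discrete Unit) α.I)
    { app := fun (i : Discrete Unit × α.I) => (λ_ (α.F.obj i.2)).hom
      naturality := by
        rintro ⟨⟨⟨⟩⟩, i⟩ ⟨⟨⟨⟩⟩, j⟩ ⟨⟨⟨⟨⟩⟩⟩, φ⟩
        exact leftUnitor_naturality (α.F.map φ) }

def lI : IHom α (tObj (iUnit K C) α) 0 :=
  ofFunctor (β := tObj (iUnit K C) α) (Prod.sectR (⟨()⟩ : Discrete Unit) α.I)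
    { app := fun i => (λ_ (α.F.obj i)).inv
      naturality := fun i j φ => leftUnitor_inv_naturality (α.F.map φ) }

def rM : IHom (tObj α (iUnit K C)) α 0 :=
  ofFunctor (CategoryTheory.Prod.fst α.I (Discrete Unit))
    { app := fun (i : α.I × Discrete Unit) => (ρ_ (α.F.obj i.1)).hom
      naturality := by
        rintro ⟨i, ⟨⟨⟩⟩⟩ ⟨j, ⟨⟨⟩⟩⟩ ⟨φ, ⟨⟨⟨⟩⟩⟩⟩
        exact rightUnitor_naturality (α.F.map φ) }

def rI : IHom α (tObj α (iUnit K C)) 0 :=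
  ofFunctor (β := tObj α (iUnit K C)) (Prod.sectL α.I (⟨()⟩ : Discrete Unit))
    { app := fun i => (ρ_ (α.F.obj i)).inv
      naturality := fun i j φ => rightUnitor_inv_naturality (α.F.map φ) }

end Structure

theorem aM_nat {A B D A' B' D' : IndC K C} {a b c ab bc d : ℤ} (f : IHom A A' a)
    (g : IHom B B' b) (p : IHom D D' c) (h₁ : a + b = ab) (h₂ : ab + c = d) (h₃ : b + c = bc)
    (h₄ : a + bc = d) (h₅ : d + 0 = d) (h₆ : 0 + d = d) :
    iComp (iTens (iTens f g h₁) p h₂) (aM A' B' D') h₅ =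
      iComp (aM A B D) (iTens f (iTens g p h₃) h₄) h₆ := by
  refine Subtype.ext (funext fun i => ?_)
  obtain ⟨x, fx, hx⟩ := exists_rep (f.1 i.1.1)
  obtain ⟨y, gy, hy⟩ := exists_rep (g.1 i.1.2)
  obtain ⟨z, pz, hz⟩ := exists_rep (p.1 i.2)
  change post h₅ (aM A' B' D') (tens h₂ (tens h₁ (f.1 i.1.1) (g.1 i.1.2)) (p.1 i.2)) =
    post h₆ (iTens f (iTens g p h₃) h₄) (of _ _)
  rw [post_of]
  change _ = pre h₆ _ (tens h₄ (f.1 i.1.1) (tens h₃ (g.1 i.1.2) (p.1 i.2)))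
  rw [← hx, ← hy, ← hz, tens_of, tens_of, tens_of, tens_of, post_of, pre_of]
  refine (pre_of _ _ _ _).trans (congrArg _ ?_)
  exact aHom_nat fx gy pz h₁ h₂ h₃ h₄ h₅ h₆

theorem lM_nat {A B : IndC K C} (f : IHom A B k) (h₁ : 0 + k = k) (h₂ : k + 0 = k) :
    iComp (iTens (iId (iUnit K C)) f h₁) (lM B) h₂ = iComp (lM A) f h₁ := by
  refine Subtype.ext (funext fun i => ?_)
  obtain ⟨x, fx, hx⟩ := exists_rep (f.1 i.2)
  change post h₂ (lM B) (tens h₁ (of i.1 (GrCat.idm (unit K))) (f.1 i.2)) = post h₁ f (of _ _)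
  rw [post_of]
  change _ = pre h₁ _ (f.1 i.2)
  rw [← hx, tens_of, post_of, pre_of]
  refine (pre_of _ _ _ _).trans (congrArg _ ?_)
  exact lHom_nat fx h₁ h₂

theorem rM_nat {A B : IndC K C} (f : IHom A B k) (h₁ : k + 0 = k) (h₂ : 0 + k = k) :
    iComp (iTens f (iId (iUnit K C)) h₁) (rM B) h₁ = iComp (rM A) f h₂ := by
  refine Subtype.ext (funext fun i => ?_)
  obtain ⟨x, fx, hx⟩ := exists_rep (f.1 i.1)
  change post h₁ (rM B) (tens h₁ (f.1 i.1) (of i.2 (GrCat.idm (unit K)))) = post h₂ f (of _ _)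
  rw [post_of]
  change _ = pre h₂ _ (f.1 i.1)
  rw [← hx, tens_of, post_of, pre_of]
  refine (pre_of _ _ _ _).trans (congrArg _ ?_)
  exact rHom_nat fx h₁ h₂

theorem iTens_ofFunctor {α β α' β' : IndC K C} (E : α.I ⥤ β.I) (η : α.F ⟶ E ⋙ β.F)
    (E' : α'.I ⥤ β'.I) (η' : α'.F ⟶ E' ⋙ β'.F) (h : (0 : ℤ) + 0 = 0) (i : (tObj α α').I) :
    (iTens (ofFunctor E η) (ofFunctor E' η') h).1 i =
      of (β := tObj β β') (E.obj i.1, E'.obj i.2) (tHom (η.app i.1) (η'.app i.2) h) :=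
  tens_of _ _ _ _ _

theorem iInv {α β : IndC K C} {E : α.I ⥤ β.I} {η : α.F ⟶ E ⋙ β.F} {E' : β.I ⥤ α.I}
    {η' : β.F ⟶ E' ⋙ α.F} (h : (0 : ℤ) + 0 = 0)
    (h' : ∀ i, of (β := α) (E'.obj (E.obj i)) (comp (η.app i) (η'.app (E.obj i)) h) =
      of i (GrCat.idm (α.obj i))) : iComp (ofFunctor E η) (ofFunctor E' η') h = iId α :=
  Subtype.ext (funext fun i => (ofFunctor_comp _ _ _ _ _ _).trans (h' i))

theorem iPentagon (W X Y Z : IndC K C) (h : (0 : ℤ) + 0 = 0) :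
    iComp (iTens (aM W X Y) (iId Z) h) (iComp (aM W (tObj X Y) Z)
      (iTens (iId W) (aM X Y Z) h) h) h =
      iComp (aM (tObj W X) Y Z) (aM W X (tObj Y Z)) h := by
  refine Subtype.ext (funext fun i => ?_)
  have h1 : (iTens (aM W X Y) (iId Z) h).1 i = of _ _ := iTens_ofFunctor _ _ _ _ h i
  have h2 (j) : (iTens (iId W) (aM X Y Z) h).1 j = of _ _ := iTens_ofFunctor _ _ _ _ h j
  refine Eq.trans ?_ (ofFunctor_comp _ _ _ _ _ _).symm
  refine (congrArg (post h _) h1).trans ?_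
  rw [post_of]
  refine (congrArg (pre h _) ((post_of _ _ _ _).trans
    ((congrArg (pre h _) (h2 _)).trans (pre_of _ _ _ _)))).trans ?_
  refine (pre_of _ _ _ _).trans (congrArg _ ?_)
  exact pentagon _ _ _ _ h

theorem iTriangle (X Y : IndC K C) (h : (0 : ℤ) + 0 = 0) :
    iComp (aM X (iUnit K C) Y) (iTens (iId X) (lM Y) h) h = iTens (rM X) (iId Y) h := by
  refine Subtype.ext (funext fun i => ?_)
  have h1 : (iTens (rM X) (iId Y) h).1 i = of _ _ := iTens_ofFunctor _ _ _ _ h i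
  have h2 (j) : (iTens (iId X) (lM Y) h).1 j = of _ _ := iTens_ofFunctor _ _ _ _ h j
  refine Eq.trans ?_ h1.symm
  refine (post_of _ _ _ _).trans ((congrArg (pre h _) (h2 _)).trans ?_)
  refine (pre_of _ _ _ _).trans (congrArg _ ?_)
  exact triangle _ _ h

instance grMonCat : GrMonCat.{v} K (IndC K C) where
  toGrCat := grCat
  unit := iUnit K C
  tObj := tObj
  tHom := iTens
  add_tHom f f' g h := by
    refine Subtype.ext (funext fun i => ?_)
    exact LinearMap.congr_fun (map_add (tens h) (f.1 i.1) (f'.1 i.1)) (g.1 i.2)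
  smul_tHom a f g h := by
    refine Subtype.ext (funext fun i => ?_)
    exact LinearMap.congr_fun (map_smul (tens h) a (f.1 i.1)) (g.1 i.2)
  tHom_add f g g' h := by
    refine Subtype.ext (funext fun i => ?_)
    exact map_add (tens h (f.1 i.1)) (g.1 i.2) (g'.1 i.2)
  tHom_smul a f g h := by
    refine Subtype.ext (funext fun i => ?_)
    exact map_smul (tens h (f.1 i.1)) a (g.1 i.2)
  tHom_id X Y h := by
    refine Subtype.ext (funext fun i => ?_)
    refine (tens_of _ _ _ _ _).trans (congrArg _ ?_)
    exact tHom_id _ _ h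
  tHom_comp f g f' g' h h' h₁ h₂ h₃ h₄ := by
    refine Subtype.ext (funext fun i => ?_)
    exact post_tens _ _ _ _ _ _ _ _ _ _
  aHom := aM
  aInv := aI
  lHom := lM
  lInv := lI
  rHom := rM
  rInv := rI
  aHom_aInv X Y Z h := iInv h fun i => congrArg _ (aHom_aInv _ _ _ h)
  aInv_aHom X Y Z h := iInv h fun i => congrArg _ (aInv_aHom _ _ _ h)
  lHom_lInv X h := iInv h fun i => congrArg _ (lHom_lInv _ h)
  lInv_lHom X h := iInv h fun i => congrArg _ (lInv_lHom _ h)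
  rHom_rInv X h := iInv h fun i => congrArg _ (rHom_rInv _ h)
  rInv_rHom X h := iInv h fun i => congrArg _ (rInv_rHom _ h)
  aHom_nat := aM_nat
  lHom_nat := lM_nat
  rHom_nat := rM_nat
  pentagon := iPentagon
  triangle := iTriangle

end IndC

end

/-! ## The diagrammatic category with Kirby objects -/

/-- The image of an expression under a map of generators. -/
def Tm.relabel {K : Type u} {O O' : Type} (F : O → O') {G : BWord O → BWord O → ℤ → Type}
    {G' : BWord O' → BWord O' → ℤ → Type}
    (φ : ∀ {X Y d}, G X Y d → G' (X.map F) (Y.map F) d) :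
    ∀ {X Y d}, Tm K G X Y d → Tm K G' (X.map F) (Y.map F) d
  | _, _, _, .gen g => .gen (φ g)
  | _, _, _, .idm X => .idm (X.map F)
  | _, _, _, .comp f g h => .comp (f.relabel F φ) (g.relabel F φ) h
  | _, _, _, .tHom f g h => .tHom (f.relabel F φ) (g.relabel F φ) h
  | _, _, _, .aHom X Y Z => .aHom (X.map F) (Y.map F) (Z.map F)
  | _, _, _, .aInv X Y Z => .aInv (X.map F) (Y.map F) (Z.map F)
  | _, _, _, .lHom X => .lHom (X.map F)
  | _, _, _, .lInv X => .lInv (X.map F)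
  | _, _, _, .rHom X => .rHom (X.map F)
  | _, _, _, .rInv X => .rInv (X.map F)
  | _, _, _, .zero X Y d => .zero (X.map F) (Y.map F) d
  | _, _, _, .add f g => .add (f.relabel F φ) (g.relabel F φ)
  | _, _, _, .smul a f => .smul a (f.relabel F φ)

/-- A map of generators compatible with the relations respects the generated congruences. -/
theorem TmRel.relabel {K : Type u} [Field K] {O O' : Type} (F : O → O')
    {G : BWord O → BWord O → ℤ → Type} {G' : BWord O' → BWord O' → ℤ → Type}
    (φ : ∀ {X Y d}, G X Y d → G' (X.map F) (Y.map F) d)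
    {R : ∀ {X Y d}, Tm K G X Y d → Tm K G X Y d → Prop}
    {R' : ∀ {X Y d}, Tm K G' X Y d → Tm K G' X Y d → Prop}
    (hR : ∀ {X Y d} {f g : Tm K G X Y d}, R f g → R' (f.relabel F φ) (g.relabel F φ))
    {X Y : BWord O} {d : ℤ} {f g : Tm K G X Y d} (h : TmRel R f g) :
    TmRel R' (f.relabel F φ) (g.relabel F φ) := by
  induction h with
  | rel h => exact .rel (hR h)
  | refl f => exact .refl _
  | symm _ ih => exact .symm ih
  | trans _ _ ih ih' => exact .trans ih ih'
  | comp_congr h _ _ ih ih' => exact .comp_congr h ih ih'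
  | tHom_congr h _ _ ih ih' => exact .tHom_congr h ih ih'
  | add_congr _ _ ih ih' => exact .add_congr ih ih'
  | smul_congr a _ ih => exact .smul_congr a ih
  | add_assoc f g p => exact .add_assoc _ _ _
  | add_comm f g => exact .add_comm _ _
  | zero_add f => exact .zero_add _
  | neg_add f => exact .neg_add _
  | smul_add a f g => exact .smul_add _ _ _
  | add_smul a b f => exact .add_smul _ _ _
  | mul_smul a b f => exact .mul_smul _ _ _
  | one_smul f => exact .one_smul _
  | add_comp f f' g h => exact .add_comp _ _ _ _
  | smul_comp a f g h => exact .smul_comp _ _ _ _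
  | comp_add f g g' h => exact .comp_add _ _ _ _
  | comp_smul a f g h => exact .comp_smul _ _ _ _
  | add_tHom f f' g h => exact .add_tHom _ _ _ _
  | smul_tHom a f g h => exact .smul_tHom _ _ _ _
  | tHom_add f g g' h => exact .tHom_add _ _ _ _
  | tHom_smul a f g h => exact .tHom_smul _ _ _ _
  | id_comp f h => exact .id_comp _ _
  | comp_id f h => exact .comp_id _ _
  | assoc f g p h₁ h₂ h₃ h₄ => exact .assoc _ _ _ _ _ _ _
  | tHom_id X Y h => exact .tHom_id _ _ _
  | tHom_comp f g f' g' h h' h₁ h₂ h₃ h₄ => exact .tHom_comp _ _ _ _ _ _ _ _ _ _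
  | aHom_aInv X Y Z h => exact .aHom_aInv _ _ _ _
  | aInv_aHom X Y Z h => exact .aInv_aHom _ _ _ _
  | lHom_lInv X h => exact .lHom_lInv _ _
  | lInv_lHom X h => exact .lInv_lHom _ _
  | rHom_rInv X h => exact .rHom_rInv _ _
  | rInv_rHom X h => exact .rInv_rHom _ _
  | aHom_nat f g p h₁ h₂ h₃ h₄ h₅ h₆ => exact .aHom_nat _ _ _ _ _ _ _ _ _
  | lHom_nat f h₁ h₂ => exact .lHom_nat _ _ _
  | rHom_nat f h₁ h₂ => exact .rHom_nat _ _ _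
  | pentagon W X Y Z h => exact .pentagon _ _ _ _ _
  | triangle X Y h => exact .triangle _ _ _

namespace DTm

variable {K : Type u}

/-- The tensor powers of the generating object. -/
abbrev pw (n : ℕ) : BWord Unit := BWord.pow () n

/-- The cup with a dot. -/
def dcup : E K .unit (.tensor c c) 2 := .comp cup dotL (zero_add 2)

/-- The alternating sum of dots `x₁ - x₂ + x₃ - ⋯` on `n` strands. -/
def z [Field K] : ∀ n : ℕ, E K (pw n) (pw n) 2
  | 0 => .zero _ _ 2
  | n + 1 => .add (.tHom (z n) (.idm c) (add_zero 2))
      (.smul ((-1) ^ n) (.tHom (.idm (pw n)) dot (zero_add 2)))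

/-- The canonical isomorphism between `c ^ m ⊗ c ^ n` and `c ^ (m + n)`. -/
def fuse (m : ℕ) : ∀ n : ℕ, E K ((pw m).tensor (pw n)) (pw (m + n)) 0
  | 0 => .rHom (pw m)
  | n + 1 => .comp (.aInv (pw m) (pw n) c) (.tHom (fuse m n) (.idm c) (add_zero 0)) (add_zero 0)

/-- Insertion of a (dotted) cup on the right of `n` strands. -/
def cupRight (n : ℕ) {d : ℤ} (f : E K .unit (.tensor c c) d) : E K (pw n) (pw (n + 2)) d :=
  .comp (.rInv (pw n)) (.comp (.tHom (.idm (pw n)) f (zero_add d)) (.aInv (pw n) c c) (add_zero d))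
    (zero_add d)

/-- Insertion of a (dotted) cup between `i` strands and `j` strands. -/
def cupMid (i j : ℕ) {d : ℤ} (f : E K .unit (.tensor c c) d) :
    E K ((pw i).tensor (pw j)) (pw (i + 2 + j)) d :=
  .comp (.tHom (cupRight i f) (.idm (pw j)) (add_zero d)) (fuse (i + 2) j) (add_zero d)

end DTm

/-- The generating objects: `c` and two Kirby objects. -/
inductive KLetter : Type
  | c : KLetter
  | κ (i : ZMod 2) : KLetter

/-- The inclusion on objects. -/
abbrev BWord.J (X : BWord Unit) : BWord KLetter := X.map fun _ => KLetter.c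

/-- The generating Kirby objects. -/
abbrev kw (i : ZMod 2) : BWord KLetter := .of (.κ i)

/-- Generating morphisms: those of the dotted Temperley-Lieb category, the maps `ι_n`, the
multiplication maps and the dots on the Kirby strands. -/
inductive KGen : BWord KLetter → BWord KLetter → ℤ → Type
  | old {X Y : BWord Unit} {d : ℤ} (g : DGen X Y d) : KGen X.J Y.J d
  | iota (n : ℕ) (i : ZMod 2) (h : (n : ZMod 2) = i) : KGen (DTm.pw n).J (kw i) (-(n : ℤ))
  | mul (i j k : ZMod 2) (h : i + j = k) : KGen ((kw i).tensor (kw j)) (kw k) 0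
  | kdot (i : ZMod 2) : KGen (kw i) (kw i) 2

namespace KTm

variable {K : Type u}

/-- Expressions of the dotted Temperley-Lieb category as expressions with Kirby objects. -/
abbrev J {X Y : BWord Unit} {d : ℤ} (f : Tm K DGen X Y d) : Tm K KGen X.J Y.J d :=
  f.relabel (fun _ => KLetter.c) KGen.old

abbrev iota (n : ℕ) (i : ZMod 2) (h : (n : ZMod 2) = i) :
    Tm K KGen (DTm.pw n).J (kw i) (-(n : ℤ)) := .gen (.iota n i h)
abbrev mul (i j k : ZMod 2) (h : i + j = k) : Tm K KGen ((kw i).tensor (kw j)) (kw k) 0 :=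
  .gen (.mul i j k h)
abbrev kdot (i : ZMod 2) : Tm K KGen (kw i) (kw i) 2 := .gen (.kdot i)

end KTm

open KTm in
/-- Defining relations of the category with Kirby objects. -/
inductive KRel (K : Type u) [Field K] :
    ∀ {X Y : BWord KLetter} {d : ℤ}, Tm K KGen X Y d → Tm K KGen X Y d → Prop
  | old {X Y : BWord Unit} {d : ℤ} {f g : Tm K DGen X Y d} : DRel K f g → KRel K (J f) (J g)
  | unit_mul (i : ZMod 2) (h : (0 : ZMod 2) + i = i) : KRel K
      (.comp (.lInv (kw i)) (.comp (.tHom (iota 0 0 Nat.cast_zero) (.idm (kw i))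
        (by simp : -((0 : ℕ) : ℤ) + 0 = 0)) (mul 0 i i h) (add_zero 0)) (add_zero 0))
      (.idm (kw i))
  | mul_unit (i : ZMod 2) (h : i + (0 : ZMod 2) = i) : KRel K
      (.comp (.rInv (kw i)) (.comp (.tHom (.idm (kw i)) (iota 0 0 Nat.cast_zero)
        (by simp : 0 + -((0 : ℕ) : ℤ) = 0)) (mul i 0 i h) (add_zero 0)) (add_zero 0))
      (.idm (kw i))
  | mul_assoc (i j k ij jk l : ZMod 2) (h₁ : i + j = ij) (h₂ : ij + k = l) (h₃ : j + k = jk)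
      (h₄ : i + jk = l) : KRel K
      (.comp (.tHom (mul i j ij h₁) (.idm (kw k)) (add_zero 0)) (mul ij k l h₂) (add_zero 0))
      (.comp (.aHom (kw i) (kw j) (kw k)) (.comp (.tHom (.idm (kw i)) (mul j k jk h₃) (add_zero 0))
        (mul i jk l h₄) (add_zero 0)) (add_zero 0))
  | mul_kdot (i j k : ZMod 2) (h : i + j = k) : KRel K
      (.comp (mul i j k h) (kdot k) (zero_add 2))
      (.add (.comp (.tHom (kdot i) (.idm (kw j)) (add_zero 2)) (mul i j k h) (add_zero 2))
        (.smul ((-1) ^ i.val)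
          (.comp (.tHom (.idm (kw i)) (kdot j) (zero_add 2)) (mul i j k h) (add_zero 2))))
  | iota_kdot (n : ℕ) (i : ZMod 2) (h : (n : ZMod 2) = i) : KRel K
      (.comp (iota n i h) (kdot i) (add_comm (-(n : ℤ)) 2))
      (.comp (J (DTm.z n)) (iota n i h) rfl)
  | cup_iota (i j : ℕ) (p : ZMod 2) (h : ((i + 2 + j : ℕ) : ZMod 2) = p) : KRel K
      (.comp (J (DTm.cupMid i j DTm.cup)) (iota (i + 2 + j) p h) rfl) (.zero _ _ _)
  | dcup_iota (i j : ℕ) (p : ZMod 2) (h : ((i + 2 + j : ℕ) : ZMod 2) = p)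
      (h' : ((i + j : ℕ) : ZMod 2) = p) : KRel K
      (.comp (J (DTm.cupMid i j DTm.dcup)) (iota (i + 2 + j) p h)
        (by push_cast; ring : 2 + -((i + 2 + j : ℕ) : ℤ) = 0 + -((i + j : ℕ) : ℤ)))
      (.comp (J (DTm.fuse i j)) (iota (i + j) p h') rfl)
  | iota_mul (m n : ℕ) (i j k : ZMod 2) (hm : (m : ZMod 2) = i) (hn : (n : ZMod 2) = j)
      (h : i + j = k) (hmn : ((m + n : ℕ) : ZMod 2) = k) : KRel K
      (.comp (.tHom (iota m i hm) (iota n j hn) rfl) (mul i j k h) rfl)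
      (.comp (J (DTm.fuse m n)) (iota (m + n) k hmn)
        (by push_cast; ring : 0 + -((m + n : ℕ) : ℤ) = -(m : ℤ) + -(n : ℤ) + 0))

/-- The category `KdTL'`: objects are tensor products of copies of `c` and of Kirby objects. -/
def KPre : Type := BWord KLetter

instance KPre.grMonCat (K : Type u) [Field K] : GrMonCat.{u} K KPre :=
  presented (K := K) (KRel K)

namespace KPre

open GrCat GrMonCat

variable {K : Type u} [Field K]

/-- The morphism represented by an expression. -/
def mk {X Y : BWord KLetter} {d : ℤ} (f : Tm K KGen X Y d) : Hom K (C := KPre) X Y d :=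
  PHom.mk (KRel K) f

/-- The functor from the dotted Temperley-Lieb category, on objects. -/
def J (X : DTL) : KPre := BWord.J X

/-- The functor from the dotted Temperley-Lieb category, on morphisms. -/
def Jm {X Y : DTL} {d : ℤ} : Hom K X Y d → Hom K (J X) (J Y) d :=
  Quot.map KTm.J fun _ _ h => TmRel.relabel _ _ (fun h => KRel.old h) h

/-- The Kirby objects and the adjoined generating morphisms. -/
def kirby (i : ZMod 2) : KPre := kw i

def iota (n : ℕ) (i : ZMod 2) (h : (n : ZMod 2) = i) :
    Hom K (J (DTL.cpow n)) (kirby i) (-(n : ℤ)) := mk (KTm.iota n i h)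

def mul (i j k : ZMod 2) (h : i + j = k) :
    Hom K (tObj K (kirby i) (kirby j)) (kirby k) 0 := mk (KTm.mul i j k h)

def kdot (i : ZMod 2) : Hom K (kirby i) (kirby i) 2 := mk (KTm.kdot i)

end KPre

/-! ## Canonical inclusions -/

namespace GrMonCat

open GrCat

variable {K : Type u'} [Field K] {C : Type u} [GrMonCat.{v} K C]

theorem aInv_nat' {X Y Z X' Y' Z' : C} {a b c ab bc d d' e : ℤ} (f : Hom K X X' a)
    (g : Hom K Y Y' b) (p : Hom K Z Z' c) (h₁ : a + b = ab) (h₂ : ab + c = d) (h₃ : b + c = bc)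
    (h₄ : a + bc = d') (h₅ : d' + 0 = e) (h₆ : 0 + d = e) :
    comp (tHom f (tHom g p h₃) h₄) (aInv X' Y' Z') h₅ =
      comp (aInv X Y Z) (tHom (tHom f g h₁) p h₂) h₆ := by
  obtain rfl : d' = d := by omega
  obtain rfl : e = d' := by omega
  have h := aHom_nat f g p h₁ h₂ h₃ h₄ h₅ h₆
  have h1 := congrArg (fun t => comp (comp (aInv X Y Z) t h₆) (aInv X' Y' Z') h₅) h
  rw [← assoc _ _ _ h₆ h₅ h₅ h₆, assoc _ (aHom X' Y' Z') _ h₅ h₅ (add_zero 0) h₅, aHom_aInv,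
    comp_id, ← assoc _ _ _ (add_zero 0) h₆ h₆ h₆, aInv_aHom, id_comp] at h1
  exact h1.symm

theorem lInv_nat' {X Y : C} {k d e : ℤ} (f : Hom K X Y k) (h₁ : 0 + k = d) (h₂ : 0 + d = e)
    (h₃ : k + 0 = e) :
    comp f (lInv Y) h₃ = comp (lInv X) (tHom (GrCat.idm (unit K)) f h₁) h₂ := by
  obtain rfl : d = k := by omega
  obtain rfl : e = d := by omega
  have h := lHom_nat f h₁ h₃
  have h1 := congrArg (fun t => comp (comp (lInv X) t h₁) (lInv Y) h₃) h
  rw [← assoc _ _ _ h₁ h₃ h₃ h₁, assoc _ (lHom Y) _ h₃ h₃ (add_zero 0) h₃, lHom_lInv,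
    comp_id, ← assoc _ _ _ (add_zero 0) h₁ h₁ h₁, lInv_lHom, id_comp] at h1
  exact h1.symm

theorem rInv_nat' {X Y : C} {k d e : ℤ} (f : Hom K X Y k) (h₁ : k + 0 = d) (h₂ : 0 + d = e)
    (h₃ : k + 0 = e) :
    comp f (rInv Y) h₃ = comp (rInv X) (tHom f (GrCat.idm (unit K)) h₁) h₂ := by
  obtain rfl : d = k := by omega
  obtain rfl : e = d := by omega
  have h := rHom_nat f h₁ h₂
  have h1 := congrArg (fun t => comp (comp (rInv X) t h₂) (rInv Y) h₃) h
  rw [← assoc _ _ _ h₂ h₃ h₃ h₂, assoc _ (rHom Y) _ h₁ h₃ (add_zero 0) h₃, rHom_rInv,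
    comp_id, ← assoc _ _ _ (add_zero 0) h₂ h₂ h₂, rInv_rHom, id_comp] at h1
  exact h1.symm

theorem eq_of_rHom {X Z T : C} {k l m : ℤ} (f : Hom K X T k) (q : Hom K (tObj K X (unit K)) Z m)
    (p : Hom K Z T l) (e : m + l = 0 + k) (h : comp q p e = comp (rHom X) f rfl)
    (e' : m + l = k) : f = comp (comp (rInv X) q (zero_add m)) p e' := by
  rw [assoc _ _ _ _ _ e (by omega), h, ← assoc _ _ _ (add_zero 0) (zero_add _) _ _,
    rInv_rHom, id_comp]

end GrMonCat

namespace KPre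

open GrCat GrMonCat

/-- The set indexing the canonical inclusions into an object. -/
def Lev : KPre → Type
  | .unit => Unit
  | .of .c => Unit
  | .of (.κ i) => {n : ℕ // (n : ZMod 2) = i}
  | .tensor S T => Lev S × Lev T

/-- The source of a canonical inclusion. -/
def dom : ∀ S : KPre, Lev S → DTL
  | .unit, _ => BWord.unit
  | .of .c, _ => DTL.c
  | .of (.κ _), n => DTL.cpow n.1
  | .tensor S T, a => BWord.tensor (dom S a.1) (dom T a.2)

/-- The degree of a canonical inclusion. -/
def deg : ∀ S : KPre, Lev S → ℤ
  | .unit, _ => 0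
  | .of .c, _ => 0
  | .of (.κ _), n => -(n.1 : ℤ)
  | .tensor S T, a => deg S a.1 + deg T a.2

variable {K : Type u} [Field K]

/-- The canonical inclusions: tensor products of identities and of the maps `ι_n`. -/
def incl : ∀ (S : KPre) (a : Lev S), Hom K (J (dom S a)) S (deg S a)
  | .unit, _ => GrCat.idm (K := K) (C := KPre) BWord.unit
  | .of .c, _ => GrCat.idm (K := K) (C := KPre) (BWord.of KLetter.c)
  | .of (.κ i), n => iota n.1 i n.2
  | .tensor S T, a => tHom (K := K) (C := KPre) (incl S a.1) (incl T a.2) rfl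

/-- `x` factors through the canonical inclusion with index `b`. -/
def FacAt {X : DTL} {T : KPre} {k : ℤ} (x : Hom K (J X) T k) (b : Lev T) : Prop :=
  ∃ (e : ℤ) (D : Hom K (J X) (J (dom T b)) e) (h : e + deg T b = k), x = comp D (incl T b) h

/-- `x` factors through a canonical inclusion. -/
def Fac {X : DTL} {T : KPre} {k : ℤ} (x : Hom K (J X) T k) : Prop := ∃ b, FacAt x b

theorem FacAt.comp_left {X Y : DTL} {T : KPre} {k l m : ℤ} {x : Hom K (J X) T k} {b : Lev T}
    (hx : FacAt x b) (y : Hom K (J Y) (J X) l) (h : l + k = m) : FacAt (comp y x h) b := by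
  obtain ⟨e, D, h', rfl⟩ := hx
  exact ⟨l + e, comp y D rfl, by omega, (assoc _ _ _ _ _ _ _).symm⟩

theorem FacAt.trans {X : DTL} {T : KPre} {k : ℤ} {x : Hom K (J X) T k} {b b' : Lev T}
    (hx : FacAt x b) (hb : FacAt (K := K) (incl T b) b') : FacAt x b' := by
  obtain ⟨e, D, h, rfl⟩ := hx
  exact hb.comp_left D h

theorem FacAt.tHom {X X' : DTL} {T T' : KPre} {k k' m : ℤ} {x : Hom K (J X) T k}
    {x' : Hom K (J X') T' k'} {b : Lev T} {b' : Lev T'} (hx : FacAt x b) (hx' : FacAt x' b')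
    (h : k + k' = m) :
    FacAt (X := tObj K X X') (T := tObj K T T') (tHom x x' h) (b, b') := by
  obtain ⟨e, D, h1, rfl⟩ := hx
  obtain ⟨e', D', h1', rfl⟩ := hx'
  refine ⟨e + e', GrMonCat.tHom (K := K) (C := KPre) D D' rfl, ?_, ?_⟩
  · change e + e' + (deg T b + deg T' b') = m
    omega
  · exact tHom_comp _ _ _ _ _ _ _ _ _ _

theorem iota_step (n : ℕ) (i : ZMod 2) (h : (n : ZMod 2) = i) (h' : ((n + 2 : ℕ) : ZMod 2) = i) :
    FacAt (K := K) (T := kirby i) (iota n i h) ⟨n + 2, h'⟩ := by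
  have e1 : 2 + -((n + 2 : ℕ) : ℤ) = 0 + -(n : ℤ) := by
    push_cast
    ring
  have h1 : comp (K := K) (C := KPre) (Jm (DTL.mk K (DTm.cupMid n 0 DTm.dcup)))
      (iota (n + 2) i h') e1 =
      comp (K := K) (C := KPre) (rHom (K := K) (C := KPre) (J (DTL.cpow n))) (iota n i h) rfl :=
    PHom.sound (.rel (KRel.dcup_iota (K := K) n 0 i h' h))
  refine ⟨2, comp (K := K) (C := KPre) (rInv (K := K) (C := KPre) (J (DTL.cpow n)))
    (Jm (DTL.mk K (DTm.cupMid n 0 DTm.dcup))) (zero_add 2), e1.trans (zero_add _), ?_⟩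
  exact eq_of_rHom (C := KPre) _ _ _ e1 h1 _

theorem iota_le (n s : ℕ) (i : ZMod 2) (h : (n : ZMod 2) = i)
    (h' : ((n + 2 * s : ℕ) : ZMod 2) = i) :
    FacAt (K := K) (T := kirby i) (iota n i h) ⟨n + 2 * s, h'⟩ := by
  induction s with
  | zero =>
    exact ⟨0, GrCat.idm (K := K) (C := KPre) _, zero_add _, (id_comp _ _).symm⟩
  | succ s ih =>
    have h0 : ((2 : ℕ) : ZMod 2) = 0 := rfl
    have h2 : ((n + 2 * s : ℕ) : ZMod 2) = i := by
      rw [← h']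
      push_cast
      linear_combination (-1 : ZMod 2) * h0
    exact (ih h2).trans (iota_step (n + 2 * s) i h2 h')

/-- The canonical inclusions into an object are directed. -/
theorem directed (T : KPre) (b b' : Lev T) :
    ∃ c : Lev T, FacAt (K := K) (incl T b) c ∧ FacAt (K := K) (incl T b') c := by
  have hrefl {T : KPre} (b : Lev T) : FacAt (K := K) (incl T b) b :=
    ⟨0, GrCat.idm (K := K) (C := KPre) _, zero_add _, (id_comp _ _).symm⟩
  induction T with
  | unit => exact ⟨(), hrefl (T := BWord.unit) b, hrefl (T := BWord.unit) b'⟩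
  | of a =>
    cases a with
    | c => exact ⟨(), hrefl (T := BWord.of .c) b, hrefl (T := BWord.of .c) b'⟩
    | κ i =>
      obtain ⟨n, hn⟩ := b
      obtain ⟨n', hn'⟩ := b'
      have key : ∀ n n' : ℕ, (n : ZMod 2) = (n' : ZMod 2) → n ≤ n' → ∃ s, n' = n + 2 * s := by
        intro n n' h hle
        have h1 := (ZMod.natCast_eq_natCast_iff' n n' 2).1 h
        exact ⟨(n' - n) / 2, by omega⟩
      rcases le_total n n' with hle | hle
      · obtain ⟨s, rfl⟩ := key n n' (hn.trans hn'.symm) hle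
        exact ⟨⟨_, hn'⟩, iota_le n s i hn hn', hrefl (T := kirby i) ⟨_, hn'⟩⟩
      · obtain ⟨s, rfl⟩ := key n' n (hn'.trans hn.symm) hle
        exact ⟨⟨_, hn⟩, hrefl (T := kirby i) ⟨_, hn⟩, iota_le n' s i hn' hn⟩
  | tensor S T ih ih' =>
    obtain ⟨c, h1, h2⟩ := ih b.1 b'.1
    obtain ⟨c', h1', h2'⟩ := ih' b.2 b'.2
    exact ⟨(c, c'), FacAt.tHom h1 h1' rfl, FacAt.tHom h2 h2' rfl⟩

theorem lev_nonempty (T : KPre) : Nonempty (Lev T) := by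
  induction T with
  | unit => exact ⟨()⟩
  | of a =>
    cases a with
    | c => exact ⟨()⟩
    | κ i => exact ⟨⟨i.val, ZMod.natCast_zmod_val i⟩⟩
  | tensor S T ih ih' => exact ⟨(ih.some, ih'.some)⟩

theorem Fac.comp_left {X Y : DTL} {T : KPre} {k l m : ℤ} {x : Hom K (J X) T k}
    (hx : Fac x) (y : Hom K (J Y) (J X) l) (h : l + k = m) : Fac (comp y x h) :=
  ⟨hx.choose, hx.choose_spec.comp_left y h⟩

theorem Fac.tHom {X X' : DTL} {T T' : KPre} {k k' m : ℤ} {x : Hom K (J X) T k}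
    {x' : Hom K (J X') T' k'} (hx : Fac x) (hx' : Fac x') (h : k + k' = m) :
    Fac (X := tObj K X X') (T := tObj K T T') (tHom x x' h) :=
  ⟨(hx.choose, hx'.choose), hx.choose_spec.tHom hx'.choose_spec h⟩

theorem Fac.zero {X : DTL} {T : KPre} {k : ℤ} : Fac (0 : Hom K (J X) T k) :=
  let b := (lev_nonempty T).some
  ⟨b, k - deg T b, 0, sub_add_cancel _ _, (zero_comp _ _).symm⟩

theorem Fac.smul {X : DTL} {T : KPre} {k : ℤ} {x : Hom K (J X) T k} (hx : Fac x) (a : K) :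
    Fac (a • x) := by
  obtain ⟨b, e, D, h, rfl⟩ := hx
  exact ⟨b, e, a • D, h, (smul_comp _ _ _ _).symm⟩

theorem Fac.add {X : DTL} {T : KPre} {k : ℤ} {x y : Hom K (J X) T k} (hx : Fac x) (hy : Fac y) :
    Fac (x + y) := by
  obtain ⟨b, hb⟩ := hx
  obtain ⟨b', hb'⟩ := hy
  obtain ⟨c, h1, h2⟩ := directed (K := K) T b b'
  obtain ⟨e, D, h, rfl⟩ := hb.trans h1
  obtain ⟨e', D', h', rfl⟩ := hb'.trans h2
  obtain rfl : e' = e := by omega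
  exact ⟨c, e', D + D', h, (add_comp _ _ _ _).symm⟩

/-- The identity of a finite object factors through a canonical inclusion. -/
theorem Fac.id_finite (X : DTL) : Fac (K := K) (GrCat.idm (K := K) (J X)) := by
  induction X with
  | unit => exact ⟨(), 0, GrCat.idm (K := K) (C := KPre) _, zero_add _, (id_comp _ _).symm⟩
  | of a => exact ⟨(), 0, GrCat.idm (K := K) (C := KPre) _, zero_add _, (id_comp _ _).symm⟩
  | tensor X Y ih ih' =>
    have h := tHom_id (K := K) (J X) (J Y) (add_zero 0)
    have h1 := Fac.tHom ih ih' (add_zero 0)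
    exact (congrArg (fun t => Fac (K := K) (X := tObj K X Y) (T := tObj K (J X) (J Y)) t) h).mp h1

theorem Fac.of_finite {X Y : DTL} {k : ℤ} (x : Hom K (J X) (J Y) k) : Fac x := by
  have h := comp_id x (add_zero k)
  exact h ▸ (Fac.id_finite (K := K) Y).comp_left x (add_zero k)

/-- Composites of `D` with canonical inclusions factor through canonical inclusions. -/
def Good {S T : KPre} {d : ℤ} (D : Hom K S T d) : Prop :=
  ∀ (a : Lev S) {m : ℤ} (h : deg S a + d = m), Fac (comp (incl S a) D h)

theorem Good.comp {S T R : KPre} {k l m : ℤ} {f : Hom K S T k} {g : Hom K T R l} (hf : Good f)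
    (hg : Good g) (h : k + l = m) : Good (comp f g h) := by
  intro a d hd
  obtain ⟨b, e, D, h1, h2⟩ := hf a (rfl : deg S a + k = _)
  have h3 := (hg b (rfl : deg T b + l = _)).comp_left D (by omega : e + (deg T b + l) = d)
  rwa [← assoc D (incl T b) g h1 (by omega) rfl _, ← h2, assoc _ _ _ _ _ h hd] at h3

theorem Good.tHom {S T S' T' : KPre} {k l m : ℤ} {f : Hom K S T k} {g : Hom K S' T' l}
    (hf : Good f) (hg : Good g) (h : k + l = m) : Good (tHom f g h) := by
  intro a d hd
  have hd' : deg S a.1 + deg S' a.2 + m = d := hd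
  have h1 := Fac.tHom (hf a.1 rfl) (hg a.2 rfl)
    (by omega : deg S a.1 + k + (deg S' a.2 + l) = d)
  have h2 : GrCat.comp (incl (K := K) (tObj K S S') a) (GrMonCat.tHom f g h) hd =
      GrMonCat.tHom (GrCat.comp (incl S a.1) f rfl) (GrCat.comp (incl S' a.2) g rfl) (by omega) :=
    (GrMonCat.tHom_comp (incl S a.1) f (incl S' a.2) g rfl rfl (by omega) rfl h hd').symm
  rw [h2]
  exact h1

theorem incl_fac {T : KPre} (b : Lev T) : Fac (K := K) (incl T b) :=
  ⟨b, 0, GrCat.idm (K := K) (C := KPre) _, zero_add _, (id_comp _ _).symm⟩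

theorem good_aHom (X Y Z : KPre) : Good (aHom (K := K) X Y Z) := by
  rintro ⟨⟨a, b⟩, c⟩ m h
  have h' : deg X a + deg Y b + deg Z c + 0 = m := h
  have h1 := aHom_nat' (K := K) rfl rfl (incl X a) (incl Y b) (incl Z c) rfl rfl rfl rfl h'
    (by omega)
  have h2 : comp (incl (K := K) (tObj K (tObj K X Y) Z) ((a, b), c)) (aHom X Y Z) h = _ := h1
  rw [h2]
  exact (incl_fac (T := tObj K X (tObj K Y Z)) (a, (b, c))).comp_left
    (X := tObj K (dom X a) (tObj K (dom Y b) (dom Z c)))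
    (Y := tObj K (tObj K (dom X a) (dom Y b)) (dom Z c)) _ _

theorem good_aInv (X Y Z : KPre) : Good (aInv (K := K) X Y Z) := by
  rintro ⟨a, ⟨b, c⟩⟩ m h
  have h' : deg X a + (deg Y b + deg Z c) + 0 = m := h
  have h1 := aInv_nat' (K := K) (incl X a) (incl Y b) (incl Z c) rfl rfl rfl rfl h'
    (by omega)
  have h2 : comp (incl (K := K) (tObj K X (tObj K Y Z)) (a, (b, c))) (aInv X Y Z) h = _ := h1
  rw [h2]
  exact (incl_fac (T := tObj K (tObj K X Y) Z) ((a, b), c)).comp_left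
    (Y := tObj K (dom X a) (tObj K (dom Y b) (dom Z c)))
    (X := tObj K (tObj K (dom X a) (dom Y b)) (dom Z c)) _ _

theorem good_lHom (X : KPre) : Good (lHom (K := K) X) := by
  rintro ⟨u, a⟩ m h
  have h' : 0 + deg X a + 0 = m := h
  have h1 := lHom_nat' (K := K) rfl rfl rfl (incl X a) rfl h' (by omega)
  have h2 : comp (incl (K := K) (tObj K (GrMonCat.unit K) X) (u, a)) (lHom X) h = _ := h1
  rw [h2]
  exact (incl_fac a).comp_left (X := dom X a) (Y := tObj K (GrMonCat.unit K) (dom X a)) _ _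

theorem good_lInv (X : KPre) : Good (lInv (K := K) X) := by
  intro a m h
  rw [lInv_nat' (incl X a) rfl (by omega) h]
  exact (incl_fac (T := tObj K (GrMonCat.unit K) X) ((), a)).comp_left
    (Y := dom X a) (X := tObj K (GrMonCat.unit K) (dom X a)) _ _

theorem good_rHom (X : KPre) : Good (rHom (K := K) X) := by
  rintro ⟨a, u⟩ m h
  have h' : deg X a + 0 + 0 = m := h
  have h1 := rHom_nat' (K := K) rfl rfl rfl (incl X a) rfl h' (by omega)
  have h2 : comp (incl (K := K) (tObj K X (GrMonCat.unit K)) (a, u)) (rHom X) h = _ := h1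
  rw [h2]
  exact (incl_fac a).comp_left (X := dom X a) (Y := tObj K (dom X a) (GrMonCat.unit K)) _ _

theorem good_rInv (X : KPre) : Good (rInv (K := K) X) := by
  intro a m h
  rw [rInv_nat' (incl X a) rfl (by omega) h]
  exact (incl_fac (T := tObj K X (GrMonCat.unit K)) (a, ())).comp_left
    (Y := dom X a) (X := tObj K (dom X a) (GrMonCat.unit K)) _ _

theorem good_old {X Y : BWord Unit} {d : ℤ} (g : DGen X Y d) :
    Good (mk (K := K) (.gen (.old g))) := by
  intro a m h
  exact Fac.of_finite (X := dom _ a) (Y := Y) _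

theorem good_iota (n : ℕ) (i : ZMod 2) (hn : (n : ZMod 2) = i) :
    Good (iota (K := K) n i hn) := by
  intro a m h
  exact (incl_fac (T := kirby i) ⟨n, hn⟩).comp_left (X := DTL.cpow n) _ _

theorem good_mul (i j k : ZMod 2) (hk : i + j = k) : Good (mul (K := K) i j k hk) := by
  rintro ⟨⟨n, hn⟩, ⟨n', hn'⟩⟩ m h
  have hnn : ((n + n' : ℕ) : ZMod 2) = k := by
    push_cast
    rw [hn, hn', hk]
  have e1 : (0 : ℤ) + -((n + n' : ℕ) : ℤ) = -(n : ℤ) + -(n' : ℤ) + 0 := by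
    push_cast
    ring
  have hm : -(n : ℤ) + -(n' : ℤ) + 0 = m := h
  subst hm
  have h2 : comp (incl (K := K) (tObj K (kirby i) (kirby j)) (⟨n, hn⟩, ⟨n', hn'⟩))
      (mul i j k hk) h = comp (K := K) (C := KPre) (Jm (DTL.mk K (DTm.fuse n n')))
        (iota (n + n') k hnn) e1 :=
    PHom.sound (.rel (KRel.iota_mul (K := K) n n' i j k hn hn' hk hnn))
  rw [h2]
  exact (incl_fac (T := kirby k) ⟨n + n', hnn⟩).comp_left
    (X := DTL.cpow (n + n')) (Y := tObj K (DTL.cpow n) (DTL.cpow n'))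
    (Jm (DTL.mk K (DTm.fuse n n'))) e1

theorem good_kdot (i : ZMod 2) : Good (kdot (K := K) i) := by
  rintro ⟨n, hn⟩ m h
  have hm : -(n : ℤ) + 2 = m := h
  obtain rfl : 2 + -(n : ℤ) = m := by omega
  have h2 : comp (incl (K := K) (kirby i) ⟨n, hn⟩) (kdot i) h =
      comp (K := K) (C := KPre) (Jm (DTL.mk K (DTm.z n))) (iota n i hn) rfl :=
    PHom.sound (.rel (KRel.iota_kdot (K := K) n i hn))
  rw [h2]
  exact (incl_fac (T := kirby i) ⟨n, hn⟩).comp_left (X := DTL.cpow n) (Y := DTL.cpow n)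
    (Jm (DTL.mk K (DTm.z n))) rfl

theorem good_id (X : KPre) : Good (GrCat.idm (K := K) X) := by
  intro a m h
  obtain rfl : deg X a = m := by omega
  rw [comp_id]
  exact incl_fac a

theorem good_zero (X Y : KPre) (d : ℤ) : Good (0 : Hom K X Y d) := by
  intro a m h
  rw [comp_zero]
  exact Fac.zero

theorem good_all {S T : KPre} {d : ℤ} (D : Hom K S T d) : Good D := by
  induction D using PHom.ind with
  | h f =>
    induction f with
    | gen g =>
      cases g with
      | old g => exact good_old g
      | iota n i h => exact good_iota n i h
      | mul i j k h => exact good_mul i j k h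
      | kdot i => exact good_kdot i
    | idm X => exact good_id X
    | comp f g h ih ih' => exact Good.comp ih ih' h
    | tHom f g h ih ih' => exact Good.tHom ih ih' h
    | aHom X Y Z => exact good_aHom X Y Z
    | aInv X Y Z => exact good_aInv X Y Z
    | lHom X => exact good_lHom X
    | lInv X => exact good_lInv X
    | rHom X => exact good_rHom X
    | rInv X => exact good_rInv X
    | zero X Y d => exact good_zero X Y d
    | add f g ih ih' =>
      intro a m h
      have h2 := comp_add (incl (K := K) _ a) (mk f) (mk g) h
      exact h2 ▸ (ih a h).add (ih' a h)
    | smul r f ih =>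
      intro a m h
      have h2 := comp_smul r (incl (K := K) _ a) (mk f) h
      exact h2 ▸ (ih a h).smul r

/-- Every morphism with finite source factors through a canonical inclusion. -/
theorem fac_all {X : DTL} {T : KPre} {k : ℤ} (x : Hom K (J X) T k) : Fac x := by
  obtain ⟨b, e, D, h, hD⟩ := Fac.id_finite (K := K) X
  have h1 := (good_all x b rfl).comp_left D (by omega : e + (deg (J X) b + k) = k)
  rw [← assoc D _ x h (zero_add k), ← hD, id_comp] at h1
  exact h1

end KPre

noncomputable section

/-! ## The completion: formal sums of diagrams -/

open GrCat GrMonCat KPre in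
/-- A formal sum of morphisms of degree `d` from `S` to `T`, such that every canonical inclusion
into `S` composes to zero with all but finitely many of the summands. -/
structure FSum (K : Type u) [Field K] (S T : KPre) (d : ℤ) where
  I : Type
  D : I → Hom K S T d
  fin : ∀ a : Lev S, {i | comp (incl S a) (D i) rfl ≠ 0}.Finite

namespace FSum

open GrCat GrMonCat KPre

variable {K : Type u} [Field K]

/-- The sum of the composites of a morphism with the summands of a formal sum; this is used for
morphisms with finite source only, where all but finitely many of the composites vanish. -/
def act {S T : KPre} {d : ℤ} (D : FSum K S T d) {X : KPre} {k m : ℤ}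
    (x : Hom K X S k) (h : k + d = m) : Hom K X T m := ∑ᶠ i, comp x (D.D i) h

/-- The truncation of a formal sum along a canonical inclusion. -/
def trunc {S T : KPre} {d : ℤ} (D : FSum K S T d) (a : Lev S) :
    Hom K (J (dom S a)) T (deg S a + d) := D.act (incl S a) rfl

theorem finite {S T : KPre} {d : ℤ} (D : FSum K S T d) {X : DTL} {k m : ℤ}
    (x : Hom K (J X) S k) (h : k + d = m) : {i | comp x (D.D i) h ≠ 0}.Finite := by
  obtain ⟨b, e, y, h1, rfl⟩ := fac_all x
  refine (D.fin b).subset fun i hi h0 => hi ?_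
  rw [assoc y (incl S b) (D.D i) h1 h rfl (by omega), h0, comp_zero]

theorem act_comp_left {S T : KPre} {d : ℤ} (D : FSum K S T d) {X Y : DTL} {k l kl m n : ℤ}
    (y : Hom K (J Y) (J X) l) (x : Hom K (J X) S k) (h₁ : l + k = kl) (h₂ : kl + d = n)
    (h₃ : k + d = m) (h₄ : l + m = n) :
    D.act (comp y x h₁) h₂ = comp y (D.act x h₃) h₄ := by
  have h := (compL (K := K) h₄ y).toAddMonoidHom.map_finsum (f := fun i => comp x (D.D i) h₃)
    (D.finite x h₃)
  refine (Eq.trans ?_ h.symm)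
  exact finsum_congr fun i => assoc _ _ _ _ _ _ _

theorem act_congr {S T : KPre} {d : ℤ} {D E : FSum K S T d} (hDE : D.trunc = E.trunc) {X : DTL}
    {k m : ℤ} (x : Hom K (J X) S k) (h : k + d = m) : D.act x h = E.act x h := by
  obtain ⟨b, e, y, h1, rfl⟩ := fac_all x
  rw [D.act_comp_left y (incl S b) h1 h rfl (by omega),
    E.act_comp_left y (incl S b) h1 h rfl (by omega)]
  exact congrArg (fun t => comp y t (by omega)) (congrFun hDE b)

theorem act_add_left {S T : KPre} {d : ℤ} (D : FSum K S T d) {X : DTL} {k m : ℤ}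
    (x y : Hom K (J X) S k) (h : k + d = m) : D.act (x + y) h = D.act x h + D.act y h := by
  unfold act
  rw [← finsum_add_distrib (D.finite x h) (D.finite y h)]
  exact finsum_congr fun i => add_comp _ _ _ _

theorem act_smul_left {S T : KPre} {d : ℤ} (D : FSum K S T d) {X : DTL} {k m : ℤ}
    (r : K) (x : Hom K (J X) S k) (h : k + d = m) : D.act (r • x) h = r • D.act x h := by
  unfold act
  rw [smul_finsum' r (D.finite x h)]
  exact finsum_congr fun i => smul_comp _ _ _ _

/-- The linear map given by `act`. -/
def actL {S T : KPre} {d : ℤ} (D : FSum K S T d) (X : DTL) {k m : ℤ}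
    (h : k + d = m) : Hom K (J X) S k →ₗ[K] Hom K (J X) T m where
  toFun x := D.act x h
  map_add' x y := D.act_add_left x y h
  map_smul' r x := D.act_smul_left r x h

/-- A morphism as a formal sum with one summand. -/
def single {S T : KPre} {d : ℤ} (f : Hom K S T d) : FSum K S T d where
  I := Unit
  D _ := f
  fin _ := Set.toFinite _

theorem single_act {S T : KPre} {d : ℤ} (f : Hom K S T d) {X : KPre} {k m : ℤ}
    (x : Hom K X S k) (h : k + d = m) : (single f).act x h = comp x f h :=
  finsum_unique (α := Unit) _

/-- The empty sum, the sum of formal sums and the scalar multiples of formal sums. -/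
def zero (S T : KPre) (d : ℤ) : FSum K S T d where
  I := Empty
  D i := i.elim
  fin _ := Set.toFinite _

def add {S T : KPre} {d : ℤ} (D E : FSum K S T d) : FSum K S T d where
  I := D.I ⊕ E.I
  D := Sum.elim D.D E.D
  fin a := by
    refine (((D.fin a).image Sum.inl).union ((E.fin a).image Sum.inr)).subset ?_
    rintro (i | i) hi
    · exact Or.inl ⟨i, hi, rfl⟩
    · exact Or.inr ⟨i, hi, rfl⟩

def smul {S T : KPre} {d : ℤ} (r : K) (D : FSum K S T d) : FSum K S T d where
  I := D.I
  D i := r • D.D i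
  fin a := by
    refine (D.fin a).subset fun i hi h0 => hi ?_
    rw [comp_smul, h0, smul_zero]

theorem zero_act {S T : KPre} {d : ℤ} {X : KPre} {k m : ℤ} (x : Hom K X S k) (h : k + d = m) :
    (zero S T d).act x h = 0 := finsum_of_isEmpty (α := Empty) _

theorem add_act {S T : KPre} {d : ℤ} (D E : FSum K S T d) {X : DTL} {k m : ℤ}
    (x : Hom K (J X) S k) (h : k + d = m) : (D.add E).act x h = D.act x h + E.act x h := by
  have h1 := finsum_mem_union' (f := fun i : D.I ⊕ E.I => comp x ((D.add E).D i) h)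
    (s := Set.range Sum.inl) (t := Set.range Sum.inr) Set.isCompl_range_inl_range_inr.disjoint
    (((D.add E).finite x h).subset fun i hi => hi.2)
    (((D.add E).finite x h).subset fun i hi => hi.2)
  rw [Set.range_inl_union_range_inr, finsum_mem_univ, finsum_mem_range Sum.inl_injective,
    finsum_mem_range Sum.inr_injective] at h1
  exact h1

theorem smul_act {S T : KPre} {d : ℤ} (r : K) (D : FSum K S T d) {X : DTL} {k m : ℤ}
    (x : Hom K (J X) S k) (h : k + d = m) : (D.smul r).act x h = r • D.act x h := by
  unfold act
  rw [smul_finsum' r (D.finite x h)]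
  exact finsum_congr fun i => comp_smul _ _ _ _

theorem comp_finite {S T R : KPre} {k l d : ℤ} (D : FSum K S T k) (E : FSum K T R l)
    (h : k + l = d) {X : DTL} {m e : ℤ} (x : Hom K (J X) S m) (h' : m + d = e) :
    {p : D.I × E.I | comp x (comp (D.D p.1) (E.D p.2) h) h' ≠ 0}.Finite := by
  refine ((D.finite x rfl).biUnion fun i _ =>
    ((E.finite (comp x (D.D i) rfl) (show m + k + l = e by omega)).image fun j => (i, j))).subset ?_
  rintro ⟨i, j⟩ hp
  have hp1 : comp (comp x (D.D i) rfl) (E.D j) (show m + k + l = e by omega) ≠ 0 := by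
    rwa [assoc _ _ _ _ _ h h']
  refine Set.mem_biUnion (x := i) (fun h0 => hp1 ?_) ⟨j, hp1, rfl⟩
  rw [h0, zero_comp]

/-- The formal composition. -/
def comp {S T R : KPre} {k l d : ℤ} (D : FSum K S T k) (E : FSum K T R l) (h : k + l = d) :
    FSum K S R d where
  I := D.I × E.I
  D p := GrCat.comp (D.D p.1) (E.D p.2) h
  fin a := comp_finite D E h (incl S a) rfl

theorem comp_act {S T R : KPre} {k l d : ℤ} (D : FSum K S T k) (E : FSum K T R l)
    (h : k + l = d) {X : DTL} {m e n : ℤ} (x : Hom K (J X) S m) (h' : m + d = e)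
    (h₁ : m + k = n) (h₂ : n + l = e) : (comp D E h).act x h' = E.act (D.act x h₁) h₂ := by
  have h1 := (E.actL X h₂).toAddMonoidHom.map_finsum (f := fun i => GrCat.comp x (D.D i) h₁)
    (D.finite x h₁)
  refine ((finsum_curry _ (comp_finite D E h x h')).trans ?_).trans h1.symm
  exact finsum_congr fun i => finsum_congr fun j => (GrCat.assoc _ _ _ _ _ _ _).symm

theorem tHom_finite {S T S' T' : KPre} {k l d : ℤ} (D : FSum K S T k) (E : FSum K S' T' l)
    (h : k + l = d) {X Y : DTL} {m m' n e : ℤ} (x : Hom K (J X) S m) (y : Hom K (J Y) S' m')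
    (h₁ : m + m' = n) (h₂ : n + d = e) :
    {p : D.I × E.I | GrCat.comp (GrMonCat.tHom x y h₁) (GrMonCat.tHom (D.D p.1) (E.D p.2) h) h₂
      ≠ 0}.Finite := by
  refine ((D.finite x rfl).prod (E.finite y rfl)).subset ?_
  rintro ⟨i, j⟩ hp
  have h0 := tHom_comp x (D.D i) y (E.D j) rfl rfl (by omega) h₁ h h₂
  refine ⟨fun h1 => hp ?_, fun h1 => hp ?_⟩
  · exact h0.symm.trans (by rw [h1, zero_tHom])
  · exact h0.symm.trans (by rw [h1, tHom_zero])

/-- The formal tensor product. -/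
def tHom {S T S' T' : KPre} {k l d : ℤ} (D : FSum K S T k) (E : FSum K S' T' l) (h : k + l = d) :
    FSum K (tObj K S S') (tObj K T T') d where
  I := D.I × E.I
  D p := GrMonCat.tHom (D.D p.1) (E.D p.2) h
  fin a := tHom_finite D E h (incl S a.1) (incl S' a.2) rfl rfl

theorem tHom_act {S T S' T' : KPre} {k l d : ℤ} (D : FSum K S T k) (E : FSum K S' T' l)
    (h : k + l = d) {X Y : DTL} {m m' n e p q : ℤ} (x : Hom K (J X) S m) (y : Hom K (J Y) S' m')
    (h₁ : m + m' = n) (h₂ : n + d = e) (h₃ : m + k = p) (h₄ : m' + l = q) (h₅ : p + q = e) :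
    (tHom D E h).act (GrMonCat.tHom x y h₁) h₂ =
      GrMonCat.tHom (D.act x h₃) (E.act y h₄) h₅ := by
  have h1 := ((tHomL (K := K) h₅).flip (E.act y h₄)).toAddMonoidHom.map_finsum
    (f := fun i => GrCat.comp x (D.D i) h₃) (D.finite x h₃)
  refine ((finsum_curry _ (tHom_finite D E h x y h₁ h₂)).trans ?_).trans h1.symm
  refine finsum_congr fun i => ?_
  have h2 := (tHomL (K := K) h₅ (GrCat.comp x (D.D i) h₃)).toAddMonoidHom.map_finsum
    (f := fun j => GrCat.comp y (E.D j) h₄) (E.finite y h₄)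
  refine Eq.trans ?_ h2.symm
  exact finsum_congr fun j => (tHom_comp _ _ _ _ _ _ _ _ _ _).symm

/-- The truncations of formal sums form a subspace. -/
def fam (K : Type u) [Field K] (S T : KPre) (d : ℤ) :
    Submodule K (∀ a : Lev S, Hom K (J (dom S a)) T (deg S a + d)) where
  carrier := Set.range trunc
  zero_mem' := ⟨zero S T d, funext fun a => zero_act _ _⟩
  add_mem' := by
    rintro _ _ ⟨D, rfl⟩ ⟨E, rfl⟩
    exact ⟨D.add E, funext fun a => add_act D E _ _⟩
  smul_mem' := by
    rintro r _ ⟨D, rfl⟩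
    exact ⟨D.smul r, funext fun a => smul_act r D _ _⟩

end FSum

/-- Morphisms of the completion: equivalence classes of formal sums, where two formal sums are
equivalent if their truncations agree. -/
def KHom (K : Type u) [Field K] (S T : KPre) (d : ℤ) : Type (max 1 u) :=
  Quotient (Setoid.ker (FSum.trunc (K := K) (S := S) (T := T) (d := d)))

namespace KHom

open GrCat GrMonCat KPre

variable {K : Type u} [Field K]

/-- The class of a formal sum. -/
def mk {S T : KPre} {d : ℤ} (D : FSum K S T d) : KHom K S T d := Quotient.mk _ D

/-- A morphism of the completion is determined by its truncations. -/
def famEquiv (S T : KPre) (d : ℤ) : KHom K S T d ≃ FSum.fam K S T d :=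
  Setoid.quotientKerEquivRange _

instance addCommGroup (S T : KPre) (d : ℤ) : AddCommGroup (KHom K S T d) :=
  (famEquiv S T d).addCommGroup

instance module (S T : KPre) (d : ℤ) : Module K (KHom K S T d) :=
  (famEquiv S T d).module K

/-- The truncation of a morphism of the completion. -/
def trunc {S T : KPre} {d : ℤ} (a : Lev S) :
    KHom K S T d →ₗ[K] Hom K (J (dom S a)) T (deg S a + d) :=
  LinearMap.proj a ∘ₗ (FSum.fam K S T d).subtype ∘ₗ ((famEquiv S T d).linearEquiv K).toLinearMap

theorem trunc_mk {S T : KPre} {d : ℤ} (a : Lev S) (D : FSum K S T d) :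
    trunc a (mk D) = D.trunc a := rfl

theorem mk_eq_iff {S T : KPre} {d : ℤ} {D E : FSum K S T d} :
    mk D = mk E ↔ D.trunc = E.trunc := Quotient.eq

/-- The composite of a morphism from a finite object with a morphism of the completion. -/
def act {S T : KPre} {d : ℤ} {X : DTL} {k m : ℤ} (x : Hom K (J X) S k)
    (F : KHom K S T d) (h : k + d = m) : Hom K (J X) T m :=
  Quotient.lift (fun D : FSum K S T d => D.act x h) (fun _ _ e => FSum.act_congr e x h) F

theorem act_incl {S T : KPre} {d : ℤ} (a : Lev S) (F : KHom K S T d) :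
    act (incl S a) F rfl = trunc a F := by
  induction F using Quotient.ind with
  | _ D => rfl

theorem ext {S T : KPre} {d : ℤ} {F G : KHom K S T d}
    (h : ∀ a (m : ℤ) (e : deg S a + d = m), act (incl S a) F e = act (incl S a) G e) : F = G := by
  apply (famEquiv S T d).injective
  apply Subtype.ext
  funext a
  have h1 := h a _ rfl
  rwa [act_incl, act_incl] at h1

theorem act_comp_left {S T : KPre} {d : ℤ} (F : KHom K S T d) {X Y : DTL} {k l kl m n : ℤ}
    (y : Hom K (J Y) (J X) l) (x : Hom K (J X) S k) (h₁ : l + k = kl) (h₂ : kl + d = n)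
    (h₃ : k + d = m) (h₄ : l + m = n) :
    act (comp y x h₁) F h₂ = comp y (act x F h₃) h₄ := by
  induction F using Quotient.ind with
  | _ D => exact D.act_comp_left y x h₁ h₂ h₃ h₄

theorem act_add {S T : KPre} {d : ℤ} {X : DTL} {k m : ℤ} (x : Hom K (J X) S k)
    (F G : KHom K S T d) (h : k + d = m) : act x (F + G) h = act x F h + act x G h := by
  obtain ⟨b, e, y, h1, rfl⟩ := fac_all x
  simp only [act_comp_left _ y (incl S b) h1 h rfl (by omega), act_incl, map_add, comp_add]

theorem act_smul {S T : KPre} {d : ℤ} {X : DTL} {k m : ℤ} (r : K) (x : Hom K (J X) S k)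
    (F : KHom K S T d) (h : k + d = m) : act x (r • F) h = r • act x F h := by
  obtain ⟨b, e, y, h1, rfl⟩ := fac_all x
  simp only [act_comp_left _ y (incl S b) h1 h rfl (by omega), act_incl, map_smul, comp_smul]

theorem add_act {S T : KPre} {d : ℤ} {X : DTL} {k m : ℤ} (x y : Hom K (J X) S k)
    (F : KHom K S T d) (h : k + d = m) : act (x + y) F h = act x F h + act y F h := by
  induction F using Quotient.ind with
  | _ D => exact D.act_add_left x y h

theorem smul_act {S T : KPre} {d : ℤ} {X : DTL} {k m : ℤ} (r : K) (x : Hom K (J X) S k)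
    (F : KHom K S T d) (h : k + d = m) : act (r • x) F h = r • act x F h := by
  induction F using Quotient.ind with
  | _ D => exact D.act_smul_left r x h

/-- Composition and tensor product are formal: the summands are composed and tensored. -/
def comp {S T R : KPre} {k l d : ℤ} (F : KHom K S T k) (G : KHom K T R l) (h : k + l = d) :
    KHom K S R d :=
  Quotient.map₂ (fun D E => FSum.comp D E h) (by
    intro D D' hD E E' hE
    funext a
    refine (FSum.comp_act D E h (incl S a) rfl rfl (by omega)).trans
      (Eq.trans ?_ (FSum.comp_act D' E' h (incl S a) rfl rfl (by omega)).symm)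
    rw [FSum.act_congr hD, FSum.act_congr hE]) F G

def tHom {S T S' T' : KPre} {k l d : ℤ} (F : KHom K S T k) (G : KHom K S' T' l) (h : k + l = d) :
    KHom K (tObj K S S') (tObj K T T') d :=
  Quotient.map₂ (fun D E => FSum.tHom D E h) (by
    intro D D' hD E E' hE
    funext a
    refine (FSum.tHom_act D E h (incl S a.1) (incl S' a.2) rfl rfl rfl rfl
      (by change _ = deg S a.1 + deg S' a.2 + d; omega)).trans
      (Eq.trans ?_ (FSum.tHom_act D' E' h (incl S a.1) (incl S' a.2) rfl rfl rfl rfl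
        (by change _ = deg S a.1 + deg S' a.2 + d; omega)).symm)
    rw [FSum.act_congr hD, FSum.act_congr hE]) F G

/-- A finite sum of diagrams as a morphism of the completion. -/
def of {S T : KPre} {d : ℤ} (f : Hom K S T d) : KHom K S T d := mk (FSum.single f)

theorem act_of {S T : KPre} {d : ℤ} {X : DTL} {k m : ℤ} (x : Hom K (J X) S k)
    (f : Hom K S T d) (h : k + d = m) : act x (of f) h = GrCat.comp x f h :=
  FSum.single_act f x h

theorem act_comp {S T R : KPre} {k l d : ℤ} (F : KHom K S T k) (G : KHom K T R l)
    (h : k + l = d) {X : DTL} {m e n : ℤ} (x : Hom K (J X) S m) (h' : m + d = e)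
    (h₁ : m + k = n) (h₂ : n + l = e) : act x (comp F G h) h' = act (act x F h₁) G h₂ := by
  induction F using Quotient.ind with
  | _ D =>
    induction G using Quotient.ind with
    | _ E => exact FSum.comp_act D E h x h' h₁ h₂

theorem act_tHom {S T S' T' : KPre} {k l d : ℤ} (F : KHom K S T k) (G : KHom K S' T' l)
    (h : k + l = d) {X Y : DTL} {m m' n e p q : ℤ} (x : Hom K (J X) S m) (y : Hom K (J Y) S' m')
    (h₁ : m + m' = n) (h₂ : n + d = e) (h₃ : m + k = p) (h₄ : m' + l = q) (h₅ : p + q = e) :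
    act (X := tObj K X Y) (GrMonCat.tHom x y h₁) (tHom F G h) h₂ =
      GrMonCat.tHom (act x F h₃) (act y G h₄) h₅ := by
  induction F using Quotient.ind with
  | _ D =>
    induction G using Quotient.ind with
    | _ E => exact FSum.tHom_act D E h x y h₁ h₂ h₃ h₄ h₅

theorem mk_comp_mk {S T R : KPre} {k l d : ℤ} (D : FSum K S T k) (E : FSum K T R l)
    (h : k + l = d) : comp (mk D) (mk E) h = mk (FSum.comp D E h) := rfl

theorem mk_tHom_mk {S T S' T' : KPre} {k l d : ℤ} (D : FSum K S T k) (E : FSum K S' T' l)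
    (h : k + l = d) : tHom (mk D) (mk E) h = mk (FSum.tHom D E h) := rfl

end KHom

end

noncomputable section

namespace KHom

open GrCat GrMonCat KPre

variable {K : Type u} [Field K]

theorem act_of_comp {S T R : KPre} {k l d : ℤ} {X : DTL} {m n e : ℤ} (x : Hom K (J X) S m)
    (f : Hom K S T k) (G : KHom K T R l) (h : k + l = d) (h' : m + d = e) (h₁ : m + k = n)
    (h₂ : n + l = e) :
    act x (comp (of f) G h) h' = act (GrCat.comp x f h₁) G h₂ := by
  rw [act_comp _ _ h x h' h₁ h₂, act_of]

theorem act_comp_of {S T R : KPre} {k l d : ℤ} {X : DTL} {m n e : ℤ} (x : Hom K (J X) S m)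
    (F : KHom K S T k) (g : Hom K T R l) (h : k + l = d) (h' : m + d = e) (h₁ : m + k = n)
    (h₂ : n + l = e) :
    act x (comp F (of g) h) h' = GrCat.comp (act x F h₁) g h₂ := by
  rw [act_comp _ _ h x h' h₁ h₂, act_of]

theorem of_comp {S T R : KPre} {k l d : ℤ} (f : Hom K S T k) (g : Hom K T R l) (h : k + l = d) :
    comp (of f) (of g) h = of (GrCat.comp f g h) := by
  refine ext fun a m e => ?_
  rw [act_of_comp _ _ _ h e rfl (by omega), act_of, act_of]
  exact GrCat.assoc _ _ _ _ _ _ _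

theorem of_add {S T : KPre} {d : ℤ} (f g : Hom K S T d) : of (f + g) = of f + of g := by
  refine ext fun a m e => ?_
  rw [act_add, act_of, act_of, act_of, GrCat.comp_add]

theorem of_smul {S T : KPre} {d : ℤ} (r : K) (f : Hom K S T d) : of (r • f) = r • of f := by
  refine ext fun a m e => ?_
  rw [act_smul, act_of, act_of, GrCat.comp_smul]

theorem add_comp {S T R : KPre} {k l d : ℤ} (F F' : KHom K S T k) (G : KHom K T R l)
    (h : k + l = d) : comp (F + F') G h = comp F G h + comp F' G h := ext fun a m e => by
  rw [act_comp _ _ h _ e rfl (by omega), act_add, add_act, act_add,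
    act_comp _ _ h _ e rfl (by omega), act_comp _ _ h _ e rfl (by omega)]

theorem smul_comp {S T R : KPre} {k l d : ℤ} (r : K) (F : KHom K S T k) (G : KHom K T R l)
    (h : k + l = d) : comp (r • F) G h = r • comp F G h := ext fun a m e => by
  rw [act_comp _ _ h _ e rfl (by omega), act_smul, smul_act, act_smul,
    act_comp _ _ h _ e rfl (by omega)]

theorem comp_add {S T R : KPre} {k l d : ℤ} (F : KHom K S T k) (G G' : KHom K T R l)
    (h : k + l = d) : comp F (G + G') h = comp F G h + comp F G' h := ext fun a m e => by
  rw [act_comp _ _ h _ e rfl (by omega), act_add, act_add,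
    act_comp _ _ h _ e rfl (by omega), act_comp _ _ h _ e rfl (by omega)]

theorem comp_smul {S T R : KPre} {k l d : ℤ} (r : K) (F : KHom K S T k) (G : KHom K T R l)
    (h : k + l = d) : comp F (r • G) h = r • comp F G h := ext fun a m e => by
  rw [act_comp _ _ h _ e rfl (by omega), act_smul, act_smul,
    act_comp _ _ h _ e rfl (by omega)]

theorem id_comp {S T : KPre} {k : ℤ} (F : KHom K S T k) (h : 0 + k = k) :
    comp (of (GrCat.idm S)) F h = F := ext fun a m e => by
  rw [act_of_comp _ _ _ h e (add_zero _) e, GrCat.comp_id]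

theorem comp_id {S T : KPre} {k : ℤ} (F : KHom K S T k) (h : k + 0 = k) :
    comp F (of (GrCat.idm T)) h = F := ext fun a m e => by
  rw [act_comp_of _ _ _ h e e (add_zero _), GrCat.comp_id]

theorem assoc {S T R Q : KPre} {a b c ab bc d : ℤ} (F : KHom K S T a) (G : KHom K T R b)
    (P : KHom K R Q c) (h₁ : a + b = ab) (h₂ : ab + c = d) (h₃ : b + c = bc) (h₄ : a + bc = d) :
    comp (comp F G h₁) P h₂ = comp F (comp G P h₃) h₄ := ext fun x m e => by
  rw [act_comp _ _ h₂ _ e rfl (by omega), act_comp _ _ h₁ _ rfl rfl (by omega),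
    act_comp _ _ h₄ _ e rfl (by omega), act_comp (n := deg S x + ab) _ _ h₃ _ _ (by omega) (by omega)]

/-- The composite with a tensor product of two morphisms from finite objects. -/
def act₂ {S S' T : KPre} {d : ℤ} {X Y : DTL} {k l m : ℤ} (x : Hom K (J X) S k)
    (y : Hom K (J Y) S' l) (F : KHom K (tObj K S S') T d) (h : k + l + d = m) :
    Hom K (tObj K (J X) (J Y)) T m :=
  act (X := tObj K X Y) (GrMonCat.tHom x y rfl) F h

theorem ext_tensor {S S' T : KPre} {d : ℤ} {F G : KHom K (tObj K S S') T d}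
    (h : ∀ (a : Lev S) (b : Lev S') (m : ℤ) (e : deg S a + deg S' b + d = m),
      act₂ (incl S a) (incl S' b) F e = act₂ (incl S a) (incl S' b) G e) : F = G :=
  ext fun a m e => h a.1 a.2 m e

theorem act₂_add {S S' T : KPre} {d : ℤ} {X Y : DTL} {k l m : ℤ} (x : Hom K (J X) S k)
    (y : Hom K (J Y) S' l) (F G : KHom K (tObj K S S') T d) (h : k + l + d = m) :
    act₂ x y (F + G) h = act₂ x y F h + act₂ x y G h := act_add _ _ _ _

theorem act₂_smul {S S' T : KPre} {d : ℤ} {X Y : DTL} {k l m : ℤ} (r : K) (x : Hom K (J X) S k)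
    (y : Hom K (J Y) S' l) (F : KHom K (tObj K S S') T d) (h : k + l + d = m) :
    act₂ x y (r • F) h = r • act₂ x y F h := act_smul _ _ _ _

theorem act₂_of {S S' T : KPre} {d : ℤ} {X Y : DTL} {k l m : ℤ} (x : Hom K (J X) S k)
    (y : Hom K (J Y) S' l) (f : Hom K (tObj K S S') T d) (h : k + l + d = m) :
    act₂ x y (of f) h = GrCat.comp (GrMonCat.tHom x y rfl) f h := act_of _ _ _

theorem act₂_tHom {S T S' T' : KPre} {k l d : ℤ} (F : KHom K S T k) (G : KHom K S' T' l)
    (h : k + l = d) {X Y : DTL} {m m' e p q : ℤ} (x : Hom K (J X) S m) (y : Hom K (J Y) S' m')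
    (h₂ : m + m' + d = e) (h₃ : m + k = p) (h₄ : m' + l = q) (h₅ : p + q = e) :
    act₂ x y (tHom F G h) h₂ = GrMonCat.tHom (act x F h₃) (act y G h₄) h₅ :=
  act_tHom _ _ _ _ _ _ _ _ _ _

theorem act₂_tHom_comp {S T S' T' R : KPre} {k l d b c : ℤ} (F : KHom K S T k)
    (G : KHom K S' T' l) (H : KHom K (tObj K T T') R b) (h : k + l = d) (h' : d + b = c)
    {X Y : DTL} {m m' e p q : ℤ} (x : Hom K (J X) S m) (y : Hom K (J Y) S' m')
    (h₂ : m + m' + c = e) (h₃ : m + k = p) (h₄ : m' + l = q) (h₅ : p + q + b = e) :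
    act₂ x y (comp (tHom F G h) H h') h₂ = act₂ (act x F h₃) (act y G h₄) H h₅ :=
  (act_comp _ _ h' _ h₂ (by omega) h₅).trans
    (congrArg (fun t => act (X := tObj K X Y) t H h₅) (act_tHom _ _ h _ _ rfl _ h₃ h₄ rfl))

theorem of_tHom {S T S' T' : KPre} {k l d : ℤ} (f : Hom K S T k) (g : Hom K S' T' l)
    (h : k + l = d) : tHom (of f) (of g) h = of (GrMonCat.tHom f g h) := by
  refine ext_tensor fun a b m e => ?_
  rw [act₂_tHom _ _ h _ _ e rfl rfl (by omega), act₂_of, act_of, act_of]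
  exact GrMonCat.tHom_comp _ _ _ _ _ _ _ _ _ _

theorem add_tHom {S T S' T' : KPre} {k l d : ℤ} (F F' : KHom K S T k) (G : KHom K S' T' l)
    (h : k + l = d) : tHom (F + F') G h = tHom F G h + tHom F' G h :=
  ext_tensor fun a b m e => by
    rw [act₂_tHom _ _ h _ _ e rfl rfl (by omega), act_add, GrMonCat.add_tHom, act₂_add,
      act₂_tHom _ _ h _ _ e rfl rfl (by omega), act₂_tHom _ _ h _ _ e rfl rfl (by omega)]

theorem smul_tHom {S T S' T' : KPre} {k l d : ℤ} (r : K) (F : KHom K S T k) (G : KHom K S' T' l)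
    (h : k + l = d) : tHom (r • F) G h = r • tHom F G h :=
  ext_tensor fun a b m e => by
    rw [act₂_tHom _ _ h _ _ e rfl rfl (by omega), act_smul, GrMonCat.smul_tHom, act₂_smul,
      act₂_tHom _ _ h _ _ e rfl rfl (by omega)]

theorem tHom_add {S T S' T' : KPre} {k l d : ℤ} (F : KHom K S T k) (G G' : KHom K S' T' l)
    (h : k + l = d) : tHom F (G + G') h = tHom F G h + tHom F G' h :=
  ext_tensor fun a b m e => by
    rw [act₂_tHom _ _ h _ _ e rfl rfl (by omega), act_add, GrMonCat.tHom_add, act₂_add,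
      act₂_tHom _ _ h _ _ e rfl rfl (by omega), act₂_tHom _ _ h _ _ e rfl rfl (by omega)]

theorem tHom_smul {S T S' T' : KPre} {k l d : ℤ} (r : K) (F : KHom K S T k) (G : KHom K S' T' l)
    (h : k + l = d) : tHom F (r • G) h = r • tHom F G h :=
  ext_tensor fun a b m e => by
    rw [act₂_tHom _ _ h _ _ e rfl rfl (by omega), act_smul, GrMonCat.tHom_smul, act₂_smul,
      act₂_tHom _ _ h _ _ e rfl rfl (by omega)]

theorem tHom_comp {S T R S' T' R' : KPre} {a b c a' b' c' aa bb d : ℤ}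
    (F : KHom K S T a) (G : KHom K T R b) (F' : KHom K S' T' a') (G' : KHom K T' R' b')
    (h : a + b = c) (h' : a' + b' = c') (h₁ : c + c' = d)
    (h₂ : a + a' = aa) (h₃ : b + b' = bb) (h₄ : aa + bb = d) :
    tHom (comp F G h) (comp F' G' h') h₁ = comp (tHom F F' h₂) (tHom G G' h₃) h₄ :=
  ext_tensor fun x y m e => by
    rw [act₂_tHom _ _ h₁ _ _ e rfl rfl (by omega),
      act₂_tHom_comp _ _ _ h₂ h₄ _ _ e rfl rfl (by omega),
      act₂_tHom (p := deg S x + c) (q := deg S' y + c') _ _ h₃ _ _ _ (by omega) (by omega)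
        (by omega),
      act_comp (n := deg S x + a) _ _ h _ _ rfl (by omega),
      act_comp (n := deg S' y + a') _ _ h' _ _ rfl (by omega)]

theorem aHom_nat {X Y Z X' Y' Z' : KPre} {a b c ab bc d : ℤ} (F : KHom K X X' a)
    (G : KHom K Y Y' b) (P : KHom K Z Z' c) (h₁ : a + b = ab) (h₂ : ab + c = d) (h₃ : b + c = bc)
    (h₄ : a + bc = d) (h₅ : d + 0 = d) (h₆ : 0 + d = d) :
    comp (tHom (tHom F G h₁) P h₂) (of (aHom X' Y' Z')) h₅ =
      comp (of (aHom X Y Z)) (tHom F (tHom G P h₃) h₄) h₆ := by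
  refine ext ?_
  rintro ⟨⟨x, y⟩, z⟩ m e
  have e1 : deg X x + deg Y y + deg Z z + d = m := e
  have hL : act (incl (K := K) (tObj K (tObj K X Y) Z) ((x, y), z))
      (comp (tHom (tHom F G h₁) P h₂) (of (aHom X' Y' Z')) h₅) e =
      GrCat.comp (GrMonCat.tHom (GrMonCat.tHom (act (incl X x) F rfl) (act (incl Y y) G rfl) rfl)
        (act (incl Z z) P rfl) (by omega)) (aHom X' Y' Z') (add_zero m) := by
    refine (act_comp_of _ _ _ _ _ e (add_zero m)).trans ?_
    refine congrArg (fun t : Hom K (tObj K (tObj K (J (dom X x)) (J (dom Y y))) (J (dom Z z)))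
      (tObj K (tObj K X' Y') Z') m => GrCat.comp t (aHom X' Y' Z') (add_zero m)) ?_
    refine (act_tHom (X := tObj K (dom X x) (dom Y y)) (tHom F G h₁) P h₂
      (GrMonCat.tHom (incl X x) (incl Y y) rfl) (incl Z z) rfl e1
      (show _ = deg X x + a + (deg Y y + b) by omega) rfl (by omega)).trans ?_
    exact congrArg (fun t => GrMonCat.tHom t (act (incl Z z) P rfl) _)
      (act_tHom F G h₁ (incl X x) (incl Y y) rfl _ _ _ rfl)
  have hR : act (incl (K := K) (tObj K (tObj K X Y) Z) ((x, y), z))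
      (comp (of (aHom X Y Z)) (tHom F (tHom G P h₃) h₄) h₆) e =
      GrCat.comp (aHom (J (dom X x)) (J (dom Y y)) (J (dom Z z)))
        (GrMonCat.tHom (act (incl X x) F rfl) (GrMonCat.tHom (act (incl Y y) G rfl)
        (act (incl Z z) P rfl) rfl) (by omega)) (zero_add m) := by
    refine (act_of_comp _ _ _ _ _ (add_zero _) e).trans ?_
    have h7 := aHom_nat' (K := K) rfl rfl (incl X x) (incl Y y) (incl Z z) rfl rfl rfl rfl
      (add_zero (deg X x + deg Y y + deg Z z)) (by omega)
    refine (congrArg (fun t => act (X := tObj K (tObj K (dom X x) (dom Y y)) (dom Z z)) t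
      (tHom F (tHom G P h₃) h₄) e1) h7).trans ?_
    refine (act_comp_left (X := tObj K (dom X x) (tObj K (dom Y y) (dom Z z)))
      (Y := tObj K (tObj K (dom X x) (dom Y y)) (dom Z z)) _ _ _ _ _ (by omega)
      (zero_add m)).trans ?_
    refine congrArg (fun t : Hom K (tObj K (J (dom X x)) (tObj K (J (dom Y y)) (J (dom Z z))))
      (tObj K X' (tObj K Y' Z')) m =>
      GrCat.comp (aHom (J (dom X x)) (J (dom Y y)) (J (dom Z z))) t (zero_add m)) ?_
    refine (act_tHom (Y := tObj K (dom Y y) (dom Z z)) F (tHom G P h₃) h₄ (incl X x)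
      (GrMonCat.tHom (incl Y y) (incl Z z) rfl) rfl (by omega) rfl
      (show _ = deg Y y + b + (deg Z z + c) by omega) (by omega)).trans ?_
    exact congrArg (fun t => GrMonCat.tHom (act (incl X x) F rfl) t _)
      (act_tHom G P h₃ (incl Y y) (incl Z z) rfl _ _ _ rfl)
  rw [hL, hR]
  exact aHom_nat' rfl rfl _ _ _ _ _ _ _ _ _

theorem lHom_nat {X Y : KPre} {k : ℤ} (F : KHom K X Y k) (h₁ : 0 + k = k) (h₂ : k + 0 = k) :
    comp (tHom (of (GrCat.idm (GrMonCat.unit K))) F h₁) (of (lHom Y)) h₂ =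
      comp (of (lHom X)) F h₁ := by
  refine ext ?_
  rintro ⟨u, x⟩ m e
  have e1 : 0 + deg X x + k = m := e
  have hL : act (incl (K := K) (tObj K (GrMonCat.unit K) X) (u, x))
      (comp (tHom (of (GrCat.idm (GrMonCat.unit K))) F h₁) (of (lHom Y)) h₂) e =
      GrCat.comp (GrMonCat.tHom (GrCat.idm (GrMonCat.unit K)) (act (incl X x) F rfl)
        (by omega)) (lHom Y) (add_zero m) := by
    refine (act_comp_of _ _ _ _ _ e (add_zero m)).trans ?_
    refine congrArg (fun t : Hom K (tObj K (GrMonCat.unit K) (J (dom X x)))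
      (tObj K (GrMonCat.unit K) Y) m => GrCat.comp t (lHom Y) (add_zero m)) ?_
    refine (act_tHom (X := GrMonCat.unit K) (of (GrCat.idm (GrMonCat.unit K))) F h₁
      (GrCat.idm (GrMonCat.unit K)) (incl X x) rfl (by omega) (add_zero 0)
      rfl (by omega)).trans ?_
    refine congrArg (fun t => GrMonCat.tHom t (act (incl X x) F rfl) (by omega)) ?_
    exact (act_of _ _ _).trans (GrCat.comp_id _ _)
  have hR : act (incl (K := K) (tObj K (GrMonCat.unit K) X) (u, x))
      (comp (of (lHom X)) F h₁) e =
      GrCat.comp (lHom (J (dom X x))) (act (incl X x) F rfl) (by omega) := by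
    refine (act_of_comp _ _ _ _ _ (add_zero _) (by omega)).trans ?_
    have h7 := lHom_nat' (K := K) rfl rfl rfl (incl X x) rfl
      (add_zero (0 + deg X x)) rfl
    refine (congrArg (fun t => act (X := tObj K (GrMonCat.unit K) (dom X x)) t F e1) h7).trans ?_
    exact act_comp_left (X := dom X x) (Y := tObj K (GrMonCat.unit K) (dom X x)) _ _ _ _ _ _ _
  rw [hL, hR]
  exact lHom_nat' rfl rfl rfl _ _ _ _

theorem rHom_nat {X Y : KPre} {k : ℤ} (F : KHom K X Y k) (h₁ : k + 0 = k) (h₂ : 0 + k = k) :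
    comp (tHom F (of (GrCat.idm (GrMonCat.unit K))) h₁) (of (rHom Y)) h₁ =
      comp (of (rHom X)) F h₂ := by
  refine ext ?_
  rintro ⟨x, u⟩ m e
  have e1 : deg X x + 0 + k = m := e
  have hL : act (incl (K := K) (tObj K X (GrMonCat.unit K)) (x, u))
      (comp (tHom F (of (GrCat.idm (GrMonCat.unit K))) h₁) (of (rHom Y)) h₁) e =
      GrCat.comp (GrMonCat.tHom (act (incl X x) F rfl) (GrCat.idm (GrMonCat.unit K))
        (by omega)) (rHom Y) (add_zero m) := by
    refine (act_comp_of _ _ _ _ _ e (add_zero m)).trans ?_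
    refine congrArg (fun t : Hom K (tObj K (J (dom X x)) (GrMonCat.unit K))
      (tObj K Y (GrMonCat.unit K)) m => GrCat.comp t (rHom Y) (add_zero m)) ?_
    refine (act_tHom (Y := GrMonCat.unit K) F (of (GrCat.idm (GrMonCat.unit K))) h₁
      (incl X x) (GrCat.idm (GrMonCat.unit K)) rfl (by omega) rfl (add_zero 0)
      (by omega)).trans ?_
    refine congrArg (fun t => GrMonCat.tHom (act (incl X x) F rfl) t (by omega)) ?_
    exact (act_of _ _ _).trans (GrCat.comp_id _ _)
  have hR : act (incl (K := K) (tObj K X (GrMonCat.unit K)) (x, u))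
      (comp (of (rHom X)) F h₂) e =
      GrCat.comp (rHom (J (dom X x))) (act (incl X x) F rfl) (by omega) := by
    refine (act_of_comp _ _ _ _ _ (add_zero _) (by omega)).trans ?_
    have h7 := rHom_nat' (K := K) rfl rfl rfl (incl X x) rfl
      (add_zero (deg X x + 0)) (by omega)
    refine (congrArg (fun t => act (X := tObj K (dom X x) (GrMonCat.unit K)) t F e1) h7).trans ?_
    exact act_comp_left (X := dom X x) (Y := tObj K (dom X x) (GrMonCat.unit K)) _ _ _ _ _ _ _
  rw [hL, hR]
  exact rHom_nat' rfl rfl rfl _ _ _ _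

theorem pentagon (W X Y Z : KPre) (h : (0 : ℤ) + 0 = 0) :
    comp (tHom (of (aHom (K := K) W X Y)) (of (GrCat.idm Z)) h)
      (comp (of (aHom W (tObj K X Y) Z)) (tHom (of (GrCat.idm W)) (of (aHom X Y Z)) h) h) h =
      comp (of (aHom (tObj K W X) Y Z)) (of (aHom W X (tObj K Y Z))) h := by
  rw [of_tHom, of_tHom, of_comp, of_comp, of_comp, GrMonCat.pentagon]

theorem triangle (X Y : KPre) (h : (0 : ℤ) + 0 = 0) :
    comp (of (aHom (K := K) X (GrMonCat.unit K) Y)) (tHom (of (GrCat.idm X)) (of (lHom Y)) h) h =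
      tHom (of (rHom X)) (of (GrCat.idm Y)) h := by
  rw [of_tHom, of_tHom, of_comp, GrMonCat.triangle]

end KHom

/-- The completed category `KdTL`. -/
def KdTL : Type := KPre

namespace KdTL

open GrCat GrMonCat

instance grCat (K : Type u) [Field K] : GrCat.{max 1 u} K KdTL where
  Hom S T d := KHom K S T d
  addCommGroup S T d := KHom.addCommGroup S T d
  module S T d := KHom.module S T d
  idm S := KHom.of (GrCat.idm (K := K) (C := KPre) S)
  comp F G h := KHom.comp F G h
  add_comp F F' G h := KHom.add_comp F F' G h
  smul_comp r F G h := KHom.smul_comp r F G h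
  comp_add F G G' h := KHom.comp_add F G G' h
  comp_smul r F G h := KHom.comp_smul r F G h
  id_comp F h := KHom.id_comp F h
  comp_id F h := KHom.comp_id F h
  assoc F G P h₁ h₂ h₃ h₄ := KHom.assoc F G P h₁ h₂ h₃ h₄

instance grMonCat (K : Type u) [Field K] : GrMonCat.{max 1 u} K KdTL where
  toGrCat := grCat K
  unit := GrMonCat.unit K (C := KPre)
  tObj S T := tObj K (C := KPre) S T
  tHom F G h := KHom.tHom F G h
  add_tHom F F' G h := KHom.add_tHom F F' G h
  smul_tHom r F G h := KHom.smul_tHom r F G h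
  tHom_add F G G' h := KHom.tHom_add F G G' h
  tHom_smul r F G h := KHom.tHom_smul r F G h
  tHom_id S T h := (KHom.of_tHom _ _ h).trans
    (congrArg KHom.of (GrMonCat.tHom_id (K := K) (C := KPre) S T h))
  tHom_comp F G F' G' h h' h₁ h₂ h₃ h₄ := KHom.tHom_comp F G F' G' h h' h₁ h₂ h₃ h₄
  aHom X Y Z := KHom.of (aHom (K := K) (C := KPre) X Y Z)
  aInv X Y Z := KHom.of (aInv (K := K) (C := KPre) X Y Z)
  lHom X := KHom.of (lHom (K := K) (C := KPre) X)
  lInv X := KHom.of (lInv (K := K) (C := KPre) X)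
  rHom X := KHom.of (rHom (K := K) (C := KPre) X)
  rInv X := KHom.of (rInv (K := K) (C := KPre) X)
  aHom_aInv X Y Z h := (KHom.of_comp _ _ h).trans
    (congrArg KHom.of (aHom_aInv (K := K) (C := KPre) X Y Z h))
  aInv_aHom X Y Z h := (KHom.of_comp _ _ h).trans
    (congrArg KHom.of (aInv_aHom (K := K) (C := KPre) X Y Z h))
  lHom_lInv X h := (KHom.of_comp _ _ h).trans
    (congrArg KHom.of (lHom_lInv (K := K) (C := KPre) X h))
  lInv_lHom X h := (KHom.of_comp _ _ h).trans
    (congrArg KHom.of (lInv_lHom (K := K) (C := KPre) X h))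
  rHom_rInv X h := (KHom.of_comp _ _ h).trans
    (congrArg KHom.of (rHom_rInv (K := K) (C := KPre) X h))
  rInv_rHom X h := (KHom.of_comp _ _ h).trans
    (congrArg KHom.of (rInv_rHom (K := K) (C := KPre) X h))
  aHom_nat F G P h₁ h₂ h₃ h₄ h₅ h₆ := KHom.aHom_nat F G P h₁ h₂ h₃ h₄ h₅ h₆
  lHom_nat F h₁ h₂ := KHom.lHom_nat F h₁ h₂
  rHom_nat F h₁ h₂ := KHom.rHom_nat F h₁ h₂
  pentagon W X Y Z h := KHom.pentagon W X Y Z h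
  triangle X Y h := KHom.triangle X Y h

end KdTL

end

/-! ## The ind-completion of the dotted Temperley-Lieb category and the Kirby objects -/

/-- A functor of graded linear categories with prescribed values on objects. -/
structure GrFunctor (K : Type u') [Field K] {C : Type u} {C' : Type w} [GrCat.{v} K C]
    [GrCat.{v'} K C'] (o : C → C') where
  map : ∀ {X Y : C} {d : ℤ}, GrCat.Hom K X Y d →ₗ[K] GrCat.Hom K (o X) (o Y) d
  map_id : ∀ X : C, map (GrCat.idm (K := K) X) = GrCat.idm (o X)
  map_comp : ∀ {X Y Z : C} {k l m : ℤ} (f : GrCat.Hom K X Y k) (g : GrCat.Hom K Y Z l)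
    (h : k + l = m), map (GrCat.comp f g h) = GrCat.comp (map f) (map g) h

/-- The category `Ind (Mat (Kar dTL))`. -/
abbrev DTLInd (K : Type u) [Field K] : Type (max 1 u) := IndC K (MatCat (Kar K DTL))

noncomputable section

namespace DTL

open GrCat GrMonCat

variable (K : Type u) [Field K]

/-- The sum `x₁ - x₂ + x₃ - ⋯` of dots on `n` strands. -/
def z (n : ℕ) : Hom K (cpow n) (cpow n) 2 := mk K (DTm.z n)

/-- The dotted cup on the right of `n` strands. -/
def dcupRight (n : ℕ) : Hom K (cpow n) (cpow (n + 2)) 2 := mk K (DTm.cupRight n DTm.dcup)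

/-- The canonical isomorphism from `c ^ m ⊗ c ^ n` to `c ^ p` for `m + n = p`. -/
def fuse {m n p : ℕ} (h : m + n = p) : Hom K (tObj K (cpow m) (cpow n)) (cpow p) 0 :=
  h ▸ mk K (DTm.fuse m n)

/-- The embedding into the ind-completion. -/
def emb (X : DTL) : DTLInd K := IndC.const (MatCat.single 0 (Kar.of K X))

def embHom {X Y : DTL} {d : ℤ} (f : Hom K X Y d) : Hom K (emb K X) (emb K Y) d :=
  IndC.constHom (MatCat.singleHom (m := d) (Kar.trunc (A := Kar.of K X) (B := Kar.of K Y) f)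
    (by simp))

/-- A morphism in the ind-completion from a constant system. -/
def fromConst {A : MatCat (Kar K DTL)} {β : DTLInd K} {d : ℤ} (x : IndC.Colim A β d) :
    Hom K (IndC.const (K := K) A) β d :=
  ⟨fun _ => x, by
    rintro ⟨⟨⟩⟩ ⟨⟨⟩⟩ ⟨⟨⟨⟩⟩⟩
    exact IndC.Colim.pre_id _ _⟩

/-- The canonical isomorphism between `emb X ⊗ emb Y` and `emb (X ⊗ Y)`. -/
def embMat (X Y : DTL) : MatCat.MHom K (MatCat.tObj K (MatCat.single 0 (Kar.of K X))
    (MatCat.single 0 (Kar.of K Y))) (MatCat.single 0 (Kar.of K (tObj K X Y))) 0 :=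
  fun _ _ => dcast (by simp) (Kar.trunc (A := Kar.tObj (Kar.of K X) (Kar.of K Y))
    (B := Kar.of K (tObj K X Y)) (GrCat.idm (tObj K X Y)))

def embMu (X Y : DTL) : Hom K (tObj K (emb K X) (emb K Y)) (emb K (tObj K X Y)) 0 :=
  ⟨fun _ => IndC.Colim.of (β := emb K (tObj K X Y)) ⟨()⟩ (embMat K X Y), by
    rintro ⟨⟨⟨⟩⟩, ⟨⟨⟩⟩⟩ ⟨⟨⟨⟩⟩, ⟨⟨⟩⟩⟩ ⟨⟨⟨⟨⟩⟩⟩, ⟨⟨⟨⟩⟩⟩⟩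
    refine (congrArg (fun t => IndC.Colim.pre (β := emb K (tObj K X Y)) (zero_add 0) t
      (IndC.Colim.of (β := emb K (tObj K X Y)) ⟨()⟩ (embMat K X Y)))
      (IndC.tr_id (tObj K (emb K X) (emb K Y)) (⟨()⟩, ⟨()⟩))).trans ?_
    exact IndC.Colim.pre_id _ _⟩

variable [CharZero K]

/-- The image of the `n`-th Jones-Wenzl projector. -/
def sym (n : ℕ) : Kar K DTL := ⟨cpow n, jw K n, jw_idem K n⟩

/-- The stage `q ^ (-n) P n` of the directed system defining a Kirby object. -/
def stage (n : ℕ) : MatCat (Kar K DTL) := MatCat.single (-(n : ℤ)) (sym K n)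

/-- The degree zero map `P (n + 2) ∘ (1 ⊗ dotted cup) ∘ P n` from `q ^ (-n) P n` to
`q ^ (-n - 2) P (n + 2)`. -/
def U (n : ℕ) : Hom K (stage K n) (stage K (n + 2)) 0 :=
  MatCat.singleHom (m := 2) (Kar.trunc (A := sym K n) (B := sym K (n + 2)) (dcupRight K n))
    (by push_cast; ring)

/-- The Kirby object `κ i`, the formal colimit of
`q ^ (-i) P i → q ^ (-i-2) P (i+2) → q ^ (-i-4) P (i+4) → ⋯`. -/
def kirby (i : ZMod 2) : DTLInd K where
  I := ℕ
  F := CategoryTheory.Functor.ofSequence (X := fun n => stage K (i.val + 2 * n))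
    (fun n => U K (i.val + 2 * n))

/-- Evaluation of words on objects. -/
def realize : KPre → DTLInd K
  | .unit => GrMonCat.unit K
  | .of .c => emb K c
  | .of (.κ i) => kirby K i
  | .tensor S T => tObj K (realize S) (realize T)

/-- The canonical isomorphism between the evaluation of a word and the embedding of the
corresponding object. -/
def can : ∀ X : DTL, Hom K (realize K (KPre.J X)) (emb K X) 0
  | .unit => GrCat.idm (emb K BWord.unit)
  | .of _ => GrCat.idm (emb K c)
  | .tensor X Y => comp (tHom (can X) (can Y) (add_zero 0)) (embMu K X Y) (add_zero 0)

/-- The morphism from `c ^ n` to a Kirby object given by the `n`-th Jones-Wenzl projector. -/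
def jwIn (i : ZMod 2) (s : ℕ) :
    Hom K (emb K (cpow (i.val + 2 * s))) (kirby K i) (-((i.val + 2 * s : ℕ) : ℤ)) :=
  fromConst K (IndC.Colim.of (β := kirby K i) s (MatCat.singleHom (m := 0)
    (Kar.trunc (A := Kar.of K (cpow (i.val + 2 * s))) (B := sym K (i.val + 2 * s))
      (GrCat.idm (cpow (i.val + 2 * s)))) (by simp)))

/-- The component of the dot on a Kirby strand. -/
def kdotAt (i : ZMod 2) (s : ℕ) : IndC.Colim (stage K (i.val + 2 * s)) (kirby K i) 2 :=
  IndC.Colim.of (β := kirby K i) s (MatCat.singleHom (m := 2)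
    (Kar.trunc (A := sym K (i.val + 2 * s)) (B := sym K (i.val + 2 * s)) (z K (i.val + 2 * s)))
    (by simp))

/-- The component `P (m + n) ∘ (P m ⊗ P n)` of the multiplication of Kirby objects. -/
def mulAt (i j k : ZMod 2) {n n' s : ℕ} (h : i.val + 2 * n + (j.val + 2 * n') = k.val + 2 * s) :
    IndC.Colim (tObj K (stage K (i.val + 2 * n)) (stage K (j.val + 2 * n'))) (kirby K k) 0 :=
  IndC.Colim.of (β := kirby K k) s fun _ _ => dcast (by
      change (0 : ℤ) = 0 + (-((i.val + 2 * n : ℕ) : ℤ) + -((j.val + 2 * n' : ℕ) : ℤ))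
        - -((k.val + 2 * s : ℕ) : ℤ)
      rw [← h]
      push_cast
      ring)
    (Kar.trunc (A := Kar.tObj (sym K (i.val + 2 * n)) (sym K (j.val + 2 * n')))
      (B := sym K (k.val + 2 * s)) (fuse K h))

/-- The defining properties of the functor from `KdTL'` to the ind-completion: it is monoidal, it
extends the embedding, and it has the prescribed values on the adjoined generators. -/
structure IsPhi (φ : GrFunctor K (realize K)) : Prop where
  map_tHom : ∀ {S T S' T' : KPre} {k l m : ℤ} (f : Hom K S T k) (g : Hom K S' T' l)
    (h : k + l = m), φ.map (tHom f g h) = tHom (φ.map f) (φ.map g) h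
  map_aHom : ∀ X Y Z : KPre,
    φ.map (aHom (K := K) X Y Z) = aHom (realize K X) (realize K Y) (realize K Z)
  map_lHom : ∀ X : KPre, φ.map (lHom (K := K) X) = lHom (realize K X)
  map_rHom : ∀ X : KPre, φ.map (rHom (K := K) X) = rHom (realize K X)
  map_J : ∀ {X Y : DTL} {d : ℤ} (f : Hom K X Y d),
    comp (φ.map (KPre.Jm f)) (can K Y) (add_zero d) = comp (can K X) (embHom K f) (zero_add d)
  map_iota : ∀ (i : ZMod 2) (s : ℕ) (h : ((i.val + 2 * s : ℕ) : ZMod 2) = i),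
    φ.map (KPre.iota (K := K) (i.val + 2 * s) i h) =
      comp (can K (cpow (i.val + 2 * s))) (jwIn K i s) (zero_add _)
  map_mul : ∀ (i j k : ZMod 2) (h : i + j = k) (n s : ℕ)
    (hs : i.val + 2 * n + (j.val + 2 * n) = k.val + 2 * s),
    (φ.map (KPre.mul (K := K) i j k h)).1 (n, n) = mulAt K i j k hs
  map_kdot : ∀ (i : ZMod 2) (s : ℕ), (φ.map (KPre.kdot (K := K) i)).1 s = kdotAt K i s

end DTL

end

set_option linter.unusedSectionVars false

/-! ## The total category of a graded linear category -/

/-- The linear category whose morphisms are the finite sums of homogeneous morphisms. -/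
def Tot (K : Type u') (C : Type u) [Field K] [GrCat.{v} K C] : Type u := C

noncomputable section

namespace Tot

open GrCat GrMonCat DirectSum

variable {K : Type u'} [Field K] {C : Type u}

section Cat

variable [GrCat.{v} K C]

abbrev THom (K : Type u') [Field K] [GrCat.{v} K C] (X Y : C) : Type v := ⨁ d : ℤ, Hom K X Y d

/-- A homogeneous morphism as a morphism of the total category. -/
def homL {X Y : C} {d : ℤ} : Hom K X Y d →ₗ[K] THom K X Y := lof K ℤ (fun d => Hom K X Y d) d

theorem homL_dcast {X Y : C} {k l : ℤ} (h : k = l) (f : Hom K X Y k) :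
    homL (dcast h f) = homL f := by subst h; rfl

def tcomp (X Y Z : C) : THom K X Y →ₗ[K] THom K Y Z →ₗ[K] THom K X Z :=
  toModule K ℤ _ fun k => LinearMap.flip (toModule K ℤ _ fun l =>
    LinearMap.flip ((compL (K := K) (X := X) (Y := Y) (Z := Z) (rfl : k + l = k + l)).compr₂ homL))

theorem tcomp_homL {X Y Z : C} {k l m : ℤ} (f : Hom K X Y k) (g : Hom K Y Z l) (h : k + l = m) :
    tcomp X Y Z (homL f) (homL g) = homL (comp f g h) := by
  subst h
  simp only [tcomp, homL, toModule_lof, LinearMap.flip_apply]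
  rfl

theorem ind {X Y : C} {p : THom K X Y → Prop} (h0 : p 0)
    (h1 : ∀ d (f : Hom K X Y d), p (homL f)) (h2 : ∀ f g, p f → p g → p (f + g)) (f) : p f :=
  DirectSum.induction_on f h0 h1 h2

theorem tcomp_id_left {X Y : C} (f : THom K X Y) : tcomp X X Y (homL (GrCat.idm X)) f = f := by
  induction f using ind with
  | h0 => rw [map_zero]
  | h1 d f => rw [tcomp_homL _ _ (zero_add d), GrCat.id_comp]
  | h2 f g hf hg => rw [map_add, hf, hg]

theorem tcomp_id_right {X Y : C} (f : THom K X Y) : tcomp X Y Y f (homL (GrCat.idm Y)) = f := by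
  induction f using ind with
  | h0 => rw [map_zero, LinearMap.zero_apply]
  | h1 d f => rw [tcomp_homL _ _ (add_zero d), GrCat.comp_id]
  | h2 f g hf hg => rw [map_add, LinearMap.add_apply, hf, hg]

theorem tcomp_assoc {W X Y Z : C} (f : THom K W X) (g : THom K X Y) (h : THom K Y Z) :
    tcomp W Y Z (tcomp W X Y f g) h = tcomp W X Z f (tcomp X Y Z g h) := by
  induction f using ind with
  | h0 => simp
  | h2 a b ha hb => simp only [map_add, LinearMap.add_apply, ha, hb]
  | h1 a f =>
  induction g using ind with
  | h0 => simp
  | h2 a b ha hb => simp only [map_add, LinearMap.add_apply, ha, hb]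
  | h1 b g =>
  induction h using ind with
  | h0 => simp
  | h2 a b ha hb => simp only [map_add, ha, hb]
  | h1 c h =>
  rw [tcomp_homL f g rfl, tcomp_homL g h rfl, tcomp_homL _ _ rfl,
    tcomp_homL _ _ (show a + (b + c) = a + b + c by omega),
    GrCat.assoc f g h rfl rfl rfl (by omega)]

theorem tcomp_add_left {X Y Z : C} (f f' : THom K X Y) (g : THom K Y Z) :
    tcomp X Y Z (f + f') g = tcomp X Y Z f g + tcomp X Y Z f' g := by simp

theorem tcomp_add_right {X Y Z : C} (f : THom K X Y) (g g' : THom K Y Z) :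
    tcomp X Y Z f (g + g') = tcomp X Y Z f g + tcomp X Y Z f g' := by simp

theorem tcomp_smul_left {X Y Z : C} (a : K) (f : THom K X Y) (g : THom K Y Z) :
    tcomp X Y Z (a • f) g = a • tcomp X Y Z f g := by simp

theorem tcomp_smul_right {X Y Z : C} (f : THom K X Y) (a : K) (g : THom K Y Z) :
    tcomp X Y Z f (a • g) = a • tcomp X Y Z f g := by simp

instance thomGroup (X Y : C) : AddCommGroup (THom K X Y) := inferInstance

instance thomModule (X Y : C) : Module K (THom K X Y) := inferInstance

instance category : Category.{v} (Tot K C) where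
  Hom X Y := THom K (C := C) X Y
  id X := homL (K := K) (C := C) (GrCat.idm (K := K) (C := C) X)
  comp {X Y Z} f g := tcomp (K := K) (C := C) X Y Z f g
  id_comp f := tcomp_id_left (K := K) (C := C) f
  comp_id f := tcomp_id_right (K := K) (C := C) f
  assoc f g h := tcomp_assoc (K := K) (C := C) f g h

instance preadditive : Preadditive (Tot K C) where
  homGroup X Y := thomGroup (K := K) (C := C) X Y
  add_comp X Y Z f f' g := tcomp_add_left (K := K) (C := C) f f' g
  comp_add X Y Z f g g' := tcomp_add_right (K := K) (C := C) f g g'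

instance linear : Linear K (Tot K C) where
  homModule X Y := thomModule (K := K) (C := C) X Y
  smul_comp X Y Z a f g := tcomp_smul_left (K := K) (C := C) a f g
  comp_smul X Y Z f a g := tcomp_smul_right (K := K) (C := C) f a g

/-- An object regarded as an object of the total category. -/
abbrev o (K : Type u') [Field K] {C : Type u} [GrCat.{v} K C] (X : C) : Tot K C := X

def hom {X Y : C} {d : ℤ} : Hom K X Y d →ₗ[K] (o K X ⟶ o K Y) where
  toFun f := homL (K := K) (C := C) f
  map_add' f g := map_add (homL (K := K) (C := C)) f g
  map_smul' a f := LinearMap.map_smul (homL (K := K) (C := C)) a f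

theorem hom_inj {X Y : C} {d : ℤ} {f g : Hom K X Y d} (h : hom f = hom g) : f = g :=
  DirectSum.of_injective (β := fun d => Hom K X Y d) d h

theorem hom_dcast {X Y : C} {k l : ℤ} (h : k = l) (f : Hom K X Y k) : hom (dcast h f) = hom f :=
  homL_dcast h f

theorem hom_comp {X Y Z : C} {k l m : ℤ} (f : Hom K X Y k) (g : Hom K Y Z l) (h : k + l = m) :
    hom (comp f g h) = hom f ≫ hom g := (tcomp_homL f g h).symm

theorem hom_ind {X Y : C} {p : (o K X ⟶ o K Y) → Prop} (h0 : p 0)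
    (h1 : ∀ d (f : Hom K X Y d), p (hom f)) (h2 : ∀ f g, p f → p g → p (f + g)) (f) : p f :=
  ind (K := K) (C := C) h0 h1 h2 f

def componentL {X Y : C} (d : ℤ) : THom K X Y →ₗ[K] Hom K X Y d :=
  DirectSum.component K ℤ (fun d => Hom K X Y d) d

/-- The homogeneous component of degree `d`. -/
def component {X Y : C} (d : ℤ) : (o K X ⟶ o K Y) →ₗ[K] Hom K X Y d where
  toFun f := componentL (K := K) (C := C) d f
  map_add' f g := map_add (componentL (K := K) (C := C) d) f g
  map_smul' a f := LinearMap.map_smul (componentL (K := K) (C := C) d) a f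

theorem component_hom {X Y : C} {d : ℤ} (f : Hom K X Y d) : component d (hom f) = f :=
  DirectSum.component.lof_self K d f

theorem component_hom_ne {X Y : C} {d e : ℤ} (f : Hom K X Y d) (h : e ≠ d) :
    component e (hom f) = 0 := DirectSum.of_eq_of_ne (β := fun d => Hom K X Y d) _ _ _ h

theorem component_comp {X Y Z : C} {k l m : ℤ} (f : Hom K X Y k) (g : o K Y ⟶ o K Z)
    (h : k + l = m) : component m (hom f ≫ g) = comp f (component l g) h := by
  induction g using hom_ind with
  | h0 => simp
  | h1 d g =>
    rw [← hom_comp f g rfl]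
    by_cases hd : l = d
    · subst hd; subst h
      rw [component_hom, component_hom]
    · rw [component_hom_ne _ hd, component_hom_ne _ (by omega), comp_zero]
  | h2 g g' hg hg' => rw [Preadditive.comp_add, map_add, map_add, hg, hg', comp_add]

def mapHomL {C' : Type w} [GrCat.{v'} K C'] {X Y : C} {X' Y' : C'}
    (F : ∀ d, Hom K X Y d →ₗ[K] Hom K X' Y' d) : THom K X Y →ₗ[K] THom K X' Y' :=
  toModule K ℤ _ fun d => homL ∘ₗ F d

/-- A degree preserving linear map on morphisms induces a map on the total category. -/
def mapHom {C' : Type w} [GrCat.{v'} K C'] {X Y : C} {X' Y' : C'}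
    (F : ∀ d, Hom K X Y d →ₗ[K] Hom K X' Y' d) : (o K X ⟶ o K Y) →ₗ[K] (o K X' ⟶ o K Y') where
  toFun f := mapHomL F f
  map_add' f g := map_add (mapHomL F) f g
  map_smul' a f := LinearMap.map_smul (mapHomL F) a f

theorem mapHom_hom {C' : Type w} [GrCat.{v'} K C'] {X Y : C} {X' Y' : C'}
    (F : ∀ d, Hom K X Y d →ₗ[K] Hom K X' Y' d) {d : ℤ} (f : Hom K X Y d) :
    mapHom F (hom f) = hom (F d f) := toModule_lof (M := fun d => Hom K X Y d) K d f

end Cat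

section Mon

variable [GrMonCat.{v} K C]

def ttens (X Y X' Y' : C) :
    THom K X Y →ₗ[K] THom K X' Y' →ₗ[K] THom K (tObj K X X') (tObj K Y Y') :=
  toModule K ℤ _ fun k => LinearMap.flip (toModule K ℤ _ fun l =>
    LinearMap.flip ((tHomL (K := K) (X := X) (Y := Y) (X' := X') (Y' := Y')
      (rfl : k + l = k + l)).compr₂ homL))

theorem ttens_homL {X Y X' Y' : C} {k l m : ℤ} (f : Hom K X Y k) (g : Hom K X' Y' l)
    (h : k + l = m) : ttens X Y X' Y' (homL f) (homL g) = homL (tHom f g h) := by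
  subst h
  simp only [ttens, homL, toModule_lof, LinearMap.flip_apply]
  rfl

theorem ttens_comp {X Y Z X' Y' Z' : C} (f : THom K X Y) (g : THom K Y Z) (f' : THom K X' Y')
    (g' : THom K Y' Z') : ttens X Z X' Z' (tcomp X Y Z f g) (tcomp X' Y' Z' f' g') =
      tcomp _ _ _ (ttens X Y X' Y' f f') (ttens Y Z Y' Z' g g') := by
  induction f using ind with
  | h0 => simp
  | h2 a b ha hb => simp only [map_add, LinearMap.add_apply, ha, hb]
  | h1 a f =>
  induction g using ind with
  | h0 => simp
  | h2 a b ha hb => simp only [map_add, LinearMap.add_apply, ha, hb]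
  | h1 b g =>
  induction f' using ind with
  | h0 => simp
  | h2 a b ha hb => simp only [map_add, LinearMap.add_apply, ha, hb]
  | h1 a' f' =>
  induction g' using ind with
  | h0 => simp
  | h2 a b ha hb => simp only [map_add, ha, hb]
  | h1 b' g' =>
  rw [tcomp_homL _ _ rfl, tcomp_homL _ _ rfl, ttens_homL _ _ rfl, ttens_homL _ _ rfl,
    ttens_homL _ _ rfl, tcomp_homL _ _ (show a + a' + (b + b') = a + b + (a' + b') by omega),
    tHom_comp _ _ _ _ rfl rfl rfl rfl rfl (by omega)]

theorem nat_aux {X Y Z X' Y' Z' : C} (f : THom K X X') (g : THom K Y Y') (p : THom K Z Z') :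
    tcomp _ _ _ (ttens _ _ _ _ (ttens _ _ _ _ f g) p) (homL (aHom (K := K) X' Y' Z')) =
      tcomp _ _ _ (homL (aHom X Y Z)) (ttens _ _ _ _ f (ttens _ _ _ _ g p)) := by
  induction f using ind with
  | h0 => simp
  | h2 a b ha hb => simp only [map_add, LinearMap.add_apply, ha, hb]
  | h1 a f =>
  induction g using ind with
  | h0 => simp
  | h2 a b ha hb => simp only [map_add, LinearMap.add_apply, ha, hb]
  | h1 b g =>
  induction p using ind with
  | h0 => simp
  | h2 a b ha hb => simp only [map_add, LinearMap.add_apply, ha, hb]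
  | h1 c p =>
  rw [ttens_homL _ _ rfl, ttens_homL _ _ rfl, ttens_homL _ _ rfl,
    ttens_homL _ _ (show a + (b + c) = a + b + c by omega), tcomp_homL _ _ (add_zero _),
    tcomp_homL _ _ (zero_add _), aHom_nat f g p rfl rfl rfl (by omega)]

theorem lnat_aux {X Y : C} (f : THom K X Y) :
    tcomp _ _ _ (ttens _ _ _ _ (homL (GrCat.idm (unit K))) f) (homL (lHom Y)) =
      tcomp _ _ _ (homL (lHom X)) f := by
  induction f using ind with
  | h0 => simp
  | h2 a b ha hb => simp only [map_add, LinearMap.add_apply, ha, hb]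
  | h1 a f =>
    rw [ttens_homL _ _ (zero_add a), tcomp_homL _ _ (add_zero a), tcomp_homL _ _ (zero_add a),
      lHom_nat f]

theorem rnat_aux {X Y : C} (f : THom K X Y) :
    tcomp _ _ _ (ttens _ _ _ _ f (homL (GrCat.idm (unit K)))) (homL (rHom Y)) =
      tcomp _ _ _ (homL (rHom X)) f := by
  induction f using ind with
  | h0 => simp
  | h2 a b ha hb => simp only [map_add, LinearMap.add_apply, ha, hb]
  | h1 a f =>
    rw [ttens_homL _ _ (add_zero a), tcomp_homL _ _ (add_zero a), tcomp_homL _ _ (zero_add a),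
      rHom_nat f]

theorem pent_aux (W X Y Z : C) :
    tcomp _ _ _ (ttens _ _ _ _ (homL (aHom (K := K) W X Y)) (homL (GrCat.idm Z)))
      (tcomp _ _ _ (homL (aHom W (tObj K X Y) Z)) (ttens _ _ _ _ (homL (GrCat.idm W))
      (homL (aHom X Y Z)))) =
      tcomp _ _ _ (homL (aHom (tObj K W X) Y Z)) (homL (aHom W X (tObj K Y Z))) := by
  rw [ttens_homL _ _ (add_zero 0), ttens_homL _ _ (add_zero 0), tcomp_homL _ _ (add_zero 0),
    tcomp_homL _ _ (add_zero 0), tcomp_homL _ _ (add_zero 0), GrMonCat.pentagon]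

theorem tri_aux (X Y : C) :
    tcomp _ _ _ (homL (aHom (K := K) X (unit K) Y))
      (ttens _ _ _ _ (homL (GrCat.idm X)) (homL (lHom Y))) =
      ttens _ _ _ _ (homL (rHom X)) (homL (GrCat.idm Y)) := by
  rw [ttens_homL _ _ (add_zero 0), ttens_homL _ _ (add_zero 0), tcomp_homL _ _ (add_zero 0),
    GrMonCat.triangle]

theorem ttens_add_left {X Y X' Y' : C} (f f' : THom K X Y) (g : THom K X' Y') :
    ttens X Y X' Y' (f + f') g = ttens X Y X' Y' f g + ttens X Y X' Y' f' g := by simp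

theorem ttens_add_right {X Y X' Y' : C} (f : THom K X Y) (g g' : THom K X' Y') :
    ttens X Y X' Y' f (g + g') = ttens X Y X' Y' f g + ttens X Y X' Y' f g' := by simp

theorem ttens_smul_left {X Y X' Y' : C} (a : K) (f : THom K X Y) (g : THom K X' Y') :
    ttens X Y X' Y' (a • f) g = a • ttens X Y X' Y' f g := by simp

theorem ttens_smul_right {X Y X' Y' : C} (f : THom K X Y) (a : K) (g : THom K X' Y') :
    ttens X Y X' Y' f (a • g) = a • ttens X Y X' Y' f g := by simp

theorem ttens_zero_left {X Y X' Y' : C} (g : THom K X' Y') :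
    ttens X Y X' Y' (0 : THom K X Y) g = 0 := by simp

theorem ttens_zero_right {X Y X' Y' : C} (f : THom K X Y) :
    ttens X Y X' Y' f (0 : THom K X' Y') = 0 := by simp

instance monStruct : MonoidalCategoryStruct (Tot K C) where
  tensorObj X Y := tObj K (C := C) X Y
  tensorUnit := GrMonCat.unit K (C := C)
  tensorHom {X Y X' Y'} f g := ttens (K := K) (C := C) X Y X' Y' f g
  whiskerLeft X Y Y' f := ttens (K := K) (C := C) X X Y Y' (homL (GrCat.idm (K := K) (C := C) X)) f
  whiskerRight {Y Y'} f X := ttens (K := K) (C := C) Y Y' X X f (homL (GrCat.idm (K := K) (C := C) X))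
  associator X Y Z :=
    { hom := homL (aHom (K := K) (C := C) X Y Z)
      inv := homL (aInv (K := K) (C := C) X Y Z)
      hom_inv_id := (tcomp_homL _ _ (add_zero 0)).trans
        (congrArg homL (aHom_aInv (K := K) (C := C) X Y Z _))
      inv_hom_id := (tcomp_homL _ _ (add_zero 0)).trans
        (congrArg homL (aInv_aHom (K := K) (C := C) X Y Z _)) }
  leftUnitor X :=
    { hom := homL (lHom (K := K) (C := C) X)
      inv := homL (lInv (K := K) (C := C) X)
      hom_inv_id := (tcomp_homL _ _ (add_zero 0)).trans
        (congrArg homL (lHom_lInv (K := K) (C := C) X _))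
      inv_hom_id := (tcomp_homL _ _ (add_zero 0)).trans
        (congrArg homL (lInv_lHom (K := K) (C := C) X _)) }
  rightUnitor X :=
    { hom := homL (rHom (K := K) (C := C) X)
      inv := homL (rInv (K := K) (C := C) X)
      hom_inv_id := (tcomp_homL _ _ (add_zero 0)).trans
        (congrArg homL (rHom_rInv (K := K) (C := C) X _))
      inv_hom_id := (tcomp_homL _ _ (add_zero 0)).trans
        (congrArg homL (rInv_rHom (K := K) (C := C) X _)) }

instance monoidal : MonoidalCategory (Tot K C) :=
  MonoidalCategory.ofTensorHom
    (id_tensorHom_id := fun X Y => (ttens_homL _ _ (add_zero 0)).trans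
      (congrArg homL (GrMonCat.tHom_id (K := K) (C := C) X Y _)))
    (id_tensorHom := fun _ _ _ _ => rfl)
    (tensorHom_id := fun _ _ => rfl)
    (tensorHom_comp_tensorHom := fun f f' g g' => (ttens_comp (K := K) (C := C) f g f' g').symm)
    (associator_naturality := fun f g h => nat_aux (K := K) (C := C) f g h)
    (leftUnitor_naturality := fun f => lnat_aux (K := K) (C := C) f)
    (rightUnitor_naturality := fun f => rnat_aux (K := K) (C := C) f)
    (pentagon := fun W X Y Z => pent_aux (K := K) (C := C) W X Y Z)
    (triangle := fun X Y => tri_aux (K := K) (C := C) X Y)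

instance monPre : MonoidalPreadditive (Tot K C) where
  whiskerLeft_zero {X Y Z} := ttens_zero_right (K := K) (C := C) _
  zero_whiskerRight {X Y Z} := ttens_zero_left (K := K) (C := C) _
  whiskerLeft_add _ _ := ttens_add_right (K := K) (C := C) _ _ _
  add_whiskerRight _ _ := ttens_add_left (K := K) (C := C) _ _ _

instance monLin : MonoidalLinear K (Tot K C) where
  whiskerLeft_smul _ _ _ a f := ttens_smul_right (K := K) (C := C) _ a f
  smul_whiskerRight a _ _ f _ := ttens_smul_left (K := K) (C := C) a f _

open MonoidalCategory

theorem hom_tHom {X Y X' Y' : C} {k l m : ℤ} (f : Hom K X Y k) (g : Hom K X' Y' l)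
    (h : k + l = m) : hom (tHom f g h) = hom f ⊗ₘ hom g := (ttens_homL f g h).symm

theorem hom_tHom_id {X Y : C} {k m : ℤ} (f : Hom K X Y k) (Z : C)
    (h : k + 0 = m) : hom (tHom f (GrCat.idm Z) h) = hom f ▷ o K Z := (ttens_homL f _ h).symm

theorem hom_id_tHom {X Y : C} {k m : ℤ} (f : Hom K X Y k) (Z : C)
    (h : 0 + k = m) : hom (tHom (GrCat.idm Z) f h) = o K Z ◁ hom f := (ttens_homL _ f h).symm

end Mon

end Tot

end

/-! ## Dotted Temperley-Lieb calculus in a monoidal linear category -/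

namespace TLGen

open MonoidalCategory

variable {K : Type u'} [Field K] {M : Type u} [Category.{v} M] [MonoidalCategory M] {c : M}
  (cap : c ⊗ c ⟶ 𝟙_ M) (cup : 𝟙_ M ⟶ c ⊗ c)

theorem lastCup_comp_left (k : 𝟙_ M ⟶ c ⊗ c) (x : c ⟶ c) (X : M) :
    lastCup (k ≫ x ▷ c) X = lastCup k X ≫ (X ◁ x) ▷ c := by
  simp only [lastCup]; monoidal

theorem lastCup_comp_right (k : 𝟙_ M ⟶ c ⊗ c) (x : c ⟶ c) (X : M) :
    lastCup (k ≫ c ◁ x) X = lastCup k X ≫ (X ⊗ c) ◁ x := by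
  simp only [lastCup]; monoidal

theorem lastCap_comp_left (k : c ⊗ c ⟶ 𝟙_ M) (x : c ⟶ c) (X : M) :
    lastCap (x ▷ c ≫ k) X = (X ◁ x) ▷ c ≫ lastCap k X := by
  simp only [lastCap]; monoidal

theorem lastCap_comp_right (k : c ⊗ c ⟶ 𝟙_ M) (x : c ⟶ c) (X : M) :
    lastCap (c ◁ x ≫ k) X = (X ⊗ c) ◁ x ≫ lastCap k X := by
  simp only [lastCap]; monoidal

/-- The extension of `F : A ⊗ B ⟶ D` by one strand on the right. -/
def ext {A B D : M} (F : A ⊗ B ⟶ D) (c : M) : A ⊗ (B ⊗ c) ⟶ D ⊗ c := (α_ A B c).inv ≫ F ▷ c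

theorem ext_lastCup {A B D : M} (F : A ⊗ B ⟶ D) (k : 𝟙_ M ⟶ c ⊗ c) :
    A ◁ lastCup k B ≫ ext (ext F c) c = F ≫ lastCup k D := by
  rw [← lastCup_natural]
  simp only [lastCup, ext]
  monoidal

theorem ext_lastCap {A B D : M} (F : A ⊗ B ⟶ D) (k : c ⊗ c ⟶ 𝟙_ M) :
    A ◁ lastCap k B ≫ F = ext (ext F c) c ≫ lastCap k D := by
  simp only [ext, comp_whiskerRight, Category.assoc, lastCap_natural]
  simp only [lastCap]
  monoidal

theorem ext_e {A B D : M} (F : A ⊗ B ⟶ D) :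
    A ◁ e cap cup B ≫ ext (ext F c) c = ext (ext F c) c ≫ e cap cup D := by
  simp only [e, MonoidalCategory.whiskerLeft_comp, Category.assoc, ext_lastCup]
  rw [← Category.assoc, ext_lastCap, Category.assoc]

theorem whiskerRight_ext {A A' B D : M} (p : A ⟶ A') (F : A' ⊗ B ⟶ D) :
    p ▷ (B ⊗ c) ≫ ext F c = ext (p ▷ B ≫ F) c := by
  simp [ext]

theorem whiskerLeft_ext {A B B' D : M} (p : B ⟶ B') (F : A ⊗ B' ⟶ D) :
    A ◁ (p ▷ c) ≫ ext F c = ext (A ◁ p ≫ F) c := by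
  simp [ext]

theorem ext_comp {A B D D' : M} (F : A ⊗ B ⟶ D) (p : D ⟶ D') :
    ext F c ≫ p ▷ c = ext (F ≫ p) c := by
  simp [ext]

theorem ext_dot {A B D : M} (F : A ⊗ B ⟶ D) (x : c ⟶ c) :
    A ◁ (B ◁ x) ≫ ext F c = ext F c ≫ D ◁ x := by
  rw [ext, Category.assoc, ← whisker_exchange, ← Category.assoc, ← Category.assoc]
  congr 1
  monoidal

theorem ext_assoc {A B C B' D E : M} {f : B ⊗ C ⟶ B'} {g : A ⊗ B' ⟶ E} {h : A ⊗ B ⟶ D}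
    {k : D ⊗ C ⟶ E} (H : (α_ A B C).hom ≫ A ◁ f ≫ g = h ▷ C ≫ k) :
    (α_ A B (C ⊗ c)).hom ≫ A ◁ ext f c ≫ ext g c = h ▷ (C ⊗ c) ≫ ext k c := by
  rw [whiskerRight_ext, ← H]
  simp only [ext]
  monoidal

variable [Preadditive M] [Linear K M] [MonoidalPreadditive M] [MonoidalLinear K M]

theorem lastCup_lastCap (circle : cup ≫ cap = (2 : K) • 𝟙 _) (X : M) :
    lastCup cup X ≫ lastCap cap X = (2 : K) • 𝟙 _ := by
  have : lastCup cup X ≫ lastCap cap X = (ρ_ X).inv ≫ X ◁ (cup ≫ cap) ≫ (ρ_ X).hom := by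
    simp [lastCup, lastCap]
  rw [this, circle]
  simp

theorem lastCup_step [CharZero K] (circle : cup ≫ cap = (2 : K) • 𝟙 _) {X : M} {Q : X ⟶ X}
    {P : X ⊗ c ⟶ X ⊗ c} {a b : K} (hab : a * b = 1) (h : Inv cap cup X Q P b) :
    lastCup cup X ≫ step cap cup a P = 0 := by
  have he : e cap cup X ≫ step cap cup a P = 0 := by
    have h1 := h.ePe =≫ P ▷ c
    simp only [Category.assoc, Linear.smul_comp] at h1
    have h2 : Q ▷ c ▷ c ≫ e cap cup X ≫ P ▷ c = e cap cup X ≫ P ▷ c := by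
      rw [← Category.assoc, e_natural, Category.assoc, ← comp_whiskerRight, h.left]
    simp only [step, Preadditive.comp_sub, Linear.comp_smul, h1, h2, smul_smul, hab, one_smul,
      sub_self]
  have h3 := lastCup cup X ≫= he
  rw [e, Category.assoc, ← Category.assoc (lastCup cup X), lastCup_lastCap cap cup circle X,
    Linear.smul_comp, Category.id_comp, Limits.comp_zero] at h3
  exact (smul_eq_zero.1 h3).resolve_left two_ne_zero

theorem step_lastCap [CharZero K] (circle : cup ≫ cap = (2 : K) • 𝟙 _) {X : M} {Q : X ⟶ X}
    {P : X ⊗ c ⟶ X ⊗ c} {a b : K} (hab : a * b = 1) (h : Inv cap cup X Q P b) :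
    step cap cup a P ≫ lastCap cap X = 0 := by
  have he : step cap cup a P ≫ e cap cup X = 0 := by
    have h1 := P ▷ c ≫= h.ePe
    simp only [Linear.comp_smul] at h1
    have h2 : P ▷ c ≫ Q ▷ c ▷ c ≫ e cap cup X = P ▷ c ≫ e cap cup X := by
      rw [← Category.assoc, ← comp_whiskerRight, h.right]
    simp only [step, Preadditive.sub_comp, Linear.smul_comp, Category.assoc, h1, h2, smul_smul,
      hab, one_smul, sub_self]
  have h3 := he =≫ lastCap cap X
  rw [e, Category.assoc, Category.assoc, lastCup_lastCap cap cup circle X,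
    Linear.comp_smul, Category.comp_id, Limits.zero_comp, Linear.comp_smul] at h3
  exact (smul_eq_zero.1 h3).resolve_left two_ne_zero

/-- The relations satisfied by the dot. -/
structure Dot (x : c ⟶ c) : Prop where
  dot_cup : cup ≫ x ▷ c = cup ≫ c ◁ x
  dot_cap : x ▷ c ≫ cap = c ◁ x ≫ cap
  sq : x ≫ x = 0
  sum : x ▷ c + c ◁ x = (x ▷ c ≫ cap) ≫ cup + cap ≫ cup ≫ x ▷ c

variable {cap cup} {x : c ⟶ c}

theorem Dot.sum_last (hx : Dot cap cup x) (X : M) :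
    (X ◁ x) ▷ c + (X ⊗ c) ◁ x =
      (X ◁ x) ▷ c ≫ e cap cup X + e cap cup X ≫ (X ◁ x) ▷ c := by
  have h := congrArg (fun t => (α_ X c c).hom ≫ X ◁ t ≫ (α_ X c c).inv) hx.sum
  simp only [MonoidalPreadditive.whiskerLeft_add, Preadditive.add_comp, Preadditive.comp_add] at h
  have h1 : (α_ X c c).hom ≫ X ◁ (x ▷ c) ≫ (α_ X c c).inv = (X ◁ x) ▷ c := by monoidal
  have h2 : (α_ X c c).hom ≫ X ◁ (c ◁ x) ≫ (α_ X c c).inv = (X ⊗ c) ◁ x := by monoidal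
  have h3 : (α_ X c c).hom ≫ X ◁ ((x ▷ c ≫ cap) ≫ cup) ≫ (α_ X c c).inv =
      (X ◁ x) ▷ c ≫ e cap cup X := by
    simp only [e, lastCap, lastCup]; monoidal
  have h4 : (α_ X c c).hom ≫ X ◁ (cap ≫ cup ≫ x ▷ c) ≫ (α_ X c c).inv =
      e cap cup X ≫ (X ◁ x) ▷ c := by
    simp only [e, lastCap, lastCup]; monoidal
  rwa [h1, h2, h3, h4] at h

/-- Sliding a dotted cup past a strand. -/
theorem Dot.slide (hx : Dot cap cup x)
    (zigL : (ρ_ c).inv ≫ c ◁ cup ≫ (α_ _ _ _).inv ≫ cap ▷ c ≫ (λ_ c).hom = 𝟙 c) (X : M) :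
    X ◁ x ≫ lastCup cup (X ⊗ c) + lastCup (cup ≫ x ▷ c) (X ⊗ c) =
      X ◁ x ≫ lastCup cup X ▷ c + lastCup (cup ≫ x ▷ c) X ▷ c := by
  have h := lastCup cup (X ⊗ c) ≫= congrArg (fun t => t ▷ c) (hx.sum_last X)
  have hs := snakeL cap cup zigL X
  simp only [MonoidalPreadditive.add_whiskerRight, Preadditive.comp_add, e, comp_whiskerRight,
    Category.assoc] at h
  rw [← lastCup_comp_left, ← Category.assoc _ ((X ◁ x) ▷ c ▷ c), lastCup_natural,
    Category.assoc, ← Category.assoc (lastCup cup (X ⊗ c)) (lastCap cap X ▷ c), hs,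
    ← Category.assoc (lastCup cup (X ⊗ c)) (lastCap cap X ▷ c), hs, Category.id_comp,
    Category.id_comp, ← comp_whiskerRight, ← lastCup_comp_left] at h
  exact h

/-- The alternating sum of dots with one more strand. -/
def zstep {X : M} (x : c ⟶ c) (s : K) (z : X ⟶ X) : X ⊗ c ⟶ X ⊗ c := z ▷ c + s • X ◁ x

theorem zstep_two {X : M} (s : K) (z : X ⟶ X) : zstep x (-s) (zstep x s z) =
    z ▷ c ▷ c + s • ((X ◁ x) ▷ c - (X ⊗ c) ◁ x) := by
  simp only [zstep, MonoidalPreadditive.add_whiskerRight, MonoidalLinear.smul_whiskerRight,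
    neg_smul, smul_sub]
  abel

theorem lastCup_zstep {X : M} (k : 𝟙_ M ⟶ c ⊗ c) (hk : k ≫ x ▷ c = k ≫ c ◁ x) (s : K)
    (z : X ⟶ X) : lastCup k X ≫ zstep x (-s) (zstep x s z) = z ≫ lastCup k X := by
  rw [zstep_two, Preadditive.comp_add, Linear.comp_smul, Preadditive.comp_sub,
    ← lastCup_comp_left, ← lastCup_comp_right, hk, sub_self, smul_zero, add_zero, lastCup_natural]

theorem zstep_lastCap {X : M} (k : c ⊗ c ⟶ 𝟙_ M) (hk : x ▷ c ≫ k = c ◁ x ≫ k) (s : K)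
    (z : X ⟶ X) : zstep x (-s) (zstep x s z) ≫ lastCap k X = lastCap k X ≫ z := by
  rw [zstep_two, Preadditive.add_comp, Linear.smul_comp, Preadditive.sub_comp,
    ← lastCap_comp_left, ← lastCap_comp_right, hk, sub_self, smul_zero, add_zero, lastCap_natural]

theorem Dot.dcup (hx : Dot cap cup x) :
    (cup ≫ x ▷ c) ≫ x ▷ c = (cup ≫ x ▷ c) ≫ c ◁ x := by
  rw [Category.assoc, ← comp_whiskerRight, hx.sq, Category.assoc, ← whisker_exchange,
    ← Category.assoc, ← hx.dot_cup, Category.assoc, ← comp_whiskerRight, hx.sq]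

theorem Dot.e_zstep (hx : Dot cap cup x) {X : M} (s : K) (z : X ⟶ X) :
    e cap cup X ≫ zstep x (-s) (zstep x s z) = zstep x (-s) (zstep x s z) ≫ e cap cup X := by
  rw [e, Category.assoc, lastCup_zstep cup hx.dot_cup, ← Category.assoc (zstep _ _ _),
    zstep_lastCap cap hx.dot_cap, Category.assoc]

theorem Dot.step_zstep (hx : Dot cap cup x) {X : M} (s a : K) (z : X ⟶ X) (P : X ⊗ c ⟶ X ⊗ c)
    (h : P ≫ zstep x s z = zstep x s z ≫ P) : step cap cup a P ≫ zstep x (-s) (zstep x s z) =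
      zstep x (-s) (zstep x s z) ≫ step cap cup a P := by
  have h1 : P ▷ c ≫ zstep x (-s) (zstep x s z) = zstep x (-s) (zstep x s z) ≫ P ▷ c := by
    rw [zstep, Preadditive.comp_add, Preadditive.add_comp, ← comp_whiskerRight, h,
      comp_whiskerRight, Linear.comp_smul, Linear.smul_comp, whisker_exchange]
  have h2 := hx.e_zstep s z
  simp only [step, Preadditive.sub_comp, Preadditive.comp_sub, Linear.smul_comp, Linear.comp_smul,
    Category.assoc, h1]
  rw [← Category.assoc (e cap cup X), h2, Category.assoc, ← Category.assoc (P ▷ c), h1,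
    Category.assoc]

end TLGen

noncomputable section

namespace TLGen

open MonoidalCategory

variable {K : Type u'} [Field K] {M : Type u} [Category.{v} M] [MonoidalCategory M]
  [Preadditive M] [Linear K M] [MonoidalPreadditive M] [MonoidalLinear K M] {c : M} {x : c ⟶ c}

theorem ext_zstep {A B D : M} (F : A ⊗ B ⟶ D) (a b : K) (zA : A ⟶ A) (zB : B ⟶ B) (zD : D ⟶ D)
    (h : F ≫ zD = zA ▷ B ≫ F + a • (A ◁ zB ≫ F)) : ext F c ≫ zstep x (a * b) zD =
      zA ▷ (B ⊗ c) ≫ ext F c + a • (A ◁ zstep x b zB ≫ ext F c) := by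
  rw [zstep, zstep, Preadditive.comp_add, ext_comp, h, Linear.comp_smul, ← ext_dot,
    MonoidalPreadditive.whiskerLeft_add, MonoidalLinear.whiskerLeft_smul, Preadditive.add_comp,
    Linear.smul_comp, whiskerLeft_ext, whiskerRight_ext, smul_add, smul_smul, ← add_assoc]
  congr 1
  simp only [ext, MonoidalPreadditive.add_whiskerRight, MonoidalLinear.smul_whiskerRight,
    Preadditive.comp_add, Linear.comp_smul]

section Absorb

variable {A A' B D : M} {p : D ⟶ D} {q : D ⊗ c ⟶ D ⊗ c}

theorem ext_absorb (h : p ▷ c ≫ q = q) (F : A ⊗ B ⟶ D) : ext F c ≫ q = ext (F ≫ p) c ≫ q := by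
  rw [← ext_comp, Category.assoc, h]

theorem ext_absorb_right (h : p ▷ c ≫ q = q) {k : A ⟶ A'} {F : A' ⊗ B ⟶ D} {g : A ⊗ B ⟶ D}
    (hg : k ▷ B ≫ F ≫ p = g ≫ p) : k ▷ (B ⊗ c) ≫ ext F c ≫ q = ext g c ≫ q := by
  rw [← Category.assoc, whiskerRight_ext, ext_absorb h, Category.assoc, hg, ← ext_absorb h]

theorem ext_absorb_left {B' : M} (h : p ▷ c ≫ q = q) {k : B ⟶ B'} {F : A ⊗ B' ⟶ D}
    {g : A ⊗ B ⟶ D} (hg : A ◁ k ≫ F ≫ p = g ≫ p) :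
    A ◁ (k ▷ c) ≫ ext F c ≫ q = ext g c ≫ q := by
  rw [← Category.assoc, whiskerLeft_ext, ext_absorb h, Category.assoc, hg, ← ext_absorb h]

theorem whiskerRight_unit {k : A ⟶ A'} (F : A' ⟶ D) :
    k ▷ 𝟙_ M ≫ (ρ_ A').hom ≫ F = (ρ_ A).hom ≫ k ≫ F := by simp

theorem ext_zero : ext (0 : A ⊗ B ⟶ D) c = 0 := by simp [ext]

theorem ext_absorb_zero (h : p ▷ c ≫ q = q) {k : A ⟶ A'} {F : A' ⊗ B ⟶ D}
    (hg : k ▷ B ≫ F ≫ p = 0) : k ▷ (B ⊗ c) ≫ ext F c ≫ q = 0 := by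
  rw [ext_absorb_right h (g := 0) (by rw [hg, Limits.zero_comp]), ext_zero, Limits.zero_comp]

theorem Dot.slide_absorb {cap : c ⊗ c ⟶ 𝟙_ M} {cup : 𝟙_ M ⟶ c ⊗ c} (hx : Dot cap cup x)
    (zigL : (ρ_ c).inv ≫ c ◁ cup ≫ (α_ _ _ _).inv ≫ cap ▷ c ≫ (λ_ c).hom = 𝟙 c) {X : M}
    {p : (X ⊗ c) ⊗ c ⟶ (X ⊗ c) ⊗ c} {q : ((X ⊗ c) ⊗ c) ⊗ c ⟶ ((X ⊗ c) ⊗ c) ⊗ c}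
    (h : p ▷ c ≫ q = q) (hp : lastCup cup X ≫ p = 0) (hq : lastCup cup (X ⊗ c) ≫ q = 0) :
    lastCup (cup ≫ x ▷ c) X ▷ c ≫ q = lastCup (cup ≫ x ▷ c) (X ⊗ c) ≫ q := by
  have h1 := hx.slide zigL X =≫ q
  have h2 : lastCup cup X ▷ c ≫ q = 0 := by
    rw [← h, ← Category.assoc, ← comp_whiskerRight, hp, MonoidalPreadditive.zero_whiskerRight,
      Limits.zero_comp]
  rw [Preadditive.add_comp, Preadditive.add_comp, Category.assoc, Category.assoc, h2, hq,
    Limits.comp_zero, zero_add, zero_add] at h1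
  exact h1.symm

theorem ext_cast {D₁ D₂ : M} {r : D ⟶ D₁} {r' : D ⊗ c ⟶ D₁ ⊗ c} {s : D₁ ⟶ D₂}
    {s' : D₁ ⊗ c ⟶ D₂ ⊗ c} {p : D₂ ⊗ c ⟶ D₂ ⊗ c} {p' : D₁ ⊗ c ⟶ D₁ ⊗ c} (F : A ⊗ B ⟶ D)
    (hs : s ▷ c ≫ p = p' ≫ s') (hs' : s' ≫ p = p' ≫ s') (hr : r ▷ c ≫ p' = r' ≫ p') :
    ext (F ≫ r ≫ s) c ≫ p = ext F c ≫ r' ≫ s' ≫ p := by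
  rw [← ext_comp, Category.assoc, comp_whiskerRight, Category.assoc, hs, ← Category.assoc (r ▷ c),
    hr, Category.assoc, hs']

theorem step_absorb {cap : c ⊗ c ⟶ 𝟙_ M} {cup : 𝟙_ M ⟶ c ⊗ c} {F : A ⊗ B ⟶ D} (a : K)
    {r : B ⊗ c ⟶ B ⊗ c} {q : (D ⊗ c) ⊗ c ⟶ (D ⊗ c) ⊗ c} (hq : lastCup cup D ≫ q = 0)
    (hr : A ◁ (r ▷ c) ≫ ext (ext F c) c ≫ q = ext (ext F c) c ≫ q) :
    A ◁ step cap cup a r ≫ ext (ext F c) c ≫ q = ext (ext F c) c ≫ q := by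
  have h : A ◁ e cap cup B ≫ ext (ext F c) c ≫ q = 0 := by
    rw [← Category.assoc, ext_e, e, Category.assoc, Category.assoc, hq, Limits.comp_zero,
      Limits.comp_zero]
  rw [step, sub_eq_add_neg, ← neg_smul, MonoidalPreadditive.whiskerLeft_add,
    MonoidalLinear.whiskerLeft_smul, MonoidalCategory.whiskerLeft_comp,
    MonoidalCategory.whiskerLeft_comp, Preadditive.add_comp, Linear.smul_comp, Category.assoc,
    Category.assoc, hr, h, Limits.comp_zero, smul_zero, add_zero]

theorem lastCup_absorb {X : M} {p : X ⟶ X} {p₁ : X ⊗ c ⟶ X ⊗ c}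
    {p₂ : (X ⊗ c) ⊗ c ⟶ (X ⊗ c) ⊗ c} (h : p ▷ c ≫ p₁ = p₁) (h' : p₁ ▷ c ≫ p₂ = p₂)
    (k : 𝟙_ M ⟶ c ⊗ c) : p ≫ lastCup k X ≫ p₂ = lastCup k X ≫ p₂ := by
  rw [← Category.assoc, ← lastCup_natural, Category.assoc, ← h', ← Category.assoc (p ▷ c ▷ c),
    ← comp_whiskerRight, h]

end Absorb

end TLGen

namespace Tot

open MonoidalCategory GrCat GrMonCat

variable {K : Type u'} [Field K] {C : Type u}

theorem hom_add [GrCat.{v} K C] {X Y : C} {d : ℤ} (f g : Hom K X Y d) :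
    hom (f + g) = hom f + hom g := map_add hom f g

theorem hom_smul [GrCat.{v} K C] {X Y : C} {d : ℤ} (a : K) (f : Hom K X Y d) :
    hom (a • f) = a • hom f := map_smul hom a f

theorem hom_zero [GrCat.{v} K C] (X Y : C) (d : ℤ) :
    hom (0 : Hom K X Y d) = 0 := map_zero hom

/-- The inclusion of the degree zero subcategory. -/
def d0 [GrCat.{v} K C] {X Y : Deg0 K C} : (X ⟶ Y) →ₗ[K] (o K (C := C) X ⟶ o K (C := C) Y) :=
  hom (K := K) (C := C)

section

variable [GrMonCat.{v} K C]

theorem d0_comp {X Y Z : Deg0 K C} (f : X ⟶ Y) (g : Y ⟶ Z) : d0 (f ≫ g) = d0 f ≫ d0 g :=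
  hom_comp (C := C) _ _ _

theorem d0_whiskerRight {X Y : Deg0 K C} (f : X ⟶ Y) (Z : Deg0 K C) :
    d0 (f ▷ Z) = d0 f ▷ o K (C := C) Z := hom_tHom_id (C := C) _ _ _

theorem d0_whiskerLeft {X Y : Deg0 K C} (f : X ⟶ Y) (Z : Deg0 K C) :
    d0 (Z ◁ f) = o K (C := C) Z ◁ d0 f := hom_id_tHom (C := C) _ _ _

theorem d0_lastCap {c : Deg0 K C} (cap : c ⊗ c ⟶ 𝟙_ _) (X : Deg0 K C) :
    d0 (TLGen.lastCap cap X) = TLGen.lastCap (c := o K (C := C) c) (d0 cap) (o K (C := C) X) := by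
  rw [TLGen.lastCap, d0_comp, d0_comp, d0_whiskerLeft]
  rfl

theorem d0_lastCup {c : Deg0 K C} (cup : 𝟙_ _ ⟶ c ⊗ c) (X : Deg0 K C) :
    d0 (TLGen.lastCup cup X) = TLGen.lastCup (c := o K (C := C) c) (d0 cup) (o K (C := C) X) := by
  rw [TLGen.lastCup, d0_comp, d0_comp, d0_whiskerLeft]
  rfl

theorem d0_e {c : Deg0 K C} (cap : c ⊗ c ⟶ 𝟙_ _) (cup : 𝟙_ _ ⟶ c ⊗ c) (X : Deg0 K C) :
    d0 (TLGen.e cap cup X) =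
      TLGen.e (c := o K (C := C) c) (d0 cap) (d0 cup) (o K (C := C) X) := by
  rw [TLGen.e, d0_comp, d0_lastCap, d0_lastCup]
  rfl

theorem d0_step {c : Deg0 K C} (cap : c ⊗ c ⟶ 𝟙_ _) (cup : 𝟙_ _ ⟶ c ⊗ c) {X : Deg0 K C} (a : K)
    (P : X ⊗ c ⟶ X ⊗ c) : d0 (TLGen.step cap cup a P) =
      TLGen.step (c := o K (C := C) c) (d0 cap) (d0 cup) (X := o K (C := C) X) a (d0 P) := by
  rw [TLGen.step, map_sub, map_smul, d0_comp, d0_comp, d0_whiskerRight, d0_e]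
  rfl

theorem d0_inv {c : Deg0 K C} {cap : c ⊗ c ⟶ 𝟙_ _} {cup : 𝟙_ _ ⟶ c ⊗ c} {X : Deg0 K C}
    {Q : X ⟶ X} {P : X ⊗ c ⟶ X ⊗ c} {b : K} (h : TLGen.Inv cap cup X Q P b) :
    TLGen.Inv (c := o K (C := C) c) (d0 cap) (d0 cup) (o K (C := C) X) (d0 Q) (d0 P) b where
  idem := by
    have := congrArg d0 h.idem
    rw [d0_comp] at this
    exact this
  left := by
    have := congrArg d0 h.left
    rw [d0_comp, d0_whiskerRight] at this
    exact this
  right := by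
    have := congrArg d0 h.right
    rw [d0_comp, d0_whiskerRight] at this
    exact this
  ePe := by
    have := congrArg d0 h.ePe
    rw [d0_comp, d0_comp, map_smul, d0_comp, d0_whiskerRight, d0_whiskerRight, d0_whiskerRight,
      d0_e] at this
    exact this

end

end Tot

namespace DTL

open Tot GrCat GrMonCat CategoryTheory.MonoidalCategory TLGen

section Basic

variable (K : Type u) [Field K]

/-- The objects of the dotted Temperley-Lieb category as objects of the total category. -/
abbrev ob (X : BWord Unit) : Tot K DTL := X

variable {K} in
/-- The morphism of the total category represented by an expression. -/
def hmk {X Y : BWord Unit} {d : ℤ} (f : Tm K DGen X Y d) : ob K X ⟶ ob K Y :=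
  hom (K := K) (C := DTL) (mk K f)

abbrev cT : Tot K DTL := ob K DTm.c
abbrev pw (n : ℕ) : Tot K DTL := ob K (BWord.pow () n)

/-- The generators, projectors and canonical isomorphisms in the total category. -/
def tcup : 𝟙_ (Tot K DTL) ⟶ cT K ⊗ cT K := hmk DTm.cup
def tcap : cT K ⊗ cT K ⟶ 𝟙_ (Tot K DTL) := hmk DTm.cap
def tdot : cT K ⟶ cT K := hmk DTm.dot
def tdcup : 𝟙_ (Tot K DTL) ⟶ cT K ⊗ cT K := tcup K ≫ tdot K ▷ cT K
def P (n : ℕ) : pw K n ⟶ pw K n := d0 (C := DTL) (jw K n)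
def Z (n : ℕ) : pw K n ⟶ pw K n := hmk (DTm.z n)
def F (m n : ℕ) : pw K m ⊗ pw K n ⟶ pw K (m + n) := hmk (DTm.fuse m n)
def R (n : ℕ) : pw K n ⟶ pw K (n + 2) := hmk (DTm.cupRight n DTm.dcup)
def castPow {m n : ℕ} (h : m = n) : pw K m ⟶ pw K n := eqToHom (congrArg (pw K) h)

variable {K}

theorem hmk_comp {X Y Z : BWord Unit} {k l m : ℤ} (f : Tm K DGen X Y k) (g : Tm K DGen Y Z l)
    (h : k + l = m) : hmk (.comp f g h) = hmk f ≫ hmk g :=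
  hom_comp (C := DTL) (mk K f) (mk K g) h

theorem hmk_tHom_id {X Y : BWord Unit} (Z : BWord Unit) {k m : ℤ} (f : Tm K DGen X Y k)
    (h : k + 0 = m) : hmk (.tHom f (.idm Z) h) = hmk f ▷ ob K Z :=
  hom_tHom_id (C := DTL) (mk K f) Z h

theorem hmk_id_tHom {X Y : BWord Unit} (Z : BWord Unit) {k m : ℤ} (f : Tm K DGen X Y k)
    (h : 0 + k = m) : hmk (.tHom (.idm Z) f h) = ob K Z ◁ hmk f :=
  hom_id_tHom (C := DTL) (mk K f) Z h

theorem hmk_eq {X Y : BWord Unit} {d : ℤ} {f g : Tm K DGen X Y d} (h : DRel K f g) :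
    hmk f = hmk g := congrArg (hom (K := K) (C := DTL)) (PHom.sound (.rel h))

theorem hmk_add {X Y : BWord Unit} {d : ℤ} (f g : Tm K DGen X Y d) :
    hmk (.add f g) = hmk f + hmk g := hom_add (C := DTL) (mk K f) (mk K g)

theorem hmk_smul {X Y : BWord Unit} {d : ℤ} (a : K) (f : Tm K DGen X Y d) :
    hmk (.smul a f) = a • hmk f := hom_smul (C := DTL) a (mk K f)

theorem hmk_zero (X Y : BWord Unit) (d : ℤ) : hmk (.zero X Y d) = (0 : ob K X ⟶ ob K Y) :=
  hom_zero (C := DTL) X Y d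

theorem hmk_dcup : hmk (K := K) DTm.dcup = tdcup K := by
  rw [DTm.dcup, hmk_comp, hmk_tHom_id]
  rfl

theorem tzigL : (ρ_ (cT K)).inv ≫ cT K ◁ tcup K ≫ (α_ _ _ _).inv ≫ tcap K ▷ cT K ≫ (λ_ _).hom =
    𝟙 _ := by
  have h := congrArg (d0 (C := DTL)) (zigL K)
  rw [d0_comp, d0_comp, d0_comp, d0_comp, d0_whiskerLeft, d0_whiskerRight] at h
  exact h

theorem tzigR : (λ_ (cT K)).inv ≫ tcup K ▷ cT K ≫ (α_ _ _ _).hom ≫ cT K ◁ tcap K ≫ (ρ_ _).hom =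
    𝟙 _ := by
  have h := congrArg (d0 (C := DTL)) (zigR K)
  rw [d0_comp, d0_comp, d0_comp, d0_comp, d0_whiskerLeft, d0_whiskerRight] at h
  exact h

theorem tcircle : tcup K ≫ tcap K = (2 : K) • 𝟙 _ := by
  have h := congrArg (d0 (C := DTL)) (circle K)
  rw [d0_comp, map_smul] at h
  exact h

theorem tdotRel : Dot (tcap K) (tcup K) (tdot K) where
  dot_cup := by
    have h := hmk_eq (DRel.dot_cup (K := K))
    rwa [hmk_comp, hmk_comp, hmk_tHom_id, hmk_id_tHom] at h
  dot_cap := by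
    have h := hmk_eq (DRel.dot_cap (K := K))
    rwa [hmk_comp, hmk_comp, hmk_tHom_id, hmk_id_tHom] at h
  sq := by
    have h := hmk_eq (DRel.dot_dot (K := K))
    rw [hmk_comp] at h
    exact h.trans (hmk_zero _ _ _)
  sum := by
    have h := hmk_eq (DRel.dot_sum (K := K))
    rwa [hmk_add, hmk_add, hmk_comp, hmk_comp, hmk_comp, hmk_comp,
      hmk_tHom_id, hmk_id_tHom] at h

theorem hmk_cupRight (n : ℕ) {d : ℤ} (f : Tm K DGen .unit (.tensor DTm.c DTm.c) d) :
    hmk (DTm.cupRight n f) = lastCup (c := cT K) (hmk f) (pw K n) := by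
  refine (hmk_comp _ _ _).trans ?_
  refine (congrArg (fun t => hmk (Tm.rInv (DTm.pw n)) ≫ t) (hmk_comp _ _ _)).trans ?_
  rw [hmk_id_tHom]
  rfl

theorem R_eq (n : ℕ) : R K n = lastCup (c := cT K) (tdcup K) (pw K n) := by
  rw [R, hmk_cupRight, hmk_dcup]

theorem hmk_cupMid (i j : ℕ) {d : ℤ} (f : Tm K DGen .unit (.tensor DTm.c DTm.c) d) :
    hmk (DTm.cupMid i j f) =
      lastCup (c := cT K) (hmk f) (pw K i) ▷ pw K j ≫ F K (i + 2) j := by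
  rw [DTm.cupMid, hmk_comp, hmk_tHom_id, hmk_cupRight]
  rfl

theorem F_zero (m : ℕ) : F K m 0 = (ρ_ (pw K m)).hom := rfl

theorem F_succ (m n : ℕ) : F K m (n + 1) = ext (F K m n) (cT K) := by
  refine (hmk_comp (Z := (BWord.pow () (m + n)).tensor DTm.c) _ _ _).trans ?_
  rw [hmk_tHom_id]
  rfl

theorem Z_zero : Z K 0 = 0 := hmk_zero _ _ _

theorem Z_succ (n : ℕ) : Z K (n + 1) = zstep (tdot K) ((-1 : K) ^ n) (Z K n) := by
  refine (hmk_add (X := (DTm.pw n).tensor DTm.c) (Y := (DTm.pw n).tensor DTm.c) _ _).trans ?_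
  exact congrArg₂ (· + ·) (hmk_tHom_id DTm.c (DTm.z n) _) ((hmk_smul _ _).trans
    (congrArg (fun t => ((-1 : K) ^ n) • t) (hmk_id_tHom (DTm.pw n) DTm.dot _)))

theorem Z_succ_succ (n : ℕ) : Z K (n + 2) =
    zstep (tdot K) (-(-1 : K) ^ n) (zstep (tdot K) ((-1 : K) ^ n) (Z K n)) := by
  rw [Z_succ, Z_succ, pow_succ, mul_neg_one]
  rfl

theorem P_zero : P K 0 = 𝟙 _ := rfl
theorem P_one : P K 1 = 𝟙 _ := rfl

theorem P_succ_succ (n : ℕ) : P K (n + 2) =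
    step (X := pw K n) (tcap K) (tcup K) (((n : K) + 1) / (n + 2)) (P K (n + 1)) :=
  d0_step (C := DTL) (cap K) (cup K) (X := cp K n) _ (jw K (n + 1))

theorem castPow_succ {m n : ℕ} (h : m = n) (h' : m + 1 = n + 1) :
    (castPow K h ▷ cT K : pw K m ⊗ cT K ⟶ pw K n ⊗ cT K) = castPow K h' := by
  subst h
  exact id_whiskerRight _ _

theorem castPow_P {m n : ℕ} (h : m = n) : castPow K h ≫ P K n = P K m ≫ castPow K h := by
  subst h
  exact (Category.id_comp _).trans (Category.comp_id _).symm

theorem R_Z (n : ℕ) : R K n ≫ Z K (n + 2) = Z K n ≫ R K n := by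
  rw [R_eq, Z_succ_succ]
  exact lastCup_zstep (c := cT K) (tdcup K) tdotRel.dcup ((-1 : K) ^ n) (Z K n)

theorem P_Z (n : ℕ) : P K n ≫ Z K n = Z K n ≫ P K n := by
  induction n using Nat.twoStepInduction with
  | zero => rw [P_zero, Category.id_comp, Category.comp_id]
  | one => rw [P_one, Category.id_comp, Category.comp_id]
  | more n _ ih =>
    rw [P_succ_succ, Z_succ_succ]
    rw [Z_succ] at ih
    exact tdotRel.step_zstep ((-1 : K) ^ n) _ (Z K n) (P K (n + 1)) ih

theorem F_Z (m n : ℕ) : F K m n ≫ Z K (m + n) =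
    Z K m ▷ pw K n ≫ F K m n + ((-1) ^ m : K) • (pw K m ◁ Z K n ≫ F K m n) := by
  induction n with
  | zero =>
    have h : pw K m ◁ Z K 0 = 0 := by rw [Z_zero, MonoidalPreadditive.whiskerLeft_zero]
    rw [h, Limits.zero_comp, smul_zero]
    exact (rightUnitor_naturality (Z K m)).symm.trans (add_zero _).symm
  | succ n ih =>
    have h := ext_zstep (x := tdot K) _ _ ((-1) ^ n) _ _ _ ih
    rw [← pow_add] at h
    rw [F_succ, Z_succ]
    refine Eq.trans ?_ h
    exact congrArg (fun t => ext (F K m n) (cT K) ≫ t) (Z_succ (m + n))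

theorem F_assoc (a b d : ℕ) : (α_ (pw K a) (pw K b) (pw K d)).hom ≫ pw K a ◁ F K b d ≫
    F K a (b + d) = F K a b ▷ pw K d ≫ F K (a + b) d ≫ castPow K (Nat.add_assoc a b d) := by
  induction d with
  | zero =>
    have h : castPow K (Nat.add_assoc a b 0) = 𝟙 _ := rfl
    have h1 : (α_ (pw K a) (pw K b) (𝟙_ _)).hom ≫ pw K a ◁ (ρ_ (pw K b)).hom ≫ F K a b =
      F K a b ▷ 𝟙_ _ ≫ (ρ_ (pw K (a + b))).hom := by simp
    rw [h, Category.comp_id]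
    exact h1
  | succ d ih =>
    have h1 := ext_assoc (c := cT K) ih
    have h2 : ext (F K (a + b) d ≫ castPow K (Nat.add_assoc a b d)) (cT K) =
        F K (a + b) (d + 1) ≫ castPow K (Nat.add_assoc a b (d + 1)) := by
      rw [F_succ, ← ext_comp, castPow_succ _ (Nat.add_assoc a b (d + 1))]
      rfl
    rw [h2] at h1
    refine Eq.trans ?_ h1
    exact congrArg₂ (fun s t => (α_ (pw K a) (pw K b) (pw K d ⊗ cT K)).hom ≫ pw K a ◁ s ≫ t)
      (F_succ b d) (F_succ a (b + d))

theorem F_unit (n : ℕ) : (λ_ (pw K n)).inv ≫ F K 0 n = castPow K (Nat.zero_add n).symm := by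
  induction n with
  | zero =>
    have h : (λ_ (𝟙_ (Tot K DTL))).inv ≫ (ρ_ (𝟙_ _)).hom = 𝟙 _ := by
      rw [← unitors_equal, Iso.inv_hom_id]
    exact h
  | succ n ih =>
    rw [← castPow_succ (Nat.zero_add n).symm (Nat.zero_add (n + 1)).symm, ← ih, F_succ]
    have h : (λ_ (pw K n ⊗ cT K)).inv ≫ ext (F K 0 n) (cT K) =
        ((λ_ (pw K n)).inv ≫ F K 0 n) ▷ cT K := by
      simp only [ext]
      monoidal
    exact h

theorem R_F (m n : ℕ) : pw K m ◁ R K n ≫ F K m (n + 2) = F K m n ≫ R K (m + n) := by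
  rw [R_eq, R_eq, F_succ, F_succ]
  exact ext_lastCup (c := cT K) (F K m n) (tdcup K)

/-- There are no morphisms of negative degree. -/
theorem eq_zero_of_neg {X Y : DTL} {d : ℤ} (hd : d < 0) (f : Hom K X Y d) : f = 0 := by
  induction f using PHom.ind with
  | h f =>
    induction f with
    | gen g => cases g <;> omega
    | idm X => omega
    | @comp X Y Z k l m f g h ih ih' =>
      by_cases hk : k < 0
      · exact (congrArg (fun t => GrCat.comp (C := DTL) t (mk K g) h) (ih hk)).trans
          (zero_comp (C := DTL) _ _)
      · exact (congrArg (fun t => GrCat.comp (C := DTL) (mk K f) t h) (ih' (by omega))).trans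
          (comp_zero (C := DTL) _ _)
    | @tHom X Y X' Y' k l m f g h ih ih' =>
      by_cases hk : k < 0
      · exact (congrArg (fun t => GrMonCat.tHom (C := DTL) t (mk K g) h) (ih hk)).trans
          (zero_tHom (C := DTL) _ _)
      · exact (congrArg (fun t => GrMonCat.tHom (C := DTL) (mk K f) t h) (ih' (by omega))).trans
          (tHom_zero (C := DTL) _ _)
    | aHom X Y Z => omega
    | aInv X Y Z => omega
    | lHom X => omega
    | lInv X => omega
    | rHom X => omega
    | rInv X => omega
    | zero X Y d => rfl
    | add f g ih ih' =>
      exact (congrArg₂ (fun s t : PHom (DRel K) _ _ _ => s + t) (ih hd) (ih' hd)).trans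
        (add_zero (0 : PHom (DRel K) _ _ _))
    | smul a f ih =>
      exact (congrArg (fun t : PHom (DRel K) _ _ _ => a • t) (ih hd)).trans
        (smul_zero (A := PHom (DRel K) _ _ _) a)

end Basic

section Projector

variable {K : Type u} [Field K] [CharZero K]

theorem tjw_inv (n : ℕ) : Inv (tcap K) (tcup K) (pw K n) (P K n) (P K (n + 1))
    (((n : K) + 2) / (n + 1)) := d0_inv (C := DTL) (jw_inv K n)

theorem P_idem (n : ℕ) : P K n ≫ P K n = P K n := by
  have h := congrArg d0 (jw_idem K n)
  rwa [d0_comp] at h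

theorem P_absorb_left (n : ℕ) :
    (P K n ▷ cT K : pw K n ⊗ cT K ⟶ pw K n ⊗ cT K) ≫ P K (n + 1) = P K (n + 1) := (tjw_inv n).left

theorem P_absorb_right (n : ℕ) :
    P K (n + 1) ≫ (P K n ▷ cT K : pw K n ⊗ cT K ⟶ pw K n ⊗ cT K) = P K (n + 1) := (tjw_inv n).right

theorem coeff_mul (n : ℕ) : (((n : K) + 1) / (n + 2)) * (((n : K) + 2) / (n + 1)) = 1 := by
  have h1 : (n : K) + 1 ≠ 0 := by exact_mod_cast n.succ_ne_zero
  have h2 : (n : K) + 2 ≠ 0 := by exact_mod_cast (n + 1).succ_ne_zero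
  field_simp

theorem lastCup_P (n : ℕ) :
    (lastCup (c := cT K) (tcup K) (pw K n) : pw K n ⟶ (pw K n ⊗ cT K) ⊗ cT K) ≫ P K (n + 2) = 0 := by
  rw [P_succ_succ]
  exact lastCup_step (tcap K) (tcup K) tcircle (coeff_mul n) (tjw_inv n)

theorem P_lastCap (n : ℕ) :
    P K (n + 2) ≫ (lastCap (c := cT K) (tcap K) (pw K n) : (pw K n ⊗ cT K) ⊗ cT K ⟶ pw K n) = 0 := by
  rw [P_succ_succ]
  exact step_lastCap (tcap K) (tcup K) tcircle (coeff_mul n) (tjw_inv n)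

theorem cupMid_P (i j : ℕ) : lastCup (c := cT K) (tcup K) (pw K i) ▷ pw K j ≫ F K (i + 2) j ≫
    P K (i + 2 + j) = 0 := by
  induction j with
  | zero =>
    refine (whiskerRight_unit (k := lastCup (c := cT K) (tcup K) (pw K i)) (P K (i + 2))).trans ?_
    exact (congrArg (fun t => (ρ_ (pw K i)).hom ≫ t) (lastCup_P i)).trans Limits.comp_zero
  | succ j ih =>
    rw [F_succ]
    exact ext_absorb_zero (P_absorb_left (i + 2 + j)) ih

theorem R_slide (n : ℕ) : (R K n ▷ cT K : pw K n ⊗ cT K ⟶ pw K (n + 2) ⊗ cT K) ≫ P K (n + 3) =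
    R K (n + 1) ≫ P K (n + 3) := by
  rw [R_eq, R_eq]
  exact (tdotRel (K := K)).slide_absorb tzigL (P_absorb_left (n + 2)) (lastCup_P n)
    (lastCup_P (n + 1))

theorem dcupMid_P (i j : ℕ) : R K i ▷ pw K j ≫ F K (i + 2) j ≫ P K (i + 2 + j) =
    F K i j ≫ R K (i + j) ≫ castPow K (show i + j + 2 = i + 2 + j by omega) ≫
      P K (i + 2 + j) := by
  induction j with
  | zero =>
    refine (whiskerRight_unit (k := R K i) (P K (i + 2))).trans ?_
    exact congrArg (fun t => (ρ_ (pw K i)).hom ≫ R K i ≫ t) (Category.id_comp (P K (i + 2))).symm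
  | succ j ih =>
    have e : i + j + 2 = i + 2 + j := by omega
    have e' : i + j + 3 = i + 2 + j + 1 := by omega
    rw [F_succ, F_succ]
    refine (ext_absorb_right (g := F K i j ≫ R K (i + j) ≫ castPow K e)
      (P_absorb_left (i + 2 + j)) ?_).trans ?_
    · rw [ih, Category.assoc, Category.assoc]
    · have h1 : (castPow K e ▷ cT K : pw K (i + j + 2) ⊗ cT K ⟶ pw K (i + 2 + j) ⊗ cT K) ≫
          P K (i + 2 + j + 1) = P K (i + j + 3) ≫ castPow K e' :=
        (congrArg (fun t => t ≫ P K (i + 2 + j + 1)) (castPow_succ e e')).trans (castPow_P e')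
      have h2 : castPow K e' ≫ P K (i + 2 + j + 1) = P K (i + j + 3) ≫ castPow K e' := castPow_P e'
      have h3 := R_slide (K := K) (i + j)
      have h4 := ext_cast (c := cT K) (A := pw K i) (B := pw K j) (D := pw K (i + j))
        (D₁ := pw K (i + j + 2)) (D₂ := pw K (i + 2 + j))
        (r := R K (i + j)) (r' := R K (i + j + 1)) (s := castPow K e) (s' := castPow K e')
        (p := P K (i + 2 + j + 1)) (p' := P K (i + j + 3)) (F K i j) h1 h2 h3
      refine h4.trans (congrArg (fun t => ext (F K i j) (cT K) ≫ t) ?_)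
      have h5 : castPow K e' ≫ P K (i + 2 + j + 1) =
        castPow K (show i + (j + 1) + 2 = i + 2 + (j + 1) by omega) ≫ P K (i + 2 + (j + 1)) := rfl
      exact congrArg (fun t => R K (i + j + 1) ≫ t) h5

theorem P_F_left (m n : ℕ) : P K m ▷ pw K n ≫ F K m n ≫ P K (m + n) = F K m n ≫ P K (m + n) := by
  induction n with
  | zero =>
    refine (whiskerRight_unit (k := P K m) (P K m)).trans ?_
    exact congrArg (fun t => (ρ_ (pw K m)).hom ≫ t) (P_idem m)
  | succ n ih =>
    rw [F_succ]
    exact ext_absorb_right (P_absorb_left (m + n)) ih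

theorem P_F_right (m n : ℕ) : pw K m ◁ P K n ≫ F K m n ≫ P K (m + n) = F K m n ≫ P K (m + n) := by
  induction n using Nat.twoStepInduction with
  | zero => rw [P_zero, MonoidalCategory.whiskerLeft_id, Category.id_comp]
  | one => rw [P_one, MonoidalCategory.whiskerLeft_id, Category.id_comp]
  | more n _ ih =>
    have h := ext_absorb_left (P_absorb_left (m + (n + 1))) ih
    rw [F_succ] at h
    rw [F_succ, F_succ, P_succ_succ]
    exact step_absorb _ (lastCup_P (m + n)) h

theorem P_R (n : ℕ) : P K n ≫ R K n ≫ P K (n + 2) = R K n ≫ P K (n + 2) := by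
  rw [R_eq]
  exact lastCup_absorb (P_absorb_left n) (P_absorb_left (n + 1)) (tdcup K)

end Projector

end DTL

end

noncomputable section

namespace Tot

open GrCat GrMonCat CategoryTheory.MonoidalCategory

variable {K : Type u'} [Field K] {C : Type u} {C' : Type w}

theorem mapHom_comp [GrCat.{v} K C] [GrCat.{v'} K C'] {X Y Z : C} {X' Y' Z' : C'}
    (F : ∀ d, Hom K X Y d →ₗ[K] Hom K X' Y' d) (G : ∀ d, Hom K Y Z d →ₗ[K] Hom K Y' Z' d)
    (H : ∀ d, Hom K X Z d →ₗ[K] Hom K X' Z' d)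
    (hH : ∀ {k l m : ℤ} (f : Hom K X Y k) (g : Hom K Y Z l) (h : k + l = m),
      H m (comp f g h) = comp (F k f) (G l g) h) (f : o K X ⟶ o K Y) (g : o K Y ⟶ o K Z) :
    mapHom H (f ≫ g) = mapHom F f ≫ mapHom G g := by
  induction f using hom_ind with
  | h0 => simp
  | h1 d f =>
    induction g using hom_ind with
    | h0 => simp
    | h1 e g =>
      rw [← hom_comp f g rfl, mapHom_hom, mapHom_hom, mapHom_hom, hH, hom_comp]
    | h2 g g' hg hg' =>
      rw [Preadditive.comp_add, map_add, map_add, Preadditive.comp_add, hg, hg']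
  | h2 f f' hf hf' =>
    rw [Preadditive.add_comp, map_add, map_add, Preadditive.add_comp, hf, hf']

theorem mapHom_whiskerRight [GrMonCat.{v} K C] [GrMonCat.{v'} K C'] {X Y : C} {X' Y' : C'}
    (Z : C) (Z' : C') (F : ∀ d, Hom K X Y d →ₗ[K] Hom K X' Y' d)
    (G : ∀ d, Hom K (tObj K X Z) (tObj K Y Z) d →ₗ[K] Hom K (tObj K X' Z') (tObj K Y' Z') d)
    (hG : ∀ {k m : ℤ} (f : Hom K X Y k) (h : k + 0 = m),
      G m (tHom f (GrCat.idm Z) h) = tHom (F k f) (GrCat.idm Z') h) (f : o K X ⟶ o K Y) :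
    mapHom G (f ▷ o K Z) = mapHom F f ▷ o K Z' := by
  induction f using hom_ind with
  | h0 => rw [MonoidalPreadditive.zero_whiskerRight]; simp
  | h1 d f =>
    rw [← hom_tHom_id f Z (add_zero d), mapHom_hom, mapHom_hom, hG, hom_tHom_id]
  | h2 f f' hf hf' =>
    rw [map_add, MonoidalPreadditive.add_whiskerRight, MonoidalPreadditive.add_whiskerRight, ← hf,
      ← hf']
    exact map_add _ _ _

theorem mapHom_whiskerLeft [GrMonCat.{v} K C] [GrMonCat.{v'} K C'] {X Y : C} {X' Y' : C'}
    (Z : C) (Z' : C') (F : ∀ d, Hom K X Y d →ₗ[K] Hom K X' Y' d)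
    (G : ∀ d, Hom K (tObj K Z X) (tObj K Z Y) d →ₗ[K] Hom K (tObj K Z' X') (tObj K Z' Y') d)
    (hG : ∀ {k m : ℤ} (f : Hom K X Y k) (h : 0 + k = m),
      G m (tHom (GrCat.idm Z) f h) = tHom (GrCat.idm Z') (F k f) h) (f : o K X ⟶ o K Y) :
    mapHom G (o K Z ◁ f) = o K Z' ◁ mapHom F f := by
  induction f using hom_ind with
  | h0 =>
    rw [map_zero]
    refine Eq.trans ?_ (MonoidalPreadditive.whiskerLeft_zero (C := Tot K C')).symm
    refine (congrArg (mapHom G) (MonoidalPreadditive.whiskerLeft_zero (C := Tot K C))).trans ?_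
    exact map_zero _
  | h1 d f =>
    rw [← hom_id_tHom f Z (zero_add d), mapHom_hom, mapHom_hom, hG, hom_id_tHom]
  | h2 f f' hf hf' =>
    rw [map_add]
    refine Eq.trans ?_ (MonoidalPreadditive.whiskerLeft_add (C := Tot K C') _ _).symm
    refine (congrArg (mapHom G) (MonoidalPreadditive.whiskerLeft_add (C := Tot K C) _ _)).trans ?_
    rw [← hf, ← hf']
    exact map_add _ _ _

end Tot

namespace KPre

open Tot GrCat GrMonCat CategoryTheory.MonoidalCategory TLGen DTL

section Basic

variable (K : Type u) [Field K]

/-- The objects of `KdTL'` as objects of the total category. -/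
abbrev kob (X : BWord KLetter) : Tot K KPre := X

variable {K}

/-- The morphism of the total category represented by an expression. -/
def kmk {X Y : BWord KLetter} {d : ℤ} (f : Tm K KGen X Y d) : kob K X ⟶ kob K Y :=
  hom (K := K) (C := KPre) (mk f)

theorem kmk_comp {X Y Z : BWord KLetter} {k l m : ℤ} (f : Tm K KGen X Y k) (g : Tm K KGen Y Z l)
    (h : k + l = m) : kmk (.comp f g h) = kmk f ≫ kmk g :=
  hom_comp (C := KPre) (mk f) (mk g) h

theorem kmk_tHom {X Y X' Y' : BWord KLetter} {k l m : ℤ} (f : Tm K KGen X Y k)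
    (g : Tm K KGen X' Y' l) (h : k + l = m) : kmk (.tHom f g h) = kmk f ⊗ₘ kmk g :=
  hom_tHom (C := KPre) (mk f) (mk g) h

theorem kmk_tHom_id {X Y : BWord KLetter} (Z : BWord KLetter) {k m : ℤ} (f : Tm K KGen X Y k)
    (h : k + 0 = m) : kmk (.tHom f (.idm Z) h) = kmk f ▷ kob K Z :=
  hom_tHom_id (C := KPre) (mk f) Z h

theorem kmk_id_tHom {X Y : BWord KLetter} (Z : BWord KLetter) {k m : ℤ} (f : Tm K KGen X Y k)
    (h : 0 + k = m) : kmk (.tHom (.idm Z) f h) = kob K Z ◁ kmk f :=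
  hom_id_tHom (C := KPre) (mk f) Z h

theorem kmk_eq {X Y : BWord KLetter} {d : ℤ} {f g : Tm K KGen X Y d} (h : KRel K f g) :
    kmk f = kmk g := congrArg (hom (K := K) (C := KPre)) (PHom.sound (.rel h))

theorem kmk_add {X Y : BWord KLetter} {d : ℤ} (f g : Tm K KGen X Y d) :
    kmk (.add f g) = kmk f + kmk g := hom_add (C := KPre) (mk f) (mk g)

theorem kmk_smul {X Y : BWord KLetter} {d : ℤ} (a : K) (f : Tm K KGen X Y d) :
    kmk (.smul a f) = a • kmk f := hom_smul (C := KPre) a (mk f)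

theorem kmk_zero (X Y : BWord KLetter) (d : ℤ) :
    kmk (.zero X Y d) = (0 : kob K X ⟶ kob K Y) := hom_zero (C := KPre) X Y d

def JmL (X Y : DTL) (d : ℤ) : Hom K X Y d →ₗ[K] Hom K (J X) (J Y) d where
  toFun := Jm
  map_add' := by
    rintro ⟨f⟩ ⟨g⟩
    rfl
  map_smul' := by
    rintro a ⟨f⟩
    rfl

theorem Jm_comp {X Y Z : DTL} {k l m : ℤ} (f : Hom K X Y k) (g : Hom K Y Z l) (h : k + l = m) :
    Jm (comp f g h) = comp (Jm f) (Jm g) h := by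
  obtain ⟨f⟩ := f
  obtain ⟨g⟩ := g
  rfl

theorem Jm_tHom {X Y X' Y' : DTL} {k l m : ℤ} (f : Hom K X Y k) (g : Hom K X' Y' l)
    (h : k + l = m) : Jm (tHom f g h) = tHom (C := KPre) (Jm f) (Jm g) h := by
  obtain ⟨f⟩ := f
  obtain ⟨g⟩ := g
  rfl

/-- The inclusion of the dotted Temperley-Lieb category on the total categories. -/
def Jt {X Y : BWord Unit} : (ob K X ⟶ ob K Y) →ₗ[K] (kob K X.J ⟶ kob K Y.J) :=
  mapHom (C := DTL) (C' := KPre) (X := X) (Y := Y) (JmL X Y)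

theorem Jt_hom {X Y : DTL} {d : ℤ} (f : Hom K X Y d) :
    Jt (hom (K := K) (C := DTL) f) = hom (C := KPre) (Jm f) :=
  mapHom_hom (C := DTL) (C' := KPre) (JmL X Y) f

theorem Jt_hmk {X Y : BWord Unit} {d : ℤ} (f : Tm K DGen X Y d) :
    Jt (hmk f) = kmk (KTm.J f) := Jt_hom _

theorem Jt_id (X : BWord Unit) : Jt (𝟙 (ob K X)) = 𝟙 (kob K X.J) :=
  Jt_hom (GrCat.idm (K := K) (C := DTL) X)

theorem Jt_comp {X Y Z : BWord Unit} (f : ob K X ⟶ ob K Y) (g : ob K Y ⟶ ob K Z) :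
    Jt (f ≫ g) = Jt f ≫ Jt g :=
  mapHom_comp (C := DTL) (C' := KPre) (JmL X Y) (JmL Y Z) (JmL X Z)
    (fun f g h => Jm_comp f g h) f g

theorem Jt_whiskerRight {X Y : BWord Unit} (f : ob K X ⟶ ob K Y) (Z : BWord Unit) :
    Jt (X := X.tensor Z) (Y := Y.tensor Z) (f ▷ ob K Z) = Jt f ▷ kob K Z.J :=
  mapHom_whiskerRight (C := DTL) (C' := KPre) Z (J Z) (JmL X Y) (JmL (X.tensor Z) (Y.tensor Z))
    (fun f h => Jm_tHom f (GrCat.idm (K := K) (C := DTL) Z) h) f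

theorem Jt_whiskerLeft {X Y : BWord Unit} (Z : BWord Unit) (f : ob K X ⟶ ob K Y) :
    Jt (X := Z.tensor X) (Y := Z.tensor Y) (ob K Z ◁ f) = kob K Z.J ◁ Jt f :=
  mapHom_whiskerLeft (C := DTL) (C' := KPre) Z (J Z) (JmL X Y) (JmL (Z.tensor X) (Z.tensor Y))
    (fun f h => Jm_tHom (GrCat.idm (K := K) (C := DTL) Z) f h) f

theorem Jt_tensorHom {X Y X' Y' : BWord Unit} (f : ob K X ⟶ ob K Y) (g : ob K X' ⟶ ob K Y') :
    Jt (X := X.tensor X') (Y := Y.tensor Y') (f ⊗ₘ g) = Jt f ⊗ₘ Jt g := by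
  rw [tensorHom_def (Jt f), ← Jt_whiskerRight, ← Jt_whiskerLeft]
  refine (congrArg (Jt (X := X.tensor X') (Y := Y.tensor Y')) (tensorHom_def f g)).trans ?_
  exact Jt_comp (X := X.tensor X') (Y := Y.tensor X') (Z := Y.tensor Y') _ _

/-- The images of the generators and of the canonical isomorphisms. -/
abbrev kc (K : Type u) [Field K] : Tot K KPre := kob K (.of .c)
abbrev kpw (K : Type u) [Field K] (n : ℕ) : Tot K KPre := kob K (BWord.pow () n).J

theorem Jt_assoc (X Y Z : BWord Unit) :
    Jt (X := (X.tensor Y).tensor Z) (Y := X.tensor (Y.tensor Z)) (α_ (ob K X) (ob K Y) (ob K Z)).hom =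
      (α_ (kob K X.J) (kob K Y.J) (kob K Z.J)).hom :=
  Jt_hom (aHom (K := K) (C := DTL) X Y Z)

theorem Jt_assoc_inv (X Y Z : BWord Unit) :
    Jt (X := X.tensor (Y.tensor Z)) (Y := (X.tensor Y).tensor Z) (α_ (ob K X) (ob K Y) (ob K Z)).inv =
      (α_ (kob K X.J) (kob K Y.J) (kob K Z.J)).inv :=
  Jt_hom (aInv (K := K) (C := DTL) X Y Z)

theorem Jt_left (X : BWord Unit) :
    Jt (X := BWord.unit.tensor X) (Y := X) (λ_ (ob K X)).hom = (λ_ (kob K X.J)).hom :=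
  Jt_hom (lHom (K := K) (C := DTL) X)

theorem Jt_left_inv (X : BWord Unit) :
    Jt (X := X) (Y := BWord.unit.tensor X) (λ_ (ob K X)).inv = (λ_ (kob K X.J)).inv :=
  Jt_hom (lInv (K := K) (C := DTL) X)

theorem Jt_right (X : BWord Unit) :
    Jt (X := X.tensor BWord.unit) (Y := X) (ρ_ (ob K X)).hom = (ρ_ (kob K X.J)).hom :=
  Jt_hom (rHom (K := K) (C := DTL) X)

theorem Jt_right_inv (X : BWord Unit) :
    Jt (X := X) (Y := X.tensor BWord.unit) (ρ_ (ob K X)).inv = (ρ_ (kob K X.J)).inv :=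
  Jt_hom (rInv (K := K) (C := DTL) X)

/-- The images of cup, cap and dot. -/
def kcup (K : Type u) [Field K] : 𝟙_ (Tot K KPre) ⟶ kc K ⊗ kc K :=
  Jt (X := .unit) (Y := DTm.c.tensor DTm.c) (tcup K)
def kcap (K : Type u) [Field K] : kc K ⊗ kc K ⟶ 𝟙_ (Tot K KPre) :=
  Jt (X := DTm.c.tensor DTm.c) (Y := .unit) (tcap K)
def kx (K : Type u) [Field K] : kc K ⟶ kc K := Jt (X := DTm.c) (Y := DTm.c) (tdot K)

theorem Jt_comp_eq {X Y Z : BWord Unit} {f : ob K X ⟶ ob K Y} {g : ob K Y ⟶ ob K Z}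
    {f' : kob K X.J ⟶ kob K Y.J} {g' : kob K Y.J ⟶ kob K Z.J} (hf : Jt f = f') (hg : Jt g = g') :
    Jt (f ≫ g) = f' ≫ g' := by
  rw [Jt_comp, hf, hg]

theorem kzigL : (ρ_ (kc K)).inv ≫ kc K ◁ kcup K ≫ (α_ _ _ _).inv ≫ kcap K ▷ kc K ≫ (λ_ _).hom =
    𝟙 _ := by
  refine Eq.trans (Eq.symm ?_) ((congrArg (Jt (X := DTm.c) (Y := DTm.c)) (tzigL (K := K))).trans
    (Jt_id DTm.c))
  exact Jt_comp_eq (Jt_right_inv _) (Jt_comp_eq (Jt_whiskerLeft _ _) (Jt_comp_eq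
    (Jt_assoc_inv _ _ _) (Jt_comp_eq (Jt_whiskerRight _ _) (Jt_left _))))

theorem kzigR : (λ_ (kc K)).inv ≫ kcup K ▷ kc K ≫ (α_ _ _ _).hom ≫ kc K ◁ kcap K ≫ (ρ_ _).hom =
    𝟙 _ := by
  refine Eq.trans (Eq.symm ?_) ((congrArg (Jt (X := DTm.c) (Y := DTm.c)) (tzigR (K := K))).trans
    (Jt_id DTm.c))
  exact Jt_comp_eq (Jt_left_inv _) (Jt_comp_eq (Jt_whiskerRight _ _) (Jt_comp_eq
    (Jt_assoc _ _ _) (Jt_comp_eq (Jt_whiskerLeft _ _) (Jt_right _))))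

theorem Jt_dotL : Jt (X := DTm.c.tensor DTm.c) (Y := DTm.c.tensor DTm.c) (tdot K ▷ cT K) =
    kx K ▷ kc K := Jt_whiskerRight _ _

theorem Jt_dotR : Jt (X := DTm.c.tensor DTm.c) (Y := DTm.c.tensor DTm.c) (cT K ◁ tdot K) =
    kc K ◁ kx K := Jt_whiskerLeft _ _

theorem kdotRel : Dot (kcap K) (kcup K) (kx K) where
  dot_cup := (Jt_comp_eq rfl Jt_dotL).symm.trans ((congrArg (Jt (X := .unit)
    (Y := DTm.c.tensor DTm.c)) (tdotRel (K := K)).dot_cup).trans (Jt_comp_eq rfl Jt_dotR))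
  dot_cap := (Jt_comp_eq Jt_dotL rfl).symm.trans ((congrArg (Jt (Y := .unit)
    (X := DTm.c.tensor DTm.c)) (tdotRel (K := K)).dot_cap).trans (Jt_comp_eq Jt_dotR rfl))
  sq := (Jt_comp_eq rfl rfl).symm.trans ((congrArg (Jt (X := DTm.c) (Y := DTm.c))
    (tdotRel (K := K)).sq).trans (map_zero _))
  sum := by
    have h := congrArg (Jt (X := DTm.c.tensor DTm.c) (Y := DTm.c.tensor DTm.c))
      (tdotRel (K := K)).sum
    refine Eq.trans (Eq.symm ?_) (h.trans ?_)
    · exact (map_add _ _ _).trans (congrArg₂ (· + ·) Jt_dotL Jt_dotR)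
    · exact (map_add _ _ _).trans (congrArg₂ (· + ·)
        (Jt_comp_eq (Y := .unit) (Jt_comp_eq Jt_dotL rfl) rfl)
        (Jt_comp_eq (Y := .unit) rfl (Jt_comp_eq rfl Jt_dotL)))

end Basic

end KPre

end

noncomputable section

namespace KPre

open Tot GrCat GrMonCat CategoryTheory.MonoidalCategory TLGen DTL

section Iota

variable {K : Type u} [Field K]

variable (K) in
abbrev kk (i : ZMod 2) : Tot K KPre := kob K (kw i)

def kiota (n : ℕ) (i : ZMod 2) (h : (n : ZMod 2) = i) : kpw K n ⟶ kk K i := kmk (KTm.iota n i h)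

def kmul (i j k : ZMod 2) (h : i + j = k) : kk K i ⊗ kk K j ⟶ kk K k := kmk (KTm.mul i j k h)

def ky (i : ZMod 2) : kk K i ⟶ kk K i := kmk (KTm.kdot i)

theorem kunit_mul (i : ZMod 2) (h : (0 : ZMod 2) + i = i) :
    (λ_ (kk K i)).inv ≫ (kiota 0 0 Nat.cast_zero ▷ kk K i : 𝟙_ _ ⊗ kk K i ⟶ kk K 0 ⊗ kk K i) ≫
      kmul 0 i i h = 𝟙 _ := by
  refine Eq.trans (Eq.symm ?_) (kmk_eq (KRel.unit_mul (K := K) i h))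
  exact (kmk_comp _ _ _).trans (congrArg (fun t => (λ_ (kk K i)).inv ≫ t) ((kmk_comp _ _ _).trans
    (congrArg (fun t => t ≫ kmul 0 i i h) (kmk_tHom_id _ _ _))))

theorem kmul_unit (i : ZMod 2) (h : i + (0 : ZMod 2) = i) :
    (ρ_ (kk K i)).inv ≫ (kk K i ◁ kiota 0 0 Nat.cast_zero : kk K i ⊗ 𝟙_ _ ⟶ kk K i ⊗ kk K 0) ≫
      kmul i 0 i h = 𝟙 _ := by
  refine Eq.trans (Eq.symm ?_) (kmk_eq (KRel.mul_unit (K := K) i h))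
  exact (kmk_comp _ _ _).trans (congrArg (fun t => (ρ_ (kk K i)).inv ≫ t) ((kmk_comp _ _ _).trans
    (congrArg (fun t => t ≫ kmul i 0 i h) (kmk_id_tHom _ _ _))))

theorem kmul_assoc (i j k ij jk l : ZMod 2) (h₁ : i + j = ij) (h₂ : ij + k = l) (h₃ : j + k = jk)
    (h₄ : i + jk = l) : kmul i j ij h₁ ▷ kk K k ≫ kmul ij k l h₂ =
      (α_ (kk K i) (kk K j) (kk K k)).hom ≫ kk K i ◁ kmul j k jk h₃ ≫ kmul i jk l h₄ := by
  have h := kmk_eq (KRel.mul_assoc (K := K) i j k ij jk l h₁ h₂ h₃ h₄)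
  refine Eq.trans (Eq.symm ?_) (h.trans ?_)
  · exact (kmk_comp _ _ _).trans (congrArg (fun t => t ≫ kmul ij k l h₂) (kmk_tHom_id _ _ _))
  · exact (kmk_comp _ _ _).trans (congrArg (fun t => (α_ (kk K i) (kk K j) (kk K k)).hom ≫ t)
      ((kmk_comp _ _ _).trans (congrArg (fun t => t ≫ kmul i jk l h₄) (kmk_id_tHom _ _ _))))

theorem kiota_ky (n : ℕ) (i : ZMod 2) (h : (n : ZMod 2) = i) :
    kiota n i h ≫ ky i = Jt (Z K n) ≫ kiota n i h := by
  refine Eq.trans (kmk_comp _ _ _).symm ((kmk_eq (KRel.iota_kdot (K := K) n i h)).trans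
    ((kmk_comp _ _ _).trans ?_))
  rw [Z, Jt_hmk]
  rfl

theorem kiota_mul (m n : ℕ) (i j k : ZMod 2) (hm : (m : ZMod 2) = i) (hn : (n : ZMod 2) = j)
    (h : i + j = k) (hmn : ((m + n : ℕ) : ZMod 2) = k) :
    (kiota m i hm ⊗ₘ kiota n j hn) ≫ kmul i j k h =
      Jt (X := (BWord.pow () m).tensor (BWord.pow () n)) (F K m n) ≫ kiota (m + n) k hmn := by
  refine Eq.trans ?_ ((kmk_eq (KRel.iota_mul (K := K) m n i j k hm hn h hmn)).trans
    ((kmk_comp _ _ _).trans ?_))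
  · exact ((kmk_comp _ _ _).trans (congrArg (fun t => t ≫ kmul i j k h) (kmk_tHom _ _ _))).symm
  · rw [F, Jt_hmk]
    rfl

theorem Jt_lastCup (k : 𝟙_ (Tot K DTL) ⟶ cT K ⊗ cT K) (X : BWord Unit) :
    Jt (Y := (X.tensor DTm.c).tensor DTm.c) (lastCup k (ob K X)) =
      lastCup (c := kc K) (Jt (X := .unit) (Y := DTm.c.tensor DTm.c) k) (kob K X.J) :=
  Jt_comp_eq (Jt_right_inv _) (Jt_comp_eq (Jt_whiskerLeft _ _) (Jt_assoc_inv _ _ _))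

theorem cup_mid_zero {X T : BWord KLetter} {Y : BWord KLetter} {k : kob K X ⟶ kob K Y}
    {f : kob K Y ⟶ kob K T} {g : kob K X ⟶ kob K T}
    (h : (k ▷ 𝟙_ _ ≫ (ρ_ (kob K Y)).hom) ≫ f = (ρ_ (kob K X)).hom ≫ g) : k ≫ f = g := by
  rw [rightUnitor_naturality, Category.assoc] at h
  exact (cancel_epi (ρ_ (kob K X)).hom).1 h

theorem lastCup_kiota (n : ℕ) (i : ZMod 2) (h : ((n + 2 : ℕ) : ZMod 2) = i) :
    lastCup (c := kc K) (kcup K) (kpw K n) ≫ kiota (n + 2) i h = 0 := by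
  have h1 := kmk_eq (KRel.cup_iota (K := K) n 0 i h)
  refine cup_mid_zero (X := (BWord.pow () n).J) (Y := (BWord.pow () (n + 2)).J) ?_
  rw [Limits.comp_zero]
  refine Eq.trans (Eq.symm ?_) (h1.trans (kmk_zero _ _ _))
  refine (kmk_comp _ _ _).trans (congrArg (fun t => t ≫ kiota (n + 2) i h) ?_)
  refine (kmk_comp _ _ _).trans (congrArg (fun t => t ≫ (ρ_ (kpw K (n + 2))).hom) ?_)
  refine (kmk_tHom_id _ _ _).trans (congrArg (fun t => t ▷ 𝟙_ _) ?_)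
  refine Eq.trans (Jt_hmk _).symm ?_
  rw [hmk_cupRight]
  exact Jt_lastCup _ _

theorem R_kiota (n : ℕ) (i : ZMod 2) (h : ((n + 2 : ℕ) : ZMod 2) = i) (h' : (n : ZMod 2) = i) :
    Jt (R K n) ≫ kiota (n + 2) i h = kiota n i h' := by
  have h1 := kmk_eq (KRel.dcup_iota (K := K) n 0 i h h')
  refine cup_mid_zero (X := (BWord.pow () n).J) (Y := (BWord.pow () (n + 2)).J) ?_
  refine Eq.trans (Eq.symm ?_) (h1.trans (kmk_comp _ _ _))
  refine (kmk_comp _ _ _).trans (congrArg (fun t => t ≫ kiota (n + 2) i h) ?_)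
  refine (kmk_comp _ _ _).trans (congrArg (fun t => t ≫ (ρ_ (kpw K (n + 2))).hom) ?_)
  refine (kmk_tHom_id _ _ _).trans (congrArg (fun t => t ▷ 𝟙_ _) ?_)
  exact (Jt_hmk _).symm

end Iota

section Projector

variable {K : Type u} [Field K]

theorem whiskerRight_absorb {M : Type u} [Category.{v} M] [MonoidalCategory M] {A A' B B' D : M}
    {f : A ⟶ A} {a : A ⟶ A'} (h : f ≫ a = a) (b : B ⟶ B') (m : A' ⊗ B' ⟶ D) :
    f ▷ B ≫ (a ⊗ₘ b) ≫ m = (a ⊗ₘ b) ≫ m := by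
  rw [MonoidalCategory.tensorHom_def, Category.assoc, ← Category.assoc (f ▷ B), ← comp_whiskerRight, h]

theorem tensorHom_comp_right {M : Type u} [Category.{v} M] [MonoidalCategory M] {A A' B B' D : M}
    (a : A ⟶ A') (u : B ⟶ B') (b : B' ⟶ D) : a ⊗ₘ (u ≫ b) = A ◁ u ≫ (a ⊗ₘ b) := by
  rw [MonoidalCategory.tensorHom_def, MonoidalCategory.tensorHom_def,
    MonoidalCategory.whiskerLeft_comp, ← Category.assoc, ← Category.assoc,
    ← MonoidalCategory.whisker_exchange]

theorem comp_comp_eq_zero {M : Type u} [Category.{v} M] [Limits.HasZeroMorphisms M] {A B C D : M}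
    (f : A ⟶ B) {g : B ⟶ C} {h : C ⟶ D} (hg : g ≫ h = 0) : (f ≫ g) ≫ h = 0 := by
  rw [Category.assoc, hg, Limits.comp_zero]

theorem F_one (n : ℕ) : F K n 1 = pw K n ◁ (λ_ (cT K)).hom := by
  rw [F_succ, F_zero]
  exact (triangle_assoc_comp_right (pw K n) (cT K)).symm ▸ rfl

/-- The map from the generating object to the odd Kirby object. -/
def kic (i : ZMod 2) (h : ((1 : ℕ) : ZMod 2) = i) : kc K ⟶ kk K i :=
  (λ_ (kc K)).inv ≫ kiota 1 i h

theorem kiota_succ {n : ℕ} {i j k : ZMod 2} (hi : (n : ZMod 2) = i) (hj : ((1 : ℕ) : ZMod 2) = j)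
    (hk : i + j = k) (h : ((n + 1 : ℕ) : ZMod 2) = k) :
    kiota (K := K) (n + 1) k h = (kiota n i hi ⊗ₘ kic j hj) ≫ kmul i j k hk := by
  have h1 := kiota_mul (K := K) n 1 i j k hi hj hk h
  rw [F_one] at h1
  have h2 : Jt (X := (BWord.pow () n).tensor (BWord.pow () 1)) (Y := BWord.pow () (n + 1))
      (pw K n ◁ (λ_ (cT K)).hom) = kpw K n ◁ (λ_ (kc K)).hom :=
    (Jt_whiskerLeft _ _).trans (congrArg (fun t => kpw K n ◁ t) (Jt_left DTm.c))
  replace h1 := h1.trans (congrArg (fun t => t ≫ kiota (n + 1) k h) h2)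
  have h3 : (kiota n i hi ⊗ₘ kic (K := K) j hj) = kpw K n ◁ (λ_ (kc K)).inv ≫
      (kiota n i hi ⊗ₘ kiota 1 j hj : kpw K n ⊗ (𝟙_ _ ⊗ kc K) ⟶ kk K i ⊗ kk K j) :=
    tensorHom_comp_right _ _ _
  rw [h3, Category.assoc]
  refine Eq.trans ?_ (congrArg (fun t => kpw K n ◁ (λ_ (kc K)).inv ≫ t) h1).symm
  have h4 : kpw K n ◁ (λ_ (kc K)).inv ≫ kpw K n ◁ (λ_ (kc K)).hom = 𝟙 (kpw K n ⊗ kc K) := by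
    rw [← MonoidalCategory.whiskerLeft_comp, Iso.inv_hom_id, MonoidalCategory.whiskerLeft_id]
  refine Eq.trans ?_ (Category.assoc _ _ _)
  exact (Category.id_comp _).symm.trans (congrArg (fun t => t ≫ kiota (n + 1) k h) h4.symm)

theorem P_kiota [CharZero K] (n : ℕ) (i : ZMod 2) (h : (n : ZMod 2) = i) :
    Jt (P K n) ≫ kiota n i h = kiota n i h := by
  induction n using Nat.twoStepInduction generalizing i with
  | zero => rw [P_zero, Jt_id, Category.id_comp]
  | one => rw [P_one, Jt_id, Category.id_comp]
  | more n _ ih =>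
    have hA : Jt (X := BWord.pow () (n + 2)) (Y := BWord.pow () (n + 2)) (P K (n + 1) ▷ cT K) ≫
        kiota (n + 2) i h = kiota (n + 2) i h := by
      have hi : ((n + 1 : ℕ) : ZMod 2) + ((1 : ℕ) : ZMod 2) = i := by rw [← h]; push_cast; ring
      have e := kiota_succ (K := K) (n := n + 1) rfl rfl hi h
      rw [e]
      refine (congrArg (fun t => t ≫ (kiota (n + 1) _ rfl ⊗ₘ kic _ rfl) ≫ kmul _ _ i hi)
        (Jt_whiskerRight (P K (n + 1)) DTm.c)).trans ?_
      exact whiskerRight_absorb (ih _ rfl) _ _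
    have hB : Jt (X := BWord.pow () (n + 2)) (Y := BWord.pow () (n + 2))
        (e (tcap K) (tcup K) (pw K n)) ≫ kiota (n + 2) i h = 0 := by
      refine (congrArg (fun t => t ≫ kiota (n + 2) i h) (Jt_comp_eq (X := BWord.pow () (n + 2))
        (Z := BWord.pow () (n + 2)) rfl (Jt_lastCup _ _))).trans ?_
      exact comp_comp_eq_zero _ (lastCup_kiota n i h)
    have hs : Jt (X := BWord.pow () (n + 2)) (Y := BWord.pow () (n + 2)) (P K (n + 2)) =
        Jt (X := BWord.pow () (n + 2)) (Y := BWord.pow () (n + 2)) (P K (n + 1) ▷ cT K) -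
        (((n : K) + 1) / (n + 2)) • (Jt (X := BWord.pow () (n + 2)) (Y := BWord.pow () (n + 2))
          (P K (n + 1) ▷ cT K) ≫ Jt (X := BWord.pow () (n + 2)) (Y := BWord.pow () (n + 2))
          (e (tcap K) (tcup K) (pw K n)) ≫ Jt (X := BWord.pow () (n + 2))
          (Y := BWord.pow () (n + 2)) (P K (n + 1) ▷ cT K)) := by
      rw [P_succ_succ]
      refine (map_sub Jt _ _).trans (congrArg₂ (· - ·) rfl ((map_smul Jt _ _).trans
        (congrArg (fun t => (((n : K) + 1) / (n + 2)) • t) ?_)))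
      exact Jt_comp_eq rfl (Jt_comp_eq rfl rfl)
    rw [hs, Preadditive.sub_comp, Linear.smul_comp, Category.assoc, Category.assoc, hA, hB,
      Limits.comp_zero, smul_zero, sub_zero]

end Projector

end KPre

end

noncomputable section

namespace TLGen

open MonoidalCategory

variable {K : Type u'} [Field K] {M : Type u} [Category.{v} M] [MonoidalCategory M]
  [Preadditive M] [Linear K M] [MonoidalPreadditive M] [MonoidalLinear K M] {c : M} {x : c ⟶ c}
  {cap : c ⊗ c ⟶ 𝟙_ M} {cup : 𝟙_ M ⟶ c ⊗ c}

theorem lastCup_unit (k : 𝟙_ M ⟶ c ⊗ c) : lastCup k (𝟙_ M) ≫ (λ_ c).hom ▷ c = k := by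
  simp only [lastCup]; monoidal

theorem comp_tensorHom_comp {A A' B C D Z : M} {u : A ⟶ A'} {f : A' ⟶ C} {f' : A ⟶ C}
    (g : B ⟶ D) (m : C ⊗ D ⟶ Z) (h : f' = u ≫ f) : (f' ⊗ₘ g) ≫ m = u ▷ B ≫ (f ⊗ₘ g) ≫ m := by
  rw [h, MonoidalCategory.tensorHom_def, MonoidalCategory.tensorHom_def, comp_whiskerRight,
    Category.assoc, Category.assoc, Category.assoc]

theorem comp_zero_tensor {A B C D E Z : M} (k : E ⟶ A ⊗ B) (g : B ⟶ D) (m : C ⊗ D ⟶ Z) :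
    k ≫ ((0 : A ⟶ C) ⊗ₘ g) ≫ m = 0 := by
  rw [MonoidalPreadditive.zero_tensor, Limits.zero_comp, Limits.comp_zero]

theorem comp_tensor_zero {A B C D E Z : M} (k : E ⟶ A ⊗ B) (f : A ⟶ C) (m : C ⊗ D ⟶ Z) :
    k ≫ (f ⊗ₘ (0 : B ⟶ D)) ≫ m = 0 := by
  rw [MonoidalPreadditive.tensor_zero, Limits.zero_comp, Limits.comp_zero]

theorem left_of_unit {A B B' : M} {u : 𝟙_ M ⟶ B'} {m : B' ⊗ B ⟶ B}
    (h : (λ_ B).inv ≫ (u ▷ B) ≫ m = 𝟙 _) (f : A ⟶ B) : (u ⊗ₘ f) ≫ m = (λ_ A).hom ≫ f := by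
  rw [Iso.inv_comp_eq, Category.comp_id] at h
  rw [MonoidalCategory.tensorHom_def, ← whisker_exchange, Category.assoc, h,
    leftUnitor_naturality]

theorem right_of_unit {A B B' : M} {u : 𝟙_ M ⟶ B'} {m : B ⊗ B' ⟶ B}
    (h : (ρ_ B).inv ≫ (B ◁ u) ≫ m = 𝟙 _) (f : A ⟶ B) : (f ⊗ₘ u) ≫ m = (ρ_ A).hom ≫ f := by
  rw [Iso.inv_comp_eq, Category.comp_id] at h
  rw [MonoidalCategory.tensorHom_def, Category.assoc, h, rightUnitor_naturality]

/-- Tensoring with a fixed morphism on the left, as a linear map. -/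
def tensL (K : Type u') [Field K] [Linear K M] [MonoidalLinear K M] {A C : M} (f : A ⟶ C)
    (B D : M) : (B ⟶ D) →ₗ[K] (A ⊗ B ⟶ C ⊗ D) where
  toFun g := f ⊗ₘ g
  map_add' g g' := by rw [MonoidalPreadditive.tensor_add]
  map_smul' r g := by
    simp [MonoidalCategory.tensorHom_def]

/-- Tensoring with a fixed morphism on the right, as a linear map. -/
def tensR (K : Type u') [Field K] [Linear K M] [MonoidalLinear K M] {B D : M} (g : B ⟶ D)
    (A C : M) : (A ⟶ C) →ₗ[K] (A ⊗ B ⟶ C ⊗ D) where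
  toFun f := f ⊗ₘ g
  map_add' f f' := by rw [MonoidalPreadditive.add_tensor]
  map_smul' r f := by
    simp [MonoidalCategory.tensorHom_def]

theorem Dot.cup_expand (hx : Dot cap cup x) {A B Z : M} {f : c ⟶ A} {g : c ⟶ B} {m : A ⊗ B ⟶ Z}
    {t : 𝟙_ M ⟶ Z} (h0 : cup ≫ (f ⊗ₘ g) ≫ m = 0) (h1 : (cup ≫ x ▷ c) ≫ (f ⊗ₘ g) ≫ m = t)
    (a b a' b' : K) : cup ≫ ((a • f + b • (x ≫ f)) ⊗ₘ (a' • g + b' • (x ≫ g))) ≫ m =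
      (b * a' + a * b') • t := by
  have e : ((a • f + b • (x ≫ f)) ⊗ₘ (a' • g + b' • (x ≫ g))) =
      (a • 𝟙 _ + b • x) ▷ c ≫ c ◁ (a' • 𝟙 _ + b' • x) ≫ (f ⊗ₘ g) := by
    have e1 : a • f + b • (x ≫ f) = (a • 𝟙 _ + b • x) ≫ f := by simp
    have e2 : a' • g + b' • (x ≫ g) = (a' • 𝟙 _ + b' • x) ≫ g := by simp
    rw [e1, e2, ← MonoidalCategory.tensorHom_comp_tensorHom, MonoidalCategory.tensorHom_def,
      Category.assoc]
  have h2 : cup ≫ c ◁ x ≫ (f ⊗ₘ g) ≫ m = t := by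
    rw [← Category.assoc, ← hx.dot_cup, h1]
  have h3 : cup ≫ x ▷ c ≫ c ◁ x ≫ (f ⊗ₘ g) ≫ m = 0 := by
    rw [← Category.assoc, ← Category.assoc, ← hx.dcup, Category.assoc cup, ← comp_whiskerRight,
      hx.sq]
    simp
  rw [Category.assoc] at h1
  rw [e]
  simp only [MonoidalPreadditive.add_whiskerRight, MonoidalPreadditive.whiskerLeft_add,
    MonoidalLinear.smul_whiskerRight, MonoidalLinear.whiskerLeft_smul, id_whiskerRight,
    MonoidalCategory.whiskerLeft_id, Preadditive.add_comp, Preadditive.comp_add, Linear.smul_comp,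
    Linear.comp_smul, Category.id_comp, Category.assoc, h0, h1, h2, h3, smul_zero, zero_add,
    add_zero, smul_smul, ← add_smul]
  congr 1
  ring

theorem Dot.cap_expand (hx : Dot cap cup x) {A B Z : M} {f : c ⟶ A} {g : c ⟶ B} {m : A ⊗ B ⟶ Z}
    {t : 𝟙_ M ⟶ Z} (h0 : cup ≫ (f ⊗ₘ g) ≫ m = 0) (h1 : (cup ≫ x ▷ c) ≫ (f ⊗ₘ g) ≫ m = t) :
    cap ≫ t = ((x ≫ f) ⊗ₘ g) ≫ m + (f ⊗ₘ (x ≫ g)) ≫ m := by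
  have h := hx.sum =≫ ((f ⊗ₘ g) ≫ m)
  have e1 : (x ≫ f) ⊗ₘ g = x ▷ c ≫ (f ⊗ₘ g) := by
    rw [MonoidalCategory.tensorHom_def, MonoidalCategory.tensorHom_def, comp_whiskerRight,
      Category.assoc]
  have e2 : f ⊗ₘ (x ≫ g) = c ◁ x ≫ (f ⊗ₘ g) := KPre.tensorHom_comp_right _ _ _
  rw [Preadditive.add_comp, Preadditive.add_comp, Category.assoc, Category.assoc, Category.assoc,
    h0, h1, Limits.comp_zero, Limits.comp_zero, zero_add] at h
  rw [← h, e1, e2, Category.assoc, Category.assoc]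

theorem sum_lastCup (hx : Dot cap cup x) {X Z : M} {p : (X ⊗ c) ⊗ c ⟶ (X ⊗ c) ⊗ c}
    {f : (X ⊗ c) ⊗ c ⟶ Z} (hp : p ≫ lastCap cap X = 0) (hf : lastCup cup X ≫ f = 0) :
    p ≫ (X ◁ x) ▷ c ≫ f = - (p ≫ (X ⊗ c) ◁ x ≫ f) := by
  rw [eq_neg_iff_add_eq_zero, ← Preadditive.comp_add, ← Preadditive.add_comp, hx.sum_last,
    Preadditive.add_comp, Preadditive.comp_add, e, Category.assoc, Category.assoc, hf,
    Limits.comp_zero, Limits.comp_zero, Limits.comp_zero, zero_add]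
  simp only [Category.assoc]
  rw [← Category.assoc p, hp, Limits.zero_comp]

theorem iterate_mem {T Z : M} {p z z' b : T ⟶ T} {f : T ⟶ Z} {s r : K} (hz : z = z' + s • b)
    (hzb : z' ≫ b = b ≫ z') (hb : b ≫ b = 0) (hpz : p ≫ z = z ≫ p) (hp : p ≫ f = f)
    (hr : p ≫ b ≫ f = r • (z ≫ f)) (N : Submodule K (T ⟶ Z)) (hf : f ∈ N)
    (hN : ∀ g ∈ N, z ≫ g ∈ N) (l : ℕ) : p ≫ (fun g => z' ≫ g)^[l] f ∈ N ∧
      p ≫ (fun g => z' ≫ g)^[l] (b ≫ f) ∈ N := by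
  have hcomm : ∀ (l : ℕ) (g : T ⟶ Z), b ≫ (fun g => z' ≫ g)^[l] g = (fun g => z' ≫ g)^[l] (b ≫ g) := by
    intro l
    induction l with
    | zero => intro g; rfl
    | succ l ih =>
      intro g
      rw [Function.iterate_succ_apply', Function.iterate_succ_apply', ← ih, ← Category.assoc,
        ← hzb, Category.assoc]
  have hz' : ∀ g : T ⟶ Z, z' ≫ g = z ≫ g - s • (b ≫ g) := by
    intro g
    rw [hz, Preadditive.add_comp, Linear.smul_comp, add_sub_cancel_right]
  have h2 : ∀ l, p ≫ (fun g => z' ≫ g)^[l] (b ≫ f) ∈ N := by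
    intro l
    induction l with
    | zero =>
      change p ≫ b ≫ f ∈ N
      rw [hr]
      exact N.smul_mem _ (hN _ hf)
    | succ l ih =>
      rw [Function.iterate_succ_apply', hz', hcomm, ← Category.assoc b b, hb, Limits.zero_comp]
      have h0 : (fun g => z' ≫ g)^[l] (0 : T ⟶ Z) = 0 := by
        clear ih
        induction l with
        | zero => rfl
        | succ l ih => rw [Function.iterate_succ_apply', ih, Limits.comp_zero]
      rw [h0, smul_zero, sub_zero, ← Category.assoc, hpz, Category.assoc]
      exact hN _ ih
  refine ⟨?_, h2 l⟩
  induction l with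
  | zero =>
    change p ≫ f ∈ N
    rwa [hp]
  | succ l ih =>
    rw [Function.iterate_succ_apply', hz', Preadditive.comp_sub, Linear.comp_smul, hcomm,
      ← Category.assoc, hpz, Category.assoc]
    exact N.sub_mem (hN _ ih) (N.smul_mem _ (h2 l))

end TLGen

namespace KPre

open Tot GrCat GrMonCat CategoryTheory.MonoidalCategory TLGen DTL

section W

variable (K : Type u) [Field K]

/-- The morphisms from a finite object to a Kirby object that are assembled from the maps on the
letters by multiplication. -/
def W : ∀ (X : BWord Unit) (i : ZMod 2), Submodule K (kob K X.J ⟶ kk K i)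
  | .unit, i => Submodule.span K {f | ∃ h, f = kiota 0 i h}
  | .of _, i => Submodule.span K {f | ∃ h, f = kic i h ∨ f = kx K ≫ kic i h}
  | .tensor X Y, k => Submodule.span K {f | ∃ (i j : ZMod 2) (h : i + j = k),
      ∃ a ∈ W X i, ∃ b ∈ W Y j, f = (a ⊗ₘ b) ≫ kmul i j k h}

variable {K}

theorem kiota_mem_unit (i : ZMod 2) (h : ((0 : ℕ) : ZMod 2) = i) :
    kiota 0 i h ∈ W K .unit i := Submodule.subset_span ⟨h, rfl⟩

theorem kic_mem (i : ZMod 2) (h : ((1 : ℕ) : ZMod 2) = i) : kic i h ∈ W K DTm.c i :=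
  Submodule.subset_span ⟨h, Or.inl rfl⟩

theorem kx_kic_mem (i : ZMod 2) (h : ((1 : ℕ) : ZMod 2) = i) : kx K ≫ kic i h ∈ W K DTm.c i :=
  Submodule.subset_span ⟨h, Or.inr rfl⟩

theorem tensor_mem {X Y : BWord Unit} {i j k : ZMod 2} (h : i + j = k) {a : kob K X.J ⟶ kk K i}
    {b : kob K Y.J ⟶ kk K j} (ha : a ∈ W K X i) (hb : b ∈ W K Y j) :
    (a ⊗ₘ b) ≫ kmul i j k h ∈ W K (X.tensor Y) k :=
  Submodule.subset_span ⟨i, j, h, a, ha, b, hb, rfl⟩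

theorem W_unit_ind {V : Type*} [AddCommGroup V] [Module K V] (i : ZMod 2)
    (L : (𝟙_ (Tot K KPre) ⟶ kk K i) →ₗ[K] V) (N : Submodule K V)
    (h : ∀ h, L (kiota 0 i h) ∈ N) (f : kob K (BWord.unit : BWord Unit).J ⟶ kk K i)
    (hf : f ∈ W K .unit i) : L f ∈ N := by
  refine (Submodule.span_le (p := N.comap L)).2 ?_ hf
  rintro _ ⟨h', rfl⟩
  exact h h'

theorem W_c_ind {V : Type*} [AddCommGroup V] [Module K V] (i : ZMod 2)
    (L : (kc K ⟶ kk K i) →ₗ[K] V) (N : Submodule K V) (h : ∀ h, L (kic i h) ∈ N)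
    (h' : ∀ h, L (kx K ≫ kic i h) ∈ N) (f : kob K DTm.c.J ⟶ kk K i)
    (hf : f ∈ W K DTm.c i) : L f ∈ N := by
  refine (Submodule.span_le (p := N.comap L)).2 ?_ hf
  rintro _ ⟨h1, rfl | rfl⟩
  · exact h h1
  · exact h' h1

theorem W_tensor_ind {V : Type*} [AddCommGroup V] [Module K V] {X Y : BWord Unit} (k : ZMod 2)
    (L : (kob K X.J ⊗ kob K Y.J ⟶ kk K k) →ₗ[K] V) (N : Submodule K V)
    (h : ∀ i j h, ∀ a ∈ W K X i, ∀ b ∈ W K Y j, L ((a ⊗ₘ b) ≫ kmul i j k h) ∈ N)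
    (f : kob K (X.tensor Y).J ⟶ kk K k) (hf : f ∈ W K (X.tensor Y) k) : L f ∈ N := by
  refine (Submodule.span_le (p := N.comap L)).2 ?_ hf
  rintro _ ⟨i, j, h1, a, ha, b, hb, rfl⟩
  exact h i j h1 a ha b hb

theorem W_c_cases {i : ZMod 2} {f : kc K ⟶ kk K i} (hf : f ∈ W K DTm.c i) :
    f = 0 ∨ ∃ (h : _) (a b : K), f = a • kic i h + b • (kx K ≫ kic i h) := by
  by_cases h : ((1 : ℕ) : ZMod 2) = i
  · right
    have h1 : f ∈ Submodule.span K {kic i h, kx K ≫ kic i h} := by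
      refine W_c_ind i LinearMap.id _ ?_ ?_ f hf
      · exact fun _ => Submodule.subset_span (Or.inl rfl)
      · exact fun _ => Submodule.subset_span (Or.inr rfl)
    obtain ⟨a, b, e⟩ := Submodule.mem_span_pair.1 h1
    exact ⟨h, a, b, e.symm⟩
  · left
    have h1 := W_c_ind i LinearMap.id ⊥ (fun h' => absurd h' h) (fun h' => absurd h' h) f hf
    exact h1

/-- Precomposition with `f` preserves the distinguished morphisms. -/
def Pres {X Y : BWord Unit} (f : kob K X.J ⟶ kob K Y.J) : Prop :=
  ∀ i, ∀ g ∈ W K Y i, f ≫ g ∈ W K X i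

theorem kic_two (k : ZMod 2) (h : ((1 : ℕ) : ZMod 2) + ((1 : ℕ) : ZMod 2) = k)
    (h2 : ((2 : ℕ) : ZMod 2) = k) : kiota (K := K) 2 k h2 =
      ((λ_ (kc K)).hom ▷ kc K) ≫ (kic _ rfl ⊗ₘ kic _ rfl) ≫ kmul _ _ k h := by
  refine (kiota_succ (n := 1) rfl rfl h h2).trans ?_
  exact comp_tensorHom_comp _ _ (Iso.hom_inv_id_assoc _ _).symm

theorem kcup_two (k : ZMod 2) (h : ((1 : ℕ) : ZMod 2) + ((1 : ℕ) : ZMod 2) = k) :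
    kcup K ≫ (kic _ rfl ⊗ₘ kic _ rfl) ≫ kmul _ _ k h = 0 := by
  have h2 : ((2 : ℕ) : ZMod 2) = k := by rw [← h]; push_cast; norm_num
  have h1 := lastCup_kiota (K := K) 0 k h2
  have h3 := lastCup_unit (c := kc K) (kcup K) =≫
    ((kic _ rfl ⊗ₘ kic _ rfl) ≫ kmul _ _ k h)
  refine h3.symm.trans ((Category.assoc _ _ _).trans (Eq.trans ?_ h1))
  exact congrArg (fun t => lastCup (c := kc K) (kcup K) (𝟙_ _) ≫ t) (kic_two k h h2).symm

theorem kdcup_two (k : ZMod 2) (h : ((1 : ℕ) : ZMod 2) + ((1 : ℕ) : ZMod 2) = k)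
    (h0 : ((0 : ℕ) : ZMod 2) = k) :
    (kcup K ≫ kx K ▷ kc K) ≫ (kic _ rfl ⊗ₘ kic _ rfl) ≫ kmul _ _ k h = kiota 0 k h0 := by
  have h2 : ((2 : ℕ) : ZMod 2) = k := by rw [← h]; push_cast; norm_num
  have h1 := R_kiota (K := K) 0 k h2 h0
  have h3 := lastCup_unit (c := kc K) (kcup K ≫ kx K ▷ kc K) =≫
    ((kic _ rfl ⊗ₘ kic _ rfl) ≫ kmul _ _ k h)
  refine h3.symm.trans ((Category.assoc _ _ _).trans (Eq.trans ?_ h1))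
  refine congrArg₂ (fun s t => s ≫ t) ?_ (kic_two k h h2).symm
  rw [R_eq]
  refine Eq.trans ?_ (Jt_lastCup (tdcup K) .unit).symm
  exact congrArg (fun t => lastCup (c := kc K) t (𝟙_ _)) (Jt_comp_eq rfl Jt_dotL).symm

theorem zero_eq (k : ZMod 2) (h : ((1 : ℕ) : ZMod 2) + ((1 : ℕ) : ZMod 2) = k) :
    ((0 : ℕ) : ZMod 2) = k := by rw [← h]; decide

theorem pres_cup : Pres (X := .unit) (Y := DTm.c.tensor DTm.c) (kcup K) := by
  intro k g hg
  refine W_tensor_ind k (Linear.leftComp K (kk K k) (kcup K)) (W K .unit k) ?_ g hg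
  intro i j h a ha b hb
  change kcup K ≫ (a ⊗ₘ b) ≫ kmul i j k h ∈ W K .unit k
  have hz : ∀ t, t = 0 → t ∈ W K .unit k := fun t e => e ▸ Submodule.zero_mem _
  obtain rfl | ⟨h1, r, s, rfl⟩ := W_c_cases ha
  · exact hz _ (comp_zero_tensor _ _ _)
  obtain rfl | ⟨h2, r', s', rfl⟩ := W_c_cases hb
  · exact hz _ (comp_tensor_zero _ _ _)
  subst h1
  subst h2
  have h0 := zero_eq k h
  refine (congrArg (fun t => t ∈ W K .unit k)
    ((kdotRel (K := K)).cup_expand (kcup_two k h) (kdcup_two k h h0) r s r' s')).mpr ?_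
  exact Submodule.smul_mem _ _ (kiota_mem_unit k h0)

theorem pres_cap : Pres (X := DTm.c.tensor DTm.c) (Y := .unit) (kcap K) := by
  intro k g hg
  refine W_unit_ind k (Linear.leftComp K (kk K k) (kcap K)) (W K (DTm.c.tensor DTm.c) k) ?_ g hg
  intro h0
  have h : ((1 : ℕ) : ZMod 2) + ((1 : ℕ) : ZMod 2) = k := by rw [← h0]; decide
  change kcap K ≫ kiota 0 k h0 ∈ W K (DTm.c.tensor DTm.c) k
  have h1 := (kdotRel (K := K)).cap_expand (kcup_two k h) (kdcup_two k h h0)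
  refine (congrArg (fun t => t ∈ W K (DTm.c.tensor DTm.c) k) h1).mpr ?_
  exact Submodule.add_mem _ (tensor_mem h (kx_kic_mem _ rfl) (kic_mem _ rfl))
    (tensor_mem h (kic_mem _ rfl) (kx_kic_mem _ rfl))

theorem pres_dot : Pres (X := DTm.c) (Y := DTm.c) (kx K) := by
  intro k g hg
  refine W_c_ind k (Linear.leftComp K (kk K k) (kx K)) (W K DTm.c k) ?_ ?_ g hg
  · exact fun h => kx_kic_mem k h
  · intro h
    change kx K ≫ kx K ≫ kic k h ∈ _
    rw [← Category.assoc, (kdotRel (K := K)).sq, Limits.zero_comp]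
    exact Submodule.zero_mem _

theorem pres_id (X : BWord Unit) : Pres (𝟙 (kob K X.J)) := by
  intro i g hg
  rwa [Category.id_comp]

theorem Pres.comp {X Y Z : BWord Unit} {f : kob K X.J ⟶ kob K Y.J} {g : kob K Y.J ⟶ kob K Z.J}
    (hf : Pres f) (hg : Pres g) : Pres (f ≫ g) := by
  intro i a ha
  rw [Category.assoc]
  exact hf i _ (hg i _ ha)

theorem Pres.tensor {X Y X' Y' : BWord Unit} {f : kob K X.J ⟶ kob K Y.J}
    {g : kob K X'.J ⟶ kob K Y'.J} (hf : Pres f) (hg : Pres g) :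
    Pres (X := X.tensor X') (Y := Y.tensor Y') (f ⊗ₘ g) := by
  intro k t ht
  refine W_tensor_ind k (Linear.leftComp K (kk K k) (f ⊗ₘ g)) (W K (X.tensor X') k) ?_ t ht
  intro i j h a ha b hb
  change (f ⊗ₘ g) ≫ (a ⊗ₘ b) ≫ kmul i j k h ∈ W K (X.tensor X') k
  rw [← Category.assoc, MonoidalCategory.tensorHom_comp_tensorHom]
  exact tensor_mem h (hf i a ha) (hg j b hb)

theorem kmul_assoc' {X Y Z : BWord Unit} {i j k ij jk l : ZMod 2} (h₁ : i + j = ij)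
    (h₂ : ij + k = l) (h₃ : j + k = jk) (h₄ : i + jk = l) (a : kob K X.J ⟶ kk K i)
    (b : kob K Y.J ⟶ kk K j) (d : kob K Z.J ⟶ kk K k) :
    (((a ⊗ₘ b) ≫ kmul i j ij h₁) ⊗ₘ d) ≫ kmul ij k l h₂ = (α_ _ _ _).hom ≫
      (a ⊗ₘ ((b ⊗ₘ d) ≫ kmul j k jk h₃)) ≫ kmul i jk l h₄ := by
  have h := kmul_assoc (K := K) i j k ij jk l h₁ h₂ h₃ h₄
  have e1 : ((a ⊗ₘ b) ≫ kmul i j ij h₁) ⊗ₘ d = ((a ⊗ₘ b) ⊗ₘ d) ≫ kmul i j ij h₁ ▷ kk K k := by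
    rw [← MonoidalCategory.tensorHom_id, MonoidalCategory.tensorHom_comp_tensorHom,
      Category.comp_id]
  have e2 : a ⊗ₘ ((b ⊗ₘ d) ≫ kmul j k jk h₃) = (a ⊗ₘ (b ⊗ₘ d)) ≫ kk K i ◁ kmul j k jk h₃ := by
    rw [← MonoidalCategory.id_tensorHom, MonoidalCategory.tensorHom_comp_tensorHom,
      Category.comp_id]
  rw [e1, e2, Category.assoc, Category.assoc, h, ← Category.assoc,
    MonoidalCategory.associator_naturality, Category.assoc]

theorem pres_assoc (X Y Z : BWord Unit) : Pres (X := (X.tensor Y).tensor Z)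
    (Y := X.tensor (Y.tensor Z)) (α_ (kob K X.J) (kob K Y.J) (kob K Z.J)).hom := by
  intro l t ht
  refine W_tensor_ind (Y := Y.tensor Z) l (Linear.leftComp K (kk K l)
    (α_ (kob K X.J) (kob K Y.J) (kob K Z.J)).hom) (W K ((X.tensor Y).tensor Z) l) ?_ t ht
  intro i jk h₄ a ha b hb
  refine W_tensor_ind jk ((Linear.leftComp K (kk K l)
    (α_ (kob K X.J) (kob K Y.J) (kob K Z.J)).hom) ∘ₗ (Linear.rightComp K _ (kmul i jk l h₄)) ∘ₗ
    (tensL K a (kob K Y.J ⊗ kob K Z.J) (kk K jk)))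
    (W K ((X.tensor Y).tensor Z) l) ?_ b hb
  intro j k h₃ b hb d hd
  have h₂ : i + j + k = l := by rw [add_assoc, h₃, h₄]
  have h := kmul_assoc' rfl h₂ h₃ h₄ a b d
  exact (congrArg (· ∈ W K ((X.tensor Y).tensor Z) l) h).mp
    (tensor_mem h₂ (tensor_mem rfl ha hb) hd)

theorem pres_assoc_inv (X Y Z : BWord Unit) : Pres (X := X.tensor (Y.tensor Z))
    (Y := (X.tensor Y).tensor Z) (α_ (kob K X.J) (kob K Y.J) (kob K Z.J)).inv := by
  intro l t ht
  refine W_tensor_ind (X := X.tensor Y) l (Linear.leftComp K (kk K l)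
    (α_ (kob K X.J) (kob K Y.J) (kob K Z.J)).inv) (W K (X.tensor (Y.tensor Z)) l) ?_ t ht
  intro ij k h₂ a ha d hd
  refine W_tensor_ind ij ((Linear.leftComp K (kk K l)
    (α_ (kob K X.J) (kob K Y.J) (kob K Z.J)).inv) ∘ₗ (Linear.rightComp K _ (kmul ij k l h₂)) ∘ₗ
    (tensR K d (kob K X.J ⊗ kob K Y.J) (kk K ij)))
    (W K (X.tensor (Y.tensor Z)) l) ?_ a ha
  intro i j h₁ a ha b hb
  have h₄ : i + (j + k) = l := by rw [← add_assoc, h₁, h₂]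
  have h := (Iso.inv_comp_eq _).2 (kmul_assoc' h₁ h₂ rfl h₄ a b d)
  exact (congrArg (· ∈ W K (X.tensor (Y.tensor Z)) l) h).mpr
    (tensor_mem h₄ ha (tensor_mem rfl hb hd))

theorem kunit_mul_left {X : BWord Unit} {i j : ZMod 2} (h0 : ((0 : ℕ) : ZMod 2) = i)
    (h : i + j = j) (f : kob K X.J ⟶ kk K j) :
    ((kiota 0 i h0 : 𝟙_ (Tot K KPre) ⟶ kk K i) ⊗ₘ f) ≫ kmul i j j h =
      (λ_ (kob K X.J)).hom ≫ f := by
  obtain rfl : (0 : ZMod 2) = i := by rw [← h0]; rfl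
  exact left_of_unit (kunit_mul j h) f

theorem kmul_unit_right {X : BWord Unit} {i j : ZMod 2} (h0 : ((0 : ℕ) : ZMod 2) = i)
    (h : j + i = j) (f : kob K X.J ⟶ kk K j) :
    (f ⊗ₘ (kiota 0 i h0 : 𝟙_ (Tot K KPre) ⟶ kk K i)) ≫ kmul j i j h =
      (ρ_ (kob K X.J)).hom ≫ f := by
  obtain rfl : (0 : ZMod 2) = i := by rw [← h0]; rfl
  exact right_of_unit (kmul_unit j h) f

theorem pres_left (X : BWord Unit) : Pres (X := BWord.unit.tensor X) (Y := X)
    (λ_ (kob K X.J)).hom := by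
  intro i f hf
  exact (congrArg (· ∈ W K (BWord.unit.tensor X) i) (kunit_mul_left Nat.cast_zero (zero_add i) f)).mp
    (tensor_mem (zero_add i) (kiota_mem_unit _ _) hf)

theorem pres_right (X : BWord Unit) : Pres (X := X.tensor BWord.unit) (Y := X)
    (ρ_ (kob K X.J)).hom := by
  intro i f hf
  exact (congrArg (· ∈ W K (X.tensor BWord.unit) i) (kmul_unit_right Nat.cast_zero (add_zero i) f)).mp
    (tensor_mem (add_zero i) hf (kiota_mem_unit _ _))

theorem pres_left_inv (X : BWord Unit) : Pres (X := X) (Y := BWord.unit.tensor X)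
    (λ_ (kob K X.J)).inv := by
  intro k t ht
  refine W_tensor_ind (X := .unit) k (Linear.leftComp K (kk K k) (λ_ (kob K X.J)).inv) (W K X k)
    ?_ t ht
  intro i j h a ha b hb
  refine W_unit_ind i ((Linear.leftComp K (kk K k) (λ_ (kob K X.J)).inv) ∘ₗ
    (Linear.rightComp K _ (kmul i j k h)) ∘ₗ (tensR K b (𝟙_ (Tot K KPre)) (kk K i))) (W K X k) ?_ a ha
  intro h0
  obtain rfl : (0 : ZMod 2) = i := by rw [← h0]; rfl
  obtain rfl : j = k := by rw [← h, zero_add]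
  exact (congrArg (· ∈ W K X j) ((Iso.inv_comp_eq _).2 (kunit_mul_left h0 h b))).mpr hb

theorem pres_right_inv (X : BWord Unit) : Pres (X := X) (Y := X.tensor BWord.unit)
    (ρ_ (kob K X.J)).inv := by
  intro k t ht
  refine W_tensor_ind (Y := .unit) k (Linear.leftComp K (kk K k) (ρ_ (kob K X.J)).inv) (W K X k)
    ?_ t ht
  intro i j h a ha b hb
  refine W_unit_ind j ((Linear.leftComp K (kk K k) (ρ_ (kob K X.J)).inv) ∘ₗ
    (Linear.rightComp K _ (kmul i j k h)) ∘ₗ (tensL K a (𝟙_ (Tot K KPre)) (kk K j))) (W K X k) ?_ b hb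
  intro h0
  obtain rfl : (0 : ZMod 2) = j := by rw [← h0]; rfl
  obtain rfl : i = k := by rw [← h, add_zero]
  exact (congrArg (· ∈ W K X i) ((Iso.inv_comp_eq _).2 (kmul_unit_right h0 h a))).mpr ha

theorem pres_zero (X Y : BWord Unit) : Pres (0 : kob K X.J ⟶ kob K Y.J) := by
  intro i f hf
  rw [Limits.zero_comp]
  exact Submodule.zero_mem _

theorem Pres.add {X Y : BWord Unit} {f g : kob K X.J ⟶ kob K Y.J} (hf : Pres f) (hg : Pres g) :
    Pres (f + g) := by
  intro i a ha
  rw [Preadditive.add_comp]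
  exact Submodule.add_mem _ (hf i a ha) (hg i a ha)

theorem Pres.smul {X Y : BWord Unit} {f : kob K X.J ⟶ kob K Y.J} (hf : Pres f) (r : K) :
    Pres (r • f) := by
  intro i a ha
  rw [Linear.smul_comp]
  exact Submodule.smul_mem _ _ (hf i a ha)

theorem pres_kmk {X Y : BWord Unit} {d : ℤ} (f : Tm K DGen X Y d) : Pres (kmk (KTm.J f)) := by
  induction f with
  | gen g =>
    cases g with
    | cup => exact (Jt_hmk (K := K) DTm.cup) ▸ pres_cup
    | cap => exact (Jt_hmk (K := K) DTm.cap) ▸ pres_cap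
    | dot => exact (Jt_hmk (K := K) DTm.dot) ▸ pres_dot
  | idm X => exact pres_id (K := K) X
  | comp f g h ih ih' => exact kmk_comp (KTm.J f) (KTm.J g) h ▸ ih.comp ih'
  | tHom f g h ih ih' => exact kmk_tHom (KTm.J f) (KTm.J g) h ▸ ih.tensor ih'
  | aHom X Y Z => exact pres_assoc X Y Z
  | aInv X Y Z => exact pres_assoc_inv X Y Z
  | lHom X => exact pres_left X
  | lInv X => exact pres_left_inv X
  | rHom X => exact pres_right X
  | rInv X => exact pres_right_inv X
  | zero X Y d => exact (kmk_zero (K := K) X.J Y.J d).symm ▸ pres_zero X Y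
  | add f g ih ih' => exact kmk_add (KTm.J f) (KTm.J g) ▸ ih.add ih'
  | smul r f ih => exact kmk_smul r (KTm.J f) ▸ ih.smul r

/-- Every morphism of the dotted Temperley-Lieb category preserves the distinguished morphisms. -/
theorem pres_Jt {X Y : BWord Unit} (D : ob K X ⟶ ob K Y) : Pres (Jt D) := by
  induction D using hom_ind with
  | h0 => exact (map_zero (Jt (K := K) (X := X) (Y := Y))).symm ▸ pres_zero X Y
  | h1 d f =>
    induction f using PHom.ind with
    | h f => exact (Jt_hmk (K := K) f) ▸ pres_kmk f
  | h2 f g hf hg => exact (map_add (Jt (K := K) (X := X) (Y := Y)) f g).symm ▸ hf.add hg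

theorem kiota_mem (n : ℕ) (i : ZMod 2) (h : (n : ZMod 2) = i) :
    kiota n i h ∈ W K (BWord.pow () n) i := by
  induction n generalizing i with
  | zero => exact kiota_mem_unit i h
  | succ n ih =>
    have hi : (n : ZMod 2) + ((1 : ℕ) : ZMod 2) = i := by rw [← h]; push_cast; rfl
    rw [kiota_succ rfl rfl hi h]
    exact tensor_mem (X := BWord.pow () n) (Y := DTm.c) hi (ih _ rfl) (kic_mem _ rfl)

end W

end KPre

end

noncomputable section

namespace KPre

open Tot GrCat GrMonCat CategoryTheory.MonoidalCategory TLGen DTL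

section Factor

variable {K : Type u} [Field K]

/-- The canonical inclusions in the total category. -/
def kincl (S : BWord KLetter) (a : Lev S) : kob K (BWord.J (dom S a)) ⟶ kob K S :=
  hom (K := K) (C := KPre) (incl S a)

theorem kincl_tensor (S T : BWord KLetter) (a : Lev S) (b : Lev T) :
    kincl (K := K) (S.tensor T) (a, b) = kincl S a ⊗ₘ kincl T b :=
  hom_tHom (C := KPre) _ _ _

/-- `t` factors through the canonical inclusion with index `b` by a morphism of `dTL`. -/
def JFacAt {X : BWord Unit} {T : BWord KLetter} (t : kob K X.J ⟶ kob K T) (b : Lev T) : Prop :=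
  ∃ D : ob K X ⟶ ob K (dom T b), t = Jt D ≫ kincl T b

def JFac {X : BWord Unit} {T : BWord KLetter} (t : kob K X.J ⟶ kob K T) : Prop := ∃ b, JFacAt t b

theorem JFacAt.comp_left {X Y : BWord Unit} {T : BWord KLetter} {t : kob K X.J ⟶ kob K T}
    {b : Lev T} (ht : JFacAt t b) (D : ob K Y ⟶ ob K X) : JFacAt (Jt D ≫ t) b := by
  obtain ⟨D', rfl⟩ := ht
  exact ⟨D ≫ D', (Category.assoc _ _ _).symm.trans
    (congrArg (fun u => u ≫ kincl T b) (Jt_comp D D').symm)⟩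

theorem JFacAt.trans {X : BWord Unit} {T : BWord KLetter} {t : kob K X.J ⟶ kob K T}
    {b b' : Lev T} (ht : JFacAt t b) (hb : JFacAt (K := K) (X := dom T b) (kincl T b) b') :
    JFacAt t b' := by
  obtain ⟨D, rfl⟩ := ht
  exact hb.comp_left D

theorem JFacAt.tensor {X Y : BWord Unit} {S T : BWord KLetter} {s : kob K X.J ⟶ kob K S}
    {t : kob K Y.J ⟶ kob K T} {a : Lev S} {b : Lev T} (hs : JFacAt s a) (ht : JFacAt t b) :
    JFacAt (X := X.tensor Y) (T := S.tensor T) (s ⊗ₘ t) (a, b) := by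
  obtain ⟨D, rfl⟩ := hs
  obtain ⟨D', rfl⟩ := ht
  refine ⟨D ⊗ₘ D', ?_⟩
  refine (MonoidalCategory.tensorHom_comp_tensorHom _ _ _ _).symm.trans ?_
  exact congrArg₂ (fun s t => s ≫ t) (Jt_tensorHom D D').symm (kincl_tensor S T a b).symm

theorem jfacAt_self (T : BWord KLetter) (b : Lev T) :
    JFacAt (K := K) (X := dom T b) (kincl T b) b :=
  ⟨𝟙 _, ((congrArg (fun u => u ≫ kincl T b) (Jt_id _)).trans (Category.id_comp _)).symm⟩

theorem kiota_le (n s : ℕ) (i : ZMod 2) (h : (n : ZMod 2) = i)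
    (h' : ((n + 2 * s : ℕ) : ZMod 2) = i) :
    JFacAt (K := K) (X := BWord.pow () n) (T := kw i) (kiota n i h) ⟨n + 2 * s, h'⟩ := by
  induction s with
  | zero => exact jfacAt_self (kw i) ⟨n, h⟩
  | succ s ih =>
    have h0 : ((2 : ℕ) : ZMod 2) = 0 := rfl
    have h2 : ((n + 2 * s : ℕ) : ZMod 2) = i := by
      rw [← h']
      push_cast
      linear_combination (-1 : ZMod 2) * h0
    exact (ih h2).trans ⟨R K (n + 2 * s), (R_kiota (n + 2 * s) i h' h2).symm⟩

theorem jdirected (T : BWord KLetter) (b b' : Lev T) : ∃ c : Lev T,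
    JFacAt (K := K) (X := dom T b) (kincl T b) c ∧
      JFacAt (K := K) (X := dom T b') (kincl T b') c := by
  induction T with
  | unit => exact ⟨(), jfacAt_self .unit b, jfacAt_self .unit b'⟩
  | of a =>
    cases a with
    | c => exact ⟨(), jfacAt_self (.of .c) b, jfacAt_self (.of .c) b'⟩
    | κ i =>
      obtain ⟨n, hn⟩ := b
      obtain ⟨n', hn'⟩ := b'
      have key : ∀ n n' : ℕ, (n : ZMod 2) = (n' : ZMod 2) → n ≤ n' → ∃ s, n' = n + 2 * s := by
        intro n n' h hle
        have h1 := (ZMod.natCast_eq_natCast_iff' n n' 2).1 h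
        exact ⟨(n' - n) / 2, by omega⟩
      rcases le_total n n' with hle | hle
      · obtain ⟨s, rfl⟩ := key n n' (hn.trans hn'.symm) hle
        exact ⟨⟨_, hn'⟩, kiota_le n s i hn hn', jfacAt_self (kw i) ⟨_, hn'⟩⟩
      · obtain ⟨s, rfl⟩ := key n' n (hn'.trans hn.symm) hle
        exact ⟨⟨_, hn⟩, jfacAt_self (kw i) ⟨_, hn⟩, kiota_le n' s i hn' hn⟩
  | tensor S T ih ih' =>
    obtain ⟨c, h1, h2⟩ := ih b.1 b'.1
    obtain ⟨c', h1', h2'⟩ := ih' b.2 b'.2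
    refine ⟨(c, c'), ?_, ?_⟩
    · exact (kincl_tensor (K := K) S T b.1 b.2) ▸ JFacAt.tensor h1 h1'
    · exact (kincl_tensor (K := K) S T b'.1 b'.2) ▸ JFacAt.tensor h2 h2'

theorem jfac_zero (X : BWord Unit) (T : BWord KLetter) :
    JFac (0 : kob K X.J ⟶ kob K T) :=
  ⟨(lev_nonempty T).some, 0, by rw [map_zero, Limits.zero_comp]⟩

theorem JFac.smul {X : BWord Unit} {T : BWord KLetter} {t : kob K X.J ⟶ kob K T} (ht : JFac t)
    (r : K) : JFac (r • t) := by
  obtain ⟨b, D, rfl⟩ := ht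
  exact ⟨b, r • D, by rw [map_smul, Linear.smul_comp]⟩

theorem JFac.add {X : BWord Unit} {T : BWord KLetter} {s t : kob K X.J ⟶ kob K T} (hs : JFac s)
    (ht : JFac t) : JFac (s + t) := by
  obtain ⟨b, hb⟩ := hs
  obtain ⟨b', hb'⟩ := ht
  obtain ⟨c, h1, h2⟩ := jdirected (K := K) T b b'
  obtain ⟨D, rfl⟩ := hb.trans h1
  obtain ⟨D', rfl⟩ := hb'.trans h2
  exact ⟨c, D + D', by rw [map_add, Preadditive.add_comp]⟩

/-- Composites of `t` with canonical inclusions factor through canonical inclusions. -/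
def JGood {S T : BWord KLetter} (t : kob K S ⟶ kob K T) : Prop :=
  ∀ a : Lev S, JFac (X := dom S a) (kincl S a ≫ t)

theorem JGood.comp {S T R : BWord KLetter} {s : kob K S ⟶ kob K T} {t : kob K T ⟶ kob K R}
    (hs : JGood s) (ht : JGood t) : JGood (s ≫ t) := by
  intro a
  obtain ⟨b, D, hD⟩ := hs a
  obtain ⟨b', h⟩ := ht b
  have h1 := h.comp_left D
  rw [← Category.assoc, ← hD, Category.assoc] at h1
  exact ⟨b', h1⟩

theorem JGood.tensor {S T S' T' : BWord KLetter} {s : kob K S ⟶ kob K T}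
    {t : kob K S' ⟶ kob K T'} (hs : JGood s) (ht : JGood t) :
    JGood (S := S.tensor S') (T := T.tensor T') (s ⊗ₘ t) := by
  rintro ⟨a, a'⟩
  obtain ⟨b, hb⟩ := hs a
  obtain ⟨b', hb'⟩ := ht a'
  refine ⟨(b, b'), ?_⟩
  refine (congrArg (fun t => JFacAt (X := (dom S a).tensor (dom S' a')) (T := T.tensor T') t (b, b')) ?_).mpr
    (hb.tensor hb')
  refine (congrArg (fun u => u ≫ (s ⊗ₘ t)) (kincl_tensor S S' a a')).trans ?_
  exact MonoidalCategory.tensorHom_comp_tensorHom _ _ _ _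

theorem jgood_aHom (X Y Z : BWord KLetter) : JGood (S := (X.tensor Y).tensor Z)
    (T := X.tensor (Y.tensor Z)) (α_ (kob K X) (kob K Y) (kob K Z)).hom := by
  rintro ⟨⟨a, b⟩, d⟩
  refine ⟨(a, (b, d)), (α_ (ob K (dom X a)) (ob K (dom Y b)) (ob K (dom Z d))).hom, ?_⟩
  exact ((congrArg (fun u => u ≫ (α_ (kob K X) (kob K Y) (kob K Z)).hom)
    ((kincl_tensor (X.tensor Y) Z (a, b) d).trans (congrArg (fun u => u ⊗ₘ kincl Z d)
      (kincl_tensor X Y a b)))).trans (associator_naturality _ _ _)).trans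
    (congrArg₂ (fun u w => u ≫ w) (Jt_assoc _ _ _).symm ((kincl_tensor X (Y.tensor Z) a (b, d)).trans
      (congrArg (fun u => kincl X a ⊗ₘ u) (kincl_tensor Y Z b d))).symm)

theorem jgood_aInv (X Y Z : BWord KLetter) : JGood (S := X.tensor (Y.tensor Z))
    (T := (X.tensor Y).tensor Z) (α_ (kob K X) (kob K Y) (kob K Z)).inv := by
  rintro ⟨a, ⟨b, d⟩⟩
  refine ⟨((a, b), d), (α_ (ob K (dom X a)) (ob K (dom Y b)) (ob K (dom Z d))).inv, ?_⟩
  exact ((congrArg (fun u => u ≫ (α_ (kob K X) (kob K Y) (kob K Z)).inv)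
    ((kincl_tensor X (Y.tensor Z) a (b, d)).trans
      (congrArg (fun u => kincl X a ⊗ₘ u) (kincl_tensor Y Z b d)))).trans
        (associator_inv_naturality _ _ _)).trans
    (congrArg₂ (fun u w => u ≫ w) (Jt_assoc_inv _ _ _).symm
      ((kincl_tensor (X.tensor Y) Z (a, b) d).trans (congrArg (fun u => u ⊗ₘ kincl Z d)
      (kincl_tensor X Y a b))).symm)

theorem jgood_lHom (X : BWord KLetter) : JGood (S := BWord.unit.tensor X) (T := X)
    (λ_ (kob K X)).hom := by
  rintro ⟨⟨⟩, a⟩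
  refine ⟨a, (λ_ (ob K (dom X a))).hom, ?_⟩
  exact ((congrArg (fun u => u ≫ (λ_ (kob K X)).hom) ((kincl_tensor .unit X () a).trans
    (MonoidalCategory.id_tensorHom _ _))).trans (leftUnitor_naturality _)).trans
      (congrArg (fun u => u ≫ kincl X a) (Jt_left _).symm)

theorem jgood_rHom (X : BWord KLetter) : JGood (S := X.tensor .unit) (T := X)
    (ρ_ (kob K X)).hom := by
  rintro ⟨a, ⟨⟩⟩
  refine ⟨a, (ρ_ (ob K (dom X a))).hom, ?_⟩
  exact ((congrArg (fun u => u ≫ (ρ_ (kob K X)).hom) ((kincl_tensor X .unit a ()).trans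
    (MonoidalCategory.tensorHom_id _ _))).trans (rightUnitor_naturality _)).trans
      (congrArg (fun u => u ≫ kincl X a) (Jt_right _).symm)

theorem jgood_lInv (X : BWord KLetter) : JGood (T := BWord.unit.tensor X) (S := X)
    (λ_ (kob K X)).inv := by
  intro a
  refine ⟨((), a), (λ_ (ob K (dom X a))).inv, ?_⟩
  exact (leftUnitor_inv_naturality _).trans (congrArg₂ (fun u w => u ≫ w) (Jt_left_inv _).symm
    ((kincl_tensor .unit X () a).trans (MonoidalCategory.id_tensorHom _ _)).symm)

theorem jgood_rInv (X : BWord KLetter) : JGood (T := X.tensor .unit) (S := X)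
    (ρ_ (kob K X)).inv := by
  intro a
  refine ⟨(a, ()), (ρ_ (ob K (dom X a))).inv, ?_⟩
  exact (rightUnitor_inv_naturality _).trans (congrArg₂ (fun u w => u ≫ w) (Jt_right_inv _).symm
    ((kincl_tensor X .unit a ()).trans (MonoidalCategory.tensorHom_id _ _)).symm)

theorem kincl_finite (X : BWord Unit) (a : Lev X.J) :
    ∃ (w : ob K (dom X.J a) ⟶ ob K X) (w' : ob K X ⟶ ob K (dom X.J a)),
      Jt w = kincl X.J a ∧ Jt w' ≫ kincl X.J a = 𝟙 (kob K X.J) := by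
  induction X with
  | unit => exact ⟨𝟙 _, 𝟙 _, Jt_id _, (Category.comp_id _).trans (Jt_id _)⟩
  | of a => exact ⟨𝟙 _, 𝟙 _, Jt_id _, (Category.comp_id _).trans (Jt_id _)⟩
  | tensor X Y ih ih' =>
    obtain ⟨a, b⟩ := a
    obtain ⟨w, w', h, h'⟩ := ih a
    obtain ⟨v, v', g, g'⟩ := ih' b
    refine ⟨w ⊗ₘ v, w' ⊗ₘ v', ?_, ?_⟩
    · refine (Jt_tensorHom w v).trans (Eq.trans ?_ (kincl_tensor X.J Y.J a b).symm)
      rw [h, g]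
    · refine (congrArg₂ (fun s t => s ≫ t) (Jt_tensorHom w' v') (kincl_tensor X.J Y.J a b)).trans ?_
      refine (MonoidalCategory.tensorHom_comp_tensorHom _ _ _ _).trans ?_
      rw [h', g']
      exact MonoidalCategory.id_tensorHom_id _ _

theorem comp_retract {M : Type u} [Category.{v} M] {A B C D : M} (f : A ⟶ B) (g : B ⟶ C)
    {r : C ⟶ D} {s : D ⟶ C} (h : r ≫ s = 𝟙 _) : (f ≫ g ≫ r) ≫ s = f ≫ g := by
  rw [Category.assoc, Category.assoc, h, Category.comp_id]

theorem jgood_Jt {X Y : BWord Unit} (D : ob K X ⟶ ob K Y) : JGood (Jt D) := by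
  intro a
  obtain ⟨w, w', h, -⟩ := kincl_finite (K := K) X a
  obtain ⟨v, v', -, g⟩ := kincl_finite (K := K) Y (lev_nonempty Y.J).some
  refine ⟨_, w ≫ D ≫ v', ?_⟩
  refine Eq.symm ((congrArg (fun u => u ≫ kincl Y.J (lev_nonempty Y.J).some)
    (Jt_comp_eq h (Jt_comp D v'))).trans ?_)
  exact comp_retract _ _ g

theorem jgood_kmk {S T : BWord KLetter} {d : ℤ} (f : Tm K KGen S T d) : JGood (kmk f) := by
  induction f with
  | gen g =>
    cases g with
    | old g => exact Jt_hmk (K := K) (.gen g) ▸ jgood_Jt _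
    | iota n i h =>
      intro a
      obtain ⟨w, -, hw, -⟩ := kincl_finite (K := K) (DTm.pw n) a
      exact ⟨⟨n, h⟩, w, hw ▸ rfl⟩
    | mul i j k h =>
      rintro ⟨⟨m, hm⟩, ⟨n, hn⟩⟩
      have hmn : ((m + n : ℕ) : ZMod 2) = k := by
        push_cast
        rw [hm, hn, h]
      refine ⟨⟨m + n, hmn⟩, F K m n, ?_⟩
      exact (congrArg (fun u => u ≫ kmul i j k h) (kincl_tensor (kw i) (kw j) ⟨m, hm⟩ ⟨n, hn⟩)).trans
        (kiota_mul m n i j k hm hn h hmn)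
    | kdot i =>
      rintro ⟨n, h⟩
      exact ⟨⟨n, h⟩, Z K n, kiota_ky n i h⟩
  | idm X => exact fun a => ⟨a, (Category.comp_id (kincl (K := K) X a)).symm ▸ jfacAt_self X a⟩
  | comp f g h ih ih' => exact kmk_comp f g h ▸ ih.comp ih'
  | tHom f g h ih ih' => exact kmk_tHom f g h ▸ ih.tensor ih'
  | aHom X Y Z => exact jgood_aHom X Y Z
  | aInv X Y Z => exact jgood_aInv X Y Z
  | lHom X => exact jgood_lHom X
  | lInv X => exact jgood_lInv X
  | rHom X => exact jgood_rHom X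
  | rInv X => exact jgood_rInv X
  | zero X Y d =>
    intro a
    rw [kmk_zero, Limits.comp_zero]
    exact jfac_zero _ _
  | add f g ih ih' =>
    intro a
    rw [kmk_add, Preadditive.comp_add]
    exact (ih a).add (ih' a)
  | smul r f ih =>
    intro a
    rw [kmk_smul, Linear.comp_smul]
    exact (ih a).smul r

theorem jgood_all {S T : BWord KLetter} (t : kob K S ⟶ kob K T) : JGood t := by
  induction t using hom_ind with
  | h0 =>
    intro a
    rw [Limits.comp_zero]
    exact jfac_zero _ _
  | h1 d f =>
    induction f using PHom.ind with
    | h f => exact jgood_kmk f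
  | h2 f g hf hg =>
    intro a
    rw [Preadditive.comp_add]
    exact (hf a).add (hg a)

/-- Every morphism with finite source factors through a canonical inclusion. -/
theorem jfac_all {X : BWord Unit} {T : BWord KLetter} (t : kob K X.J ⟶ kob K T) : JFac t := by
  obtain ⟨w, w', -, h⟩ := kincl_finite (K := K) X (lev_nonempty X.J).some
  obtain ⟨b, hb⟩ := jgood_all t (lev_nonempty X.J).some
  have h1 := hb.comp_left w'
  rw [← Category.assoc, h, Category.id_comp] at h1
  exact ⟨b, h1⟩

theorem mem_W {X : BWord Unit} {i : ZMod 2} (t : kob K X.J ⟶ kk K i) : t ∈ W K X i := by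
  obtain ⟨⟨n, h⟩, D, rfl⟩ := jfac_all t
  exact pres_Jt (Y := BWord.pow () n) D i _ (kiota_mem n i h)

end Factor

end KPre

end

noncomputable section

namespace TLGen

open MonoidalCategory

variable {K : Type u'} [Field K] {M : Type u} [Category.{v} M] [MonoidalCategory M]
  [Preadditive M] [Linear K M] [MonoidalPreadditive M] [MonoidalLinear K M] {c : M} {x : c ⟶ c}
  {cap : c ⊗ c ⟶ 𝟙_ M} {cup : 𝟙_ M ⟶ c ⊗ c}

theorem whiskerRight_tensorHom_comp {A A' B D E Z : M} (u : A ⟶ A') (a : A' ⟶ D) (b : B ⟶ E)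
    (m : D ⊗ E ⟶ Z) : u ▷ B ≫ (a ⊗ₘ b) ≫ m = ((u ≫ a) ⊗ₘ b) ≫ m := by
  rw [MonoidalCategory.tensorHom_def, MonoidalCategory.tensorHom_def, comp_whiskerRight,
    Category.assoc, Category.assoc, Category.assoc]

theorem iterate_whiskerRight {A B D E Z : M} (u : A ⟶ A) (a : A ⟶ D) (b : B ⟶ E)
    (m : D ⊗ E ⟶ Z) (l : ℕ) : (((fun g => u ≫ g)^[l] a) ⊗ₘ b) ≫ m =
      (fun g => u ▷ B ≫ g)^[l] ((a ⊗ₘ b) ≫ m) := by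
  induction l with
  | zero => rfl
  | succ l ih =>
    rw [Function.iterate_succ_apply', Function.iterate_succ_apply', ← ih,
      whiskerRight_tensorHom_comp]

theorem iterate_comp_right {A D : M} {u : A ⟶ A} {a : A ⟶ D} {y : D ⟶ D} (h : a ≫ y = u ≫ a)
    (l : ℕ) : ∃ w : D ⟶ D, (fun g => u ≫ g)^[l] a = a ≫ w := by
  induction l with
  | zero => exact ⟨𝟙 _, (Category.comp_id _).symm⟩
  | succ l ih =>
    obtain ⟨w, hw⟩ := ih
    refine ⟨y ≫ w, ?_⟩
    rw [Function.iterate_succ_apply', hw, ← Category.assoc, ← h, Category.assoc]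

theorem zstep_zero_absorb {X Z : M} {p z : X ⊗ c ⟶ X ⊗ c} {f : X ⊗ c ⟶ Z} (hp : p = 𝟙 _)
    (hz : z = zstep x (1 : K) 0) : p ≫ X ◁ x ≫ f = ((1 : K) / 1) • (z ≫ f) := by
  subst hp hz
  simp [zstep]

theorem last_dot_step (hx : Dot cap cup x) {X A B Z : M} {p z : X ⊗ c ⟶ X ⊗ c}
    {p' z' : (X ⊗ c) ⊗ c ⟶ (X ⊗ c) ⊗ c} {f : X ⊗ c ⟶ A} {g : c ⟶ B} {m : A ⊗ B ⟶ Z}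
    {f' : (X ⊗ c) ⊗ c ⟶ Z} {s : K} (n : ℕ) (hn : (n : K) + 1 ≠ 0) (hn' : (n : K) + 2 ≠ 0)
    (hs : s * s = 1) (hz : z' = zstep x (-s) z)
    (hf' : f' = (f ⊗ₘ g) ≫ m) (hp : p' ≫ p ▷ c = p') (hpf : p' ≫ f' = f')
    (hpz : p' ≫ z' = z' ≫ p') (hcap : p' ≫ lastCap cap X = 0) (hcup : lastCup cup X ≫ f' = 0)
    (ih : p ≫ X ◁ x ≫ f = (s / (n + 1)) • (z ≫ f)) :
    p' ≫ (X ⊗ c) ◁ x ≫ f' = (-s / (n + 2)) • (z' ≫ f') := by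
  have h1 : z' ≫ f' = p' ≫ z ▷ c ≫ f' + (-s) • (p' ≫ (X ⊗ c) ◁ x ≫ f') := by
    conv_lhs => rw [← hpf, ← Category.assoc, ← hpz, hz, zstep]
    simp only [Category.assoc, Preadditive.add_comp, Preadditive.comp_add, Linear.smul_comp,
      Linear.comp_smul]
  have h2 : z ≫ f = (s * (n + 1)) • (p ≫ X ◁ x ≫ f) := by
    rw [ih, smul_smul]
    have : s * ((n : K) + 1) * (s / (n + 1)) = 1 := by
      field_simp
      linear_combination hs
    rw [this, one_smul]
  have h3 : p' ≫ z ▷ c ≫ f' = (s * (n + 1)) • (p' ≫ (X ◁ x) ▷ c ≫ f') := by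
    have e : z ▷ c ≫ f' = (s * (n + 1)) • (p ▷ c ≫ (X ◁ x) ▷ c ≫ f') := by
      rw [hf', whiskerRight_tensorHom_comp, h2, whiskerRight_tensorHom_comp,
        whiskerRight_tensorHom_comp]
      simp [MonoidalCategory.tensorHom_def]
    rw [e, Linear.comp_smul, ← Category.assoc, hp]
  rw [h1, h3, sum_lastCup hx hcap hcup, smul_neg, ← neg_smul, ← add_smul, smul_smul]
  have : -s / ((n : K) + 2) * (-(s * (n + 1)) + -s) = 1 := by
    field_simp
    linear_combination (n + 2) * hs
  rw [this, one_smul]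

theorem bend_right (zigL : (ρ_ c).inv ≫ c ◁ cup ≫ (α_ _ _ _).inv ≫ cap ▷ c ≫ (λ_ c).hom = 𝟙 c)
    {A S T : M} {p : A ⟶ A} {k : A ⟶ S} {t : A ⟶ T ⊗ c} {D : S ⊗ c ⟶ T}
    (h : (p ⊗ₘ 𝟙 c) ≫ t ▷ c ≫ lastCap cap T = (k ⊗ₘ 𝟙 c) ≫ D) :
    p ≫ t = k ≫ lastCup cup S ≫ D ▷ c := by
  rw [MonoidalCategory.tensorHom_id, MonoidalCategory.tensorHom_id] at h
  rw [← Category.assoc, ← lastCup_natural, Category.assoc, ← comp_whiskerRight, ← h,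
    comp_whiskerRight, comp_whiskerRight, ← Category.assoc, lastCup_natural, Category.assoc,
    ← Category.assoc (lastCup cup A), lastCup_natural, Category.assoc, snakeL cap cup zigL,
    Category.comp_id]

theorem bend_left (zigR : (λ_ c).inv ≫ cup ▷ c ≫ (α_ _ _ _).hom ≫ c ◁ cap ≫ (ρ_ c).hom = 𝟙 c)
    {A S T : M} {p : A ⟶ A} {k : A ⟶ S} {t : A ⟶ c ⊗ T} {D : c ⊗ S ⟶ T}
    (h : (𝟙 c ⊗ₘ p) ≫ c ◁ t ≫ (α_ c c T).inv ≫ cap ▷ T ≫ (λ_ T).hom = (𝟙 c ⊗ₘ k) ≫ D) :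
    p ≫ t = k ≫ ((λ_ S).inv ≫ cup ▷ S ≫ (α_ c c S).hom) ≫ c ◁ D := by
  rw [MonoidalCategory.id_tensorHom, MonoidalCategory.id_tensorHom] at h
  have nat : ∀ {X Y : M} (f : X ⟶ Y), f ≫ (λ_ Y).inv ≫ cup ▷ Y ≫ (α_ c c Y).hom =
      ((λ_ X).inv ≫ cup ▷ X ≫ (α_ c c X).hom) ≫ c ◁ (c ◁ f) := by
    intro X Y f
    simp only [Category.assoc]
    rw [← associator_naturality_right, ← whisker_exchange_assoc, leftUnitor_inv_naturality_assoc]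
  have snake : ((λ_ (c ⊗ T)).inv ≫ cup ▷ (c ⊗ T) ≫ (α_ c c (c ⊗ T)).hom) ≫ c ◁ ((α_ c c T).inv ≫
      cap ▷ T ≫ (λ_ T).hom) = 𝟙 _ := by
    have h1 : ((λ_ (c ⊗ T)).inv ≫ cup ▷ (c ⊗ T) ≫ (α_ c c (c ⊗ T)).hom) ≫ c ◁ ((α_ c c T).inv ≫
      cap ▷ T ≫ (λ_ T).hom) = ((λ_ c).inv ≫ cup ▷ c ≫ (α_ _ _ _).hom ≫ c ◁ cap ≫ (ρ_ c).hom) ▷ T := by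
      monoidal
    rw [h1, zigR, id_whiskerRight]
  rw [← Category.assoc, nat, Category.assoc, ← MonoidalCategory.whiskerLeft_comp, ← h,
    ← Category.assoc (c ◁ p), ← MonoidalCategory.whiskerLeft_comp,
    MonoidalCategory.whiskerLeft_comp, ← Category.assoc _ (c ◁ c ◁ (p ≫ t)), ← nat, Category.assoc,
    snake, Category.comp_id]

end TLGen

namespace KPre

open Tot GrCat GrMonCat CategoryTheory.MonoidalCategory TLGen DTL

section Proj

variable {K : Type u} [Field K] [CharZero K]

/-- The span of the maps `y ^ l ∘ ι n`. -/
def zspan (K : Type u) [Field K] (n : ℕ) (i : ZMod 2) : Submodule K (kpw K n ⟶ kk K i) :=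
  Submodule.span K {f | ∃ (h : _) (l : ℕ), f = (fun g => Jt (Z K n) ≫ g)^[l] (kiota n i h)}

theorem iterate_mem_zspan {n : ℕ} {i : ZMod 2} (h : (n : ZMod 2) = i) (l : ℕ) :
    (fun g => Jt (Z K n) ≫ g)^[l] (kiota n i h) ∈ zspan K n i := Submodule.subset_span ⟨h, l, rfl⟩

theorem comp_zspan {n : ℕ} {i : ZMod 2} {f : kpw K n ⟶ kk K i} (hf : f ∈ zspan K n i) :
    Jt (Z K n) ≫ f ∈ zspan K n i := by
  refine (Submodule.span_le (p := (zspan K n i).comap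
    (Linear.leftComp K (kk K i) (Jt (Z K n))))).2 ?_ hf
  rintro _ ⟨h, l, rfl⟩
  exact Submodule.subset_span ⟨h, l + 1, (Function.iterate_succ_apply' _ _ _).symm⟩

theorem Jt_Z_succ (n : ℕ) : Jt (X := BWord.pow () (n + 1)) (Y := BWord.pow () (n + 1))
    (Z K (n + 1)) = zstep (kx K) ((-1 : K) ^ n) (Jt (Z K n)) := by
  rw [Z_succ]
  refine (map_add Jt _ _).trans (congrArg₂ (· + ·) (Jt_whiskerRight _ DTm.c) ?_)
  exact (map_smul Jt _ _).trans (congrArg (fun t => (-1 : K) ^ n • t) (Jt_whiskerLeft _ _))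

theorem Jt_P_absorb (n : ℕ) : Jt (X := BWord.pow () (n + 1)) (Y := BWord.pow () (n + 1))
    (P K (n + 1)) ≫ (Jt (P K n) ▷ kc K : kpw K n ⊗ kc K ⟶ kpw K n ⊗ kc K) = Jt (P K (n + 1)) :=
  (Jt_comp_eq rfl (Jt_whiskerRight _ DTm.c)).symm.trans (congrArg Jt (P_absorb_right n))

theorem Jt_P_Z (n : ℕ) : Jt (P K n) ≫ Jt (Z K n) = Jt (Z K n) ≫ Jt (P K n) := by
  rw [← Jt_comp, P_Z, Jt_comp]

theorem Jt_lastCap (k : cT K ⊗ cT K ⟶ 𝟙_ (Tot K DTL)) (X : BWord Unit) :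
    Jt (X := (X.tensor DTm.c).tensor DTm.c) (lastCap k (ob K X)) =
      lastCap (c := kc K) (Jt (Y := .unit) (X := DTm.c.tensor DTm.c) k) (kob K X.J) :=
  Jt_comp_eq (Jt_assoc _ _ _) (Jt_comp_eq (Jt_whiskerLeft _ _) (Jt_right _))

theorem Jt_P_lastCap (n : ℕ) : (Jt (P K (n + 2)) : (kpw K n ⊗ kc K) ⊗ kc K ⟶ _) ≫
    lastCap (c := kc K) (kcap K) (kpw K n) = 0 :=
  (Jt_comp_eq rfl (Jt_lastCap _ _)).symm.trans ((congrArg Jt (P_lastCap n)).trans (map_zero _))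

theorem last_dot_kiota (n : ℕ) (i : ZMod 2) (h : ((n + 1 : ℕ) : ZMod 2) = i) :
    (Jt (P K (n + 1)) : kpw K n ⊗ kc K ⟶ kpw K n ⊗ kc K) ≫ kpw K n ◁ kx K ≫ kiota (n + 1) i h =
      ((-1 : K) ^ n / (n + 1)) • ((Jt (Z K (n + 1)) : kpw K n ⊗ kc K ⟶ kpw K n ⊗ kc K) ≫
        kiota (n + 1) i h) := by
  induction n generalizing i with
  | zero =>
    have hc : (-1 : K) ^ 0 / (((0 : ℕ) : K) + 1) = 1 / 1 := by simp
    rw [hc]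
    refine zstep_zero_absorb (x := kx K) (Jt_id _) ((Jt_Z_succ 0).trans ?_)
    rw [pow_zero, Z_zero, map_zero]
  | succ n ih =>
    have hi : ((n + 1 : ℕ) : ZMod 2) + ((1 : ℕ) : ZMod 2) = i := by rw [← h]; push_cast; ring
    have h1 : (n : K) + 1 ≠ 0 := by exact_mod_cast n.succ_ne_zero
    have h2 : (n : K) + 2 ≠ 0 := by exact_mod_cast (n + 1).succ_ne_zero
    have hs : (-1 : K) ^ n * (-1) ^ n = 1 := by rw [← mul_pow]; norm_num
    have hpow : (-1 : K) ^ (n + 1) = -(-1) ^ n := by ring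
    have hcast : ((n + 1 : ℕ) : K) + 1 = n + 2 := by push_cast; ring
    rw [hpow, hcast]
    exact last_dot_step (c := kc K) (kdotRel (K := K)) n h1 h2 hs
      ((Jt_Z_succ (n + 1)).trans
        (congrArg (fun s => zstep (kx K) s (Jt (Z K (n + 1)))) hpow)) (kiota_succ (n := n + 1) rfl rfl hi h)
      (Jt_P_absorb (n + 1)) (P_kiota (n + 2) i h) (Jt_P_Z (n + 2)) (Jt_P_lastCap n)
      (lastCup_kiota n i h) (ih _ rfl)

theorem whiskerLeft_sq_zero {M : Type u} [Category.{v} M] [MonoidalCategory M] [Preadditive M]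
    [MonoidalPreadditive M] {c : M} {x : c ⟶ c} (h : x ≫ x = 0) (X : M) :
    X ◁ x ≫ X ◁ x = 0 := by
  rw [← MonoidalCategory.whiskerLeft_comp, h, MonoidalPreadditive.whiskerLeft_zero]

theorem P_comp_mem {n : ℕ} {i : ZMod 2} {f : kpw K n ⟶ kk K i}
    (hf : f ∈ W K (BWord.pow () n) i) : Jt (P K n) ≫ f ∈ zspan K n i := by
  induction n generalizing i with
  | zero =>
    rw [P_zero, Jt_id]
    refine (congrArg (· ∈ zspan K 0 i) (Category.id_comp f)).mpr ?_
    exact W_unit_ind i LinearMap.id _ (fun h => iterate_mem_zspan h 0) f hf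
  | succ n ih =>
    obtain ⟨N, hN⟩ : ∃ N : Submodule K (kpw K n ⊗ kc K ⟶ kk K i), N = zspan K (n + 1) i := ⟨_, rfl⟩
    refine (congrArg (fun N : Submodule K (kpw K n ⊗ kc K ⟶ kk K i) =>
      (Jt (P K (n + 1)) : kpw K n ⊗ kc K ⟶ kpw K n ⊗ kc K) ≫ f ∈ N) hN).mp ?_
    refine W_tensor_ind (X := BWord.pow () n) (Y := DTm.c) i (Linear.leftComp K (kk K i)
      (Jt (P K (n + 1)) : kpw K n ⊗ kc K ⟶ kpw K n ⊗ kc K)) (N) ?_ f hf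
    intro j l hjl a ha b hb
    have e1 : (Jt (P K (n + 1)) : kpw K n ⊗ kc K ⟶ kpw K n ⊗ kc K) ≫ (a ⊗ₘ b) ≫ kmul j l i hjl =
        (Jt (P K (n + 1)) : kpw K n ⊗ kc K ⟶ kpw K n ⊗ kc K) ≫
          ((Jt (P K n) ≫ a) ⊗ₘ b) ≫ kmul j l i hjl :=
      (congrArg (fun u => u ≫ (a ⊗ₘ b) ≫ kmul j l i hjl) (Jt_P_absorb n)).symm.trans
        ((Category.assoc _ _ _).trans (congrArg (fun u => (Jt (P K (n + 1)) :
          kpw K n ⊗ kc K ⟶ kpw K n ⊗ kc K) ≫ u) (whiskerRight_tensorHom_comp _ _ _ _)))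
    refine (congrArg (· ∈ N) e1).mpr ?_
    have ha' := ih ha
    generalize Jt (P K n) ≫ a = a' at ha'
    refine (Submodule.span_le (p := (N).comap ((Linear.leftComp K (kk K i)
      (Jt (P K (n + 1)) : kpw K n ⊗ kc K ⟶ kpw K n ⊗ kc K)) ∘ₗ
      (Linear.rightComp K (kpw K n ⊗ kc K) (kmul j l i hjl)) ∘ₗ (tensR K b (kpw K n) (kk K j))))).2 ?_ ha'
    rintro _ ⟨hn, m, rfl⟩
    have main : ∀ (h1 : ((1 : ℕ) : ZMod 2) = l),
        (Jt (P K (n + 1)) : kpw K n ⊗ kc K ⟶ kpw K n ⊗ kc K) ≫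
          (((fun g => Jt (Z K n) ≫ g)^[m] (kiota n j hn)) ⊗ₘ kic l h1) ≫ kmul j l i hjl ∈
            N ∧
        (Jt (P K (n + 1)) : kpw K n ⊗ kc K ⟶ kpw K n ⊗ kc K) ≫
          (((fun g => Jt (Z K n) ≫ g)^[m] (kiota n j hn)) ⊗ₘ (kx K ≫ kic l h1)) ≫ kmul j l i hjl ∈
            N := by
      intro h1
      have hk : ((n + 1 : ℕ) : ZMod 2) = i := by rw [← hjl, ← hn, ← h1]; push_cast; rfl
      have key := iterate_mem (T := kpw K n ⊗ kc K) (s := (-1 : K) ^ n)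
        (z' := Jt (Z K n) ▷ kc K) (b := kpw K n ◁ kx K)
        (Jt_Z_succ n) (whisker_exchange _ _).symm (whiskerLeft_sq_zero kdotRel.sq _)
        (Jt_P_Z (n + 1)) (P_kiota (n + 1) i hk) (last_dot_kiota n i hk) N
        (hN ▸ iterate_mem_zspan hk 0) (fun g hg => by subst hN; exact comp_zspan hg) m
      have e2 := kiota_succ (K := K) hn h1 hjl hk
      have e3 : ∀ u v : kpw K n ⊗ kc K ⟶ kk K i, u = v →
          (Jt (P K (n + 1)) : kpw K n ⊗ kc K ⟶ kpw K n ⊗ kc K) ≫ v ∈ N →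
          (Jt (P K (n + 1)) : kpw K n ⊗ kc K ⟶ kpw K n ⊗ kc K) ≫ u ∈ N := by
        rintro u _ rfl h
        exact h
      refine ⟨e3 _ _ ((iterate_whiskerRight _ _ _ _ m).trans (congrArg
        (fun g => Jt (Z K n) ▷ kc K ≫ g)^[m] e2.symm)) key.1, e3 _ _
        ((iterate_whiskerRight _ _ _ _ m).trans (congrArg (fun g => Jt (Z K n) ▷ kc K ≫ g)^[m]
          ?_)) key.2⟩
      exact (congrArg (fun u => u ≫ kmul j l i hjl) (tensorHom_comp_right _ _ _)).trans
        ((Category.assoc _ _ _).trans (congrArg (fun u => kpw K n ◁ kx K ≫ u) e2.symm))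
    refine W_c_ind l ((Linear.leftComp K (kk K i) (Jt (P K (n + 1)) :
      kpw K n ⊗ kc K ⟶ kpw K n ⊗ kc K)) ∘ₗ (Linear.rightComp K (kpw K n ⊗ kc K) (kmul j l i hjl)) ∘ₗ
      (tensL K ((fun g => Jt (Z K n) ≫ g)^[m] (kiota n j hn)) (kc K) (kk K l)))
      (N) (fun h1 => (main h1).1) (fun h1 => (main h1).2) b hb

end Proj

end KPre

end

noncomputable section

namespace KPre

open Tot GrCat GrMonCat CategoryTheory.MonoidalCategory TLGen DTL

section Extend

variable {K : Type u} [Field K]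

/-- The tensor product of Jones-Wenzl projectors on the source of a canonical inclusion. -/
def prg : ∀ (S : KPre) (a : Lev S), Hom K (dom S a) (dom S a) 0
  | .unit, _ => GrCat.idm (K := K) (C := DTL) BWord.unit
  | .of .c, _ => GrCat.idm (K := K) (C := DTL) DTL.c
  | .of (.κ _), n => jw K n.1
  | .tensor S T, a => tHom (K := K) (C := DTL) (prg S a.1) (prg T a.2) (add_zero 0)

def kpr (S : BWord KLetter) (a : Lev S) : kob K (BWord.J (dom S a)) ⟶ kob K (BWord.J (dom S a)) :=
  Jt (hom (K := K) (C := DTL) (prg S a))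

theorem kpr_tensor (S T : BWord KLetter) (a : Lev S) (b : Lev T) :
    kpr (K := K) (S.tensor T) (a, b) = kpr S a ⊗ₘ kpr T b :=
  (congrArg (Jt (X := (dom S a).tensor (dom T b)) (Y := (dom S a).tensor (dom T b)))
    (hom_tHom (C := DTL) (prg S a) (prg T b) (add_zero 0))).trans (Jt_tensorHom _ _)

theorem kpr_c (a : Lev (BWord.of KLetter.c)) : kpr (K := K) (BWord.of KLetter.c) a = 𝟙 (kc K) :=
  Jt_id _

theorem kpr_unit (a : Lev .unit) : kpr (K := K) .unit a = 𝟙 (𝟙_ (Tot K KPre)) := Jt_id _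

/-- After composition with the projectors, morphisms to `T` extend along the canonical inclusions
into `S`. -/
def Extends (S T : BWord KLetter) : Prop := ∀ (a : Lev S) (t : kob K (BWord.J (dom S a)) ⟶ kob K T),
  ∃ D : kob K S ⟶ kob K T, kpr S a ≫ t = kincl S a ≫ D

theorem tensorHom_absorb {M : Type u} [Category.{v} M] [MonoidalCategory M] {A A' B B' C D E : M}
    {p : A ⟶ A} {q : B ⟶ B} {a : A ⟶ C} {b : B ⟶ D} {k : A ⟶ A'} {l : B ⟶ B'} {a' : A' ⟶ C}
    {b' : B' ⟶ D} (h : p ≫ a = k ≫ a') (h' : q ≫ b = l ≫ b') (m : C ⊗ D ⟶ E) :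
    (p ⊗ₘ q) ≫ (a ⊗ₘ b) ≫ m = (k ⊗ₘ l) ≫ (a' ⊗ₘ b') ≫ m := by
  rw [← Category.assoc, ← Category.assoc, MonoidalCategory.tensorHom_comp_tensorHom,
    MonoidalCategory.tensorHom_comp_tensorHom, h, h']

theorem extend_tensor_left {M : Type u} [Category.{v} M] [MonoidalCategory M] {X S A A' B B' : M}
    {p : X ⟶ X} {k : X ⟶ S} {t : X ⟶ A' ⊗ B'} {D : X ⟶ A ⊗ B} {a : A ⟶ A'} {b : B ⟶ B'}
    {E : S ⟶ A' ⊗ B} (h : t = D ≫ (a ⊗ₘ b)) (hE : p ≫ D ≫ a ▷ B = k ≫ E) :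
    p ≫ t = k ≫ E ≫ A' ◁ b := by
  rw [h, MonoidalCategory.tensorHom_def, ← Category.assoc k, ← hE]
  simp only [Category.assoc]

theorem extend_tensor_right {M : Type u} [Category.{v} M] [MonoidalCategory M] {X S A A' B B' : M}
    {p : X ⟶ X} {k : X ⟶ S} {t : X ⟶ A' ⊗ B'} {D : X ⟶ A ⊗ B} {a : A ⟶ A'} {b : B ⟶ B'}
    {E : S ⟶ A ⊗ B'} (h : t = D ≫ (a ⊗ₘ b)) (hE : p ≫ D ≫ A ◁ b = k ≫ E) :
    p ≫ t = k ≫ E ≫ a ▷ B' := by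
  rw [h, MonoidalCategory.tensorHom_def', ← Category.assoc k, ← hE]
  simp only [Category.assoc]

variable [CharZero K]

theorem extends_W (S : BWord KLetter) (a : Lev S) (i : ZMod 2)
    (f : kob K (BWord.J (dom S a)) ⟶ kk K i) (hf : f ∈ W K (dom S a) i) :
    ∃ D : kob K S ⟶ kk K i, kpr S a ≫ f = kincl S a ≫ D := by
  induction S generalizing i with
  | unit => exact ⟨f, (congrArg (fun u => u ≫ f) (kpr_unit a))⟩
  | of l =>
    cases l with
    | c => exact ⟨f, (congrArg (fun u => u ≫ f) (kpr_c a))⟩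
    | κ j =>
      obtain ⟨n, hn⟩ := a
      have h := P_comp_mem (n := n) hf
      have h2 : Jt (P K n) ≫ f ∈ LinearMap.range (Linear.leftComp K (kk K i) (kiota (K := K) n j hn)) := by
        refine Submodule.span_le.2 ?_ h
        rintro _ ⟨hi, l, rfl⟩
        obtain rfl : j = i := by rw [← hn, ← hi]
        obtain ⟨w, hw⟩ := iterate_comp_right (kiota_ky (K := K) n j hi) l
        exact ⟨w, hw.symm⟩
      obtain ⟨D, hD⟩ := h2
      exact ⟨D, hD.symm⟩
  | tensor S T ih ih' =>
    obtain ⟨a, b⟩ := a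
    have h2 := W_tensor_ind (X := dom S a) (Y := dom T b) i (Linear.leftComp K (kk K i)
      (kpr S a ⊗ₘ kpr T b)) (LinearMap.range (Linear.leftComp K (kk K i)
      (kincl S a ⊗ₘ kincl T b))) ?_ f hf
    · obtain ⟨D, hD⟩ := h2
      refine ⟨D, ?_⟩
      refine (congrArg (fun u => u ≫ f) (kpr_tensor S T a b)).trans (hD.symm.trans ?_)
      exact congrArg (fun u => u ≫ D) (kincl_tensor S T a b).symm
    · intro p q hpq s hs t ht
      obtain ⟨D, hD⟩ := ih a p s hs
      obtain ⟨D', hD'⟩ := ih' b q t ht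
      exact ⟨(D ⊗ₘ D') ≫ kmul p q i hpq, (tensorHom_absorb hD hD' _).symm⟩

theorem extends_kirby (S : BWord KLetter) (i : ZMod 2) : Extends (K := K) S (kw i) :=
  fun a t => extends_W S a i t (mem_W (X := dom S a) t)

theorem Extends.trans {S T T' : BWord KLetter} (h : Extends (K := K) S T) (f : kob K T ⟶ kob K T')
    (g : kob K T' ⟶ kob K T) (hgf : g ≫ f = 𝟙 _) : Extends (K := K) S T' := by
  intro a t
  obtain ⟨D, hD⟩ := h a (t ≫ g)
  refine ⟨D ≫ f, ?_⟩
  rw [← Category.assoc, ← hD, Category.assoc, Category.assoc, hgf, Category.comp_id]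

theorem extends_tensor_c {T : BWord KLetter} (h : ∀ S, Extends (K := K) S T) (S : BWord KLetter) :
    Extends (K := K) S (T.tensor (.of .c)) := by
  intro a t
  obtain ⟨D, hD⟩ := h (S.tensor (.of .c)) (a, ())
    ((t : _ ⟶ kob K T ⊗ kc K) ▷ kc K ≫ lastCap (c := kc K) (kcap K) (kob K T))
  exact ⟨_, bend_right (kzigL (K := K)) ((congrArg (fun u => u ≫ t ▷ kc K ≫ lastCap (c := kc K) (kcap K) (kob K T))
    ((kpr_tensor S (.of .c) a ()).trans (congrArg (fun u => kpr S a ⊗ₘ u) (kpr_c ())))).symm.trans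
    (hD.trans (congrArg (fun u => u ≫ D) (kincl_tensor S (.of .c) a ()))))⟩

theorem extends_c_tensor {T : BWord KLetter} (h : ∀ S, Extends (K := K) S T) (S : BWord KLetter) :
    Extends (K := K) S (.tensor (.of .c) T) := by
  intro a t
  obtain ⟨D, hD⟩ := h (.tensor (.of .c) S) ((), a)
    (kc K ◁ (t : _ ⟶ kc K ⊗ kob K T) ≫ (α_ (kc K) (kc K) (kob K T)).inv ≫ kcap K ▷ kob K T ≫
      (λ_ (kob K T)).hom)
  exact ⟨_, bend_left (kzigR (K := K)) ((congrArg (fun u => u ≫ kc K ◁ t ≫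
    (α_ (kc K) (kc K) (kob K T)).inv ≫ kcap K ▷ kob K T ≫ (λ_ (kob K T)).hom)
    ((kpr_tensor (.of .c) S () a).trans (congrArg (fun u => u ⊗ₘ kpr S a) (kpr_c ())))).symm.trans
    (hD.trans (congrArg (fun u => u ≫ D) (kincl_tensor (.of .c) S () a))))⟩

theorem extends_tensor_finite {T : BWord KLetter} (h : ∀ S, Extends (K := K) S T) (Y : BWord Unit)
    (S : BWord KLetter) : Extends (K := K) S (T.tensor Y.J) := by
  induction Y generalizing S T with
  | unit =>
    exact (h S).trans (T' := T.tensor .unit) (ρ_ (kob K T)).inv (ρ_ (kob K T)).hom (Iso.hom_inv_id _)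
  | of _ => exact extends_tensor_c h S
  | tensor Y Y' ih ih' =>
    exact (ih' (ih h) S).trans (T := (T.tensor Y.J).tensor Y'.J) (T' := T.tensor (Y.J.tensor Y'.J))
      (α_ (kob K T) (kob K Y.J) (kob K Y'.J)).hom (α_ (kob K T) (kob K Y.J) (kob K Y'.J)).inv
      (Iso.inv_hom_id _)

theorem extends_finite_tensor {T : BWord KLetter} (h : ∀ S, Extends (K := K) S T) (Y : BWord Unit)
    (S : BWord KLetter) : Extends (K := K) S (Y.J.tensor T) := by
  induction Y generalizing S T with
  | unit =>
    exact (h S).trans (T' := .tensor .unit T) (λ_ (kob K T)).inv (λ_ (kob K T)).hom (Iso.hom_inv_id _)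
  | of _ => exact extends_c_tensor h S
  | tensor Y Y' ih ih' =>
    exact (ih (ih' h) S).trans (T := Y.J.tensor (Y'.J.tensor T)) (T' := (Y.J.tensor Y'.J).tensor T)
      (α_ (kob K Y.J) (kob K Y'.J) (kob K T)).inv (α_ (kob K Y.J) (kob K Y'.J) (kob K T)).hom
      (Iso.hom_inv_id _)

/-- The word contains a Kirby object. -/
def HasKirby : BWord KLetter → Prop
  | .unit => False
  | .of .c => False
  | .of (.κ _) => True
  | .tensor S T => HasKirby S ∨ HasKirby T

theorem extends_of_hasKirby {T : BWord KLetter} (hT : HasKirby T) (S : BWord KLetter) :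
    Extends (K := K) S T := by
  induction T generalizing S with
  | unit => exact hT.elim
  | of l =>
    cases l with
    | c => exact hT.elim
    | κ i => exact extends_kirby S i
  | tensor T T' ih ih' =>
    intro a t
    obtain ⟨⟨b, b'⟩, D, hD⟩ := jfac_all (X := dom S a) t
    have hD' : t = Jt D ≫ (kincl T b ⊗ₘ kincl T' b') :=
      hD.trans (congrArg (fun u => Jt D ≫ u) (kincl_tensor T T' b b'))
    rcases hT with hT | hT
    · obtain ⟨E, hE⟩ := extends_tensor_finite (ih hT) (dom T' b') S a
        (Jt D ≫ kincl T b ▷ kob K (BWord.J (dom T' b')))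
      refine ⟨E ≫ kob K T ◁ kincl T' b', ?_⟩
      exact extend_tensor_left (hD' : t = Jt D ≫ (kincl T b ⊗ₘ kincl T' b')) hE
    · obtain ⟨E, hE⟩ := extends_finite_tensor (ih' hT) (dom T b) S a
        (Jt D ≫ kob K (BWord.J (dom T b)) ◁ kincl T' b')
      refine ⟨E ≫ kincl T b ▷ kob K T', ?_⟩
      exact extend_tensor_right (hD' : t = Jt D ≫ (kincl T b ⊗ₘ kincl T' b')) hE

theorem kincl_iso {S : BWord KLetter} (hS : ¬ HasKirby S) (a : Lev S) :
    kpr (K := K) S a = 𝟙 _ ∧ ∃ w : kob K S ⟶ kob K (BWord.J (dom S a)), kincl S a ≫ w = 𝟙 _ := by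
  induction S with
  | unit => exact ⟨kpr_unit a, 𝟙 _, Category.comp_id _⟩
  | of l =>
    cases l with
    | c => exact ⟨kpr_c a, 𝟙 _, Category.comp_id _⟩
    | κ i => exact (hS trivial).elim
  | tensor S T ih ih' =>
    obtain ⟨a, b⟩ := a
    obtain ⟨h1, w1, h2⟩ := ih (fun h => hS (Or.inl h)) a
    obtain ⟨h3, w2, h4⟩ := ih' (fun h => hS (Or.inr h)) b
    refine ⟨(kpr_tensor S T a b).trans ?_, w1 ⊗ₘ w2, (congrArg (fun u => u ≫ (w1 ⊗ₘ w2))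
      (kincl_tensor S T a b)).trans ((MonoidalCategory.tensorHom_comp_tensorHom _ _ _ _).trans ?_)⟩
    · rw [h1, h3]
      exact MonoidalCategory.id_tensorHom_id _ _
    · rw [h2, h4]
      exact MonoidalCategory.id_tensorHom_id _ _

theorem extends_all {S T : BWord KLetter} (h : HasKirby T ∨ ¬ HasKirby S) :
    Extends (K := K) S T := by
  rcases h with h | h
  · exact extends_of_hasKirby h S
  · intro a t
    obtain ⟨h1, w, h2⟩ := kincl_iso (K := K) h a
    refine ⟨w ≫ t, ?_⟩
    rw [h1, ← Category.assoc, h2]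

/-- The homogeneous form of the extension property. -/
theorem exists_extension {S T : KPre} (h : HasKirby T ∨ ¬ HasKirby S) (a : Lev S) {k d : ℤ}
    (t : Hom K (J (dom S a)) T k) (hk : deg S a + d = k) :
    ∃ D : Hom K S T d, comp (Jm (prg S a)) t (zero_add k) = comp (incl S a) D hk := by
  obtain ⟨D, hD⟩ := extends_all (K := K) h a (hom (K := K) (C := KPre) t)
  refine ⟨component (C := KPre) d D, ?_⟩
  have h1 := component_comp (incl S a) D hk
  refine Eq.trans ?_ h1
  refine Eq.trans ?_ (congrArg (component (C := KPre) k) hD)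
  have h2 : kpr S a = hom (K := K) (C := KPre) (Jm (prg S a)) := Jt_hom _
  rw [h2]
  exact ((component_comp (Jm (prg S a)) (hom (K := K) (C := KPre) t) (zero_add k)).trans
    (congrArg (fun u => comp (Jm (prg S a)) u (zero_add k)) (component_hom t))).symm

end Extend

end KPre

end

noncomputable section

namespace Tot

open GrCat

variable {K : Type u'} [Field K] {C : Type u} [GrCat.{v} K C]

/-- A pair of inverse homogeneous morphisms as an isomorphism of the total category. -/
def isoOf {X Y : C} {k l : ℤ} (f : Hom K X Y k) (g : Hom K Y X l) (hk : k + l = 0)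
    (hl : l + k = 0) (h : comp f g hk = GrCat.idm X) (h' : comp g f hl = GrCat.idm Y) :
    o K X ≅ o K Y where
  hom := hom f
  inv := hom g
  hom_inv_id := (hom_comp f g hk).symm.trans (congrArg hom h)
  inv_hom_id := (hom_comp g f hl).symm.trans (congrArg hom h')

end Tot

namespace GrFunctor

open Tot GrCat GrMonCat CategoryTheory.MonoidalCategory

variable {K : Type u'} [Field K] {C : Type u} {C' : Type w}

section Cat

variable [GrCat.{v} K C] [GrCat.{v'} K C'] {F : C → C'} (φ : GrFunctor K F)

/-- The functor of total categories. -/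
def tot : Tot K C ⥤ Tot K C' where
  obj X := F X
  map {X Y} f := mapHom (C := C) (C' := C') (X := X) (Y := Y) (fun d => φ.map) f
  map_id X := (mapHom_hom (C := C) (C' := C') _ (GrCat.idm (K := K) (C := C) X)).trans
    (congrArg hom (φ.map_id X))
  map_comp {X Y Z} f g := mapHom_comp (C := C) (C' := C') (X := X) (Y := Y) (Z := Z)
    (fun d => φ.map) (fun d => φ.map) (fun d => φ.map) (fun f g h => φ.map_comp f g h) f g

theorem tot_hom {X Y : C} {d : ℤ} (f : Hom K X Y d) : φ.tot.map (hom f) = hom (φ.map f) :=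
  mapHom_hom _ f

end Cat

variable [GrMonCat.{v} K C] [GrMonCat.{v'} K C'] {F : C → C'} (φ : GrFunctor K F)

/-- Monoidal structure maps of a functor of graded monoidal categories. -/
structure MonData where
  eps : Hom K (unit K) (F (unit K)) 0
  epsInv : Hom K (F (unit K)) (unit K) 0
  mu : ∀ X Y : C, Hom K (tObj K (F X) (F Y)) (F (tObj K X Y)) 0
  muInv : ∀ X Y : C, Hom K (F (tObj K X Y)) (tObj K (F X) (F Y)) 0
  eps_inv : comp eps epsInv (add_zero 0) = GrCat.idm _
  inv_eps : comp epsInv eps (add_zero 0) = GrCat.idm _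
  mu_inv : ∀ X Y, comp (mu X Y) (muInv X Y) (add_zero 0) = GrCat.idm _
  inv_mu : ∀ X Y, comp (muInv X Y) (mu X Y) (add_zero 0) = GrCat.idm _
  nat : ∀ {X Y X' Y' : C} {k l m : ℤ} (f : Hom K X Y k) (g : Hom K X' Y' l) (h : k + l = m),
    comp (tHom (φ.map f) (φ.map g) h) (mu Y Y') (add_zero m) =
      comp (mu X X') (φ.map (tHom f g h)) (zero_add m)
  assoc : ∀ X Y Z : C, comp (tHom (mu X Y) (GrCat.idm (F Z)) (add_zero 0))
    (comp (mu (tObj K X Y) Z) (φ.map (aHom X Y Z)) (add_zero 0)) (add_zero 0) =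
    comp (aHom (F X) (F Y) (F Z)) (comp (tHom (GrCat.idm (F X)) (mu Y Z) (add_zero 0))
      (mu X (tObj K Y Z)) (add_zero 0)) (add_zero 0)
  left : ∀ X : C, lHom (F X) = comp (tHom eps (GrCat.idm (F X)) (add_zero 0))
    (comp (mu (unit K) X) (φ.map (lHom X)) (add_zero 0)) (add_zero 0)
  right : ∀ X : C, rHom (F X) = comp (tHom (GrCat.idm (F X)) eps (add_zero 0))
    (comp (mu X (unit K)) (φ.map (rHom X)) (add_zero 0)) (add_zero 0)

namespace MonData

variable {φ} (D : MonData φ)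

theorem hom_comp_eq {X Y Z : C} {k l m : ℤ} (f : Hom K X Y k) (g : Hom K Y Z l) (h : k + l = m)
    {p : o K X ⟶ o K Y} {q : o K Y ⟶ o K Z} (hp : hom f = p) (hq : hom g = q) :
    hom (comp f g h) = p ≫ q := by
  rw [Tot.hom_comp, hp, hq]

def muIso (X Y : C) : o K (F X) ⊗ o K (F Y) ≅ o K (F (tObj K X Y)) :=
  isoOf (C := C') (X := tObj K (F X) (F Y)) (Y := F (tObj K X Y)) (D.mu X Y) (D.muInv X Y) (add_zero 0) (add_zero 0) (D.mu_inv X Y) (D.inv_mu X Y)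

def epsIso : 𝟙_ (Tot K C') ≅ o K (F (unit K)) :=
  isoOf (C := C') (X := unit K) (Y := F (unit K)) D.eps D.epsInv (add_zero 0) (add_zero 0) D.eps_inv D.inv_eps

variable (φ) in
abbrev totMap {X Y : C} : (o K X ⟶ o K Y) →ₗ[K] (o K (F X) ⟶ o K (F Y)) :=
  mapHom fun d => φ.map

theorem totMap_hom {X Y : C} {d : ℤ} (f : Hom K X Y d) : totMap φ (hom f) = hom (φ.map f) :=
  mapHom_hom _ f

theorem nat_left {X Y : C} (f : o K X ⟶ o K Y) (X' : C) :
    totMap φ f ▷ o K (F X') ≫ (D.muIso Y X').hom =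
      (D.muIso X X').hom ≫ totMap φ (X := tObj K X X') (Y := tObj K Y X') (f ▷ o K X') := by
  induction f using hom_ind (K := K) (C := C) (X := X) (Y := Y) with
  | h0 =>
    rw [map_zero, MonoidalPreadditive.zero_whiskerRight, MonoidalPreadditive.zero_whiskerRight,
      Limits.zero_comp]
    exact ((congrArg (fun t => (D.muIso X X').hom ≫ t) (map_zero (totMap φ))).trans
      Limits.comp_zero).symm
  | h1 d f =>
    have h := D.nat f (GrCat.idm (K := K) (C := C) X') (add_zero d)
    rw [φ.map_id] at h
    replace h := congrArg hom h
    refine Eq.trans ?_ (h.trans ?_)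
    · refine Eq.symm (hom_comp_eq _ _ _ ((hom_tHom_id _ _ _).trans ?_) rfl)
      exact congrArg (fun t => t ▷ o K (F X')) (totMap_hom f).symm
    · exact hom_comp_eq _ _ _ rfl ((totMap_hom _).symm.trans
        (congrArg (totMap φ) (hom_tHom_id f X' (add_zero d))))
  | h2 f g hf hg =>
    rw [map_add, MonoidalPreadditive.add_whiskerRight, Preadditive.add_comp, hf, hg,
      ← Preadditive.comp_add, MonoidalPreadditive.add_whiskerRight]
    exact congrArg (fun t => (D.muIso X X').hom ≫ t) (map_add (totMap φ) _ _).symm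

theorem nat_right {X Y : C} (X' : C) (f : o K X ⟶ o K Y) :
    o K (F X') ◁ totMap φ f ≫ (D.muIso X' Y).hom =
      (D.muIso X' X).hom ≫ totMap φ (X := tObj K X' X) (Y := tObj K X' Y) (o K X' ◁ f) := by
  induction f using hom_ind (K := K) (C := C) (X := X) (Y := Y) with
  | h0 =>
    rw [map_zero, MonoidalPreadditive.whiskerLeft_zero, Limits.zero_comp]
    exact ((congrArg (fun t => (D.muIso X' X).hom ≫ t) ((congrArg (totMap φ)
      (MonoidalPreadditive.whiskerLeft_zero (C := Tot K C))).trans (map_zero (totMap φ)))).trans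
      Limits.comp_zero).symm
  | h1 d f =>
    have h := D.nat (GrCat.idm (K := K) (C := C) X') f (zero_add d)
    rw [φ.map_id] at h
    replace h := congrArg hom h
    refine Eq.trans ?_ (h.trans ?_)
    · refine Eq.symm (hom_comp_eq _ _ _ ((hom_id_tHom _ _ _).trans ?_) rfl)
      exact congrArg (fun t => o K (F X') ◁ t) (totMap_hom f).symm
    · exact hom_comp_eq _ _ _ rfl ((totMap_hom _).symm.trans
        (congrArg (totMap φ) (hom_id_tHom f X' (zero_add d))))
  | h2 f g hf hg =>
    rw [map_add, MonoidalPreadditive.whiskerLeft_add, Preadditive.add_comp, hf, hg,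
      ← Preadditive.comp_add]
    exact congrArg (fun t => (D.muIso X' X).hom ≫ t) ((map_add (totMap φ) _ _).symm.trans
      (congrArg (totMap φ) (MonoidalPreadditive.whiskerLeft_add (C := Tot K C) _ _).symm))

theorem assoc_tot (X Y Z : C) : (D.muIso X Y).hom ▷ o K (F Z) ≫ (D.muIso (tObj K X Y) Z).hom ≫
      φ.tot.map (α_ (o K X) (o K Y) (o K Z)).hom =
    (α_ (o K (F X)) (o K (F Y)) (o K (F Z))).hom ≫ o K (F X) ◁ (D.muIso Y Z).hom ≫
      (D.muIso X (tObj K Y Z)).hom :=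
  (hom_comp_eq _ _ _ (hom_tHom_id _ _ _) (hom_comp_eq _ _ _ rfl (φ.tot_hom _).symm)).symm.trans
    ((congrArg hom (D.assoc X Y Z)).trans (hom_comp_eq _ _ _ rfl
      (hom_comp_eq _ _ _ (hom_id_tHom _ _ _) rfl)))

theorem left_tot (X : C) : (λ_ (o K (F X))).hom =
    D.epsIso.hom ▷ o K (F X) ≫ (D.muIso (unit K) X).hom ≫ φ.tot.map (λ_ (o K X)).hom :=
  (congrArg hom (D.left X)).trans (hom_comp_eq _ _ _ (hom_tHom_id _ _ _)
    (hom_comp_eq _ _ _ rfl (φ.tot_hom _).symm))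

theorem right_tot (X : C) : (ρ_ (o K (F X))).hom =
    o K (F X) ◁ D.epsIso.hom ≫ (D.muIso X (unit K)).hom ≫ φ.tot.map (ρ_ (o K X)).hom :=
  (congrArg hom (D.right X)).trans (hom_comp_eq _ _ _ (hom_id_tHom _ _ _)
    (hom_comp_eq _ _ _ rfl (φ.tot_hom _).symm))

/-- The monoidal structure on the functor of total categories. -/
def core : φ.tot.CoreMonoidal where
  εIso := D.epsIso
  μIso X Y := D.muIso X Y
  μIso_hom_natural_left f X' := D.nat_left f X'
  μIso_hom_natural_right X' f := D.nat_right X' f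
  associativity X Y Z := D.assoc_tot X Y Z
  left_unitality X := D.left_tot X
  right_unitality X := D.right_tot X

end MonData

end GrFunctor

namespace Kar

open Tot GrCat GrMonCat CategoryTheory.MonoidalCategory

variable {K : Type u'} [Field K] {C : Type u} [GrMonCat.{v} K C]

theorem trunc_of {X Y : C} {d : ℤ} (f : Hom K X Y d) :
    (trunc (A := of K X) (B := of K Y) f).1 = f := by
  change comp (comp (GrCat.idm X) f _) (GrCat.idm Y) _ = f
  rw [id_comp, comp_id]

/-- The embedding into the idempotent completion. -/
def ofF : GrFunctor K (of K (C := C)) where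
  map {X Y d} :=
    { toFun := fun f => trunc (A := of K X) (B := of K Y) f
      map_add' := fun f g => Subtype.ext (by
        change (trunc (A := of K X) (B := of K Y) (f + g)).1 =
          (trunc (A := of K X) (B := of K Y) f).1 + (trunc (A := of K X) (B := of K Y) g).1
        rw [trunc_of, trunc_of, trunc_of])
      map_smul' := fun a f => Subtype.ext (by
        change (trunc (A := of K X) (B := of K Y) (a • f)).1 =
          a • (trunc (A := of K X) (B := of K Y) f).1
        rw [trunc_of, trunc_of]) }
  map_id X := Subtype.ext (trunc_of _)
  map_comp {X Y Z k l m} f g h := Subtype.ext (by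
    change (trunc (A := of K X) (B := of K Z) (comp f g h)).1 =
      comp (trunc (A := of K X) (B := of K Y) f).1 (trunc (A := of K Y) (B := of K Z) g).1 h
    rw [trunc_of, trunc_of, trunc_of])

theorem ofF_val {X Y : C} {d : ℤ} (f : Hom K X Y d) : ((ofF (K := K)).map f).1 = f := trunc_of f

/-- The comparison of the tensor products. -/
def ofMu (X Y : C) : Hom K (tObj (of K X) (of K Y)) (of K (GrMonCat.tObj K X Y)) 0 :=
  trunc (A := tObj (of K X) (of K Y)) (GrCat.idm (GrMonCat.tObj K X Y))

def ofMuInv (X Y : C) : Hom K (of K (GrMonCat.tObj K X Y)) (tObj (of K X) (of K Y)) 0 :=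
  trunc (B := tObj (of K X) (of K Y)) (GrCat.idm (GrMonCat.tObj K X Y))

theorem ofMu_val (X Y : C) : (ofMu (K := K) X Y).1 = GrCat.idm (GrMonCat.tObj K X Y) := by
  change comp (comp (GrMonCat.tHom (GrCat.idm X) (GrCat.idm Y) _) (GrCat.idm _) _)
    (GrCat.idm _) _ = _
  rw [comp_id, comp_id, GrMonCat.tHom_id]

theorem ofMuInv_val (X Y : C) : (ofMuInv (K := K) X Y).1 = GrCat.idm (GrMonCat.tObj K X Y) := by
  change comp (comp (GrCat.idm _) (GrCat.idm _) _)
    (GrMonCat.tHom (GrCat.idm X) (GrCat.idm Y) _) _ = _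
  rw [id_comp, id_comp, GrMonCat.tHom_id]

theorem comp_val {A B D : Kar K C} {k l m : ℤ} (f : Hom K A B k) (g : Hom K B D l) (h : k + l = m) :
    (comp f g h).1 = comp f.1 g.1 h := rfl

theorem tHom_val {A B A' B' : Kar K C} {k l m : ℤ} (f : Hom K A B k) (g : Hom K A' B' l)
    (h : k + l = m) : (GrMonCat.tHom f g h).1 = GrMonCat.tHom f.1 g.1 h := rfl

theorem idm_of_val (X : C) : (GrCat.idm (K := K) (of K X)).1 = GrCat.idm X := rfl

theorem aHom_of_val (X Y Z : C) : (aHom (K := K) (of K X) (of K Y) (of K Z)).1 = aHom X Y Z := by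
  change comp (GrMonCat.tHom (GrMonCat.tHom (GrCat.idm X) (GrCat.idm Y) _) (GrCat.idm Z) _)
    (aHom X Y Z) _ = _
  rw [GrMonCat.tHom_id, GrMonCat.tHom_id, id_comp]

theorem lHom_of_val (X : C) : (lHom (K := K) (of K X)).1 = lHom X := by
  change comp (GrMonCat.tHom (GrCat.idm _) (GrCat.idm X) _) (lHom X) _ = _
  rw [GrMonCat.tHom_id, id_comp]

theorem rHom_of_val (X : C) : (rHom (K := K) (of K X)).1 = rHom X := by
  change comp (GrMonCat.tHom (GrCat.idm X) (GrCat.idm _) _) (rHom X) _ = _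
  rw [GrMonCat.tHom_id, id_comp]

def ofData : (ofF (K := K) (C := C)).MonData where
  eps := GrCat.idm _
  epsInv := GrCat.idm _
  mu := ofMu
  muInv := ofMuInv
  eps_inv := id_comp _ _
  inv_eps := id_comp _ _
  mu_inv X Y := Subtype.ext (by
    erw [comp_val, ofMu_val, ofMuInv_val, id_comp]
    exact (GrMonCat.tHom_id _ _ _).symm)
  inv_mu X Y := Subtype.ext (by erw [comp_val, ofMu_val, ofMuInv_val, id_comp]; rfl)
  nat f g h := Subtype.ext (by
    erw [comp_val, comp_val, tHom_val, ofF_val, ofF_val, ofF_val, ofMu_val, ofMu_val, comp_id,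
        id_comp])
  assoc X Y Z := Subtype.ext (by
    erw [comp_val, comp_val, comp_val, comp_val, tHom_val, tHom_val, ofF_val, ofMu_val, ofMu_val,
        ofMu_val, ofMu_val, idm_of_val, idm_of_val, GrMonCat.tHom_id, GrMonCat.tHom_id, id_comp,
        id_comp, id_comp, comp_id, aHom_of_val])
  left X := Subtype.ext (by
    erw [comp_val, comp_val, tHom_val, ofF_val, ofMu_val, idm_of_val, lHom_of_val, id_comp]
    refine (id_comp _ _).symm.trans (congrArg (fun t => comp t (lHom X) _) ?_)
    exact (GrMonCat.tHom_id _ _ _).symm)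
  right X := Subtype.ext (by
    erw [comp_val, comp_val, tHom_val, ofF_val, ofMu_val, idm_of_val, rHom_of_val, id_comp]
    refine (id_comp _ _).symm.trans (congrArg (fun t => comp t (rHom X) _) ?_)
    exact (GrMonCat.tHom_id _ _ _).symm)

end Kar

end

noncomputable section

namespace Tot

open CategoryTheory.MonoidalCategory

variable {M : Type u} [Category.{v} M] [MonoidalCategory M]

theorem assoc_of_id (X Y Z : M) {p : X ⊗ Y ⟶ X ⊗ Y} {q : Z ⟶ Z} {r : (X ⊗ Y) ⊗ Z ⟶ (X ⊗ Y) ⊗ Z}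
    {a a' : (X ⊗ Y) ⊗ Z ⟶ X ⊗ Y ⊗ Z} {p' : X ⟶ X} {q' : Y ⊗ Z ⟶ Y ⊗ Z}
    {r' : X ⊗ Y ⊗ Z ⟶ X ⊗ Y ⊗ Z} (hp : p = 𝟙 _) (hq : q = 𝟙 _) (hr : r = 𝟙 _)
    (ha : a = (α_ X Y Z).hom) (ha' : a' = (α_ X Y Z).hom) (hp' : p' = 𝟙 _) (hq' : q' = 𝟙 _)
    (hr' : r' = 𝟙 _) : (p ⊗ₘ q) ≫ r ≫ a = a' ≫ (p' ⊗ₘ q') ≫ r' := by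
  subst hp hq hr ha ha' hp' hq' hr'
  simp

theorem left_of_id (X : M) {p : 𝟙_ M ⟶ 𝟙_ M} {q : X ⟶ X} {r : 𝟙_ M ⊗ X ⟶ 𝟙_ M ⊗ X}
    {a a' : 𝟙_ M ⊗ X ⟶ X} (hp : p = 𝟙 _) (hq : q = 𝟙 _) (hr : r = 𝟙 _)
    (ha : a = (λ_ X).hom) (ha' : a' = (λ_ X).hom) : a' = (p ⊗ₘ q) ≫ r ≫ a := by
  subst hp hq hr ha ha'
  simp

theorem right_of_id (X : M) {p : 𝟙_ M ⟶ 𝟙_ M} {q : X ⟶ X} {r : X ⊗ 𝟙_ M ⟶ X ⊗ 𝟙_ M}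
    {a a' : X ⊗ 𝟙_ M ⟶ X} (hp : p = 𝟙 _) (hq : q = 𝟙 _) (hr : r = 𝟙 _)
    (ha : a = (ρ_ X).hom) (ha' : a' = (ρ_ X).hom) : a' = (q ⊗ₘ p) ≫ r ≫ a := by
  subst hp hq hr ha ha'
  simp

end Tot

namespace MatCat

open Tot GrCat GrMonCat CategoryTheory.MonoidalCategory

variable {K : Type u'} [Field K] {C : Type u}

section Cat

variable [GrCat.{v} K C]

theorem ent_comp {A B D : MatCat C} [Unique B.ι] {k l m : ℤ} (f : Hom K A B k) (g : Hom K B D l)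
    (h : k + l = m) (i : A.ι) (j : D.ι) :
    hom (comp f g h i j) = hom (f i default) ≫ hom (g default j) := by
  change hom (mComp f g h i j) = _
  rw [mComp, Fintype.sum_unique, Tot.hom_comp]

theorem ent_idm (A : MatCat C) (i : A.ι) : hom (GrCat.idm (K := K) A i i) = 𝟙 (o K (A.X i)) := by
  change hom (mId A i i) = _
  exact (congrArg hom (mono_apply (Equiv.refl _) _ i)).trans (hom_dcast _ _)

theorem ent_ext {A B : MatCat C} {d : ℤ} {f g : Hom K A B d}
    (h : ∀ i j, hom (f i j) = hom (g i j)) : f = g :=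
  funext fun i => funext fun j => hom_inj (h i j)

theorem ent_single {k l d : ℤ} {X Y : C} {m : ℤ} (f : Hom K X Y m) (h : m = d + k - l) (i j) :
    hom (singleHom (k := k) (l := l) f h i j) = hom f := hom_dcast _ _

theorem single_comp {k l p d e m n r s : ℤ} {X Y Z : C} (f : Hom K X Y m) (g : Hom K Y Z n)
    (hf : m = d + k - l) (hg : n = e + l - p) (h : d + e = r) (h' : m + n = s)
    (hs : s = r + k - p) :
    comp (singleHom f hf) (singleHom g hg) h = singleHom (comp f g h') hs := by
  refine ent_ext fun i j => ?_
  rw [ent_comp (B := single l Y), ent_single, ent_single, ent_single, Tot.hom_comp]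

/-- A morphism as a morphism between one-term sums. -/
def sHom {X Y : C} {d : ℤ} (f : Hom K X Y d) : Hom K (single 0 X) (single 0 Y) d :=
  singleHom f (by simp)

theorem ent_sHom {X Y : C} {d : ℤ} (f : Hom K X Y d) (i j) :
    hom (sHom f i j) = hom f := ent_single _ _ _ _

/-- The embedding as one-term sums. -/
def singleF : GrFunctor K (single (C := C) 0) where
  map {X Y d} :=
    { toFun := sHom
      map_add' := fun f g => ent_ext fun i j => by
        refine (ent_sHom _ i j).trans ((map_add hom f g).trans (Eq.trans ?_
          (map_add hom (sHom f i j) (sHom g i j)).symm))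
        rw [ent_sHom, ent_sHom]
      map_smul' := fun a f => ent_ext fun i j => by
        refine (ent_sHom _ i j).trans ((LinearMap.map_smul hom a f).trans (Eq.trans ?_
          (LinearMap.map_smul hom a (sHom f i j)).symm))
        rw [ent_sHom] }
  map_id X := ent_ext fun i j => (ent_sHom _ _ _).trans (ent_idm (single 0 X) ()).symm
  map_comp f g h := (single_comp _ _ _ _ _ h _).symm

theorem ent_singleF {X Y : C} {d : ℤ} (f : Hom K X Y d) (i j) :
    hom (singleF.map f i j) = hom f := ent_sHom _ _ _

theorem singleF_surjective {X Y : C} {d : ℤ} (f : Hom K (single 0 X) (single 0 Y) d) :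
    ∃ g : Hom K X Y d, singleF.map g = f :=
  ⟨dcast (by simp) (f () ()), ent_ext fun i j => (ent_singleF _ i j).trans (hom_dcast _ _)⟩

theorem singleF_injective {X Y : C} {d : ℤ} {f g : Hom K X Y d}
    (h : singleF.map f = singleF.map g) : f = g :=
  hom_inj ((ent_singleF f () ()).symm.trans ((congrArg (fun t => hom (t () ())) h).trans
    (ent_singleF g () ())))

end Cat

variable [GrMonCat.{v} K C]

theorem ent_tHom {A B A' B' : MatCat C} {k l m : ℤ} (f : Hom K A B k) (g : Hom K A' B' l)
    (h : k + l = m) (i : A.ι × A'.ι) (j : B.ι × B'.ι) :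
    hom (GrMonCat.tHom f g h i j) = hom (f i.1 j.1) ⊗ₘ hom (g i.2 j.2) :=
  hom_tHom _ _ _

theorem ent_aHom (A B D : MatCat C) (i : (A.ι × B.ι) × D.ι) :
    hom (aHom (K := K) A B D i (i.1.1, i.1.2, i.2)) =
      (α_ (o K (A.X i.1.1)) (o K (B.X i.1.2)) (o K (D.X i.2))).hom :=
  (congrArg hom (mono_apply (A := tObj K (tObj K A B) D) (B := tObj K A (tObj K B D))
    (Equiv.prodAssoc _ _ _) (fun i => dcast (by simp only [Equiv.prodAssoc_apply]; omega)
      (aHom (A.X i.1.1) (B.X i.1.2) (D.X i.2))) i)).trans (hom_dcast _ _)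

theorem ent_lHom (A : MatCat C) (i : Unit × A.ι) :
    hom (lHom (K := K) A i i.2) = (λ_ (o K (A.X i.2))).hom :=
  (congrArg hom (mono_apply (A := tObj K (mUnit K C) A) (B := A)
    (Equiv.punitProd _) (fun i => dcast (by simp) (lHom (A.X i.2))) i)).trans (hom_dcast _ _)

theorem ent_rHom (A : MatCat C) (i : A.ι × Unit) :
    hom (rHom (K := K) A i i.1) = (ρ_ (o K (A.X i.1))).hom :=
  (congrArg hom (mono_apply (A := tObj K A (mUnit K C)) (B := A)
    (Equiv.prodPUnit _) (fun i => dcast (by simp) (rHom (A.X i.1))) i)).trans (hom_dcast _ _)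

instance {α β : Type} [Unique α] [Unique β] : Unique (α × β) where
  default := (default, default)
  uniq i := Prod.ext (Subsingleton.elim _ _) (Subsingleton.elim _ _)

def singleMu (X Y : C) :
    Hom K (MatCat.tObj K (single 0 X) (single 0 Y)) (single 0 (GrMonCat.tObj K X Y)) 0 :=
  fun _ _ => dcast (by simp) (GrCat.idm (GrMonCat.tObj K X Y))

def singleMuInv (X Y : C) :
    Hom K (single 0 (GrMonCat.tObj K X Y)) (MatCat.tObj K (single 0 X) (single 0 Y)) 0 :=
  fun _ _ => dcast (by simp) (GrCat.idm (GrMonCat.tObj K X Y))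

theorem ent_singleMu (X Y : C) (i j) :
    hom (singleMu (K := K) X Y i j) = 𝟙 (o K (GrMonCat.tObj K X Y)) := hom_dcast _ _

theorem ent_singleMuInv (X Y : C) (i j) :
    hom (singleMuInv (K := K) X Y i j) = 𝟙 (o K (GrMonCat.tObj K X Y)) := hom_dcast _ _

def singleData : (singleF (K := K) (C := C)).MonData where
  eps := GrCat.idm (C := MatCat C) (single 0 (unit K))
  epsInv := GrCat.idm (C := MatCat C) (single 0 (unit K))
  mu := singleMu
  muInv := singleMuInv
  eps_inv := id_comp (C := MatCat C) _ _
  inv_eps := id_comp (C := MatCat C) _ _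
  mu_inv X Y := ent_ext (A := MatCat.tObj K (single 0 X) (single 0 Y)) fun i j => by
    obtain rfl : i = j := Subsingleton.elim (α := Unit × Unit) i j
    refine (ent_comp (A := MatCat.tObj K (single 0 X) (single 0 Y)) (B := single 0 (GrMonCat.tObj K X Y))
      _ _ _ _ _).trans (Eq.trans ?_ (ent_idm (MatCat.tObj K (single 0 X) (single 0 Y)) i).symm)
    rw [ent_singleMu, ent_singleMuInv]
    exact Category.comp_id _
  inv_mu X Y := ent_ext fun i j => by
    obtain rfl : i = j := Subsingleton.elim (α := Unit) i j
    refine (ent_comp (B := MatCat.tObj K (single 0 X) (single 0 Y)) (A := single 0 (GrMonCat.tObj K X Y))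
      _ _ _ _ _).trans (Eq.trans ?_ (ent_idm (single 0 (GrMonCat.tObj K X Y)) i).symm)
    rw [ent_singleMu, ent_singleMuInv]
    exact Category.comp_id _
  nat {X Y X' Y' k l m} f g h := ent_ext (A := MatCat.tObj K (single 0 X) (single 0 X')) fun i j => by
    refine (ent_comp (A := MatCat.tObj K (single 0 X) (single 0 X')) (B := MatCat.tObj K (single 0 Y)
      (single 0 Y')) _ _ _ _ _).trans (Eq.trans ?_ (ent_comp (A := MatCat.tObj K (single 0 X)
      (single 0 X')) (B := single 0 (GrMonCat.tObj K X X')) _ _ _ _ _).symm)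
    rw [ent_singleMu, ent_singleMu, ent_singleF, ent_tHom, ent_singleF, ent_singleF, hom_tHom]
    exact (Category.comp_id _).trans (Category.id_comp _).symm
  assoc X Y Z := ent_ext (A := MatCat.tObj K (MatCat.tObj K (single 0 X) (single 0 Y)) (single 0 Z))
    fun i j => by
    refine (ent_comp (A := MatCat.tObj K (MatCat.tObj K (single 0 X) (single 0 Y)) (single 0 Z))
      (B := MatCat.tObj K (single 0 (GrMonCat.tObj K X Y)) (single 0 Z)) _ _ _ _ _).trans (Eq.trans ?_
      (ent_comp (A := MatCat.tObj K (MatCat.tObj K (single 0 X) (single 0 Y)) (single 0 Z))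
        (B := MatCat.tObj K (single 0 X) (MatCat.tObj K (single 0 Y) (single 0 Z))) _ _ _ _ _).symm)
    rw [ent_comp (A := MatCat.tObj K (single 0 (GrMonCat.tObj K X Y)) (single 0 Z))
      (B := single 0 (GrMonCat.tObj K (GrMonCat.tObj K X Y) Z)), ent_comp
      (A := MatCat.tObj K (single 0 X) (MatCat.tObj K (single 0 Y) (single 0 Z)))
      (B := MatCat.tObj K (single 0 X) (single 0 (GrMonCat.tObj K Y Z))), ent_tHom, ent_tHom]
    exact assoc_of_id (o K X) (o K Y) (o K Z) (ent_singleMu X Y _ _) (ent_idm (single 0 Z) ())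
      (ent_singleMu _ _ _ _) (ent_singleF _ _ _) (ent_aHom (single 0 X) (single 0 Y) (single 0 Z) i)
      (ent_idm (single 0 X) ()) (ent_singleMu _ _ _ _) (ent_singleMu _ _ _ _)
  left X := ent_ext (A := MatCat.tObj K (mUnit K C) (single 0 X)) fun i j => by
    refine Eq.trans ?_ (ent_comp (A := MatCat.tObj K (mUnit K C) (single 0 X))
      (B := MatCat.tObj K (mUnit K C) (single 0 X)) _ _ _ _ _).symm
    rw [ent_comp (A := MatCat.tObj K (mUnit K C) (single 0 X))
      (B := single 0 (GrMonCat.tObj K (unit K) X)), ent_tHom]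
    exact left_of_id (o K X) (ent_idm (single 0 (unit K)) ()) (ent_idm (single 0 X) ())
      (ent_singleMu _ _ _ _) (ent_singleF _ _ _) (ent_lHom (single 0 X) i)
  right X := ent_ext (A := MatCat.tObj K (single 0 X) (mUnit K C)) fun i j => by
    refine Eq.trans ?_ (ent_comp (A := MatCat.tObj K (single 0 X) (mUnit K C))
      (B := MatCat.tObj K (single 0 X) (mUnit K C)) _ _ _ _ _).symm
    rw [ent_comp (A := MatCat.tObj K (single 0 X) (mUnit K C))
      (B := single 0 (GrMonCat.tObj K X (unit K))), ent_tHom]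
    exact right_of_id (o K X) (ent_idm (single 0 (unit K)) ()) (ent_idm (single 0 X) ())
      (ent_singleMu _ _ _ _) (ent_singleF _ _ _) (ent_rHom (single 0 X) i)

end MatCat

namespace IndC

open Tot GrCat GrMonCat CategoryTheory.MonoidalCategory Colim

variable {K : Type u'} [Field K] {C : Type u}

section Cat

variable [GrCat.{v} K C]

/-- The embedding as constant systems. -/
def constF : GrFunctor K (const (K := K) (C := C)) where
  map {X Y d} :=
    { toFun := fun f => constHom f
      map_add' := fun f g => hom_ext fun i => map_add (of (β := const Y) ⟨()⟩) f g
      map_smul' := fun a f => hom_ext fun i => LinearMap.map_smul (of (β := const Y) ⟨()⟩) a f }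
  map_id X := rfl
  map_comp {X Y Z k l m} f g h := hom_ext fun i => ((post_of (β := const Y) (γ := const Z) h
    (constHom g) ⟨()⟩ f).trans (pre_of (β := const Z) h f ⟨()⟩ g)).symm

theorem constF_val {X Y : C} {d : ℤ} (f : Hom K X Y d) (i) :
    (constF.map f).1 i = of (β := const Y) ⟨()⟩ f := rfl

/-- The morphism from a constant system given by a class. -/
def desc {A : C} {β : IndC K C} {d : ℤ} (x : Colim A β d) : Hom K (const (K := K) A) β d :=
  ⟨fun _ => x, by
    rintro ⟨⟨⟩⟩ ⟨⟨⟩⟩ ⟨⟨⟨⟩⟩⟩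
    exact pre_id _ _⟩

/-- The canonical map from an object of a system to the system. -/
def inn (α : IndC K C) (i : α.I) : Hom K (const (K := K) (α.obj i)) α 0 :=
  desc (of i (GrCat.idm (α.obj i)))

theorem constF_comp_desc {A B : C} {β : IndC K C} {k l m : ℤ} (f : Hom K A B k) (x : Colim B β l)
    (h : k + l = m) : comp (constF.map f) (desc x) h = desc (pre h f x) := hom_ext fun _ =>
  post_of (β := const B) h (desc x) ⟨()⟩ f

theorem desc_of {A : C} {β : IndC K C} {d : ℤ} (j : β.I) (x : Hom K A (β.obj j) d)
    (h : d + 0 = d) : desc (of j x) = comp (constF.map x) (inn β j) h := by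
  rw [inn, constF_comp_desc, pre_of, comp_id]

theorem desc_val {A : C} {β : IndC K C} {d : ℤ} (f : Hom K (const (K := K) A) β d) :
    desc (f.1 ⟨()⟩) = f := hom_ext fun _ => rfl

theorem desc_injective {A : C} {β : IndC K C} {d : ℤ} {x y : Colim A β d}
    (h : desc x = desc y) : x = y := congrArg (fun t => t.1 ⟨()⟩) h

end Cat

section Exact

variable {K : Type v} [Field K] {C : Type u} [GrCat.{v} K C]

theorem factor_eq_zero {A : C} {β : IndC K C} {d : ℤ} {j : β.I} {x : Hom K A (β.obj j) d}
    (hx : comp (constF.map x) (inn β j) (add_zero d) = 0) :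
    ∃ (j' : β.I) (φ : j ⟶ j'), comp x (β.tr φ) (add_zero d) = 0 := by
  rw [← desc_of] at hx
  have h : of j x = 0 := congrArg (fun t => t.1 ⟨()⟩) hx
  have := Limits.preservesFilteredColimitsOfSize_shrink.{0, v, 0, v} (forget (ModuleCat.{v} K))
  obtain ⟨j', φ, h'⟩ := Limits.Concrete.colimit_rep_eq_zero _ (F := homFun A β d) (j := j) (x := x) h
  exact ⟨j', φ, h'⟩

end Exact

variable [GrMonCat.{v} K C]


def constMu (X Y : C) :
    Hom K (tObj (const (K := K) X) (const Y)) (const (K := K) (GrMonCat.tObj K X Y)) 0 :=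
  ⟨fun _ => of (β := const (K := K) (GrMonCat.tObj K X Y)) ⟨()⟩ (GrCat.idm (GrMonCat.tObj K X Y)), by
    rintro ⟨⟨⟨⟩⟩, ⟨⟨⟩⟩⟩ ⟨⟨⟨⟩⟩, ⟨⟨⟩⟩⟩ ⟨⟨⟨⟨⟩⟩⟩, ⟨⟨⟨⟩⟩⟩⟩
    refine (congrArg (fun t => Colim.pre (β := const (K := K) (GrMonCat.tObj K X Y)) (zero_add 0) t
      (Colim.of (β := const (K := K) (GrMonCat.tObj K X Y)) ⟨()⟩ (GrCat.idm _)))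
      (tr_id (tObj (const X) (const Y)) (⟨()⟩, ⟨()⟩))).trans ?_
    exact Colim.pre_id _ _⟩

def constMuInv (X Y : C) :
    Hom K (const (K := K) (GrMonCat.tObj K X Y)) (tObj (const X) (const Y)) 0 :=
  inn (tObj (const X) (const Y)) (⟨()⟩, ⟨()⟩)

end IndC

end

noncomputable section

namespace IndC

open Tot GrCat GrMonCat CategoryTheory.MonoidalCategory Colim

variable {K : Type u'} [Field K] {C : Type u} [GrMonCat.{v} K C]

theorem comp_of {α β γ : IndC K C} {k l m : ℤ} {f : Hom K α β k} {g : Hom K β γ l}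
    {i : α.I} {j : β.I} {j' : γ.I} {x : Hom K (α.obj i) (β.obj j) k}
    {y : Hom K (β.obj j) (γ.obj j') l} (hf : f.1 i = of j x) (hg : g.1 j = of j' y)
    (h : k + l = m) : (comp f g h).1 i = of j' (comp x y h) :=
  (congrArg (post h g) hf).trans ((post_of h g j x).trans ((congrArg (pre h x) hg).trans
    (pre_of h x j' y)))

theorem tHom_of {α β α' β' : IndC K C} {k l m : ℤ} {f : Hom K α β k} {g : Hom K α' β' l}
    {i : α.I} {j : β.I} {i' : α'.I} {j' : β'.I} {x : Hom K (α.obj i) (β.obj j) k}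
    {y : Hom K (α'.obj i') (β'.obj j') l} (hf : f.1 i = of j x) (hg : g.1 i' = of j' y)
    (h : k + l = m) : (tHom f g h).1 (i, i') = of (β := tObj β β') (j, j') (tHom x y h) :=
  (congrArg₂ (fun s t => tens h s t) hf hg).trans (tens_of h j j' x y)

theorem idm_of (α : IndC K C) (i : α.I) : (GrCat.idm (K := K) α).1 i = of i (GrCat.idm (α.obj i)) :=
  rfl

theorem aHom_of (α β γ : IndC K C) (i : α.I) (j : β.I) (k : γ.I) :
    (aHom (K := K) α β γ).1 ((i, j), k) = of (β := tObj α (tObj β γ)) (i, (j, k))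
      (aHom (α.obj i) (β.obj j) (γ.obj k)) := rfl

theorem lHom_of (α : IndC K C) (i : Discrete Unit) (j : α.I) :
    (lHom (K := K) α).1 (i, j) = of j (lHom (α.obj j)) := rfl

theorem rHom_of (α : IndC K C) (i : Discrete Unit) (j : α.I) :
    (rHom (K := K) α).1 (j, i) = of j (rHom (α.obj j)) := rfl

theorem constMu_of (X Y : C) (i) : (constMu (K := K) X Y).1 i =
    of (β := const (K := K) (GrMonCat.tObj K X Y)) ⟨()⟩ (GrCat.idm (GrMonCat.tObj K X Y)) := rfl

theorem constMuInv_of (X Y : C) (i) : (constMuInv (K := K) X Y).1 i =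
    of (β := tObj (const (K := K) X) (const Y)) (⟨()⟩, ⟨()⟩) (GrCat.idm (GrMonCat.tObj K X Y)) := rfl

theorem of_congr {A : C} {β : IndC K C} {d : ℤ} {j : β.I} {x y : Hom K A (β.obj j) d}
    (h : hom x = hom y) : of j x = of j y := congrArg _ (hom_inj h)

def constData : (constF (K := K) (C := C)).MonData where
  eps := GrCat.idm (C := IndC K C) (const (unit K))
  epsInv := GrCat.idm (C := IndC K C) (const (unit K))
  mu := constMu
  muInv := constMuInv
  eps_inv := id_comp (C := IndC K C) _ _
  inv_eps := id_comp (C := IndC K C) _ _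
  mu_inv X Y := hom_ext fun i => (comp_of (constMu_of X Y i) (constMuInv_of X Y ⟨()⟩) _).trans
    (congrArg _ (id_comp _ _))
  inv_mu X Y := hom_ext fun i => (comp_of (constMuInv_of X Y i) (constMu_of X Y _) _).trans
    (congrArg _ (id_comp _ _))
  nat {X Y X' Y' k l m} f g h := hom_ext fun i => by
    refine (comp_of (tHom_of (constF_val f i.1) (constF_val g i.2) h) (constMu_of Y Y' _) _).trans
      (Eq.trans ?_ (comp_of (constMu_of X X' i) (constF_val (tHom f g h) _) _).symm)
    exact congrArg _ ((comp_id _ _).trans (id_comp _ _).symm)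
  assoc X Y Z := hom_ext fun ⟨⟨i, j⟩, k⟩ => by
    refine (comp_of (tHom_of (constMu_of X Y (i, j)) (idm_of (const Z) k) _)
      (comp_of (constMu_of (GrMonCat.tObj K X Y) Z _) (constF_val (aHom X Y Z) _) _) _).trans
      (Eq.trans ?_ (comp_of (aHom_of (const X) (const Y) (const Z) i j k) (comp_of
      (tHom_of (idm_of (const X) i) (constMu_of Y Z (j, k)) _) (constMu_of X _ _) _) _).symm)
    refine of_congr (β := const _) ?_
    refine (GrFunctor.MonData.hom_comp_eq _ _ _ (hom_tHom _ _ _) (GrFunctor.MonData.hom_comp_eq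
      _ _ _ rfl rfl)).trans (Eq.trans ?_ (GrFunctor.MonData.hom_comp_eq _ _ _ rfl
      (GrFunctor.MonData.hom_comp_eq _ _ _ (hom_tHom _ _ _) rfl)).symm)
    exact assoc_of_id (o K X) (o K Y) (o K Z) rfl rfl rfl rfl rfl rfl rfl rfl
  left X := hom_ext fun ⟨i, j⟩ => by
    refine Eq.trans (lHom_of (const X) i j) (Eq.trans ?_ (comp_of (tHom_of (idm_of (const (unit K)) i)
      (idm_of (const X) j) _) (comp_of (constMu_of (unit K) X _) (constF_val (lHom X) _) _) _).symm)
    refine of_congr (β := const _) ?_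
    refine Eq.trans ?_ (GrFunctor.MonData.hom_comp_eq _ _ _ (hom_tHom _ _ _)
      (GrFunctor.MonData.hom_comp_eq _ _ _ rfl rfl)).symm
    exact left_of_id (o K X) rfl rfl rfl rfl rfl
  right X := hom_ext fun ⟨j, i⟩ => by
    refine Eq.trans (rHom_of (const X) i j) (Eq.trans ?_ (comp_of (tHom_of (idm_of (const X) j)
      (idm_of (const (unit K)) i) _) (comp_of (constMu_of X (unit K) _) (constF_val (rHom X) _) _)
      _).symm)
    refine of_congr (β := const _) ?_
    refine Eq.trans ?_ (GrFunctor.MonData.hom_comp_eq _ _ _ (hom_tHom _ _ _)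
      (GrFunctor.MonData.hom_comp_eq _ _ _ rfl rfl)).symm
    exact right_of_id (o K X) rfl rfl rfl rfl rfl

/-- The tensor product of two canonical maps. -/
theorem tHom_inn (α β : IndC K C) (i : α.I) (j : β.I) (h : (0 : ℤ) + 0 = 0) :
    tHom (inn α i) (inn β j) h = comp (constMu (α.obj i) (β.obj j)) (inn (tObj α β) (i, j)) h :=
  hom_ext fun ⟨a, b⟩ => by
    refine (tHom_of (f := inn α i) (g := inn β j) (i := a) (i' := b) rfl rfl h).trans (Eq.trans ?_ (comp_of
      (constMu_of (α.obj i) (β.obj j) (a, b)) (g := inn (tObj α β) (i, j)) rfl h).symm)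
    refine of_congr (β := tObj α β) ?_
    refine (congrArg hom ((GrMonCat.tHom_id (α.obj i) (β.obj j) h).trans (id_comp _ h).symm))

end IndC

namespace Tot

open CategoryTheory.MonoidalCategory Functor.LaxMonoidal Functor.OplaxMonoidal

variable {M : Type u} [Category.{v} M] [MonoidalCategory M] {N : Type w} [Category.{v'} N]
  [MonoidalCategory N] (F : M ⥤ N) [F.Monoidal]

theorem conj_assoc {X Y Z : M} {A B D : N} (a : A ≅ F.obj X) (b : B ≅ F.obj Y)
    (d : D ≅ F.obj Z) :
    (((((a.hom ⊗ₘ b.hom) ≫ μ F X Y) ⊗ₘ d.hom) ≫ μ F (X ⊗ Y) Z) ≫ F.map (α_ X Y Z).hom) ≫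
      δ F X (Y ⊗ Z) ≫ (a.inv ⊗ₘ (δ F Y Z ≫ (b.inv ⊗ₘ d.inv))) = (α_ A B D).hom := by
  have h1 : (((a.hom ⊗ₘ b.hom) ≫ μ F X Y) ⊗ₘ d.hom) =
      ((a.hom ⊗ₘ b.hom) ⊗ₘ d.hom) ≫ μ F X Y ▷ F.obj Z := by
    rw [← MonoidalCategory.tensorHom_id, MonoidalCategory.tensorHom_comp_tensorHom,
      Category.comp_id]
  have h2 : (a.inv ⊗ₘ (δ F Y Z ≫ (b.inv ⊗ₘ d.inv))) =
      F.obj X ◁ δ F Y Z ≫ (a.inv ⊗ₘ (b.inv ⊗ₘ d.inv)) := by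
    rw [← MonoidalCategory.id_tensorHom, MonoidalCategory.tensorHom_comp_tensorHom,
      Category.id_comp]
  rw [h1, h2]
  simp only [Category.assoc]
  rw [Functor.LaxMonoidal.associativity_assoc, Functor.Monoidal.μ_δ_assoc,
    ← MonoidalCategory.whiskerLeft_comp_assoc, Functor.Monoidal.μ_δ,
    MonoidalCategory.whiskerLeft_id, Category.id_comp, associator_naturality_assoc,
    MonoidalCategory.tensorHom_comp_tensorHom, MonoidalCategory.tensorHom_comp_tensorHom,
    Iso.hom_inv_id, Iso.hom_inv_id, Iso.hom_inv_id, MonoidalCategory.id_tensorHom_id,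
    MonoidalCategory.id_tensorHom_id, Category.comp_id]

theorem conj_left {X : M} {A : N} (a : A ≅ F.obj X) :
    (((ε F ⊗ₘ a.hom) ≫ μ F (𝟙_ M) X) ≫ F.map (λ_ X).hom) ≫ a.inv = (λ_ A).hom := by
  have h := Functor.LaxMonoidal.left_unitality F X
  rw [MonoidalCategory.tensorHom_def', Category.assoc, Category.assoc, Category.assoc]
  rw [← Category.assoc (ε F ▷ _), ← Category.assoc (ε F ▷ _ ≫ _), Category.assoc (ε F ▷ _), ← h,
    leftUnitor_naturality_assoc, Iso.hom_inv_id, Category.comp_id]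

theorem conj_right {X : M} {A : N} (a : A ≅ F.obj X) :
    (((a.hom ⊗ₘ ε F) ≫ μ F X (𝟙_ M)) ≫ F.map (ρ_ X).hom) ≫ a.inv = (ρ_ A).hom := by
  have h := Functor.LaxMonoidal.right_unitality F X
  rw [MonoidalCategory.tensorHom_def, Category.assoc, Category.assoc, Category.assoc]
  rw [← Category.assoc (_ ◁ ε F), ← Category.assoc (_ ◁ ε F ≫ _), Category.assoc (_ ◁ ε F), ← h,
    rightUnitor_naturality_assoc, Iso.hom_inv_id, Category.comp_id]

end Tot


namespace GrFunctor

open Tot GrCat GrMonCat CategoryTheory.MonoidalCategory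

variable {K : Type u'} [Field K]

/-- Composition of functors of graded categories. -/
def compF {C : Type u} {C' : Type w} {C'' : Type*} [GrCat.{v} K C] [GrCat.{v'} K C'] [GrCat K C'']
    {F : C → C'} {G : C' → C''} (φ : GrFunctor K F) (ψ : GrFunctor K G) :
    GrFunctor K (fun X => G (F X)) where
  map := ψ.map.comp φ.map
  map_id X := (congrArg ψ.map (φ.map_id X)).trans (ψ.map_id _)
  map_comp f g h := (congrArg ψ.map (φ.map_comp f g h)).trans (ψ.map_comp _ _ _)

namespace MonData

variable {C : Type u} {C' : Type w} {C'' : Type*} [GrMonCat.{v} K C] [GrMonCat.{v'} K C']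
    [GrMonCat K C''] {F : C → C'} {G : C' → C''} {φ : GrFunctor K F} {ψ : GrFunctor K G}
    (D : φ.MonData) (D' : ψ.MonData)

theorem comp_inv_aux {X Y Z : C''} (f : Hom K X Y 0) (f' : Hom K Y X 0) (g : Hom K Y Z 0)
    (g' : Hom K Z Y 0) (h : comp f f' (add_zero 0) = GrCat.idm X)
    (h' : comp g g' (add_zero 0) = GrCat.idm Y) :
    comp (comp f g (add_zero 0)) (comp g' f' (add_zero 0)) (add_zero 0) = GrCat.idm X := by
  rw [GrCat.assoc f g _ (add_zero 0) (add_zero 0) (add_zero 0) (add_zero 0),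
    ← GrCat.assoc g g' f' (add_zero 0) (add_zero 0) (add_zero 0) (add_zero 0), h', id_comp, h]

theorem map_inv {X Y : C'} {f : Hom K X Y 0} {f' : Hom K Y X 0}
    (h : comp f f' (add_zero 0) = GrCat.idm X) :
    comp (ψ.map f) (ψ.map f') (add_zero 0) = GrCat.idm (G X) :=
  (ψ.map_comp f f' _).symm.trans ((congrArg ψ.map h).trans (ψ.map_id X))

/-- The monoidal structure on a composite. -/
def compM : (φ.compF ψ).MonData where
  eps := comp D'.eps (ψ.map D.eps) (add_zero 0)
  epsInv := comp (ψ.map D.epsInv) D'.epsInv (add_zero 0)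
  mu X Y := comp (D'.mu (F X) (F Y)) (ψ.map (D.mu X Y)) (add_zero 0)
  muInv X Y := comp (ψ.map (D.muInv X Y)) (D'.muInv (F X) (F Y)) (add_zero 0)
  eps_inv := comp_inv_aux _ _ _ _ D'.eps_inv (map_inv D.eps_inv)
  inv_eps := comp_inv_aux _ _ _ _ (map_inv D.inv_eps) D'.inv_eps
  mu_inv X Y := comp_inv_aux _ _ _ _ (D'.mu_inv _ _) (map_inv (D.mu_inv X Y))
  inv_mu X Y := comp_inv_aux _ _ _ _ (map_inv (D.inv_mu X Y)) (D'.inv_mu _ _)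
  nat {X Y X' Y' k l m} f g h := by
    let _ := D.core.toMonoidal
    let _ := D'.core.toMonoidal
    refine hom_inj (Eq.trans (hom_comp_eq _ _ _ (hom_tHom _ _ _) (hom_comp_eq _ _ _ rfl
      (ψ.tot_hom _).symm)) (Eq.trans ?_ (hom_comp_eq _ _ _ (hom_comp_eq _ _ _ rfl
      (ψ.tot_hom _).symm) rfl).symm))
    have h1 := Functor.LaxMonoidal.μ_natural (φ.tot ⋙ ψ.tot) (hom f) (hom g)
    refine Eq.trans ?_ (h1.trans ?_)
    · exact congrArg₂ (fun s t => (s ⊗ₘ t) ≫ _) ((ψ.tot_hom _).symm.trans (congrArg _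
        (φ.tot_hom f).symm)) ((ψ.tot_hom _).symm.trans (congrArg _ (φ.tot_hom g).symm))
    · refine congrArg (fun t => _ ≫ t) ?_
      exact (congrArg ψ.tot.map ((congrArg φ.tot.map (hom_tHom f g h).symm).trans
        (φ.tot_hom _))).trans (ψ.tot_hom _)
  assoc X Y Z := by
    let _ := D.core.toMonoidal
    let _ := D'.core.toMonoidal
    have h1 := Functor.LaxMonoidal.associativity (φ.tot ⋙ ψ.tot) (o K X) (o K Y) (o K Z)
    have ht : ∀ {A B A' : C} {d : ℤ} (f : Hom K A B d), hom (ψ.map (φ.map f)) =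
      (φ.tot ⋙ ψ.tot).map (hom f) := fun f => (ψ.tot_hom _).symm.trans
        (congrArg _ (φ.tot_hom f).symm)
    have hm : ∀ X Y : C, hom (comp (D'.mu (F X) (F Y)) (ψ.map (D.mu X Y)) (add_zero 0)) =
      Functor.LaxMonoidal.μ (φ.tot ⋙ ψ.tot) (o K X) (o K Y) :=
      fun X Y => hom_comp_eq _ _ _ rfl (ψ.tot_hom _).symm
    refine hom_inj (Eq.trans (hom_comp_eq _ _ _ ((hom_tHom_id _ _ _).trans (congrArg
      (fun t => t ▷ o K (G (F Z))) (hm X Y)))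
      (hom_comp_eq _ _ _ (hm _ _) (ht (A' := X) _))) (h1.trans (hom_comp_eq _ _ _ rfl (hom_comp_eq _ _ _
      ((hom_id_tHom _ _ _).trans (congrArg (fun t => o K (G (F X)) ◁ t) (hm Y Z)))
      (hm _ _))).symm))
  left X := by
    let _ := D.core.toMonoidal
    let _ := D'.core.toMonoidal
    have h1 := Functor.LaxMonoidal.left_unitality (φ.tot ⋙ ψ.tot) (o K X)
    refine hom_inj (h1.trans (hom_comp_eq _ _ _ ((hom_tHom_id _ _ _).trans (congrArg
      (fun t => t ▷ o K (G (F X))) (hom_comp_eq _ _ _ rfl (ψ.tot_hom _).symm)))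
      (hom_comp_eq _ _ _ (hom_comp_eq _ _ _ rfl (ψ.tot_hom _).symm) ((ψ.tot_hom _).symm.trans
        (congrArg _ (φ.tot_hom _).symm)))).symm)
  right X := by
    let _ := D.core.toMonoidal
    let _ := D'.core.toMonoidal
    have h1 := Functor.LaxMonoidal.right_unitality (φ.tot ⋙ ψ.tot) (o K X)
    refine hom_inj (h1.trans (hom_comp_eq _ _ _ ((hom_id_tHom _ _ _).trans (congrArg
      (fun t => o K (G (F X)) ◁ t) (hom_comp_eq _ _ _ rfl (ψ.tot_hom _).symm)))
      (hom_comp_eq _ _ _ (hom_comp_eq _ _ _ rfl (ψ.tot_hom _).symm) ((ψ.tot_hom _).symm.trans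
        (congrArg _ (φ.tot_hom _).symm)))).symm)

/-- The same structure with the structure maps rewritten along equalities. -/
theorem exists_congr (e : Hom K (unit K) (F (unit K)) 0) (he : D.eps = e)
    (m : ∀ X Y : C, Hom K (tObj K (F X) (F Y)) (F (tObj K X Y)) 0) (hm : ∀ X Y, D.mu X Y = m X Y)
    (m' : ∀ X Y : C, Hom K (F (tObj K X Y)) (tObj K (F X) (F Y)) 0)
    (hm' : ∀ X Y, D.muInv X Y = m' X Y) :
    ∃ D' : φ.MonData, D'.eps = e ∧ D'.mu = m ∧ D'.muInv = m' :=
  ⟨D, he, funext fun X => funext (hm X), funext fun X => funext (hm' X)⟩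

section Conj

variable {X X' Y Y' Z : C} {A A' B B' P : C'}

theorem conj_inv (a : Hom K A (F X) 0) (ai : Hom K (F X) A 0) (b : Hom K B (F Y) 0)
    (bi : Hom K (F Y) B 0) (ha : comp a ai (add_zero 0) = GrCat.idm A)
    (hb : comp b bi (add_zero 0) = GrCat.idm B) :
    comp (comp (tHom a b (add_zero 0)) (D.mu X Y) (add_zero 0))
      (comp (D.muInv X Y) (tHom ai bi (add_zero 0)) (add_zero 0)) (add_zero 0) = GrCat.idm _ :=
  comp_inv_aux _ _ _ _ (by rw [← tHom_comp a ai b bi (add_zero 0) (add_zero 0) (add_zero 0), ha, hb,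
    GrMonCat.tHom_id]) (D.mu_inv X Y)

theorem inv_conj (a : Hom K A (F X) 0) (ai : Hom K (F X) A 0) (b : Hom K B (F Y) 0)
    (bi : Hom K (F Y) B 0) (ha : comp ai a (add_zero 0) = GrCat.idm _)
    (hb : comp bi b (add_zero 0) = GrCat.idm _) :
    comp (comp (D.muInv X Y) (tHom ai bi (add_zero 0)) (add_zero 0))
      (comp (tHom a b (add_zero 0)) (D.mu X Y) (add_zero 0)) (add_zero 0) = GrCat.idm _ :=
  comp_inv_aux _ _ _ _ (D.inv_mu X Y) (by rw [← tHom_comp ai a bi b (add_zero 0) (add_zero 0)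
    (add_zero 0), ha, hb, GrMonCat.tHom_id])

theorem conj_tensor (a : Hom K A (F X) 0) (a' : Hom K A' (F X') 0) (b : Hom K (F Y) B 0)
    (b' : Hom K (F Y') B' 0) {k l m : ℤ} (f : Hom K X Y k) (g : Hom K X' Y' l) (h : k + l = m) :
    comp (comp (comp (tHom a a' (add_zero 0)) (D.mu X X') (add_zero 0)) (φ.map (tHom f g h))
      (zero_add m)) (comp (D.muInv Y Y') (tHom b b' (add_zero 0)) (add_zero 0)) (add_zero m) =
    tHom (comp (comp a (φ.map f) (zero_add k)) b (add_zero k))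
      (comp (comp a' (φ.map g) (zero_add l)) b' (add_zero l)) h := by
  rw [tHom_comp _ b _ b' (add_zero k) (add_zero l) h h (add_zero 0) (add_zero m),
    tHom_comp a _ a' _ (zero_add k) (zero_add l) h (add_zero 0) h (zero_add m),
    GrCat.assoc (tHom a a' _) (D.mu X X') _ (add_zero 0) (zero_add m) (zero_add m) (zero_add m),
    ← D.nat f g h, GrCat.assoc (tHom a a' _) _ _ (zero_add m) (add_zero m) (add_zero m) (zero_add m),
    GrCat.assoc (tHom (φ.map f) (φ.map g) h) (D.mu Y Y') _ (add_zero m) (add_zero m) (add_zero 0)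
    (add_zero m), ← GrCat.assoc (D.mu Y Y') (D.muInv Y Y') _ (add_zero 0) (add_zero 0) (add_zero 0)
    (add_zero 0), D.mu_inv, id_comp, GrCat.assoc (tHom a a' _) _ _ (zero_add m) (add_zero m)
    (add_zero m) (zero_add m)]

theorem conj_assoc {Z : C} (a : Hom K A (F X) 0) (ai : Hom K (F X) A 0) (b : Hom K B (F Y) 0)
    (bi : Hom K (F Y) B 0) (p : Hom K P (F Z) 0) (pi : Hom K (F Z) P 0)
    (ha : comp a ai (add_zero 0) = GrCat.idm A) (hai : comp ai a (add_zero 0) = GrCat.idm _)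
    (hb : comp b bi (add_zero 0) = GrCat.idm B) (hbi : comp bi b (add_zero 0) = GrCat.idm _)
    (hp : comp p pi (add_zero 0) = GrCat.idm P) (hpi : comp pi p (add_zero 0) = GrCat.idm _) :
    comp (comp (comp (tHom (comp (tHom a b (add_zero 0)) (D.mu X Y) (add_zero 0)) p (add_zero 0))
      (D.mu (tObj K X Y) Z) (add_zero 0)) (φ.map (aHom X Y Z)) (add_zero 0))
      (comp (D.muInv X (tObj K Y Z)) (tHom ai (comp (D.muInv Y Z) (tHom bi pi (add_zero 0))
        (add_zero 0)) (add_zero 0)) (add_zero 0)) (add_zero 0) = aHom A B P := by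
  let _ := D.core.toMonoidal
  have h1 := Tot.conj_assoc φ.tot (X := o K X) (Y := o K Y) (Z := o K Z)
    (isoOf a ai (add_zero 0) (add_zero 0) ha hai) (isoOf b bi (add_zero 0) (add_zero 0) hb hbi)
    (isoOf p pi (add_zero 0) (add_zero 0) hp hpi)
  refine hom_inj (Eq.trans ?_ h1)
  exact hom_comp_eq _ _ _ (hom_comp_eq _ _ _ (hom_comp_eq _ _ _ ((hom_tHom _ _ _).trans
    (congrArg (fun t => t ⊗ₘ hom p) (hom_comp_eq _ _ _ (hom_tHom _ _ _) rfl))) rfl)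
    (φ.tot_hom _).symm) (hom_comp_eq _ _ _ rfl ((hom_tHom _ _ _).trans
    (congrArg (fun t => hom ai ⊗ₘ t) (hom_comp_eq _ _ _ rfl (hom_tHom _ _ _)))))

theorem conj_left (a : Hom K A (F X) 0) (ai : Hom K (F X) A 0)
    (ha : comp a ai (add_zero 0) = GrCat.idm A) (hai : comp ai a (add_zero 0) = GrCat.idm _) :
    comp (comp (comp (tHom D.eps a (add_zero 0)) (D.mu (unit K) X) (add_zero 0)) (φ.map (lHom X))
      (add_zero 0)) ai (add_zero 0) = lHom A := by
  let _ := D.core.toMonoidal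
  have h1 := Tot.conj_left φ.tot (X := o K X) (isoOf a ai (add_zero 0) (add_zero 0) ha hai)
  exact hom_inj (Eq.trans (hom_comp_eq _ _ _ (hom_comp_eq _ _ _ (hom_comp_eq _ _ _
    (hom_tHom _ _ _) rfl) (φ.tot_hom _).symm) rfl) h1)

theorem conj_right (a : Hom K A (F X) 0) (ai : Hom K (F X) A 0)
    (ha : comp a ai (add_zero 0) = GrCat.idm A) (hai : comp ai a (add_zero 0) = GrCat.idm _) :
    comp (comp (comp (tHom a D.eps (add_zero 0)) (D.mu X (unit K)) (add_zero 0)) (φ.map (rHom X))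
      (add_zero 0)) ai (add_zero 0) = rHom A := by
  let _ := D.core.toMonoidal
  have h1 := Tot.conj_right φ.tot (X := o K X) (isoOf a ai (add_zero 0) (add_zero 0) ha hai)
  exact hom_inj (Eq.trans (hom_comp_eq _ _ _ (hom_comp_eq _ _ _ (hom_comp_eq _ _ _
    (hom_tHom _ _ _) rfl) (φ.tot_hom _).symm) rfl) h1)

end Conj

end MonData

end GrFunctor

end

noncomputable section

theorem IndC.compM_eps {K : Type u'} [Field K] {C : Type u} {C' : Type w} [GrMonCat.{v} K C]
    [GrMonCat.{v'} K C'] {F : C → C'} {φ : GrFunctor K F} (D : φ.MonData)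
    (e : GrCat.Hom K (GrMonCat.unit K) (F (GrMonCat.unit K)) 0) (hD : D.eps = e) :
    (D.compM IndC.constData).eps = IndC.constF.map e := by
  subst hD
  exact GrCat.id_comp _ _

theorem IndC.compM_mu {K : Type u'} [Field K] {C : Type u} {C' : Type w} [GrMonCat.{v} K C]
    [GrMonCat.{v'} K C'] {F : C → C'} {φ : GrFunctor K F} (D : φ.MonData) {X Y : C}
    {m : GrCat.Hom K (GrMonCat.tObj K (F X) (F Y)) (F (GrMonCat.tObj K X Y)) 0}
    (h : D.mu X Y = m) : (D.compM IndC.constData).mu X Y =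
      GrCat.comp (IndC.constMu (F X) (F Y)) (IndC.constF.map m) (add_zero 0) := h ▸ rfl

theorem IndC.compM_muInv {K : Type u'} [Field K] {C : Type u} {C' : Type w} [GrMonCat.{v} K C]
    [GrMonCat.{v'} K C'] {F : C → C'} {φ : GrFunctor K F} (D : φ.MonData) {X Y : C}
    {m : GrCat.Hom K (F (GrMonCat.tObj K X Y)) (GrMonCat.tObj K (F X) (F Y)) 0}
    (h : D.muInv X Y = m) : (D.compM IndC.constData).muInv X Y =
      GrCat.comp (IndC.constF.map m) (IndC.constMuInv (F X) (F Y)) (add_zero 0) := h ▸ rfl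

namespace DTL

open Tot GrCat GrMonCat CategoryTheory.MonoidalCategory

section Emb

variable {K : Type u} [Field K]

/-- The embedding into the additive completion of the idempotent completion. -/
def matF : GrFunctor K (fun X : DTL => MatCat.single 0 (Kar.of K X)) :=
  (Kar.ofF (K := K) (C := DTL)).compF MatCat.singleF

/-- The embedding into the ind-completion. -/
def embF : GrFunctor K (emb K) := (matF (K := K)).compF (IndC.constF (K := K))

/-- The embedding of a morphism into the additive completion. -/
abbrev E {X Y : DTL} {d : ℤ} (f : Hom K X Y d) :
    Hom K (MatCat.single 0 (Kar.of K X)) (MatCat.single 0 (Kar.of K Y)) d := matF.map f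

theorem E_injective {X Y : DTL} {d : ℤ} {f g : Hom K X Y d} (h : E f = E g) : f = g := by
  have h1 := MatCat.singleF_injective h
  have h2 := congrArg Subtype.val h1
  exact (Kar.ofF_val f).symm.trans (h2.trans (Kar.ofF_val g))

theorem E_surjective {X Y : DTL} {d : ℤ} (f : Hom K (MatCat.single 0 (Kar.of K X))
    (MatCat.single 0 (Kar.of K Y)) d) : ∃ g : Hom K X Y d, E g = f := by
  obtain ⟨g, rfl⟩ := MatCat.singleF_surjective f
  exact ⟨g.1, congrArg MatCat.singleF.map (Subtype.ext (Kar.ofF_val g.1))⟩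

/-- The inverse of the comparison of tensor products in the additive completion. -/
def embMatInv (X Y : DTL) : Hom K (MatCat.single 0 (Kar.of K (tObj K X Y)))
    (tObj K (MatCat.single 0 (Kar.of K X)) (MatCat.single 0 (Kar.of K Y))) 0 :=
  comp ((MatCat.singleF (K := K)).map (Kar.ofMuInv X Y)) (MatCat.singleMuInv _ _) (add_zero 0)

theorem embMat_eq (X Y : DTL) : embMat K X Y =
    comp (MatCat.singleMu (K := K) (Kar.of K X) (Kar.of K Y))
      ((MatCat.singleF (K := K)).map (Kar.ofMu X Y)) (add_zero 0) :=
  MatCat.ent_ext (A := MatCat.tObj K (MatCat.single 0 (Kar.of K X)) (MatCat.single 0 (Kar.of K Y)))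
    fun i j => (hom_dcast _ _).trans (Eq.trans ((Category.id_comp _).symm.trans (congrArg₂
      (fun s t => s ≫ t) (MatCat.ent_singleMu _ _ _ _).symm (MatCat.ent_singleF _ _ _).symm))
      (MatCat.ent_comp (A := MatCat.tObj K (MatCat.single 0 (Kar.of K X))
      (MatCat.single 0 (Kar.of K Y))) (B := MatCat.single 0 (Kar.tObj (Kar.of K X) (Kar.of K Y)))
      _ _ _ _ _).symm)

theorem embMu_eq (X Y : DTL) : embMu K X Y = comp (IndC.constMu (K := K) _ _)
    ((IndC.constF (K := K)).map (embMat K X Y)) (add_zero 0) :=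
  IndC.hom_ext fun i => ((IndC.comp_of (IndC.constMu_of _ _ i) (IndC.constF_val (embMat K X Y) _)
    _).trans (congrArg _ (id_comp _ _))).symm

def embMuInv (X Y : DTL) : Hom K (emb K (tObj K X Y)) (tObj K (emb K X) (emb K Y)) 0 :=
  comp ((IndC.constF (K := K)).map (embMatInv X Y)) (IndC.constMuInv _ _) (add_zero 0)

theorem exists_matData : ∃ D : (matF (K := K)).MonData,
    D.eps = GrCat.idm (C := MatCat (Kar K DTL)) (unit K) ∧
    D.mu = embMat K ∧ D.muInv = embMatInv :=
  ((Kar.ofData (K := K) (C := DTL)).compM MatCat.singleData).exists_congr _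
    ((GrCat.id_comp _ _).trans (MatCat.singleF.map_id _)) _ (fun X Y => (embMat_eq X Y).symm) _
    (fun _ _ => rfl)

theorem constF_unit : (IndC.constF (K := K) (C := MatCat (Kar K DTL))).map
    (GrCat.idm (C := MatCat (Kar K DTL)) (unit K)) = GrCat.idm (C := DTLInd K) (emb K (unit K)) :=
  (IndC.constF (K := K) (C := MatCat (Kar K DTL))).map_id (unit K)

theorem exists_embData : ∃ D : (embF (K := K)).MonData,
    D.eps = GrCat.idm (C := DTLInd K) (emb K (unit K)) ∧ D.mu = embMu K ∧ D.muInv = embMuInv := by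
  obtain ⟨D, h1, h2, h3⟩ := exists_matData (K := K)
  have e1 := (IndC.compM_eps (K := K) D _ h1).trans constF_unit
  have e2 : ∀ X Y, (D.compM IndC.constData).mu X Y = embMu K X Y := fun X Y =>
    (IndC.compM_mu (K := K) D (congrFun (congrFun h2 X) Y)).trans (embMu_eq X Y).symm
  have e3 : ∀ X Y, (D.compM IndC.constData).muInv X Y = embMuInv X Y := fun X Y =>
    IndC.compM_muInv (K := K) D (congrFun (congrFun h3 X) Y)
  exact ⟨D.compM IndC.constData, e1, funext fun X => funext (e2 X), funext fun X => funext (e3 X)⟩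

end Emb

section Can

variable {K : Type u} [Field K] [CharZero K]

/-- The evaluation of a word without Kirby objects. -/
abbrev ZZ (K : Type u) [Field K] [CharZero K] (X : DTL) : DTLInd K := realize K (KPre.J X)

/-- The inverse of the canonical isomorphism. -/
def canInv : ∀ X : DTL, Hom K (emb K X) (ZZ K X) 0
  | .unit => GrCat.idm (emb K BWord.unit)
  | .of _ => GrCat.idm (emb K c)
  | .tensor X Y => comp (embMuInv X Y) (tHom (canInv X) (canInv Y) (add_zero 0)) (add_zero 0)

theorem can_canInv (X : DTL) : comp (can K X) (canInv X) (add_zero 0) = GrCat.idm _ := by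
  obtain ⟨D, h1, h2, h3⟩ := exists_embData (K := K)
  induction X with
  | unit => exact GrCat.id_comp _ _
  | of _ => exact GrCat.id_comp _ _
  | tensor X Y ih ih' =>
    have h := D.conj_inv (can K X) (canInv X) (can K Y) (canInv Y) ih ih'
    rw [h2, h3] at h
    exact h

theorem canInv_can (X : DTL) : comp (canInv X) (can K X) (add_zero 0) = GrCat.idm _ := by
  obtain ⟨D, h1, h2, h3⟩ := exists_embData (K := K)
  induction X with
  | unit => exact GrCat.id_comp _ _
  | of _ => exact GrCat.id_comp _ _
  | tensor X Y ih ih' =>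
    have h := D.inv_conj (can K X) (canInv X) (can K Y) (canInv Y) ih ih'
    rw [h2, h3] at h
    exact h

theorem conj_comp {C : Type*} [GrCat K C] {A X Y Z B : C} {k l m : ℤ} (a : Hom K A X 0)
    {B' : C} (f : Hom K X Y k) (b : Hom K Y B 0) (b' : Hom K B Y 0) (g : Hom K Y Z l)
    (e : Hom K Z B' 0) (hb : comp b b' (add_zero 0) = GrCat.idm Y) (h : k + l = m) :
    comp (comp (comp a f (zero_add k)) b (add_zero k)) (comp (comp b' g (zero_add l)) e
      (add_zero l)) h = comp (comp a (comp f g h) (zero_add m)) e (add_zero m) := by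
  rw [assoc b' g e (zero_add l) (add_zero l) (add_zero l) (zero_add l),
    ← assoc (comp (comp a f _) b _) b' (comp g e _) (add_zero k) h (zero_add l) h,
    assoc (comp a f (zero_add k)) b b' (add_zero k) (add_zero k) (add_zero 0) (add_zero k), hb,
    comp_id, assoc a f _ (zero_add k) h h (zero_add m), ← assoc f g e h (add_zero m) (add_zero l) h,
    assoc a _ e (zero_add m) (add_zero m) (add_zero m) (zero_add m)]

/-- The embedding, with values in the evaluations of words. -/
def jF : GrFunctor K (ZZ K) where
  map {X Y d} := compL (K := K) (zero_add d) (can K X) ∘ₗ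
    ((compL (K := K) (add_zero d)).flip (canInv Y) ∘ₗ embF.map)
  map_id X := by
    change comp (can K X) (comp (embF.map (GrCat.idm X)) (canInv X) (add_zero 0)) (zero_add 0) = _
    rw [embF.map_id, GrCat.id_comp, can_canInv]
  map_comp {X Y Z k l m} f g h := by
    change comp (can K X) (comp (embF.map (comp f g h)) (canInv Z) (add_zero m)) (zero_add m) = 
      comp (comp (can K X) (comp (embF.map f) (canInv Y) (add_zero k)) (zero_add k))
        (comp (can K Y) (comp (embF.map g) (canInv Z) (add_zero l)) (zero_add l)) h
    rw [embF.map_comp, ← assoc (can K X) _ (canInv Z) (zero_add m) (add_zero m) (add_zero m)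
      (zero_add m), ← assoc (can K X) _ (canInv Y) (zero_add k) (add_zero k) (add_zero k)
      (zero_add k), ← assoc (can K Y) _ (canInv Z) (zero_add l) (add_zero l) (add_zero l)
      (zero_add l)]
    exact (conj_comp _ _ _ _ _ _ (canInv_can Y) h).symm

theorem jF_map {X Y : DTL} {d : ℤ} (f : Hom K X Y d) : jF.map f =
    comp (comp (can K X) (embHom K f) (zero_add d)) (canInv Y) (add_zero d) :=
  (assoc (can K X) _ (canInv Y) (zero_add d) (add_zero d) (add_zero d) (zero_add d)).symm

theorem jF_can {X Y : DTL} {d : ℤ} (f : Hom K X Y d) :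
    comp (jF.map f) (can K Y) (add_zero d) = comp (can K X) (embHom K f) (zero_add d) := by
  rw [jF_map, assoc _ (canInv Y) (can K Y) (add_zero d) (add_zero d) (add_zero 0) (add_zero d),
    canInv_can, comp_id]

theorem jF_tHom {X Y X' Y' : DTL} {k l m : ℤ} (f : Hom K X Y k) (g : Hom K X' Y' l)
    (h : k + l = m) : jF.map (tHom f g h) = tHom (jF.map f) (jF.map g) h := by
  obtain ⟨D, h1, h2, h3⟩ := exists_embData (K := K)
  have h4 := D.conj_tensor (can K X) (can K X') (canInv Y) (canInv Y') f g h
  rw [h2, h3] at h4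
  rw [jF_map, jF_map, jF_map]
  exact h4

theorem jF_aHom (X Y Z : DTL) : jF.map (aHom (K := K) X Y Z) = aHom (ZZ K X) (ZZ K Y) (ZZ K Z) := by
  obtain ⟨D, h1, h2, h3⟩ := exists_embData (K := K)
  have h4 := D.conj_assoc (can K X) (canInv X) (can K Y) (canInv Y) (can K Z) (canInv Z)
    (can_canInv X) (canInv_can X) (can_canInv Y) (canInv_can Y) (can_canInv Z) (canInv_can Z)
  rw [h2, h3] at h4
  rw [jF_map]
  exact h4

theorem jF_lHom (X : DTL) : jF.map (lHom (K := K) X) = lHom (ZZ K X) := by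
  obtain ⟨D, h1, h2, h3⟩ := exists_embData (K := K)
  have h4 := D.conj_left (can K X) (canInv X) (can_canInv X) (canInv_can X)
  rw [h1, h2] at h4
  rw [jF_map]
  exact h4

theorem jF_rHom (X : DTL) : jF.map (rHom (K := K) X) = rHom (ZZ K X) := by
  obtain ⟨D, h1, h2, h3⟩ := exists_embData (K := K)
  have h4 := D.conj_right (can K X) (canInv X) (can_canInv X) (canInv_can X)
  rw [h1, h2] at h4
  rw [jF_map]
  exact h4

theorem inv_unique {C : Type*} [GrCat K C] {X Y : C} (f : Hom K X Y 0) {g g' : Hom K Y X 0}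
    (h : comp g f (add_zero 0) = GrCat.idm Y) (h' : comp f g' (add_zero 0) = GrCat.idm X) :
    g = g' := by
  rw [← comp_id g (add_zero 0), ← h', ← assoc g f g' (add_zero 0) (add_zero 0) (add_zero 0)
    (add_zero 0), h, id_comp]

theorem map_inv_eq {C C' : Type*} [GrCat K C] [GrCat K C'] {F : C → C'} (φ : GrFunctor K F)
    {X Y : C} (f : Hom K X Y 0) (g : Hom K Y X 0) (h : comp g f (add_zero 0) = GrCat.idm Y)
    (f' : Hom K (F X) (F Y) 0) (hf : φ.map f = f') (g' : Hom K (F Y) (F X) 0)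
    (h' : comp f' g' (add_zero 0) = GrCat.idm _) : φ.map g = g' := by
  subst hf
  exact inv_unique (φ.map f) ((φ.map_comp g f _).symm.trans ((congrArg φ.map h).trans
    (φ.map_id Y))) h'

theorem jF_aInv (X Y Z : DTL) : jF.map (aInv (K := K) X Y Z) = aInv (ZZ K X) (ZZ K Y) (ZZ K Z) :=
  map_inv_eq jF _ _ (aInv_aHom X Y Z _) _ (jF_aHom X Y Z) _ (aHom_aInv _ _ _ _)

theorem jF_lInv (X : DTL) : jF.map (lInv (K := K) X) = lInv (ZZ K X) :=
  map_inv_eq jF _ _ (lInv_lHom X _) _ (jF_lHom X) _ (lHom_lInv _ _)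

theorem jF_rInv (X : DTL) : jF.map (rInv (K := K) X) = rInv (ZZ K X) :=
  map_inv_eq jF _ _ (rInv_rHom X _) _ (jF_rHom X) _ (rHom_rInv _ _)

end Can

end DTL

end

noncomputable section

namespace Kar

open GrCat

variable {K : Type u'} [Field K] {C : Type u} [GrCat.{v} K C]

/-- The projection onto an object of the Karoubi envelope and the inclusion. -/
def proj (A : Kar K C) : Hom K (of K A.X) A 0 := trunc (A := of K A.X) (GrCat.idm A.X)

def inj (A : Kar K C) : Hom K A (of K A.X) 0 := trunc (B := of K A.X) (GrCat.idm A.X)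

theorem proj_val (A : Kar K C) : (proj A).1 = A.p := by
  change comp (comp (GrCat.idm A.X) (GrCat.idm A.X) _) A.p _ = _
  rw [id_comp, id_comp]

theorem inj_val (A : Kar K C) : (inj A).1 = A.p := by
  change comp (comp A.p (GrCat.idm A.X) _) (GrCat.idm A.X) _ = _
  rw [comp_id, comp_id]

theorem inj_proj (A : Kar K C) : comp (inj A) (proj A) (add_zero 0) = GrCat.idm A :=
  Subtype.ext (by
    change comp (inj A).1 (proj A).1 _ = A.p
    rw [inj_val, proj_val, A.idem])

theorem proj_inj (A : Kar K C) : (comp (proj A) (inj A) (add_zero 0)).1 = A.p := by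
  change comp (proj A).1 (inj A).1 _ = A.p
  rw [inj_val, proj_val, A.idem]

theorem proj_trunc_inj {A B : Kar K C} {d : ℤ} (f : Hom K A.X B.X d) :
    (comp (comp (proj A) (trunc f) (zero_add d)) (inj B) (add_zero d)).1 = (trunc f).1 := by
  change comp (comp (proj A).1 (trunc f).1 _) (inj B).1 _ = _
  rw [inj_val, proj_val, (trunc f).2.1, (trunc f).2.2]

end Kar

namespace MatCat

open GrCat Tot

variable {K : Type u'} [Field K] {C : Type u} [GrMonCat.{v} K C]

theorem single_inj_proj (A : Kar K C) {l a b : ℤ} (h₁ : 0 = a + l - 0) (h₂ : 0 = b + 0 - l)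
    (h : a + b = 0) : comp (singleHom (k := l) (l := 0) (Kar.inj A) h₁)
      (singleHom (k := 0) (l := l) (Kar.proj A) h₂) h = GrCat.idm (single l A) := by
  rw [single_comp _ _ _ _ h (add_zero 0) (by omega), Kar.inj_proj]
  exact ent_ext fun _ _ => (ent_single _ _ _ _).trans (ent_idm (single l A) ()).symm

theorem single_proj_inj (A : Kar K C) {l a b : ℤ} (h₁ : 0 = a + l - 0) (h₂ : 0 = b + 0 - l)
    (h : b + a = 0) : comp (singleHom (k := 0) (l := l) (Kar.proj A) h₂)
      (singleHom (k := l) (l := 0) (Kar.inj A) h₁) h = singleF.map (Kar.ofF.map A.p) := by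
  rw [single_comp _ _ _ _ h (add_zero 0) (by omega)]
  exact ent_ext fun _ _ => (ent_single _ _ _ _).trans ((congrArg hom (Subtype.ext
    ((Kar.proj_inj A).trans (Kar.ofF_val A.p).symm))).trans (ent_singleF _ () ()).symm)

theorem single_transfer {A B : Kar K C} {d : ℤ} (f : Hom K A.X B.X d) {l p a b c e : ℤ}
    (h₁ : 0 = a + 0 - l) (h₂ : d = e + l - p) (h₃ : 0 = b + p - 0) (h : a + e = c)
    (h' : c + b = d) :
    comp (comp (singleHom (k := 0) (l := l) (Kar.proj A) h₁) (singleHom (Kar.trunc f) h₂) h)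
      (singleHom (k := p) (l := 0) (Kar.inj B) h₃) h' =
      singleF.map (Kar.ofF.map (Kar.trunc (A := A) (B := B) f).1) := by
  rw [single_comp _ _ _ _ h (zero_add d) (by omega), single_comp _ _ _ _ h' (add_zero d) (by omega)]
  exact ent_ext fun _ _ => (ent_single _ _ _ _).trans ((congrArg hom (Subtype.ext
    ((Kar.proj_trunc_inj f).trans (Kar.ofF_val _).symm))).trans (ent_singleF _ () ()).symm)

end MatCat

namespace GrFunctor.MonData

open GrCat GrMonCat

variable {K : Type u'} [Field K] {C : Type u} {C' : Type w} [GrMonCat.{v} K C]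
    [GrMonCat.{v'} K C'] {F : C → C'} {φ : GrFunctor K F} (D : φ.MonData)

variable {X Y : C} {A B : C'} {k l m k' l' m' : ℤ} (p : Hom K (F X) A k) (q : Hom K (F Y) B l)
  (s : Hom K A (F X) k') (t : Hom K B (F Y) l')

theorem retract_tensor (hm : k + l = m) (hm' : k' + l' = m') (hk : k' + k = 0) (hl : l' + l = 0)
    (h : m' + m = 0)
    (hp : comp s p hk = GrCat.idm A) (hq : comp t q hl = GrCat.idm B) :
    comp (comp (tHom s t hm') (D.mu X Y) (add_zero m')) (comp (D.muInv X Y) (tHom p q hm)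
      (zero_add m)) h = GrCat.idm _ := by
  rw [GrCat.assoc _ (D.mu X Y) _ (add_zero m') h (zero_add m) h,
    ← GrCat.assoc (D.mu X Y) (D.muInv X Y) _ (add_zero 0) (zero_add m) (zero_add m) (zero_add m),
    D.mu_inv, id_comp, ← tHom_comp s p t q hk hl (add_zero 0), hp, hq, GrMonCat.tHom_id]

theorem section_tensor (hm : k + l = m) (hm' : k' + l' = m') (hk : k + k' = 0) (hl : l + l' = 0)
    (h : m + m' = 0) {e : Hom K X X 0} {e' : Hom K Y Y 0}
    (hp : comp p s hk = φ.map e) (hq : comp q t hl = φ.map e') :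
    comp (comp (D.muInv X Y) (tHom p q hm) (zero_add m)) (comp (tHom s t hm') (D.mu X Y)
      (add_zero m')) h = φ.map (tHom e e' (add_zero 0)) := by
  rw [GrCat.assoc _ (tHom p q hm) _ (zero_add m) h h (zero_add 0),
    ← GrCat.assoc (tHom p q hm) (tHom s t hm') _ h (add_zero 0) (add_zero m') h,
    ← tHom_comp p s q t hk hl (add_zero 0), hp, hq, D.nat,
    ← GrCat.assoc _ (D.mu X Y) _ (add_zero 0) (add_zero 0) (add_zero 0) (add_zero 0), D.inv_mu, id_comp]

theorem transfer_tensor {X' Y' : C} {A' B' : C'} {a b c : ℤ} (s' : Hom K A' (F X') k')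
    (t' : Hom K B' (F Y') l') (x : Hom K A A' 0) (y : Hom K B B' 0)
    (hm : k + l = m) (hm' : k' + l' = m') (hk : k + k' = a) (hl : l + l' = b) (h : m + m' = c)
    (hab : a + b = c) {e : Hom K X X' a} {e' : Hom K Y Y' b}
    (hp : comp (comp p x (add_zero k)) s' hk = φ.map e)
    (hq : comp (comp q y (add_zero l)) t' hl = φ.map e') :
    comp (comp (comp (D.muInv X Y) (tHom p q hm) (zero_add m)) (tHom x y (add_zero 0))
      (add_zero m)) (comp (tHom s' t' hm') (D.mu X' Y') (add_zero m')) h =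
      φ.map (tHom e e' hab) := by
  rw [GrCat.assoc _ (tHom p q hm) _ (zero_add m) (add_zero m) (add_zero m) (zero_add m),
    ← tHom_comp p x q y (add_zero k) (add_zero l) hm hm (add_zero 0) (add_zero m),
    GrCat.assoc _ (tHom _ _ hm) _ (zero_add m) h h (zero_add c),
    ← GrCat.assoc (tHom _ _ hm) (tHom s' t' hm') _ h (add_zero c) (add_zero m') h,
    ← tHom_comp _ s' _ t' hk hl hab, hp, hq, D.nat,
    ← GrCat.assoc _ (D.mu X Y) _ (add_zero 0) (zero_add c) (zero_add c) (zero_add c), D.inv_mu, id_comp]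

end GrFunctor.MonData

namespace DTL

open Tot GrCat GrMonCat CategoryTheory.MonoidalCategory KPre

section Retract

variable {K : Type u} [Field K] [CharZero K]

variable (K) in
/-- The canonical inclusion with a given index of the directed system. -/
def lev : ∀ S : KPre, (realize K S).I → Lev S
  | .unit, _ => ()
  | .of .c, _ => ()
  | .of (.κ i), s => ⟨i.val + 2 * (show ℕ from s), by
      have h0 : ((2 : ℕ) : ZMod 2) = 0 := rfl
      rw [Nat.cast_add, Nat.cast_mul, h0, zero_mul, add_zero, ZMod.natCast_zmod_val]⟩
  | .tensor S T, p => (lev S p.1, lev T p.2)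

variable (K) in
/-- The source of a canonical inclusion in the additive completion. -/
abbrev src (S : KPre) (s : (realize K S).I) : MatCat (Kar K DTL) :=
  MatCat.single 0 (Kar.of K (dom S (lev K S s)))

/-- The projections onto the stages of the directed systems. -/
def ret : ∀ (S : KPre) (s : (realize K S).I),
    Hom K (src K S s) ((realize K S).obj s) (deg S (lev K S s))
  | .unit, _ => GrCat.idm (MatCat.single 0 (Kar.of K (C := DTL) BWord.unit))
  | .of .c, _ => GrCat.idm (MatCat.single 0 (Kar.of K (C := DTL) c))
  | .of (.κ i), s => MatCat.singleHom (k := 0) (l := -((i.val + 2 * (show ℕ from s) : ℕ) : ℤ))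
      (Kar.proj (sym K (i.val + 2 * (show ℕ from s)))) (by
        change (0 : ℤ) = -((i.val + 2 * (show ℕ from s) : ℕ) : ℤ) + 0 - _
        ring)
  | .tensor S T, p => comp (embMatInv _ _) (tHom (ret S p.1) (ret T p.2) rfl) (zero_add _)

/-- The sections of these projections. -/
def sec : ∀ (S : KPre) (s : (realize K S).I),
    Hom K ((realize K S).obj s) (src K S s) (-deg S (lev K S s))
  | .unit, _ => GrCat.idm (MatCat.single 0 (Kar.of K (C := DTL) BWord.unit))
  | .of .c, _ => GrCat.idm (MatCat.single 0 (Kar.of K (C := DTL) c))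
  | .of (.κ i), s => MatCat.singleHom (l := 0) (k := -((i.val + 2 * (show ℕ from s) : ℕ) : ℤ))
      (Kar.inj (sym K (i.val + 2 * (show ℕ from s)))) (by
        change (0 : ℤ) = - -((i.val + 2 * (show ℕ from s) : ℕ) : ℤ) + _ - 0
        ring)
  | .tensor S T, p => comp (tHom (sec S p.1) (sec T p.2) (neg_add _ _).symm) (embMat K _ _)
      (add_zero _)

theorem sec_ret (S : KPre) (s : (realize K S).I) :
    comp (sec S s) (ret S s) (neg_add_cancel _) = GrCat.idm _ := by
  induction S with
  | unit => exact GrCat.id_comp (C := MatCat (Kar K DTL)) _ _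
  | of l =>
    cases l with
    | c => exact GrCat.id_comp (C := MatCat (Kar K DTL)) _ _
    | κ i =>
      exact MatCat.single_inj_proj (sym K _) _ _ _
  | tensor S T ih ih' =>
    obtain ⟨D, h1, h2, h3⟩ := exists_matData (K := K)
    have h := D.retract_tensor (ret S s.1) (ret T s.2) (sec S s.1) (sec T s.2) rfl
      (neg_add _ _).symm (neg_add_cancel _) (neg_add_cancel _) (neg_add_cancel _) (ih s.1) (ih' s.2)
    rw [h2, h3] at h
    exact h

theorem ret_sec (S : KPre) (s : (realize K S).I) :
    comp (ret S s) (sec S s) (add_neg_cancel _) = matF.map (prg S (lev K S s)) := by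
  induction S with
  | unit => exact (GrCat.id_comp (C := MatCat (Kar K DTL)) _ _).trans ((matF (K := K)).map_id _).symm
  | of l =>
    cases l with
    | c => exact (GrCat.id_comp (C := MatCat (Kar K DTL)) _ _).trans ((matF (K := K)).map_id _).symm
    | κ i =>
      exact MatCat.single_proj_inj (sym K _) _ _ _
  | tensor S T ih ih' =>
    obtain ⟨D, h1, h2, h3⟩ := exists_matData (K := K)
    have h := D.section_tensor (ret S s.1) (ret T s.2) (sec S s.1) (sec T s.2) rfl
      (neg_add _ _).symm (add_neg_cancel _) (add_neg_cancel _) (add_neg_cancel _) (ih s.1) (ih' s.2)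
    rw [h2, h3] at h
    exact h

/-- `w` represents a transition map of the directed system. -/
def IsTr (S : KPre) {s s' : (realize K S).I} (φ : s ⟶ s') {d : ℤ}
    (w : Hom K (dom S (lev K S s)) (dom S (lev K S s')) d) : Prop :=
  ∃ h : deg S (lev K S s) + -deg S (lev K S s') = d,
    comp (comp (ret S s) ((realize K S).tr φ) (add_zero _)) (sec S s') h = matF.map w

theorem IsTr.unique {S : KPre} {s s' : (realize K S).I} {φ : s ⟶ s'} {d : ℤ}
    {w w' : Hom K (dom S (lev K S s)) (dom S (lev K S s')) d} (h : IsTr S φ w) (h' : IsTr S φ w') :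
    w = w' := by
  obtain ⟨h1, h2⟩ := h
  obtain ⟨h3, h4⟩ := h'
  exact E_injective (h2.symm.trans h4)

theorem exists_isTr (S : KPre) {s s' : (realize K S).I} (φ : s ⟶ s') :
    ∃ (d : ℤ) (w : Hom K (dom S (lev K S s)) (dom S (lev K S s')) d), IsTr S φ w := by
  obtain ⟨w, hw⟩ := E_surjective (comp (comp (ret S s) ((realize K S).tr φ) (add_zero _)) (sec S s')
    rfl)
  exact ⟨_, w, rfl, hw.symm⟩

theorem IsTr.tensor {S T : KPre} {s s' : (realize K S).I} {t t' : (realize K T).I} {φ : s ⟶ s'}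
    {ψ : t ⟶ t'} {d e m : ℤ} {w : Hom K (dom S (lev K S s)) (dom S (lev K S s')) d}
    {w' : Hom K (dom T (lev K T t)) (dom T (lev K T t')) e} (h : IsTr S φ w) (h' : IsTr T ψ w')
    (hm : d + e = m) : IsTr (tObj K S T) (s := (s, t)) (s' := (s', t')) (φ, ψ)
      (tHom w w' hm) := by
  obtain ⟨h1, h2⟩ := h
  obtain ⟨h3, h4⟩ := h'
  have h5 : deg S (lev K S s) + deg T (lev K T t) +
    -(deg S (lev K S s') + deg T (lev K T t')) = m := by omega
  refine ⟨h5, ?_⟩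
  obtain ⟨D, e1, e2, e3⟩ := exists_matData (K := K)
  have h := D.transfer_tensor (ret S s) (ret T t) (sec S s') (sec T t') ((realize K S).tr φ)
    ((realize K T).tr ψ) rfl (neg_add _ _).symm h1 h3 h5 hm h2 h4
  rw [e2, e3] at h
  exact h

theorem isTr_id (S : KPre) (s : (realize K S).I) : IsTr S (𝟙 s) (prg S (lev K S s)) := by
  refine ⟨add_neg_cancel _, ?_⟩
  rw [IndC.tr_id, comp_id]
  exact ret_sec S s

theorem comp_transfer {C : Type*} [GrCat K C] {A A' A'' B B' B'' : C} {a a' b' c d e m : ℤ}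
    (p : Hom K A B a) (p' : Hom K A' B' a') (x : Hom K B B' 0) (y : Hom K B' B'' 0)
    (s' : Hom K B' A' b') (s'' : Hom K B'' A'' c) (h : a + b' = d) (h' : a' + c = e)
    (hb : b' + a' = 0) (hs : comp s' p' hb = GrCat.idm B') (hm : d + e = m) (hm' : a + c = m) :
    comp (comp p (comp x y (add_zero 0)) (add_zero a)) s'' hm' =
      comp (comp (comp p x (add_zero a)) s' h) (comp (comp p' y (add_zero a')) s'' h') hm := by
  obtain rfl : c = b' + e := by omega
  rw [assoc p' y s'' (add_zero a') h' (zero_add _) h',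
    assoc _ s' _ h hm rfl hm', ← assoc s' p' _ hb (zero_add _) h' rfl, hs, id_comp,
    ← assoc _ y s'' (add_zero a) hm' (zero_add _) hm', assoc p x y (add_zero a) (add_zero a)
    (add_zero 0) (add_zero a)]

theorem IsTr.comp {S : KPre} {s s' s'' : (realize K S).I} {φ : s ⟶ s'}
    {ψ : s' ⟶ s''} {d e m : ℤ} {w : Hom K (dom S (lev K S s)) (dom S (lev K S s')) d}
    {w' : Hom K (dom S (lev K S s')) (dom S (lev K S s'')) e} (h : IsTr S φ w) (h' : IsTr S ψ w')
    (hm : d + e = m) : IsTr S (φ ≫ ψ) (GrCat.comp w w' hm) := by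
  obtain ⟨h1, h2⟩ := h
  obtain ⟨h3, h4⟩ := h'
  refine ⟨by omega, ?_⟩
  rw [matF.map_comp, ← h2, ← h4, IndC.tr_comp]
  exact comp_transfer _ _ _ _ _ _ h1 h3 (neg_add_cancel _) (sec_ret S s') hm _

end Retract

end DTL

end

noncomputable section

namespace IndC

open Tot GrCat GrMonCat CategoryTheory.MonoidalCategory Colim

variable {K : Type u'} [Field K] {C : Type u} [GrMonCat.{v} K C]

theorem desc_comp {A : C} {β γ : IndC K C} {k l m : ℤ} (x : Colim A β k) (f : Hom K β γ l)
    (h : k + l = m) : comp (desc x) f h = desc (post h f x) := hom_ext fun _ => rfl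

theorem desc_zero {A : C} {β : IndC K C} {d : ℤ} : desc (0 : Colim A β d) = 0 := rfl

/-- The tensor product of two morphisms which factor through stages of the systems. -/
theorem tHom_factor {α β A B : IndC K C} {X Y Z : C} {k l m : ℤ} (i : α.I) (j : β.I)
    (a : Hom K A (const X) 0) (b : Hom K B (const Y) 0) (x : Hom K X (α.obj i) k)
    (y : Hom K Y (β.obj j) l) (n : Hom K (GrMonCat.tObj K X Y) Z 0)
    (n' : Hom K Z (GrMonCat.tObj K X Y) 0) (hn : comp n n' (add_zero 0) = GrCat.idm _)
    (h : k + l = m) :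
    tHom (comp a (desc (of i x)) (zero_add k)) (comp b (desc (of j y)) (zero_add l)) h =
      comp (comp (tHom a b (add_zero 0)) (comp (constMu X Y) (constF.map n) (add_zero 0))
        (add_zero 0)) (desc (of (β := tObj α β) (i, j) (comp n' (tHom x y h) (zero_add m))))
        (zero_add m) := by
  rw [tHom_comp a _ b _ (zero_add k) (zero_add l) h (add_zero 0) h (zero_add m),
    desc_of i x (add_zero k), desc_of j y (add_zero l), desc_of (β := tObj α β) _ _ (add_zero m),
    tHom_comp (constF.map x) _ (constF.map y) _ (add_zero k) (add_zero l) h h (add_zero 0)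
      (add_zero m), tHom_inn, ← GrCat.assoc _ (constMu _ _) _ (add_zero m) (add_zero m) (add_zero 0)
      (add_zero m)]
  have h1 := constData.nat (K := K) x y h
  replace h1 : comp (tHom (constF.map x) (constF.map y) h) (constMu _ _) (add_zero m) =
    comp (constMu X Y) (constF.map (tHom x y h)) (zero_add m) := h1
  have h2 : tHom x y h = comp n (comp n' (tHom x y h) (zero_add m)) (zero_add m) := by
    rw [← GrCat.assoc n n' _ (add_zero 0) (zero_add m) (zero_add m) (zero_add m), hn, GrCat.id_comp]
  rw [h1, GrCat.assoc (tHom a b (add_zero 0)) _ _ (add_zero 0) (zero_add m) (zero_add m)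
    (zero_add m), GrCat.assoc (constMu X Y) (constF.map n) _ (add_zero 0) (zero_add m) (zero_add m)
    (zero_add m), ← GrCat.assoc (constF.map n) _ _ (zero_add m) (add_zero m) (add_zero m)
    (zero_add m), ← constF.map_comp, ← h2, GrCat.assoc (constMu X Y) _ _ (zero_add m) (add_zero m)
    (add_zero m) (zero_add m)]

end IndC

namespace DTL

open Tot GrCat GrMonCat CategoryTheory.MonoidalCategory KPre IndC.Colim

section Up

variable {K : Type u} [Field K] [CharZero K]

/-- The morphism out of the embedding of a word given by a class. -/
def descE {X : DTL} {β : DTLInd K} {d : ℤ}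
    (x : IndC.Colim (MatCat.single 0 (Kar.of K X)) β d) : Hom K (emb K X) β d :=
  IndC.desc x

/-- The morphism from the evaluation of a word without Kirby objects given by a class. -/
def up {X : DTL} {β : DTLInd K} {d : ℤ}
    (x : IndC.Colim (MatCat.single 0 (Kar.of K X)) β d) : Hom K (ZZ K X) β d :=
  comp (can K X) (descE x) (zero_add d)

theorem canInv_comp {X : DTL} {β : DTLInd K} {d : ℤ} (f : Hom K (emb K X) β d) :
    comp (canInv X) (comp (can K X) f (zero_add d)) (zero_add d) = f := by
  rw [← assoc (canInv X) _ _ (add_zero 0) (zero_add d) (zero_add d) (zero_add d), canInv_can,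
    GrCat.id_comp]

theorem can_comp {X : DTL} {β : DTLInd K} {d : ℤ} (f : Hom K (ZZ K X) β d) :
    comp (can K X) (comp (canInv X) f (zero_add d)) (zero_add d) = f := by
  rw [← assoc (can K X) _ _ (add_zero 0) (zero_add d) (zero_add d) (zero_add d), can_canInv,
    GrCat.id_comp]

theorem up_injective {X : DTL} {β : DTLInd K} {d : ℤ}
    {x y : IndC.Colim (MatCat.single 0 (Kar.of K X)) β d} (h : up x = up y) : x = y := by
  have h1 := congrArg (fun t => comp (canInv X) t (zero_add d)) h
  exact IndC.desc_injective ((canInv_comp (descE x)).symm.trans (h1.trans (canInv_comp (descE y))))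

theorem exists_up {X : DTL} {β : DTLInd K} {d : ℤ} (f : Hom K (ZZ K X) β d) :
    ∃ x : IndC.Colim (MatCat.single 0 (Kar.of K X)) β d, up x = f := by
  refine ⟨(comp (canInv X) f (zero_add d)).1 ⟨()⟩, ?_⟩
  exact (congrArg (fun t => comp (can K X) t (zero_add d)) (IndC.desc_val (comp (canInv X) f
    (zero_add d)))).trans (can_comp f)

theorem up_zero {X : DTL} {β : DTLInd K} {d : ℤ} :
    up (0 : IndC.Colim (MatCat.single 0 (Kar.of K X)) β d) = 0 :=
  comp_zero (can K X) (zero_add d)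

theorem descE_comp {X : DTL} {β γ : DTLInd K} {k l m : ℤ}
    (x : IndC.Colim (MatCat.single 0 (Kar.of K X)) β k) (f : Hom K β γ l) (h : k + l = m) :
    comp (descE x) f h = descE (IndC.post h f x) := IndC.desc_comp x f h

theorem up_comp {X : DTL} {β γ : DTLInd K} {k l m : ℤ}
    (x : IndC.Colim (MatCat.single 0 (Kar.of K X)) β k) (f : Hom K β γ l) (h : k + l = m) :
    comp (up x) f h = up (IndC.post h f x) := by
  rw [up, up, assoc _ _ _ (zero_add k) h h (zero_add m), descE_comp]

theorem embHom_comp_descE {X Y : DTL} {β : DTLInd K} {k l m : ℤ} (f : Hom K X Y k)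
    (x : IndC.Colim (MatCat.single 0 (Kar.of K Y)) β l) (h : k + l = m) :
    comp (embHom K f) (descE x) h = descE (pre h (E f) x) := IndC.constF_comp_desc (E f) x h

theorem jF_up {X Y : DTL} {β : DTLInd K} {k l m : ℤ} (f : Hom K X Y k)
    (x : IndC.Colim (MatCat.single 0 (Kar.of K Y)) β l) (h : k + l = m) :
    comp (jF.map f) (up x) h = up (pre h (E f) x) := by
  rw [up, up, ← assoc _ _ _ (add_zero k) h (zero_add l) h, jF_can,
    assoc _ _ _ (zero_add k) h h (zero_add m), embHom_comp_descE]

/-- The evaluations of the canonical inclusions. -/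
def inI (S : KPre) (s : (realize K S).I) :
    Hom K (ZZ K (dom S (lev K S s))) (realize K S) (deg S (lev K S s)) := up (of s (ret S s))

theorem inI_comp (S : KPre) (s : (realize K S).I) {β : DTLInd K} {d m : ℤ}
    (f : Hom K (realize K S) β d) (h : deg S (lev K S s) + d = m) :
    comp (inI S s) f h = up (pre h (ret S s) (f.1 s)) :=
  (up_comp _ _ _).trans (congrArg up (IndC.post_of h f s (ret S s)))

theorem inI_ext {S : KPre} {β : DTLInd K} {d : ℤ} {f g : Hom K (realize K S) β d}
    (h : ∀ s, comp (inI S s) f rfl = comp (inI S s) g rfl) : f = g := by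
  refine IndC.hom_ext fun s => ?_
  have h1 := h s
  rw [inI_comp, inI_comp] at h1
  have h2 := congrArg (pre (by omega : -deg S (lev K S s) + _ = d) (sec S s)) (up_injective h1)
  rw [pre_pre _ _ (neg_add_cancel _) (zero_add d), pre_pre _ _ (neg_add_cancel _) (zero_add d),
    sec_ret, pre_id, pre_id] at h2
  exact h2

/-- Compatible families of morphisms descend. -/
theorem exists_desc {S : KPre} {β : DTLInd K} {d : ℤ} {m : (realize K S).I → ℤ}
    (t : ∀ s, Hom K (ZZ K (dom S (lev K S s))) β (m s)) (hm : ∀ s, deg S (lev K S s) + d = m s)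
    (ht : ∀ (s s' : (realize K S).I) (φ : s ⟶ s') (e : ℤ)
      (w : Hom K (dom S (lev K S s)) (dom S (lev K S s')) e) (hw : IsTr S φ w)
      (h : e + m s' = m s), comp (jF.map w) (t s') h = t s) :
    ∃ f : Hom K (realize K S) β d, ∀ s, comp (inI S s) f (hm s) = t s := by
  choose x hx using fun s => exists_up (t s)
  have hs : ∀ s, -deg S (lev K S s) + m s = d := fun s => by have := hm s; omega
  refine ⟨⟨fun s => pre (hs s) (sec S s) (x s), fun s s' φ => ?_⟩, fun s => ?_⟩
  · obtain ⟨e, w, hw⟩ := exists_isTr (K := K) S φ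
    have he : e + m s' = m s := by
      have h1 := hw.1
      have h2 := hm s
      have h3 := hm s'
      omega
    have h1 := ht s s' φ e w hw he
    rw [← hx s, ← hx s', jF_up] at h1
    change pre _ ((realize K S).tr φ) (pre (hs s') (sec S s') (x s')) = pre (hs s) (sec S s) (x s)
    rw [← up_injective h1, E, ← hw.2]
    rw [pre_pre (hs s') (zero_add d) (zero_add _) (hs s'), pre_pre he (hs s) (by
      have := hw.1; omega : -deg S (lev K S s) + e = -deg S (lev K S s')) (hs s')]
    refine congrArg (fun t => pre (hs s') t (x s')) ?_
    rw [← assoc _ _ (sec S s') (neg_add_cancel _) (zero_add _) hw.1 (by have := hw.1; omega),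
      ← assoc (sec S s) (ret S s) _ (neg_add_cancel _) (add_zero 0) (add_zero _)
      (neg_add_cancel _), sec_ret, id_comp]
  · rw [inI_comp, ← hx s]
    have h1 := ht s s (𝟙 s) 0 _ (isTr_id S s) (zero_add _)
    rw [← hx s, jF_up] at h1
    refine Eq.trans (congrArg up ?_) h1
    refine (pre_pre (hs s) (hm s) (add_neg_cancel _) (zero_add _) _ _ _).trans ?_
    rw [ret_sec]

/-- Every morphism with finite source factors through a canonical inclusion. -/
theorem exists_inI_factor {X : DTL} {T : KPre} {k : ℤ} (f : Hom K (ZZ K X) (realize K T) k) :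
    ∃ (s : (realize K T).I) (e : ℤ) (D : Hom K X (dom T (lev K T s)) e)
      (h : e + deg T (lev K T s) = k), comp (jF.map D) (inI T s) h = f := by
  obtain ⟨x, rfl⟩ := exists_up f
  obtain ⟨s, x, rfl⟩ := exists_rep x
  obtain ⟨D, hD⟩ := E_surjective (comp x (sec T s) rfl)
  refine ⟨s, _, D, by omega, ?_⟩
  rw [inI, jF_up, pre_of, hD, assoc x (sec T s) _ rfl (by omega) (neg_add_cancel _) (add_zero _),
    sec_ret, comp_id]

/-- Two factorizations with the same composite agree at a later stage. -/
theorem exists_isTr_eq_zero {X : DTL} {T : KPre} {k e : ℤ} {s : (realize K T).I}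
    {D : Hom K X (dom T (lev K T s)) e} {h : e + deg T (lev K T s) = k}
    (hD : comp (jF.map D) (inI T s) h = 0) :
    ∃ (s' : (realize K T).I) (φ : s ⟶ s') (d : ℤ)
      (w : Hom K (dom T (lev K T s)) (dom T (lev K T s')) d), IsTr T φ w ∧ comp D w rfl = 0 := by
  rw [inI, jF_up, pre_of] at hD
  have h1 := (congrArg IndC.desc (up_injective (hD.trans up_zero.symm))).trans IndC.desc_zero
  rw [IndC.desc_of _ _ (add_zero _)] at h1
  obtain ⟨s', φ, h2⟩ := IndC.factor_eq_zero h1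
  obtain ⟨d, w, hw⟩ := exists_isTr (K := K) T φ
  refine ⟨s', φ, d, w, hw, E_injective ?_⟩
  rw [E, E, matF.map_comp, ← hw.2, ← assoc _ _ (sec T s') (by omega) (by have := hw.1; omega) hw.1
    rfl, ← assoc _ _ _ h (add_zero _) (add_zero _) h, h2, zero_comp, map_zero]

theorem isTr_inI {S : KPre} {s s' : (realize K S).I} {φ : s ⟶ s'} {d : ℤ}
    {w : Hom K (dom S (lev K S s)) (dom S (lev K S s')) d} (hw : IsTr S φ w)
    (h : d + deg S (lev K S s') = deg S (lev K S s)) :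
    comp (jF.map w) (inI S s') h = inI S s := by
  rw [inI, jF_up, pre_of, E, ← hw.2, assoc _ _ _ hw.1 h (neg_add_cancel _) (add_zero _), sec_ret,
    comp_id, of_tr]
  rfl

theorem inI_tensor (S T : KPre) (s : (realize K S).I) (t : (realize K T).I) :
    inI (K := K) (tObj K S T) (s, t) = tHom (inI S s) (inI T t) rfl := by
  obtain ⟨D, e1, e2, e3⟩ := exists_matData (K := K)
  have hD : comp (embMat K (dom S (lev K S s)) (dom T (lev K T t))) (embMatInv _ _) (add_zero 0) =
      GrCat.idm _ := by
    have h := D.mu_inv (dom S (lev K S s)) (dom T (lev K T t))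
    rwa [e2, e3] at h
  have h := IndC.tHom_factor s t (can K (dom S (lev K S s))) (can K (dom T (lev K T t))) (ret S s)
    (ret T t) _ _ hD rfl
  rw [← embMu_eq] at h
  exact h.symm

end Up

end DTL

end

noncomputable section

namespace DTL

open Tot GrCat GrMonCat CategoryTheory.MonoidalCategory KPre IndC.Colim

section Transition

variable {K : Type u} [Field K] [CharZero K]

/-- The arrows of the index category of the Kirby objects. -/
def natLE (s k : ℕ) : s ⟶ s + k := homOfLE (Nat.le_add_right s k)

theorem kirby_tr_succ (i : ZMod 2) (s : ℕ) :
    @IndC.tr _ _ _ _ (kirby K i) s (s + 1 : ℕ) (natLE s 1) = U K (i.val + 2 * s) :=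
  Functor.ofSequence_map_homOfLE_succ (C := Deg0 K (MatCat (Kar K DTL)))
    (X := fun n => stage K (i.val + 2 * n))
    (fun n => U K (i.val + 2 * n)) s

theorem isTr_succ (i : ZMod 2) (s : ℕ) :
    IsTr (K := K) (.of (.κ i)) (s := s) (s' := s + 1) (natLE s 1)
      (Kar.trunc (A := sym K (i.val + 2 * s)) (B := sym K (i.val + 2 * s + 2))
        (dcupRight K (i.val + 2 * s))).1 := by
  refine ⟨?_, ?_⟩
  · change -((i.val + 2 * s : ℕ) : ℤ) + - -((i.val + 2 * (s + 1) : ℕ) : ℤ) = 2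
    push_cast
    ring
  · refine (congrArg (fun t => GrCat.comp (GrCat.comp (ret (.of (.κ i)) s) t (add_zero _))
      (sec (.of (.κ i)) (s + 1 : ℕ)) _) (kirby_tr_succ i s)).trans ?_
    exact MatCat.single_transfer (A := sym K (i.val + 2 * s)) (B := sym K (i.val + 2 * s + 2)) _
      _ _ _ _ _

theorem hom_trunc (n : ℕ) : hom (K := K) (C := DTL) (Kar.trunc (A := sym K n) (B := sym K (n + 2))
    (dcupRight K n)).1 = (P K n ≫ R K n) ≫ P K (n + 2) := by
  refine (Tot.hom_comp (C := DTL) _ _ _).trans ?_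
  exact congrArg (fun t => t ≫ P K (n + 2)) (Tot.hom_comp (C := DTL) (jw K n) (dcupRight K n) _)

/-- A property of morphisms which is closed under composition and holds for the projectors and for
dotted cups holds for the transition maps of the Kirby objects. -/
theorem IsTr.kirby_ind {i : ZMod 2} {Q : ∀ n n' : ℕ, (pw K n ⟶ pw K n') → Prop}
    (hP : ∀ n, Q n n (P K n)) (hR : ∀ n, Q n (n + 2) (R K n))
    (hQ : ∀ {a b c : ℕ} (f : pw K a ⟶ pw K b) (g : pw K b ⟶ pw K c), Q a b f → Q b c g →
      Q a c (f ≫ g)) {s s' : ℕ} {φ : s ⟶ s'} {d : ℤ}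
    {w : Hom K (cpow (i.val + 2 * s)) (cpow (i.val + 2 * s')) d}
    (hw : IsTr (K := K) (.of (.κ i)) (s := s) (s' := s') φ w) :
    Q (i.val + 2 * s) (i.val + 2 * s') (hom (K := K) (C := DTL) w) := by
  have key : ∀ k : ℕ, ∃ (e : ℤ) (w : Hom K (cpow (i.val + 2 * s)) (cpow (i.val + 2 * (s + k))) e),
      IsTr (K := K) (.of (.κ i)) (s := s) (s' := s + k) (natLE s k) w ∧
      Q (i.val + 2 * s) (i.val + 2 * (s + k)) (hom (K := K) (C := DTL) w) := by
    intro k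
    induction k with
    | zero => exact ⟨0, _, isTr_id (K := K) (.of (.κ i)) s, hP _⟩
    | succ k ih =>
      obtain ⟨e, w, h1, h2⟩ := ih
      refine ⟨e + 2, _, IsTr.comp h1 (isTr_succ i (s + k)) rfl, ?_⟩
      have h3 := hQ _ _ h2 (hQ _ _ (hQ _ _ (hP _) (hR _)) (hP (i.val + 2 * (s + k) + 2)))
      rw [← hom_trunc] at h3
      exact (Tot.hom_comp (K := K) (C := DTL) w _ _).symm ▸ h3
  obtain ⟨k, rfl⟩ := Nat.exists_eq_add_of_le (leOfHom φ)
  obtain ⟨e, w', h1, h2⟩ := key k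
  obtain rfl : e = d := h1.1.symm.trans hw.1
  obtain rfl := hw.unique h1
  exact h2

theorem cast_add_two (n : ℕ) : ((n + 2 : ℕ) : ZMod 2) = n := by
  rw [Nat.cast_add]
  exact add_zero _

/-- The canonical inclusions are compatible with the transition maps. -/
theorem isTr_incl {S : KPre} {s s' : (realize K S).I} {φ : s ⟶ s'} {d : ℤ}
    {w : Hom K (dom S (lev K S s)) (dom S (lev K S s')) d} (hw : IsTr S φ w)
    (h : d + deg S (lev K S s') = deg S (lev K S s)) :
    GrCat.comp (Jm w) (incl S (lev K S s')) h = incl S (lev K S s) := by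
  induction S generalizing d with
  | unit =>
    obtain ⟨⟨⟩⟩ := s
    obtain ⟨⟨⟩⟩ := s'
    obtain ⟨⟨⟨⟩⟩⟩ := φ
    obtain rfl : d = 0 := hw.1.symm.trans (add_neg_cancel _)
    obtain rfl := hw.unique (isTr_id (K := K) .unit ⟨()⟩)
    exact GrCat.id_comp (C := KPre) _ _
  | of l =>
    cases l with
    | c =>
      obtain ⟨⟨⟩⟩ := s
      obtain ⟨⟨⟩⟩ := s'
      obtain ⟨⟨⟨⟩⟩⟩ := φ
      obtain rfl : d = 0 := hw.1.symm.trans (add_neg_cancel _)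
      obtain rfl := hw.unique (isTr_id (K := K) (.of .c) ⟨()⟩)
      exact GrCat.id_comp (C := KPre) _ _
    | κ i =>
      refine hom_inj (K := K) (C := KPre) ?_
      refine (Tot.hom_comp (C := KPre) _ _ _).trans ?_
      refine (congrArg (fun t => t ≫ kiota _ i (lev K (.of (.κ i)) s').2) (Jt_hom w).symm).trans ?_
      obtain ⟨_, h1⟩ := hw.kirby_ind (Q := fun n n' f => ∀ h : (n : ZMod 2) = i,
        ∃ h' : (n' : ZMod 2) = i, Jt f ≫ kiota n' i h' = kiota n i h)
        (fun n h => ⟨h, P_kiota n i h⟩)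
        (fun n h => ⟨(cast_add_two n).trans h, R_kiota n i _ h⟩)
        (fun f g hf hg h => by
          obtain ⟨h', hf⟩ := hf h
          obtain ⟨h'', hg⟩ := hg h'
          exact ⟨h'', by rw [Jt_comp, Category.assoc, hg, hf]⟩) (lev K (.of (.κ i)) s).2
      exact h1
  | tensor S T ih ih' =>
    obtain ⟨d₁, w₁, h₁⟩ := exists_isTr (K := K) S φ.1
    obtain ⟨d₂, w₂, h₂⟩ := exists_isTr (K := K) T φ.2
    have h3 := h₁.tensor h₂ rfl
    obtain rfl : d₁ + d₂ = d := h3.1.symm.trans hw.1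
    obtain rfl := hw.unique h3
    have e1 : d₁ + deg S (lev K S s'.1) = deg S (lev K S s.1) := by have := h₁.1; omega
    have e2 : d₂ + deg T (lev K T s'.2) = deg T (lev K T s.2) := by have := h₂.1; omega
    have h4 := tHom_comp (K := K) (C := KPre) (Jm w₁) (incl S (lev K S s'.1)) (Jm w₂)
      (incl T (lev K T s'.2)) e1 e2 rfl rfl rfl h
    rw [ih h₁ e1, ih' h₂ e2] at h4
    exact (congrArg (fun t => GrCat.comp t (incl (.tensor S T) (lev K (.tensor S T) s')) h)
      (Jm_tHom w₁ w₂ rfl)).trans h4.symm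

end Transition

end DTL

end

noncomputable section

namespace Tot

open GrCat

theorem ext_component {K : Type u'} [Field K] {C : Type u} [GrCat.{v} K C] {X Y : C}
    {f g : o K X ⟶ o K Y} (h : ∀ d, component d f = component d g) : f = g :=
  DirectSum.ext_component (M := fun d => Hom K (C := C) X Y d) K h

end Tot

namespace DTL

open Tot GrCat GrMonCat CategoryTheory.MonoidalCategory KPre TLGen

section Ambient

attribute [local irreducible] IndC.grCat

variable (K : Type u) [Field K] [CharZero K]

/-- The evaluations of words in the total category of the ind-completion. -/
abbrev ro (X : BWord KLetter) : Tot K (DTLInd K) := o K (realize K X)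

variable {K}

/-- The functor `jF` on the total categories. -/
def jT {X Y : BWord Unit} : (ob K X ⟶ ob K Y) →ₗ[K] (ro K X.J ⟶ ro K Y.J) :=
  mapHom (C := DTL) (C' := DTLInd K) (X := X) (Y := Y) (fun d => jF.map)

theorem jT_hom {X Y : DTL} {d : ℤ} (f : Hom K X Y d) :
    jT (hom (K := K) (C := DTL) f) = hom (C := DTLInd K) (jF.map f) :=
  mapHom_hom (C := DTL) (C' := DTLInd K) _ f

theorem jT_id (X : BWord Unit) : jT (𝟙 (ob K X)) = 𝟙 (ro K X.J) := jF.tot.map_id X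

theorem jT_comp {X Y Z : BWord Unit} (f : ob K X ⟶ ob K Y) (g : ob K Y ⟶ ob K Z) :
    jT (f ≫ g) = jT f ≫ jT g := jF.tot.map_comp f g

theorem jF_map_id (X : DTL) : jF.map (GrCat.idm (K := K) X) = GrCat.idm (ZZ K X) := jF.map_id X

theorem jT_whiskerRight {X Y : BWord Unit} (f : ob K X ⟶ ob K Y) (Z : BWord Unit) :
    jT (X := X.tensor Z) (Y := Y.tensor Z) (f ▷ ob K Z) = jT f ▷ ro K Z.J :=
  mapHom_whiskerRight (C := DTL) (C' := DTLInd K) Z (ZZ K Z) (fun d => jF.map) (fun d => jF.map)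
    (fun f h => (jF_tHom f (GrCat.idm (K := K) (C := DTL) Z) h).trans
      (congrArg (fun t => tHom (jF.map f) t h) (jF_map_id Z))) f

theorem jT_whiskerLeft {X Y : BWord Unit} (Z : BWord Unit) (f : ob K X ⟶ ob K Y) :
    jT (X := Z.tensor X) (Y := Z.tensor Y) (ob K Z ◁ f) = ro K Z.J ◁ jT f :=
  mapHom_whiskerLeft (C := DTL) (C' := DTLInd K) Z (ZZ K Z) (fun d => jF.map) (fun d => jF.map)
    (fun f h => (jF_tHom (GrCat.idm (K := K) (C := DTL) Z) f h).trans
      (congrArg (fun t => tHom t (jF.map f) h) (jF_map_id Z))) f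

theorem jT_tensorHom {X Y X' Y' : BWord Unit} (f : ob K X ⟶ ob K Y) (g : ob K X' ⟶ ob K Y') :
    jT (X := X.tensor X') (Y := Y.tensor Y') (f ⊗ₘ g) = jT f ⊗ₘ jT g := by
  rw [tensorHom_def (jT f), ← jT_whiskerRight, ← jT_whiskerLeft]
  refine (congrArg (jT (X := X.tensor X') (Y := Y.tensor Y')) (tensorHom_def f g)).trans ?_
  exact jT_comp (X := X.tensor X') (Y := Y.tensor X') (Z := Y.tensor Y') _ _

theorem jT_assoc (X Y Z : BWord Unit) :
    jT (X := (X.tensor Y).tensor Z) (Y := X.tensor (Y.tensor Z)) (α_ (ob K X) (ob K Y) (ob K Z)).hom =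
      (α_ (ro K X.J) (ro K Y.J) (ro K Z.J)).hom :=
  (jT_hom (aHom (K := K) (C := DTL) X Y Z)).trans (congrArg hom (jF_aHom X Y Z))

theorem jT_left_inv (X : BWord Unit) :
    jT (X := X) (Y := BWord.unit.tensor X) (λ_ (ob K X)).inv = (λ_ (ro K X.J)).inv :=
  (jT_hom (lInv (K := K) (C := DTL) X)).trans (congrArg hom (jF_lInv X))

theorem jT_comp_eq {X Y Z : BWord Unit} {f : ob K X ⟶ ob K Y} {g : ob K Y ⟶ ob K Z}
    {f' : ro K X.J ⟶ ro K Y.J} {g' : ro K Y.J ⟶ ro K Z.J} (hf : jT f = f') (hg : jT g = g') :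
    jT (f ≫ g) = f' ≫ g' := by
  rw [jT_comp, hf, hg]

theorem two_mul_half {n : ℕ} {i : ZMod 2} (h : (n : ZMod 2) = i) : i.val + 2 * (n / 2) = n := by
  subst h
  rw [ZMod.val_natCast]
  exact Nat.mod_add_div n 2

/-- The image of `ι_n`. -/
def zio (n : ℕ) (i : ZMod 2) (h : (n : ZMod 2) = i) :
    Hom K (ZZ K (cpow n)) (kirby K i) (-(n : ℤ)) :=
  Eq.rec (motive := fun m _ => Hom K (ZZ K (cpow m)) (kirby K i) (-(m : ℤ)))
    (inI (K := K) (.of (.κ i)) (n / 2 : ℕ)) (two_mul_half h)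

theorem zio_eq (i : ZMod 2) (s : ℕ) (h : ((i.val + 2 * s : ℕ) : ZMod 2) = i) :
    zio (K := K) (i.val + 2 * s) i h = inI (K := K) (.of (.κ i)) s := by
  have key : ∀ (t : ℕ) (e : i.val + 2 * t = i.val + 2 * s),
      (Eq.rec (motive := fun m _ => Hom K (ZZ K (cpow m)) (kirby K i) (-(m : ℤ)))
        (inI (K := K) (.of (.κ i)) t) e : Hom K (ZZ K (cpow (i.val + 2 * s))) (kirby K i)
          (-((i.val + 2 * s : ℕ) : ℤ))) = inI (K := K) (.of (.κ i)) s := by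
    intro t e
    obtain rfl : t = s := by omega
    rfl
  exact key _ _

variable (K) in
/-- The image of `ι_n` in the total category. -/
def io (n : ℕ) (i : ZMod 2) (h : (n : ZMod 2) = i) : ro K (BWord.pow () n).J ⟶ ro K (kw i) :=
  hom (C := DTLInd K) (zio n i h)

theorem io_eq (i : ZMod 2) (s : ℕ) :
    hom (C := DTLInd K) (inI (K := K) (.of (.κ i)) s) =
      io K (i.val + 2 * s) i (lev K (.of (.κ i)) s).2 := (congrArg hom (zio_eq i s _)).symm

theorem castPow_io {m n : ℕ} (e : m = n) (i : ZMod 2) (h : (n : ZMod 2) = i)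
    (h' : (m : ZMod 2) = i) : jT (castPow K e) ≫ io K n i h = io K m i h' := by
  subst e
  exact (congrArg (fun t => t ≫ io K m i h) (jT_id _)).trans (Category.id_comp _)

theorem transition_io {i : ZMod 2} {s s' : ℕ} {φ : s ⟶ s'} {d : ℤ}
    {w : Hom K (cpow (i.val + 2 * s)) (cpow (i.val + 2 * s')) d}
    (hw : IsTr (K := K) (.of (.κ i)) (s := s) (s' := s') φ w)
    (h : ((i.val + 2 * s : ℕ) : ZMod 2) = i) (h' : ((i.val + 2 * s' : ℕ) : ZMod 2) = i) :
    jT (X := BWord.pow () _) (Y := BWord.pow () _) (hom (K := K) (C := DTL) w) ≫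
      io K (i.val + 2 * s') i h' = io K (i.val + 2 * s) i h := by
  have h1 : d + deg (.of (.κ i)) (lev K (.of (.κ i)) s') = deg (.of (.κ i)) (lev K (.of (.κ i)) s) := by
    have := hw.1
    omega
  rw [io, io, zio_eq, zio_eq]
  refine (congrArg (fun t => t ≫ hom (C := DTLInd K) (inI (K := K) (.of (.κ i)) s'))
    (jT_hom w)).trans ?_
  exact (Tot.hom_comp (C := DTLInd K) _ _ h1).symm.trans (congrArg hom (isTr_inI hw h1))

theorem P_io (n : ℕ) (i : ZMod 2) (h : (n : ZMod 2) = i) :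
    jT (P K n) ≫ io K n i h = io K n i h := by
  obtain ⟨s, rfl⟩ : ∃ s, n = i.val + 2 * s := ⟨_, (two_mul_half h).symm⟩
  exact transition_io (isTr_id (K := K) (.of (.κ i)) s) h h

theorem R_io (n : ℕ) (i : ZMod 2) (h : ((n + 2 : ℕ) : ZMod 2) = i) (h' : (n : ZMod 2) = i) :
    jT (R K n) ≫ io K (n + 2) i h = io K n i h' := by
  obtain ⟨s, rfl⟩ : ∃ s, n = i.val + 2 * s := ⟨_, (two_mul_half h').symm⟩
  have h1 := transition_io (isTr_succ (K := K) i s) h' h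
  have h2 : jT ((P K (i.val + 2 * s) ≫ R K (i.val + 2 * s)) ≫ P K (i.val + 2 * s + 2)) ≫
    io K (i.val + 2 * s + 2) i h = io K (i.val + 2 * s) i h' := by
    rw [← hom_trunc]
    exact h1
  rw [Category.assoc, P_R, jT_comp, Category.assoc, P_io] at h2
  exact h2

theorem ro_ext {S : BWord KLetter} {β : DTLInd K} {f g : ro K S ⟶ o K β}
    (h : ∀ s, hom (C := DTLInd K) (inI S s) ≫ f = hom (C := DTLInd K) (inI S s) ≫ g) : f = g := by
  refine ext_component (C := DTLInd K) fun d => inI_ext (S := S) fun s => ?_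
  have h1 := congrArg (component (C := DTLInd K) (deg S (lev K S s) + d)) (h s)
  rwa [component_comp _ _ rfl, component_comp _ _ rfl] at h1

theorem ro_ext_kirby {i : ZMod 2} {β : DTLInd K} {f g : ro K (kw i) ⟶ o K β}
    (h : ∀ n hn, io K n i hn ≫ f = io K n i hn ≫ g) : f = g := by
  refine ro_ext (S := kw i) fun (s : ℕ) => ?_
  exact (congrArg (fun t => t ≫ f) (io_eq i s)).trans ((h _ _).trans
    (congrArg (fun t => t ≫ g) (io_eq i s)).symm)

theorem hom_inI_tensor (S T : BWord KLetter) (s : (realize K S).I) (t : (realize K T).I) :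
    hom (C := DTLInd K) (inI (K := K) (S.tensor T) (s, t)) =
      hom (C := DTLInd K) (inI S s) ⊗ₘ hom (C := DTLInd K) (inI T t) :=
  (congrArg hom (inI_tensor S T s t)).trans (hom_tHom (C := DTLInd K) _ _ _)

theorem ro_ext_kirby₂ {i j : ZMod 2} {β : DTLInd K} {f g : ro K ((kw i).tensor (kw j)) ⟶ o K β}
    (h : ∀ m n hm hn, (io K m i hm ⊗ₘ io K n j hn) ≫ f = (io K m i hm ⊗ₘ io K n j hn) ≫ g) :
    f = g := by
  refine ro_ext (S := (kw i).tensor (kw j)) fun (s : ℕ × ℕ) => ?_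
  have h2 := (hom_inI_tensor (kw i) (kw j) s.1 s.2).trans (congrArg₂ (fun t u => t ⊗ₘ u)
    (io_eq (K := K) i s.1) (io_eq (K := K) j s.2))
  exact (congrArg (fun t => t ≫ f) h2).trans ((h _ _ _ _).trans (congrArg (fun t => t ≫ g) h2).symm)

theorem ro_ext_kirby₃ {i j k : ZMod 2} {β : DTLInd K}
    {f g : ro K (((kw i).tensor (kw j)).tensor (kw k)) ⟶ o K β}
    (h : ∀ l m n hl hm hn, ((io K l i hl ⊗ₘ io K m j hm) ⊗ₘ io K n k hn) ≫ f =
      ((io K l i hl ⊗ₘ io K m j hm) ⊗ₘ io K n k hn) ≫ g) : f = g := by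
  refine ro_ext (S := ((kw i).tensor (kw j)).tensor (kw k)) fun (s : (ℕ × ℕ) × ℕ) => ?_
  have h2 := (hom_inI_tensor (kw i) (kw j) s.1.1 s.1.2).trans (congrArg₂ (fun t u => t ⊗ₘ u)
    (io_eq (K := K) i s.1.1) (io_eq (K := K) j s.1.2))
  have h3 := (hom_inI_tensor (K := K) ((kw i).tensor (kw j)) (kw k) s.1 s.2).trans
    (congrArg₂ (fun t u => t ⊗ₘ u) h2 (io_eq (K := K) k s.2))
  exact (congrArg (fun t => t ≫ f) h3).trans ((h _ _ _ _ _ _).trans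
    (congrArg (fun t => t ≫ g) h3).symm)

end Ambient

end DTL

end

noncomputable section

namespace DTL

open Tot GrCat GrMonCat CategoryTheory.MonoidalCategory KPre TLGen

section Aux

variable {M : Type u} [Category.{v} M] {A B A' B' C D N : M}

theorem comp_absorb {f : A ⟶ B} {g : B ⟶ C} {p : C ⟶ C} {w : C ⟶ D} {a : A ⟶ A'} {r : A' ⟶ C}
    {v : A' ⟶ D} (h : (f ≫ g ≫ p) ≫ w = (a ≫ r ≫ p) ≫ w) (hp : p ≫ w = w) (hr : r ≫ w = v) :
    f ≫ g ≫ w = a ≫ v := by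
  rwa [Category.assoc, Category.assoc, Category.assoc, Category.assoc, hp, hr] at h

theorem comp_exchange {f : A ⟶ B} {g : B ⟶ B} {g' : A ⟶ A} {w : B ⟶ D} {v : A ⟶ D}
    (h : f ≫ g = g' ≫ f) (hw : f ≫ w = v) : f ≫ g ≫ w = g' ≫ v := by
  rw [← Category.assoc, h, Category.assoc, hw]

variable [MonoidalCategory M]

theorem comp_whiskerRight_comp {f : A ⟶ B} {g : B ⟶ C} {a : A ⊗ N ⟶ D} {b : B ⊗ N ⟶ D}
    {c : C ⊗ N ⟶ D} (hf : f ▷ N ≫ b = a) (hg : g ▷ N ≫ c = b) : (f ≫ g) ▷ N ≫ c = a := by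
  rw [comp_whiskerRight, Category.assoc, hg, hf]

theorem comp_whiskerLeft_comp {f : A ⟶ B} {g : B ⟶ C} {a : N ⊗ A ⟶ D} {b : N ⊗ B ⟶ D}
    {c : N ⊗ C ⟶ D} (hf : N ◁ f ≫ b = a) (hg : N ◁ g ≫ c = b) : N ◁ (f ≫ g) ≫ c = a := by
  rw [MonoidalCategory.whiskerLeft_comp, Category.assoc, hg, hf]

theorem tensorHom_comp_eq {f : A ⟶ B} {g : A' ⟶ B'} {a : A ⊗ A' ⟶ D} {b : B ⊗ A' ⟶ D}
    {c : B ⊗ B' ⟶ D} (hf : f ▷ A' ≫ b = a) (hg : B ◁ g ≫ c = b) : (f ⊗ₘ g) ≫ c = a := by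
  rw [MonoidalCategory.tensorHom_def, Category.assoc, hg, hf]

end Aux

section Mul

attribute [local irreducible] IndC.grCat

variable {K : Type u} [Field K] [CharZero K]

variable (K) in
/-- The images of the canonical isomorphisms between tensor powers. -/
def jFuse (m n : ℕ) : ro K (BWord.pow () m).J ⊗ ro K (BWord.pow () n).J ⟶
    ro K (BWord.pow () (m + n)).J :=
  jT (X := (BWord.pow () m).tensor (BWord.pow () n)) (F K m n)

theorem fuse_io_left {a b n : ℕ} {k : ZMod 2} {f : pw K a ⟶ pw K b} {hb ha}
    {r : pw K (a + n) ⟶ pw K (b + n)}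
    (h : f ▷ pw K n ≫ F K b n ≫ P K (b + n) = F K a n ≫ r ≫ P K (b + n))
    (hr : jT r ≫ io K (b + n) k hb = io K (a + n) k ha) :
    jT f ▷ ro K (BWord.pow () n).J ≫ jFuse K b n ≫ io K (b + n) k hb =
      jFuse K a n ≫ io K (a + n) k ha := by
  have h1 := congrArg (fun t => jT (X := (BWord.pow () a).tensor (BWord.pow () n)) t ≫
    io K (b + n) k hb) h
  have h2 := jT_comp_eq (jT_whiskerRight f (BWord.pow () n))
    (jT_comp_eq (X := (BWord.pow () b).tensor (BWord.pow () n)) (f := F K b n) (g := P K (b + n)) rfl rfl)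
  have h3 := jT_comp_eq (X := (BWord.pow () a).tensor (BWord.pow () n)) (f := F K a n) rfl
    (jT_comp_eq (f := r) (g := P K (b + n)) rfl rfl)
  have h4 := (congrArg (fun t => t ≫ io K (b + n) k hb) h2).symm.trans (h1.trans
    (congrArg (fun t => t ≫ io K (b + n) k hb) h3))
  exact comp_absorb h4 (P_io _ _ _) hr

theorem fuse_io_right {a b n : ℕ} {k : ZMod 2} {f : pw K a ⟶ pw K b} {hb ha}
    {r : pw K (n + a) ⟶ pw K (n + b)}
    (h : pw K n ◁ f ≫ F K n b ≫ P K (n + b) = F K n a ≫ r ≫ P K (n + b))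
    (hr : jT r ≫ io K (n + b) k hb = io K (n + a) k ha) :
    ro K (BWord.pow () n).J ◁ jT f ≫ jFuse K n b ≫ io K (n + b) k hb =
      jFuse K n a ≫ io K (n + a) k ha := by
  have h1 := congrArg (fun t => jT (X := (BWord.pow () n).tensor (BWord.pow () a)) t ≫
    io K (n + b) k hb) h
  have h2 := jT_comp_eq (jT_whiskerLeft (BWord.pow () n) f)
    (jT_comp_eq (X := (BWord.pow () n).tensor (BWord.pow () b)) (f := F K n b) (g := P K (n + b)) rfl rfl)
  have h3 := jT_comp_eq (X := (BWord.pow () n).tensor (BWord.pow () a)) (f := F K n a) rfl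
    (jT_comp_eq (f := r) (g := P K (n + b)) rfl rfl)
  have h4 := (congrArg (fun t => t ≫ io K (n + b) k hb) h2).symm.trans (h1.trans
    (congrArg (fun t => t ≫ io K (n + b) k hb) h3))
  exact comp_absorb h4 (P_io _ _ _) hr

theorem R_fuse_io (a n : ℕ) (k : ZMod 2) (h : ((a + 2 + n : ℕ) : ZMod 2) = k)
    (h' : ((a + n : ℕ) : ZMod 2) = k) :
    jT (R K a) ▷ ro K (BWord.pow () n).J ≫ jFuse K (a + 2) n ≫ io K (a + 2 + n) k h =
      jFuse K a n ≫ io K (a + n) k h' := by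
  refine fuse_io_left (r := R K (a + n) ≫ castPow K (show a + n + 2 = a + 2 + n by omega)) ?_ ?_
  · rw [dcupMid_P, Category.assoc]
  · have h'' : ((a + n + 2 : ℕ) : ZMod 2) = k := (cast_add_two _).trans h'
    rw [jT_comp, Category.assoc, castPow_io _ k h h'', R_io _ k h'' h']

theorem fuse_R_io (n a : ℕ) (k : ZMod 2) (h : ((n + (a + 2) : ℕ) : ZMod 2) = k)
    (h' : ((n + a : ℕ) : ZMod 2) = k) :
    ro K (BWord.pow () n).J ◁ jT (R K a) ≫ jFuse K n (a + 2) ≫ io K (n + (a + 2)) k h =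
      jFuse K n a ≫ io K (n + a) k h' := by
  refine fuse_io_right (r := R K (n + a)) ?_ (R_io _ k h h')
  rw [← Category.assoc, R_F, Category.assoc]

theorem P_fuse_io (a n : ℕ) (k : ZMod 2) (h : ((a + n : ℕ) : ZMod 2) = k) :
    jT (P K a) ▷ ro K (BWord.pow () n).J ≫ jFuse K a n ≫ io K (a + n) k h =
      jFuse K a n ≫ io K (a + n) k h := by
  refine fuse_io_left (r := 𝟙 _) ?_ ?_
  · rw [P_F_left, Category.id_comp]
  · rw [jT_id, Category.id_comp]

theorem fuse_P_io (n a : ℕ) (k : ZMod 2) (h : ((n + a : ℕ) : ZMod 2) = k) :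
    ro K (BWord.pow () n).J ◁ jT (P K a) ≫ jFuse K n a ≫ io K (n + a) k h =
      jFuse K n a ≫ io K (n + a) k h := by
  refine fuse_io_right (r := 𝟙 _) ?_ ?_
  · rw [P_F_right, Category.id_comp]
  · rw [jT_id, Category.id_comp]

theorem fuse_io_transition_left {i : ZMod 2} {s s' : ℕ} {φ : s ⟶ s'} {d : ℤ}
    {w : Hom K (cpow (i.val + 2 * s)) (cpow (i.val + 2 * s')) d}
    (hw : IsTr (K := K) (.of (.κ i)) (s := s) (s' := s') φ w) {n : ℕ} {k : ZMod 2}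
    (h : ((i.val + 2 * s + n : ℕ) : ZMod 2) = k) (h' : ((i.val + 2 * s' + n : ℕ) : ZMod 2) = k) :
    jT (X := BWord.pow () _) (Y := BWord.pow () _) (hom (K := K) (C := DTL) w) ▷
      ro K (BWord.pow () n).J ≫ jFuse K (i.val + 2 * s') n ≫ io K (i.val + 2 * s' + n) k h' =
      jFuse K (i.val + 2 * s) n ≫ io K (i.val + 2 * s + n) k h := by
  obtain ⟨_, h1⟩ := hw.kirby_ind (Q := fun a b f => ∀ h : ((a + n : ℕ) : ZMod 2) = k,
    ∃ h' : ((b + n : ℕ) : ZMod 2) = k, jT f ▷ ro K (BWord.pow () n).J ≫ jFuse K b n ≫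
      io K (b + n) k h' = jFuse K a n ≫ io K (a + n) k h)
    (fun a h => ⟨h, P_fuse_io a n k h⟩)
    (fun a h => ⟨by rw [← h, Nat.add_right_comm]; exact cast_add_two _, R_fuse_io a n k _ h⟩)
    (fun f g hf hg h => by
      obtain ⟨h', hf⟩ := hf h
      obtain ⟨h'', hg⟩ := hg h'
      exact ⟨h'', (congrArg (fun t => t ▷ _ ≫ _) (jT_comp f g)).trans
        (comp_whiskerRight_comp (M := Tot K (DTLInd K)) hf hg)⟩) h
  exact h1

theorem fuse_io_transition_right {i : ZMod 2} {s s' : ℕ} {φ : s ⟶ s'} {d : ℤ}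
    {w : Hom K (cpow (i.val + 2 * s)) (cpow (i.val + 2 * s')) d}
    (hw : IsTr (K := K) (.of (.κ i)) (s := s) (s' := s') φ w) {n : ℕ} {k : ZMod 2}
    (h : ((n + (i.val + 2 * s) : ℕ) : ZMod 2) = k)
    (h' : ((n + (i.val + 2 * s') : ℕ) : ZMod 2) = k) :
    ro K (BWord.pow () n).J ◁ jT (X := BWord.pow () _) (Y := BWord.pow () _)
      (hom (K := K) (C := DTL) w) ≫ jFuse K n (i.val + 2 * s') ≫ io K (n + (i.val + 2 * s')) k h' =
      jFuse K n (i.val + 2 * s) ≫ io K (n + (i.val + 2 * s)) k h := by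
  obtain ⟨_, h1⟩ := hw.kirby_ind (Q := fun a b f => ∀ h : ((n + a : ℕ) : ZMod 2) = k,
    ∃ h' : ((n + b : ℕ) : ZMod 2) = k, ro K (BWord.pow () n).J ◁ jT f ≫ jFuse K n b ≫
      io K (n + b) k h' = jFuse K n a ≫ io K (n + a) k h)
    (fun a h => ⟨h, fuse_P_io n a k h⟩)
    (fun a h => ⟨by rw [← h]; exact cast_add_two _, fuse_R_io n a k _ h⟩)
    (fun f g hf hg h => by
      obtain ⟨h', hf⟩ := hf h
      obtain ⟨h'', hg⟩ := hg h'
      exact ⟨h'', (congrArg (fun t => _ ◁ t ≫ _) (jT_comp f g)).trans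
        (comp_whiskerLeft_comp (M := Tot K (DTLInd K)) hf hg)⟩) h
  exact h1

theorem kirby_tensor_cast {i j k : ZMod 2} (hk : i + j = k) {m n : ℕ} (hm : (m : ZMod 2) = i)
    (hn : (n : ZMod 2) = j) : ((m + n : ℕ) : ZMod 2) = k := by
  rw [Nat.cast_add, hm, hn, hk]

/-- The multiplication of Kirby objects. -/
theorem exists_zmul (i j k : ZMod 2) (hk : i + j = k) :
    ∃ μ : Hom K (tObj K (kirby K i) (kirby K j)) (kirby K k) 0,
      ∀ m n hm hn, (io K m i hm ⊗ₘ io K n j hn) ≫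
        (hom (C := DTLInd K) μ : ro K (kw i) ⊗ ro K (kw j) ⟶ ro K (kw k)) =
        jFuse K m n ≫ io K (m + n) k (kirby_tensor_cast hk hm hn) := by
  have hc : ∀ s : ℕ × ℕ, ((i.val + 2 * s.1 + (j.val + 2 * s.2) : ℕ) : ZMod 2) = k := fun s =>
    kirby_tensor_cast hk (lev K (.of (.κ i)) s.1).2 (lev K (.of (.κ j)) s.2).2
  refine (exists_desc (K := K) (S := .tensor (kw i) (kw j)) (β := kirby K k) (d := 0)
    (m := fun s : ℕ × ℕ => 0 + -((i.val + 2 * s.1 + (j.val + 2 * s.2) : ℕ) : ℤ))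
    (fun s : ℕ × ℕ => GrCat.comp (jF.map (DTL.mk K (DTm.fuse (i.val + 2 * s.1) (j.val + 2 * s.2))))
      (zio (i.val + 2 * s.1 + (j.val + 2 * s.2)) k (hc s)) rfl)
    (fun s : ℕ × ℕ => by
      change -((i.val + 2 * s.1 : ℕ) : ℤ) + -((j.val + 2 * s.2 : ℕ) : ℤ) + 0 = _
      push_cast
      ring)
    (fun (s s' : ℕ × ℕ) φ e w hw h => ?_)).elim fun μ hμ => ⟨μ, fun m n hm hn => ?_⟩
  · obtain ⟨d₁, w₁, h₁⟩ := exists_isTr (K := K) (kw i) φ.1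
    obtain ⟨d₂, w₂, h₂⟩ := exists_isTr (K := K) (kw j) φ.2
    have h3 := h₁.tensor h₂ rfl
    obtain rfl : d₁ + d₂ = e := h3.1.symm.trans hw.1
    obtain rfl := hw.unique h3
    refine hom_inj (C := DTLInd K) ?_
    refine (Tot.hom_comp (C := DTLInd K) _ _ _).trans ?_
    refine Eq.trans ?_ ((Tot.hom_comp (C := DTLInd K) _ _ _).trans
      (congrArg (fun u => u ≫ io K _ k (hc s)) (jT_hom _).symm)).symm
    have h4 : hom (C := DTLInd K) (jF.map (tHom w₁ w₂ rfl)) =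
        jT (hom (K := K) (C := DTL) w₁) ⊗ₘ jT (hom (K := K) (C := DTL) w₂) :=
      (jT_hom _).symm.trans ((congrArg jT (hom_tHom (C := DTL) w₁ w₂ rfl)).trans
        (jT_tensorHom _ _))
    have h5 := (Tot.hom_comp (C := DTLInd K) (jF.map (DTL.mk K (DTm.fuse (i.val + 2 * s'.1)
      (j.val + 2 * s'.2)))) (zio (i.val + 2 * s'.1 + (j.val + 2 * s'.2)) k (hc s')) rfl).trans
      (congrArg (fun u => u ≫ io K _ k (hc s')) (jT_hom _).symm)
    refine (congrArg₂ (fun t u => t ≫ u) h4 h5).trans ?_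
    have h6 := fuse_io_transition_left (K := K) h₁ (n := j.val + 2 * s.2) (k := k) (hc s)
      (hc (s'.1, s.2))
    have h7 := fuse_io_transition_right (K := K) h₂ (n := i.val + 2 * s'.1) (k := k)
      (hc (s'.1, s.2)) (hc s')
    exact tensorHom_comp_eq (M := Tot K (DTLInd K)) h6 h7
  · obtain ⟨s, rfl⟩ : ∃ s, m = i.val + 2 * s := ⟨_, (two_mul_half hm).symm⟩
    obtain ⟨t, rfl⟩ : ∃ s, n = j.val + 2 * s := ⟨_, (two_mul_half hn).symm⟩
    have h1 := congrArg (hom (C := DTLInd K)) (hμ (s, t))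
    have h2 := (hom_inI_tensor (kw i) (kw j) s t).trans (congrArg₂ (fun t u => t ⊗ₘ u)
      (io_eq (K := K) i s) (io_eq (K := K) j t))
    refine (congrArg (fun t => t ≫ hom (C := DTLInd K) μ) h2.symm).trans
      ((Tot.hom_comp (C := DTLInd K) _ _ _).symm.trans (h1.trans ?_))
    exact (Tot.hom_comp (C := DTLInd K) _ _ _).trans
      (congrArg (fun u => u ≫ io K _ k (hc (s, t))) (jT_hom _).symm)

/-- The dot on a Kirby object. -/
theorem exists_zdot (i : ZMod 2) :
    ∃ y : Hom K (kirby K i) (kirby K i) 2, ∀ n h, io K n i h ≫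
      (hom (C := DTLInd K) y : ro K (kw i) ⟶ ro K (kw i)) = jT (Z K n) ≫ io K n i h := by
  refine (exists_desc (K := K) (S := kw i) (β := kirby K i) (d := 2)
    (m := fun s : ℕ => 2 + -((i.val + 2 * s : ℕ) : ℤ))
    (fun s : ℕ => GrCat.comp (jF.map (DTL.mk K (DTm.z (i.val + 2 * s))))
      (zio (i.val + 2 * s) i (lev K (.of (.κ i)) s).2) rfl)
    (fun s : ℕ => add_comm _ _)
    (fun (s s' : ℕ) φ e w hw h => ?_)).elim fun y hy => ⟨y, fun n hn => ?_⟩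
  · refine hom_inj (C := DTLInd K) ?_
    refine (Tot.hom_comp (C := DTLInd K) _ _ _).trans ?_
    refine Eq.trans ?_ ((Tot.hom_comp (C := DTLInd K) _ _ _).trans
      (congrArg (fun u => u ≫ io K _ i (lev K (.of (.κ i)) s).2) (jT_hom _).symm)).symm
    have h5 := (Tot.hom_comp (C := DTLInd K) (jF.map (DTL.mk K (DTm.z (i.val + 2 * s'))))
      (zio (i.val + 2 * s') i (lev K (.of (.κ i)) s').2) rfl).trans
      (congrArg (fun u => u ≫ io K _ i (lev K (.of (.κ i)) s').2) (jT_hom _).symm)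
    refine (congrArg₂ (fun t u => t ≫ u) (jT_hom w).symm h5).trans ?_
    have h1 : jT (hom (K := K) (C := DTL) w) ≫ io K _ i (lev K (.of (.κ i)) s').2 =
        io K _ i (lev K (.of (.κ i)) s).2 := transition_io hw _ _
    have h2 : hom (K := K) (C := DTL) w ≫ Z K (i.val + 2 * s') =
        Z K (i.val + 2 * s) ≫ hom (K := K) (C := DTL) w :=
      hw.kirby_ind (Q := fun a b f => f ≫ Z K b = Z K a ≫ f) P_Z R_Z
        (fun f g hf hg => by rw [Category.assoc, hg, ← Category.assoc, hf, Category.assoc])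
    have h3 := (jT_comp _ _).symm.trans ((congrArg jT h2).trans (jT_comp _ _))
    exact comp_exchange (M := Tot K (DTLInd K)) h3 h1
  · obtain ⟨s, rfl⟩ : ∃ s, n = i.val + 2 * s := ⟨_, (two_mul_half hn).symm⟩
    refine (congrArg (fun t => t ≫ hom (C := DTLInd K) y) (io_eq i s).symm).trans
      ((Tot.hom_comp (C := DTLInd K) _ _ _).symm.trans
      ((congrArg (hom (C := DTLInd K)) (hy s)).trans ?_))
    exact (Tot.hom_comp (C := DTLInd K) _ _ _).trans
      (congrArg (fun u => u ≫ io K _ i (lev K (.of (.κ i)) s).2) (jT_hom _).symm)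

end Mul

end DTL

end

noncomputable section

namespace DTL

open Tot GrCat GrMonCat CategoryTheory.MonoidalCategory KPre TLGen

section Aux

variable {M : Type u} [Category.{v} M] [MonoidalCategory M] {A A' A'' B B' B'' C C' D E : M}

theorem left_unit_aux {u : 𝟙_ M ⟶ A} {x : B ⟶ C} {μ : A ⊗ C ⟶ C} {f : 𝟙_ M ⊗ B ⟶ B'} {y : B' ⟶ C}
    {r : B ⟶ B'} (h : (u ⊗ₘ x) ≫ μ = f ≫ y) (hf : (λ_ B).inv ≫ f = r) (hy : r ≫ y = x) :
    x ≫ (λ_ C).inv ≫ u ▷ C ≫ μ = x ≫ 𝟙 C := by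
  rw [← Category.assoc, MonoidalCategory.leftUnitor_inv_naturality, Category.assoc,
    ← Category.assoc (𝟙_ M ◁ x), ← MonoidalCategory.tensorHom_def', h, ← Category.assoc, hf, hy,
    Category.comp_id]

theorem right_unit_aux {u : 𝟙_ M ⟶ A} {x : B ⟶ C} {μ : C ⊗ A ⟶ C} (h : (x ⊗ₘ u) ≫ μ =
    (ρ_ B).hom ≫ x) : x ≫ (ρ_ C).inv ≫ C ◁ u ≫ μ = x ≫ 𝟙 C := by
  rw [← Category.assoc, MonoidalCategory.rightUnitor_inv_naturality, Category.assoc,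
    ← Category.assoc (x ▷ 𝟙_ M), ← MonoidalCategory.tensorHom_def, h, Iso.inv_hom_id_assoc,
    Category.comp_id]

theorem assoc_left_aux {x : A ⟶ A'} {y : B ⟶ B'} {z : C ⟶ C'} {μ : A' ⊗ B' ⟶ D}
    {f : A ⊗ B ⟶ E} {w : E ⟶ D} (h : (x ⊗ₘ y) ≫ μ = f ≫ w) {μ' : D ⊗ C' ⟶ A''} {f' : E ⊗ C ⟶ B''}
    {w' : B'' ⟶ A''} (h' : (w ⊗ₘ z) ≫ μ' = f' ≫ w') :
    ((x ⊗ₘ y) ⊗ₘ z) ≫ μ ▷ C' ≫ μ' = f ▷ C ≫ f' ≫ w' := by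
  rw [← h', ← Category.assoc, ← Category.assoc, ← MonoidalCategory.tensorHom_id,
    MonoidalCategory.tensorHom_comp_tensorHom, h, Category.comp_id,
    ← MonoidalCategory.tensorHom_id, MonoidalCategory.tensorHom_comp_tensorHom, Category.id_comp]

theorem assoc_right_aux {x : A ⟶ A'} {y : B ⟶ B'} {z : C ⟶ C'} {μ : B' ⊗ C' ⟶ D}
    {f : B ⊗ C ⟶ E} {w : E ⟶ D} (h : (y ⊗ₘ z) ≫ μ = f ≫ w) {μ' : A' ⊗ D ⟶ A''} {f' : A ⊗ E ⟶ B''}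
    {w' : B'' ⟶ A''} (h' : (x ⊗ₘ w) ≫ μ' = f' ≫ w') :
    ((x ⊗ₘ y) ⊗ₘ z) ≫ (α_ A' B' C').hom ≫ A' ◁ μ ≫ μ' = (α_ A B C).hom ≫ A ◁ f ≫ f' ≫ w' := by
  rw [← Category.assoc, MonoidalCategory.associator_naturality, Category.assoc, ← h',
    ← Category.assoc (x ⊗ₘ y ⊗ₘ z), ← Category.assoc (A ◁ f), ← MonoidalCategory.id_tensorHom,
    MonoidalCategory.tensorHom_comp_tensorHom, h, Category.comp_id,
    ← MonoidalCategory.id_tensorHom, MonoidalCategory.tensorHom_comp_tensorHom, Category.id_comp]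

theorem assoc_aux {X Y Z V : M} {a : X ⟶ Y} {f : Y ⟶ Z} {g : Z ⟶ V} {a' : X ⟶ A} {f' : A ⟶ B}
    {c : B ⟶ V} {w : V ⟶ D} {w' : B ⟶ D} (h : a ≫ f ≫ g = a' ≫ f' ≫ c) (hc : c ≫ w = w') :
    a' ≫ f' ≫ w' = a ≫ f ≫ g ≫ w := by
  rw [← hc, ← Category.assoc f', ← Category.assoc a', ← h, Category.assoc, Category.assoc]

variable [Preadditive M] [MonoidalPreadditive M] {K : Type u'} [Ring K] [Linear K M]
  [MonoidalLinear K M]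

theorem dot_aux {x : A ⟶ A'} {y : B ⟶ B'} {a : A ⟶ A} {a' : A' ⟶ A'} {b : B ⟶ B} {b' : B' ⟶ B'}
    (hx : x ≫ a' = a ≫ x) (hy : y ≫ b' = b ≫ y) {μ : A' ⊗ B' ⟶ C} {f : A ⊗ B ⟶ D} {w : D ⟶ C}
    (h : (x ⊗ₘ y) ≫ μ = f ≫ w) {d : D ⟶ D} {d' : C ⟶ C} (hw : w ≫ d' = d ≫ w) (r : K)
    (hf : f ≫ d = a ▷ B ≫ f + r • (A ◁ b ≫ f)) :
    (x ⊗ₘ y) ≫ μ ≫ d' = (x ⊗ₘ y) ≫ (a' ▷ B' ≫ μ + r • (A' ◁ b' ≫ μ)) := by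
  rw [← Category.assoc, h, Category.assoc, hw, ← Category.assoc, hf, Preadditive.add_comp,
    Linear.smul_comp, Category.assoc, Category.assoc, ← h, Preadditive.comp_add, Linear.comp_smul,
    ← MonoidalCategory.tensorHom_id, ← MonoidalCategory.tensorHom_id,
    ← MonoidalCategory.id_tensorHom, ← MonoidalCategory.id_tensorHom, ← Category.assoc,
    ← Category.assoc (x ⊗ₘ y), ← Category.assoc (x ⊗ₘ y),
    ← Category.assoc (𝟙 A ⊗ₘ b), MonoidalCategory.tensorHom_comp_tensorHom,
    MonoidalCategory.tensorHom_comp_tensorHom, MonoidalCategory.tensorHom_comp_tensorHom,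
    MonoidalCategory.tensorHom_comp_tensorHom, hx, hy, Category.comp_id, Category.comp_id,
    Category.id_comp, Category.id_comp]

end Aux

section Relations

attribute [local irreducible] IndC.grCat

variable {K : Type u} [Field K] [CharZero K]

/-- The multiplication of Kirby objects in the ind-completion. -/
def zmul (i j k : ZMod 2) (h : i + j = k) : Hom K (tObj K (kirby K i) (kirby K j)) (kirby K k) 0 :=
  (exists_zmul i j k h).choose

/-- The dot of a Kirby object in the ind-completion. -/
def zdot (i : ZMod 2) : Hom K (kirby K i) (kirby K i) 2 := (exists_zdot i).choose

variable (K) in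
/-- The multiplication in the total category. -/
def zm (i j k : ZMod 2) (h : i + j = k) : ro K (kw i) ⊗ ro K (kw j) ⟶ ro K (kw k) :=
  hom (C := DTLInd K) (zmul i j k h)

variable (K) in
/-- The dot in the total category. -/
def zy (i : ZMod 2) : ro K (kw i) ⟶ ro K (kw i) := hom (C := DTLInd K) (zdot i)

theorem io_zm {i j k : ZMod 2} (h : i + j = k) (m n : ℕ) (hm : (m : ZMod 2) = i)
    (hn : (n : ZMod 2) = j) (hmn : ((m + n : ℕ) : ZMod 2) = k) :
    (io K m i hm ⊗ₘ io K n j hn) ≫ zm K i j k h = jFuse K m n ≫ io K (m + n) k hmn :=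
  (exists_zmul i j k h).choose_spec m n hm hn

theorem io_zy (n : ℕ) (i : ZMod 2) (h : (n : ZMod 2) = i) :
    io K n i h ≫ zy K i = jT (Z K n) ≫ io K n i h := (exists_zdot i).choose_spec n h

theorem zunit_mul (i : ZMod 2) (h : (0 : ZMod 2) + i = i) : (λ_ (ro K (kw i))).inv ≫
    (io K 0 0 Nat.cast_zero ▷ ro K (kw i) : 𝟙_ _ ⊗ ro K (kw i) ⟶ ro K (kw 0) ⊗ ro K (kw i)) ≫
      zm K 0 i i h = 𝟙 _ := by
  refine ro_ext_kirby fun n hn => ?_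
  refine left_unit_aux (M := Tot K (DTLInd K)) (io_zm h 0 n Nat.cast_zero hn
    (by rw [Nat.zero_add]; exact hn)) ((jT_comp_eq (jT_left_inv _) rfl).symm.trans
      (congrArg jT (F_unit n))) (castPow_io _ _ _ hn)

theorem jT_right (X : BWord Unit) :
    jT (X := X.tensor BWord.unit) (Y := X) (ρ_ (ob K X)).hom = (ρ_ (ro K X.J)).hom :=
  (jT_hom (rHom (K := K) (C := DTL) X)).trans (congrArg hom (jF_rHom X))

theorem zmul_unit (i : ZMod 2) (h : i + (0 : ZMod 2) = i) : (ρ_ (ro K (kw i))).inv ≫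
    (ro K (kw i) ◁ io K 0 0 Nat.cast_zero : ro K (kw i) ⊗ 𝟙_ _ ⟶ ro K (kw i) ⊗ ro K (kw 0)) ≫
      zm K i 0 i h = 𝟙 _ := by
  refine ro_ext_kirby fun n hn => ?_
  refine right_unit_aux (M := Tot K (DTLInd K)) ((io_zm h n 0 hn Nat.cast_zero hn).trans ?_)
  exact congrArg (fun t => t ≫ io K n i hn) (jT_right (BWord.pow () n))

theorem jFuse_assoc (a b d : ℕ) : (α_ (ro K (BWord.pow () a).J) (ro K (BWord.pow () b).J)
    (ro K (BWord.pow () d).J)).hom ≫ ro K (BWord.pow () a).J ◁ jFuse K b d ≫ jFuse K a (b + d) =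
      jFuse K a b ▷ ro K (BWord.pow () d).J ≫ jFuse K (a + b) d ≫
        jT (castPow K (Nat.add_assoc a b d)) :=
  (jT_comp_eq (jT_assoc _ _ _) (jT_comp_eq (X := (BWord.pow () a).tensor ((BWord.pow () b).tensor
    (BWord.pow () d))) (Y := (BWord.pow () a).tensor (BWord.pow () (b + d)))
    (jT_whiskerLeft _ (X := (BWord.pow () b).tensor (BWord.pow () d)) (F K b d)) rfl)).symm.trans
  ((congrArg jT (F_assoc a b d)).trans (jT_comp_eq (X := ((BWord.pow () a).tensor
    (BWord.pow () b)).tensor (BWord.pow () d)) (Y := (BWord.pow () (a + b)).tensor (BWord.pow () d))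
    (jT_whiskerRight (X := (BWord.pow () a).tensor (BWord.pow () b)) (F K a b) _)
    (jT_comp_eq (X := (BWord.pow () (a + b)).tensor (BWord.pow () d)) (f := F K (a + b) d) rfl rfl)))

theorem zmul_assoc (i j k ij jk l : ZMod 2) (h₁ : i + j = ij) (h₂ : ij + k = l) (h₃ : j + k = jk)
    (h₄ : i + jk = l) : zm K i j ij h₁ ▷ ro K (kw k) ≫ zm K ij k l h₂ =
      (α_ (ro K (kw i)) (ro K (kw j)) (ro K (kw k))).hom ≫ ro K (kw i) ◁ zm K j k jk h₃ ≫
        zm K i jk l h₄ := by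
  refine ro_ext_kirby₃ fun a b d ha hb hd => ?_
  have hab := kirby_tensor_cast h₁ ha hb
  have hbd := kirby_tensor_cast h₃ hb hd
  refine (assoc_left_aux (M := Tot K (DTLInd K)) (io_zm h₁ a b ha hb hab)
    (io_zm h₂ (a + b) d hab hd (kirby_tensor_cast h₂ hab hd))).trans (Eq.trans ?_
    (assoc_right_aux (M := Tot K (DTLInd K)) (io_zm h₃ b d hb hd hbd)
    (io_zm h₄ a (b + d) ha hbd (kirby_tensor_cast h₄ ha hbd))).symm)
  exact assoc_aux (M := Tot K (DTLInd K)) (jFuse_assoc a b d) (castPow_io _ _ _ _)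

theorem jFuse_Z (m n : ℕ) (r : K) (hr : (-1) ^ m = r) : jFuse K m n ≫ jT (Z K (m + n)) =
    jT (Z K m) ▷ ro K (BWord.pow () n).J ≫ jFuse K m n +
      r • (ro K (BWord.pow () m).J ◁ jT (Z K n) ≫ jFuse K m n) := by
  subst hr
  refine (jT_comp_eq (X := (BWord.pow () m).tensor (BWord.pow () n)) (f := F K m n) rfl rfl).symm.trans
    ((congrArg jT (F_Z m n)).trans ((map_add _ _ _).trans (congrArg₂ (fun s t => s + t) ?_
    ((map_smul _ _ _).trans (congrArg (fun t => ((-1) ^ m : K) • t) ?_)))))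
  · exact jT_comp_eq (Y := (BWord.pow () m).tensor (BWord.pow () n)) (jT_whiskerRight _ _) rfl
  · exact jT_comp_eq (Y := (BWord.pow () m).tensor (BWord.pow () n)) (jT_whiskerLeft _ _) rfl

theorem neg_one_pow_val {m : ℕ} {i : ZMod 2} (h : (m : ZMod 2) = i) :
    (-1 : K) ^ m = (-1) ^ i.val := by
  rw [← two_mul_half h, pow_add, pow_mul, neg_one_sq, one_pow, mul_one]

theorem zmul_zdot (i j k : ZMod 2) (h : i + j = k) : zm K i j k h ≫ zy K k =
    zy K i ▷ ro K (kw j) ≫ zm K i j k h +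
      ((-1) ^ i.val : K) • (ro K (kw i) ◁ zy K j ≫ zm K i j k h) := by
  refine ro_ext_kirby₂ fun m n hm hn => ?_
  have hmn := kirby_tensor_cast h hm hn
  have h1 := jFuse_Z (K := K) m n _ (neg_one_pow_val hm)
  have h2 := io_zm (K := K) h m n hm hn hmn
  have h3 := io_zy (K := K) (m + n) k hmn
  exact @dot_aux (Tot K (DTLInd K)) category monoidal _ _ _ _ _ _ preadditive monPre K _ linear
    monLin _ _ _ _ _ _ (io_zy m i hm) (io_zy n j hn) _ _ _ h2 _ _ h3 _ h1

theorem cup_io (i j : ℕ) (p : ZMod 2) (h : ((i + 2 + j : ℕ) : ZMod 2) = p) :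
    jT (hmk (DTm.cupMid i j DTm.cup)) ≫ io K (i + 2 + j) p h = 0 := by
  have h1 : hmk (DTm.cupMid i j DTm.cup) ≫ P K (i + 2 + j) = 0 := by
    exact ((congrArg (fun t => t ≫ P K (i + 2 + j)) (hmk_cupMid i j DTm.cup)).trans
      (Category.assoc _ _ _)).trans (cupMid_P i j)
  rw [← P_io, ← Category.assoc, ← jT_comp, h1, map_zero, Limits.zero_comp]

theorem dcup_io (i j : ℕ) (p : ZMod 2) (h : ((i + 2 + j : ℕ) : ZMod 2) = p)
    (h' : ((i + j : ℕ) : ZMod 2) = p) :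
    jT (hmk (DTm.cupMid i j DTm.dcup)) ≫ io K (i + 2 + j) p h = jFuse K i j ≫ io K (i + j) p h' := by
  rw [← R_fuse_io i j p h h', hmk_cupMid, hmk_dcup, ← R_eq]
  refine Eq.trans ?_ (Category.assoc _ _ _)
  exact congrArg (fun t => t ≫ io K (i + 2 + j) p h) (jT_comp_eq (X := (BWord.pow () i).tensor
    (BWord.pow () j)) (Y := (BWord.pow () (i + 2)).tensor (BWord.pow () j))
    (jT_whiskerRight (R K i) (BWord.pow () j)) rfl)

end Relations

end DTL

end

noncomputable section

namespace DTL

open Tot GrCat GrMonCat CategoryTheory.MonoidalCategory KPre TLGen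

section Eval

attribute [local irreducible] IndC.grCat

variable {K : Type u} [Field K] [CharZero K]

/-- The images of the generators. -/
def zgen : ∀ {X Y : BWord KLetter} {d : ℤ}, KGen X Y d → Hom K (realize K X) (realize K Y) d
  | _, _, _, .old g => jF.map (DTL.mk K (.gen g))
  | _, _, _, .iota n i h => zio n i h
  | _, _, _, .mul i j k h => zmul i j k h
  | _, _, _, .kdot i => zdot i

/-- The images of expressions. -/
def zev : ∀ {X Y : BWord KLetter} {d : ℤ}, Tm K KGen X Y d → Hom K (realize K X) (realize K Y) d
  | _, _, _, .gen g => zgen g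
  | _, _, _, .idm X => GrCat.idm (realize K X)
  | _, _, _, .comp f g h => GrCat.comp (zev f) (zev g) h
  | _, _, _, .tHom f g h => GrMonCat.tHom (zev f) (zev g) h
  | _, _, _, .aHom X Y Z => GrMonCat.aHom (realize K X) (realize K Y) (realize K Z)
  | _, _, _, .aInv X Y Z => GrMonCat.aInv (realize K X) (realize K Y) (realize K Z)
  | _, _, _, .lHom X => GrMonCat.lHom (realize K X)
  | _, _, _, .lInv X => GrMonCat.lInv (realize K X)
  | _, _, _, .rHom X => GrMonCat.rHom (realize K X)
  | _, _, _, .rInv X => GrMonCat.rInv (realize K X)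
  | _, _, _, .zero X Y d => 0
  | _, _, _, .add f g => zev f + zev g
  | _, _, _, .smul a f => a • zev f

theorem jF_zero (X Y : DTL) (d : ℤ) : jF.map (0 : Hom K X Y d) = 0 := map_zero _

theorem jF_add {X Y : DTL} {d : ℤ} (f g : Hom K X Y d) : jF.map (f + g) = jF.map f + jF.map g :=
  map_add _ _ _

theorem jF_smul {X Y : DTL} {d : ℤ} (a : K) (f : Hom K X Y d) : jF.map (a • f) = a • jF.map f :=
  map_smul _ _ _

theorem zev_J {X Y : BWord Unit} {d : ℤ} (f : Tm K DGen X Y d) :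
    zev (KTm.J f) = jF.map (DTL.mk K f) := by
  induction f with
  | gen g => rfl
  | idm X => exact (jF.map_id X).symm
  | comp f g h ihf ihg =>
    exact (congrArg₂ (fun s t => GrCat.comp s t h) ihf ihg).trans
      (jF.map_comp (DTL.mk K f) (DTL.mk K g) h).symm
  | tHom f g h ihf ihg =>
    exact (congrArg₂ (fun s t => GrMonCat.tHom s t h) ihf ihg).trans
      (jF_tHom (DTL.mk K f) (DTL.mk K g) h).symm
  | aHom X Y Z => exact (jF_aHom X Y Z).symm
  | aInv X Y Z => exact (jF_aInv X Y Z).symm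
  | lHom X => exact (jF_lHom X).symm
  | lInv X => exact (jF_lInv X).symm
  | rHom X => exact (jF_rHom X).symm
  | rInv X => exact (jF_rInv X).symm
  | zero X Y d => exact (jF_zero X Y d).symm
  | add f g ihf ihg =>
    exact (congrArg₂ (fun s t => s + t) ihf ihg).trans (jF_add (DTL.mk K f) (DTL.mk K g)).symm
  | smul a f ih => exact (congrArg (fun s => a • s) ih).trans (jF_smul a (DTL.mk K f)).symm

/-- The image of an expression in the total category. -/
def zmk {X Y : BWord KLetter} {d : ℤ} (f : Tm K KGen X Y d) : ro K X ⟶ ro K Y :=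
  hom (C := DTLInd K) (zev f)

theorem zmk_comp {X Y Z : BWord KLetter} {k l m : ℤ} (f : Tm K KGen X Y k) (g : Tm K KGen Y Z l)
    (h : k + l = m) : zmk (.comp f g h) = zmk f ≫ zmk g :=
  Tot.hom_comp (C := DTLInd K) (zev f) (zev g) h

theorem zmk_tHom {X Y X' Y' : BWord KLetter} {k l m : ℤ} (f : Tm K KGen X Y k)
    (g : Tm K KGen X' Y' l) (h : k + l = m) : zmk (.tHom f g h) = zmk f ⊗ₘ zmk g :=
  hom_tHom (C := DTLInd K) (zev f) (zev g) h

theorem zmk_tHom_id {X Y : BWord KLetter} (Z : BWord KLetter) {k m : ℤ} (f : Tm K KGen X Y k)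
    (h : k + 0 = m) : zmk (.tHom f (.idm Z) h) = zmk f ▷ ro K Z :=
  hom_tHom_id (C := DTLInd K) (zev f) (realize K Z) h

theorem zmk_id_tHom {X Y : BWord KLetter} (Z : BWord KLetter) {k m : ℤ} (f : Tm K KGen X Y k)
    (h : 0 + k = m) : zmk (.tHom (.idm Z) f h) = ro K Z ◁ zmk f :=
  hom_id_tHom (C := DTLInd K) (zev f) (realize K Z) h

theorem zmk_J {X Y : BWord Unit} {d : ℤ} (f : Tm K DGen X Y d) :
    zmk (KTm.J f) = jT (hmk f) :=
  (congrArg (hom (C := DTLInd K)) (zev_J f)).trans (jT_hom (DTL.mk K f)).symm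

theorem zmk_add {X Y : BWord KLetter} {d : ℤ} (f g : Tm K KGen X Y d) :
    zmk (.add f g) = zmk f + zmk g := map_add (hom (C := DTLInd K)) _ _

theorem zmk_smul {X Y : BWord KLetter} {d : ℤ} (a : K) (f : Tm K KGen X Y d) :
    zmk (.smul a f) = a • zmk f := map_smul (hom (C := DTLInd K)) _ _

theorem zmk_comp_eq {X Y Z : BWord KLetter} {k l m : ℤ} {f : Tm K KGen X Y k}
    {g : Tm K KGen Y Z l} {h : k + l = m} {f' : ro K X ⟶ ro K Y} {g' : ro K Y ⟶ ro K Z}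
    (hf : zmk f = f') (hg : zmk g = g') : zmk (.comp f g h) = f' ≫ g' := by
  rw [zmk_comp, hf, hg]

theorem zmk_unit_mul (i : ZMod 2) (h : (0 : ZMod 2) + i = i) :
    zmk (K := K) (.comp (.lInv (kw i)) (.comp (.tHom (KTm.iota 0 0 Nat.cast_zero) (.idm (kw i))
        (by simp : -((0 : ℕ) : ℤ) + 0 = 0)) (KTm.mul 0 i i h) (add_zero 0)) (add_zero 0)) =
      zmk (.idm (kw i)) := by
  have h4 : zmk (K := K) (.tHom (KTm.iota 0 0 Nat.cast_zero) (.idm (kw i))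
        (by simp : -((0 : ℕ) : ℤ) + 0 = 0)) = io K 0 0 Nat.cast_zero ▷ ro K (kw i) :=
    zmk_tHom_id _ _ _
  have h5 := zmk_comp_eq (h := add_zero 0) h4
    (show zmk (K := K) (KTm.mul 0 i i h) = zm K 0 i i h from rfl)
  have h6 := zmk_comp_eq (h := add_zero 0)
    (show zmk (K := K) (.lInv (kw i)) = (λ_ (ro K (kw i))).inv from rfl) h5
  exact h6.trans (zunit_mul i h)

theorem zmk_mul_unit (i : ZMod 2) (h : i + (0 : ZMod 2) = i) :
    zmk (K := K) (.comp (.rInv (kw i)) (.comp (.tHom (.idm (kw i)) (KTm.iota 0 0 Nat.cast_zero)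
        (by simp : 0 + -((0 : ℕ) : ℤ) = 0)) (KTm.mul i 0 i h) (add_zero 0)) (add_zero 0)) =
      zmk (.idm (kw i)) := by
  have h4 : zmk (K := K) (.tHom (.idm (kw i)) (KTm.iota 0 0 Nat.cast_zero)
        (by simp : 0 + -((0 : ℕ) : ℤ) = 0)) = ro K (kw i) ◁ io K 0 0 Nat.cast_zero :=
    zmk_id_tHom _ _ _
  have h5 := zmk_comp_eq (h := add_zero 0) h4
    (show zmk (K := K) (KTm.mul i 0 i h) = zm K i 0 i h from rfl)
  have h6 := zmk_comp_eq (h := add_zero 0)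
    (show zmk (K := K) (.rInv (kw i)) = (ρ_ (ro K (kw i))).inv from rfl) h5
  exact h6.trans (zmul_unit i h)

theorem zmk_mul_assoc (i j k ij jk l : ZMod 2) (h₁ : i + j = ij) (h₂ : ij + k = l)
    (h₃ : j + k = jk) (h₄ : i + jk = l) :
    zmk (K := K) (.comp (.tHom (KTm.mul i j ij h₁) (.idm (kw k)) (add_zero 0))
      (KTm.mul ij k l h₂) (add_zero 0)) =
    zmk (.comp (.aHom (kw i) (kw j) (kw k)) (.comp (.tHom (.idm (kw i)) (KTm.mul j k jk h₃)
      (add_zero 0)) (KTm.mul i jk l h₄) (add_zero 0)) (add_zero 0)) := by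
  have h1 : zmk (K := K) (.tHom (KTm.mul i j ij h₁) (.idm (kw k)) (add_zero 0)) =
    zm K i j ij h₁ ▷ ro K (kw k) := zmk_tHom_id _ _ _
  have h2 := zmk_comp_eq (h := add_zero 0) h1
    (show zmk (K := K) (KTm.mul ij k l h₂) = zm K ij k l h₂ from rfl)
  have h3 : zmk (K := K) (.tHom (.idm (kw i)) (KTm.mul j k jk h₃) (add_zero 0)) =
    ro K (kw i) ◁ zm K j k jk h₃ := zmk_id_tHom _ _ _
  have h4 := zmk_comp_eq (h := add_zero 0) h3
    (show zmk (K := K) (KTm.mul i jk l h₄) = zm K i jk l h₄ from rfl)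
  have h5 := zmk_comp_eq (h := add_zero 0) (show zmk (K := K) (.aHom (kw i) (kw j) (kw k)) =
    (α_ (ro K (kw i)) (ro K (kw j)) (ro K (kw k))).hom from rfl) h4
  exact h2.trans ((zmul_assoc i j k ij jk l h₁ h₂ h₃ h₄).trans h5.symm)

theorem zmk_mul_kdot (i j k : ZMod 2) (h : i + j = k) :
    zmk (K := K) (.comp (KTm.mul i j k h) (KTm.kdot k) (zero_add 2)) =
    zmk (.add (.comp (.tHom (KTm.kdot i) (.idm (kw j)) (add_zero 2)) (KTm.mul i j k h)
      (add_zero 2)) (.smul ((-1) ^ i.val) (.comp (.tHom (.idm (kw i)) (KTm.kdot j) (zero_add 2))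
      (KTm.mul i j k h) (add_zero 2)))) := by
  have h0 : zmk (K := K) (KTm.mul i j k h) = zm K i j k h := rfl
  have h1 : zmk (K := K) (.tHom (KTm.kdot i) (.idm (kw j)) (add_zero 2)) =
    zy K i ▷ ro K (kw j) := zmk_tHom_id _ _ _
  have h2 := zmk_comp_eq (h := add_zero 2) h1 h0
  have h3 : zmk (K := K) (.tHom (.idm (kw i)) (KTm.kdot j) (zero_add 2)) =
    ro K (kw i) ◁ zy K j := zmk_id_tHom _ _ _
  have h4 := zmk_comp_eq (h := add_zero 2) h3 h0
  have h5 := zmk_comp_eq (h := zero_add 2) h0 (show zmk (K := K) (KTm.kdot k) = zy K k from rfl)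
  rw [zmk_add, zmk_smul, h2, h4, h5]
  exact zmul_zdot i j k h

theorem zmk_iota_mul (m n : ℕ) (i j k : ZMod 2) (hm : (m : ZMod 2) = i) (hn : (n : ZMod 2) = j)
    (h : i + j = k) (hmn : ((m + n : ℕ) : ZMod 2) = k) :
    zmk (K := K) (.comp (.tHom (KTm.iota m i hm) (KTm.iota n j hn) rfl) (KTm.mul i j k h) rfl) =
    zmk (.comp (KTm.J (DTm.fuse m n)) (KTm.iota (m + n) k hmn)
      (by push_cast; ring : 0 + -((m + n : ℕ) : ℤ) = -(m : ℤ) + -(n : ℤ) + 0)) := by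
  have h1 : zmk (K := K) (.tHom (KTm.iota m i hm) (KTm.iota n j hn) rfl) =
    io K m i hm ⊗ₘ io K n j hn := zmk_tHom _ _ _
  have h2 := zmk_comp_eq (h := rfl) h1
    (show zmk (K := K) (KTm.mul i j k h) = zm K i j k h from rfl)
  have h3 : zmk (KTm.J (K := K) (DTm.fuse m n)) = jFuse K m n := zmk_J _
  have h4 : zmk (K := K) (KTm.iota (m + n) k hmn) = io K (m + n) k hmn := rfl
  have h5 := zmk_comp_eq
    (h := (by push_cast; ring : 0 + -((m + n : ℕ) : ℤ) = -(m : ℤ) + -(n : ℤ) + 0)) h3 h4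
  exact h2.trans ((io_zm h m n hm hn hmn).trans h5.symm)

theorem zmk_dcup_iota (i j : ℕ) (p : ZMod 2) (h : ((i + 2 + j : ℕ) : ZMod 2) = p)
    (h' : ((i + j : ℕ) : ZMod 2) = p) :
    zmk (K := K) (.comp (KTm.J (DTm.cupMid i j DTm.dcup)) (KTm.iota (i + 2 + j) p h)
      (by push_cast; ring : 2 + -((i + 2 + j : ℕ) : ℤ) = 0 + -((i + j : ℕ) : ℤ))) =
    zmk (.comp (KTm.J (DTm.fuse i j)) (KTm.iota (i + j) p h') rfl) := by
  have h1 : zmk (KTm.J (K := K) (DTm.cupMid i j DTm.dcup)) =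
    jT (hmk (DTm.cupMid i j DTm.dcup)) := zmk_J _
  have h2 : zmk (K := K) (KTm.iota (i + 2 + j) p h) = io K (i + 2 + j) p h := rfl
  have h3 : zmk (KTm.J (K := K) (DTm.fuse i j)) = jFuse K i j := zmk_J _
  have h4 : zmk (K := K) (KTm.iota (i + j) p h') = io K (i + j) p h' := rfl
  have h5 := zmk_comp_eq
    (h := (by push_cast; ring : 2 + -((i + 2 + j : ℕ) : ℤ) = 0 + -((i + j : ℕ) : ℤ))) h1 h2
  have h6 := zmk_comp_eq (h := rfl) h3 h4
  exact h5.trans ((dcup_io i j p h h').trans h6.symm)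

theorem zmk_rel {X Y : BWord KLetter} {d : ℤ} {f g : Tm K KGen X Y d} (h : KRel K f g) :
    zmk f = zmk g := by
  cases h with
  | old h => rw [zmk_J, zmk_J, hmk_eq h]
  | unit_mul i h => exact zmk_unit_mul i h
  | mul_unit i h => exact zmk_mul_unit i h
  | mul_assoc i j k ij jk l h₁ h₂ h₃ h₄ => exact zmk_mul_assoc i j k ij jk l h₁ h₂ h₃ h₄
  | mul_kdot i j k h => exact zmk_mul_kdot i j k h
  | iota_kdot n i h =>
    have h1 : zmk (K := K) (KTm.iota n i h) = io K n i h := rfl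
    exact (zmk_comp_eq h1 rfl).trans ((io_zy n i h).trans (zmk_comp_eq (zmk_J _) h1).symm)
  | cup_iota i j p h =>
    exact (zmk_comp_eq (zmk_J _) rfl).trans ((cup_io i j p h).trans
      (map_zero (hom (C := DTLInd K))).symm)
  | dcup_iota i j p h h' =>
    exact zmk_dcup_iota i j p h h'
  | iota_mul m n i j k hm hn h hmn =>
    exact zmk_iota_mul m n i j k hm hn h hmn

theorem zev_rel {X Y : BWord KLetter} {d : ℤ} {f g : Tm K KGen X Y d} (h : TmRel (KRel K) f g) :
    zev f = zev g := by
  induction h with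
  | rel h => exact hom_inj (C := DTLInd K) (zmk_rel h)
  | refl f => rfl
  | symm _ ih => exact ih.symm
  | trans _ _ ih ih' => exact ih.trans ih'
  | comp_congr h _ _ ih ih' => exact congrArg₂ (fun s t => GrCat.comp s t h) ih ih'
  | tHom_congr h _ _ ih ih' => exact congrArg₂ (fun s t => GrMonCat.tHom s t h) ih ih'
  | add_congr _ _ ih ih' => exact congrArg₂ (fun s t => s + t) ih ih'
  | smul_congr a _ ih => exact congrArg (fun s => a • s) ih
  | add_assoc f g p => exact _root_.add_assoc _ _ _
  | add_comm f g => exact _root_.add_comm _ _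
  | zero_add f => exact _root_.zero_add _
  | neg_add f =>
    change (-1 : K) • zev f + zev f = 0
    rw [neg_one_smul, neg_add_cancel]
  | smul_add a f g => exact _root_.smul_add _ _ _
  | add_smul a b f => exact _root_.add_smul _ _ _
  | mul_smul a b f => exact (smul_smul _ _ _).symm
  | one_smul f => exact _root_.one_smul _ _
  | add_comp f f' g h => exact GrCat.add_comp _ _ _ _
  | smul_comp a f g h => exact GrCat.smul_comp _ _ _ _
  | comp_add f g g' h => exact GrCat.comp_add _ _ _ _
  | comp_smul a f g h => exact GrCat.comp_smul _ _ _ _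
  | add_tHom f f' g h => exact GrMonCat.add_tHom _ _ _ _
  | smul_tHom a f g h => exact GrMonCat.smul_tHom _ _ _ _
  | tHom_add f g g' h => exact GrMonCat.tHom_add _ _ _ _
  | tHom_smul a f g h => exact GrMonCat.tHom_smul _ _ _ _
  | id_comp f h => exact GrCat.id_comp _ _
  | comp_id f h => exact GrCat.comp_id _ _
  | assoc f g p h₁ h₂ h₃ h₄ => exact GrCat.assoc _ _ _ _ _ _ _
  | tHom_id X Y h => exact GrMonCat.tHom_id _ _ _
  | tHom_comp f g f' g' h h' h₁ h₂ h₃ h₄ => exact GrMonCat.tHom_comp _ _ _ _ _ _ _ _ _ _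
  | aHom_aInv X Y Z h => exact GrMonCat.aHom_aInv _ _ _ _
  | aInv_aHom X Y Z h => exact GrMonCat.aInv_aHom _ _ _ _
  | lHom_lInv X h => exact GrMonCat.lHom_lInv _ _
  | lInv_lHom X h => exact GrMonCat.lInv_lHom _ _
  | rHom_rInv X h => exact GrMonCat.rHom_rInv _ _
  | rInv_rHom X h => exact GrMonCat.rInv_rHom _ _
  | aHom_nat f g p h₁ h₂ h₃ h₄ h₅ h₆ => exact GrMonCat.aHom_nat _ _ _ _ _ _ _ _ _
  | lHom_nat f h₁ h₂ => exact GrMonCat.lHom_nat _ _ _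
  | rHom_nat f h₁ h₂ => exact GrMonCat.rHom_nat _ _ _
  | pentagon W X Y Z h => exact GrMonCat.pentagon _ _ _ _ _
  | triangle X Y h => exact GrMonCat.triangle _ _ _

/-- The monoidal functor from `KdTL'` to the ind-completion. -/
def phi : GrFunctor K (C := KPre) (realize K) where
  map {X Y d} :=
    { toFun := Quot.lift zev fun _ _ h => zev_rel h
      map_add' := by
        rintro ⟨f⟩ ⟨g⟩
        rfl
      map_smul' := by
        rintro a ⟨f⟩
        rfl }
  map_id X := rfl
  map_comp := by
    rintro X Y Z k l m ⟨f⟩ ⟨g⟩ h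
    rfl

theorem phi_Jm {X Y : DTL} {d : ℤ} (f : Hom K X Y d) : phi.map (Jm f) = jF.map f := by
  obtain ⟨f⟩ := f
  exact zev_J f

end Eval

end DTL

end

noncomputable section

namespace Kar

open GrCat GrMonCat

variable {K : Type u'} [Field K] {C : Type u} [GrMonCat.{v} K C]

theorem ofF_proj {A B : Kar K C} {d : ℤ} (f : Hom K A.X B.X d)
    (hf : comp f B.p (add_zero d) = comp (comp A.p f (zero_add d)) B.p (add_zero d)) :
    comp (ofF.map f) (proj B) (add_zero d) = comp (proj A) (trunc f) (zero_add d) :=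
  Subtype.ext (by
    rw [comp_val, comp_val, proj_val, proj_val, ofF_val, hf]
    exact (trunc f).2.1.symm)

theorem ofF_proj_tensor {A B D : Kar K C} {d : ℤ} (f : Hom K (GrMonCat.tObj K A.X B.X) D.X d)
    (hf : comp f D.p (add_zero d) =
      comp (comp (GrMonCat.tHom A.p B.p (add_zero 0)) f (zero_add d)) D.p (add_zero d)) :
    comp (ofF.map f) (proj D) (add_zero d) =
      comp (comp (ofMuInv A.X B.X) (GrMonCat.tHom (proj A) (proj B) (add_zero 0)) (add_zero 0))
        (trunc (A := tObj A B) (B := D) f) (zero_add d) :=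
  Subtype.ext (by
    rw [comp_val, comp_val, comp_val, proj_val, ofF_val, ofMuInv_val, tHom_val, proj_val, proj_val,
      hf]
    refine (trunc (A := tObj A B) (B := D) f).2.1.symm.trans ?_
    exact congrArg (fun t => comp t (trunc (A := tObj A B) (B := D) f).1 (zero_add d))
      (GrCat.id_comp _ _).symm)

end Kar

namespace MatCat

open GrCat Tot CategoryTheory.MonoidalCategory

variable {K : Type u'} [Field K] {C : Type u} [GrMonCat.{v} K C]

theorem singleF_proj {A B : Kar K C} {d : ℤ} (f : Hom K A.X B.X d)
    (hf : comp f B.p (add_zero d) = comp (comp A.p f (zero_add d)) B.p (add_zero d)) {k l a b e m : ℤ}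
    (h₁ : 0 = a + 0 - l) (h₂ : 0 = b + 0 - k) (h₃ : d = e + k - l) (h : d + a = m) (h' : b + e = m) :
    comp ((singleF (K := K)).map (Kar.ofF.map f)) (singleHom (k := 0) (l := l) (Kar.proj B) h₁) h =
      comp (singleHom (k := 0) (l := k) (Kar.proj A) h₂) (singleHom (Kar.trunc f) h₃) h' := by
  rw [single_comp _ _ _ _ h' (zero_add d) (by omega), ← Kar.ofF_proj f hf]
  exact single_comp _ _ _ _ h (add_zero d) (by omega)

theorem singleF_proj_tensor {A B D : Kar K C} {d : ℤ} (f : Hom K (GrMonCat.tObj K A.X B.X) D.X d)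
    (hf : comp f D.p (add_zero d) =
      comp (comp (GrMonCat.tHom A.p B.p (add_zero 0)) f (zero_add d)) D.p (add_zero d))
    {k l p a b c q e m : ℤ} (h₁ : 0 = a + 0 - l) (h₂ : 0 = b + 0 - k) (h₃ : 0 = c + 0 - p)
    (hbc : b + c = q) (h₄ : d = e + (k + p) - l) (h : d + a = m) (h' : q + e = m) :
    comp ((singleF (K := K)).map (Kar.ofF.map f)) (singleHom (k := 0) (l := l) (Kar.proj D) h₁) h =
      comp (comp (comp ((singleF (K := K)).map (Kar.ofMuInv A.X B.X)) (singleMuInv _ _) (add_zero 0))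
        (GrMonCat.tHom (singleHom (k := 0) (l := k) (Kar.proj A) h₂)
          (singleHom (k := 0) (l := p) (Kar.proj B) h₃) hbc) (zero_add q))
        (fun _ _ => dcast h₄ (Kar.trunc (A := Kar.tObj A B) (B := D) f) :
          Hom K (MatCat.tObj K (single k A) (single p B)) (single l D) e) h' := by
  have h5 := congrArg (hom (C := Kar K C)) (Kar.ofF_proj_tensor f hf)
  refine ent_ext fun i j => ?_
  rw [ent_comp (B := single 0 (Kar.of K _)), ent_comp (B := MatCat.tObj K (single k A) (single p B)),
    ent_comp (B := MatCat.tObj K (single 0 (Kar.of K A.X)) (single 0 (Kar.of K B.X))),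
    ent_comp (B := single 0 (Kar.tObj (Kar.of K A.X) (Kar.of K B.X))), ent_tHom, ent_singleF, ent_singleF, ent_singleMuInv,
    ent_single, ent_single, ent_single]
  refine (Tot.hom_comp (C := Kar K C) _ _ _).symm.trans (h5.trans ?_)
  refine (Tot.hom_comp (C := Kar K C) _ _ _).trans (congrArg₂ (fun s t => s ≫ t) ?_
    (hom_dcast _ _).symm)
  refine (Tot.hom_comp (C := Kar K C) _ _ _).trans (congrArg₂ (fun s t => s ≫ t) ?_
    (hom_tHom (C := Kar K C) _ _ _))
  exact (Category.comp_id _).symm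

end MatCat

namespace DTL

open Tot GrCat GrMonCat CategoryTheory.MonoidalCategory KPre IndC.Colim

section Values

variable {K : Type u} [Field K] [CharZero K]

theorem val_eq_of_inI_comp {S : KPre} {β : DTLInd K} {d m : ℤ} (f : Hom K (realize K S) β d)
    (s : (realize K S).I) (h : deg S (lev K S s) + d = m)
    (x : IndC.Colim ((realize K S).obj s) β d)
    (hx : comp (inI S s) f h = up (pre h (ret S s) x)) : f.1 s = x := by
  rw [inI_comp] at hx
  have h2 := congrArg (pre (by omega : -deg S (lev K S s) + m = d) (sec S s)) (up_injective hx)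
  rw [pre_pre _ _ (neg_add_cancel _) (zero_add d), pre_pre _ _ (neg_add_cancel _) (zero_add d),
    sec_ret, pre_id, pre_id] at h2
  exact h2

theorem jF_inI_eq {S T : KPre} {s : (realize K S).I} {t : (realize K T).I} {d e m : ℤ}
    (f : Hom K (dom S (lev K S s)) (dom T (lev K T t)) d)
    (x : Hom K ((realize K S).obj s) ((realize K T).obj t) e)
    (h : d + deg T (lev K T t) = m) (h' : deg S (lev K S s) + e = m)
    (hx : comp (E f) (ret T t) h = comp (ret S s) x h') :
    comp (jF.map f) (inI T t) h = up (pre h' (ret S s) (of t x)) := by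
  rw [inI, jF_up, pre_of, pre_of, hx]

theorem z_jw (n : ℕ) : comp (z K n) (jw K n) (add_zero 2) =
    comp (comp (jw K n) (z K n) (zero_add 2)) (jw K n) (add_zero 2) := by
  refine hom_inj (K := K) (C := DTL) ?_
  have h1 : hom (K := K) (C := DTL) (comp (z K n) (jw K n) (add_zero 2)) = Z K n ≫ P K n :=
    Tot.hom_comp (C := DTL) _ _ _
  have h2 : hom (K := K) (C := DTL) (comp (comp (jw K n) (z K n) (zero_add 2)) (jw K n)
      (add_zero 2)) = (P K n ≫ Z K n) ≫ P K n :=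
    (Tot.hom_comp (C := DTL) _ _ _).trans
      (congrArg (fun t => t ≫ P K n) (Tot.hom_comp (C := DTL) _ _ _))
  rw [h1, h2, P_Z, Category.assoc, P_idem]

theorem fuse_jw {m n p : ℕ} (h : m + n = p) : comp (fuse K h) (jw K p) (add_zero 0) =
    comp (comp (tHom (jw K m) (jw K n) (add_zero 0)) (fuse K h) (zero_add 0)) (jw K p)
      (add_zero 0) := by
  subst h
  refine hom_inj (K := K) (C := DTL) ?_
  have h1 : hom (K := K) (C := DTL) (comp (fuse K (rfl : m + n = m + n)) (jw K (m + n))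
    (add_zero 0)) = F K m n ≫ P K (m + n) := Tot.hom_comp (C := DTL) _ _ _
  have h2 : hom (K := K) (C := DTL) (comp (comp (tHom (jw K m) (jw K n) (add_zero 0))
      (fuse K (rfl : m + n = m + n)) (zero_add 0)) (jw K (m + n)) (add_zero 0)) =
      ((P K m ⊗ₘ P K n) ≫ F K m n) ≫ P K (m + n) :=
    (Tot.hom_comp (C := DTL) _ _ _).trans
      (congrArg (fun t => t ≫ P K (m + n)) ((Tot.hom_comp (C := DTL) _ _ _).trans
      (congrArg (fun t => t ≫ F K m n) (hom_tHom (C := DTL) _ _ _))))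
  rw [h1, h2, MonoidalCategory.tensorHom_def, Category.assoc, Category.assoc, P_F_right, P_F_left]

theorem kdotAt_eq (i : ZMod 2) (s : ℕ) (h) :
    comp (jF.map (z K (i.val + 2 * s))) (inI (K := K) (.of (.κ i)) s) h =
      up (pre (add_comm _ _) (ret (.of (.κ i)) s) (kdotAt K i s)) :=
  jF_inI_eq (S := .of (.κ i)) (T := .of (.κ i)) (s := s) (t := s) (z K (i.val + 2 * s)) _ _ _
    (MatCat.singleF_proj (A := sym K _) (B := sym K _) _ (z_jw _) _ _ _ _ _)

theorem E_fuse_ret (i j k : ZMod 2) {n n' s : ℕ} (hs : i.val + 2 * n + (j.val + 2 * n') = k.val + 2 * s)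
    {m : ℤ} (h : 0 + -((k.val + 2 * s : ℕ) : ℤ) = m)
    (h' : -((i.val + 2 * n : ℕ) : ℤ) + -((j.val + 2 * n' : ℕ) : ℤ) + 0 = m)
    (hd : (0 : ℤ) = 0 + (-((i.val + 2 * n : ℕ) : ℤ) + -((j.val + 2 * n' : ℕ) : ℤ)) -
      -((k.val + 2 * s : ℕ) : ℤ)) :
    comp (E (fuse K hs)) (ret (.of (.κ k)) s) h =
      comp (ret (.tensor (.of (.κ i)) (.of (.κ j))) (n, n')) (fun _ _ => dcast hd
        (Kar.trunc (A := Kar.tObj (sym K (i.val + 2 * n)) (sym K (j.val + 2 * n')))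
        (B := sym K (k.val + 2 * s)) (fuse K hs)) : Hom K (MatCat.tObj K (stage K (i.val + 2 * n))
          (stage K (j.val + 2 * n'))) (stage K (k.val + 2 * s)) 0) h' :=
  MatCat.singleF_proj_tensor (A := sym K (i.val + 2 * n)) (B := sym K (j.val + 2 * n'))
    (D := sym K (k.val + 2 * s)) (fuse K hs) (fuse_jw hs) _ _ _ rfl hd h h'

theorem mulAt_eq (i j k : ZMod 2) {n n' s : ℕ} (hs : i.val + 2 * n + (j.val + 2 * n') = k.val + 2 * s)
    {m : ℤ} (h : 0 + -((k.val + 2 * s : ℕ) : ℤ) = m)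
    (h' : -((i.val + 2 * n : ℕ) : ℤ) + -((j.val + 2 * n' : ℕ) : ℤ) + 0 = m) :
    comp (jF.map (fuse K hs)) (inI (K := K) (.of (.κ k)) s) (m := m) h =
      up (pre h' (ret (.tensor (.of (.κ i)) (.of (.κ j))) (n, n')) (mulAt K i j k hs)) := by
  have h1 := (jF_up (β := kirby K k) (fuse K hs) (of s (ret (.of (.κ k)) s)) h).trans
    (congrArg up (pre_of (β := kirby K k) h (E (fuse K hs)) s (ret (.of (.κ k)) s)))
  refine h1.trans (congrArg up ?_)
  have h3 := E_fuse_ret (K := K) i j k hs h h' (by rw [← hs]; push_cast; ring)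
  refine (congrArg (fun t => of (β := kirby K k) s t) h3).trans ?_
  exact (pre_of (β := kirby K k) h' (ret (K := K) (.tensor (.of (.κ i)) (.of (.κ j))) (n, n')) s _).symm

theorem io_inI (i : ZMod 2) (s : ℕ) : inI (K := K) (.of (.κ i)) s =
    comp (can K (cpow (i.val + 2 * s))) (jwIn K i s) (zero_add _) := rfl

end Values

end DTL

end

noncomputable section

namespace DTL

open Tot GrCat GrMonCat CategoryTheory.MonoidalCategory KPre TLGen

section PhiValues

attribute [local irreducible] IndC.grCat

variable {K : Type u} [Field K] [CharZero K]

theorem hom_fuse_io {m n p : ℕ} (h : m + n = p) (k : ZMod 2) (hp : (p : ZMod 2) = k)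
    (hp' : ((m + n : ℕ) : ZMod 2) = k) :
    (hom (C := DTLInd K) (jF.map (fuse K h)) : ro K ((BWord.pow () m).tensor (BWord.pow () n)).J ⟶
      ro K (BWord.pow () p).J) ≫ io K p k hp = jFuse K m n ≫ io K (m + n) k hp' := by
  subst h
  exact congrArg (fun t => t ≫ io K (m + n) k hp')
    (jT_hom (fuse K (rfl : m + n = m + n))).symm

theorem inI_zmul (i j k : ZMod 2) (h : i + j = k) {n n' s : ℕ}
    (hs : i.val + 2 * n + (j.val + 2 * n') = k.val + 2 * s) {m : ℤ}
    (e : -((i.val + 2 * n : ℕ) : ℤ) + -((j.val + 2 * n' : ℕ) : ℤ) + 0 = m)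
    (e' : 0 + -((k.val + 2 * s : ℕ) : ℤ) = m) :
    GrCat.comp (inI (K := K) (.tensor (kw i) (kw j)) (n, n')) (zmul i j k h) e =
      GrCat.comp (jF.map (fuse K hs)) (inI (K := K) (.of (.κ k)) s) e' := by
  refine hom_inj (C := DTLInd K) ?_
  have h1 := (hom_inI_tensor (kw i) (kw j) n n').trans (congrArg₂ (fun t u => t ⊗ₘ u)
    (io_eq (K := K) i n) (io_eq (K := K) j n'))
  have h2 := io_zm (K := K) h _ _ (lev K (.of (.κ i)) n).2 (lev K (.of (.κ j)) n').2
    (kirby_tensor_cast h (lev K (.of (.κ i)) n).2 (lev K (.of (.κ j)) n').2)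
  have h3 := hom_fuse_io (K := K) hs k (lev K (.of (.κ k)) s).2
    (kirby_tensor_cast h (lev K (.of (.κ i)) n).2 (lev K (.of (.κ j)) n').2)
  refine (Tot.hom_comp (C := DTLInd K) _ _ _).trans
    ((congrArg (fun t => t ≫ zm K i j k h) h1).trans (h2.trans (h3.symm.trans ?_)))
  refine Eq.trans ?_ (Tot.hom_comp (C := DTLInd K) _ _ _).symm
  exact congrArg (fun t => hom (C := DTLInd K) (jF.map (fuse K hs)) ≫ t) (io_eq k s).symm

theorem inI_zdot (i : ZMod 2) (s : ℕ) {m : ℤ} (e) (e') :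
    GrCat.comp (inI (K := K) (.of (.κ i)) s) (zdot i) (m := m) e =
      GrCat.comp (jF.map (z K (i.val + 2 * s))) (inI (K := K) (.of (.κ i)) s) e' := by
  refine hom_inj (C := DTLInd K) ?_
  refine (Tot.hom_comp (C := DTLInd K) _ _ _).trans
    ((congrArg (fun t => t ≫ zy K i) (io_eq i s)).trans ((io_zy _ i _).trans ?_))
  exact ((Tot.hom_comp (C := DTLInd K) _ _ _).trans (congrArg₂ (fun s t => s ≫ t)
    (jT_hom (z K (i.val + 2 * s))).symm (io_eq i s))).symm

end PhiValues

section IsPhi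

variable {K : Type u} [Field K] [CharZero K]

theorem isPhi_phi : IsPhi K phi where
  map_tHom := by
    rintro S T S' T' k l m ⟨f⟩ ⟨g⟩ h
    rfl
  map_aHom X Y Z := rfl
  map_lHom X := rfl
  map_rHom X := rfl
  map_J f := by
    rw [phi_Jm]
    exact jF_can f
  map_iota i s h := (zio_eq i s h).trans (io_inI i s)
  map_mul i j k h n s hs :=
    val_eq_of_inI_comp (S := .tensor (.of (.κ i)) (.of (.κ j))) (zmul i j k h) (n, n) rfl _
      ((inI_zmul i j k h hs _ (by
        change 0 + -((k.val + 2 * s : ℕ) : ℤ) =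
          -((i.val + 2 * n : ℕ) : ℤ) + -((j.val + 2 * n : ℕ) : ℤ) + 0
        rw [← hs]
        push_cast
        ring)).trans (mulAt_eq i j k hs _ _))
  map_kdot i s :=
    val_eq_of_inI_comp (S := .of (.κ i)) (zdot i) s _ _
      ((inI_zdot i s _ _).trans (kdotAt_eq i s rfl))

theorem can_cancel {X Y : DTL} {d : ℤ} {f g : Hom K (ZZ K X) (ZZ K Y) d}
    (h : comp f (can K Y) (add_zero d) = comp g (can K Y) (add_zero d)) : f = g := by
  have h1 := congrArg (fun t => comp t (canInv Y) (add_zero d)) h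
  simp only [assoc _ (can K Y) (canInv Y) (add_zero d) (add_zero d) (add_zero 0) (add_zero d),
    can_canInv, comp_id] at h1
  exact h1

/-- Morphisms out of a product of Kirby objects are determined by their diagonal components. -/
theorem hom_ext_diag {i j : ZMod 2} {β : DTLInd K} {d : ℤ}
    {f g : Hom K (tObj K (kirby K i) (kirby K j)) β d}
    (h : ∀ n : ℕ, f.1 (n, n) = g.1 (n, n)) : f = g := by
  refine IndC.hom_ext fun (s : ℕ × ℕ) => ?_
  have φ : ((s : (tObj K (kirby K i) (kirby K j)).I) ⟶
      ((max s.1 s.2, max s.1 s.2) : ℕ × ℕ)) :=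
    (homOfLE (le_max_left s.1 s.2), homOfLE (le_max_right s.1 s.2))
  exact (f.2 _ _ φ).symm.trans ((congrArg _ (h _)).trans (g.2 _ _ φ))

variable {φ : GrFunctor K (C := KPre) (realize K)}

theorem IsPhi.map_Jm (h : IsPhi K φ) {X Y : DTL} {d : ℤ} (f : Hom K X Y d) :
    φ.map (Jm f) = jF.map f := can_cancel ((h.map_J f).trans (jF_can f).symm)

theorem IsPhi.map_gen (h : IsPhi K φ) {X Y : BWord KLetter} {d : ℤ} (g : KGen X Y d) :
    φ.map (KPre.mk (.gen g)) = zgen g := by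
  cases g with
  | old g => exact h.map_Jm (DTL.mk K (.gen g))
  | iota n i hn =>
    obtain ⟨s, rfl⟩ : ∃ s, n = i.val + 2 * s := ⟨_, (two_mul_half hn).symm⟩
    exact (h.map_iota i s hn).trans ((zio_eq i s hn).trans (io_inI i s)).symm
  | mul i j k hk =>
    refine hom_ext_diag fun n => ?_
    have hs := (two_mul_half (kirby_tensor_cast hk (lev K (.of (.κ i)) n).2
      (lev K (.of (.κ j)) n).2)).symm
    exact (h.map_mul i j k hk n _ hs).trans (isPhi_phi.map_mul i j k hk n _ hs).symm
  | kdot i =>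
    exact IndC.hom_ext fun s => (h.map_kdot i s).trans (isPhi_phi.map_kdot i s).symm

theorem map_map_zero (φ : GrFunctor K (C := KPre) (realize K)) (X Y : KPre) (d : ℤ) :
    φ.map (0 : Hom K X Y d) = 0 := map_zero _

theorem map_map_add (φ : GrFunctor K (C := KPre) (realize K)) {X Y : KPre} {d : ℤ}
    (f g : Hom K X Y d) : φ.map (f + g) = φ.map f + φ.map g := map_add _ _ _

theorem map_map_smul (φ : GrFunctor K (C := KPre) (realize K)) {X Y : KPre} {d : ℤ} (a : K)
    (f : Hom K X Y d) : φ.map (a • f) = a • φ.map f := map_smul _ _ _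

theorem IsPhi.map_mk (h : IsPhi K φ) {X Y : BWord KLetter} {d : ℤ} (f : Tm K KGen X Y d) :
    φ.map (KPre.mk f) = zev f := by
  induction f with
  | gen g => exact h.map_gen g
  | idm X => exact φ.map_id X
  | comp f g e ihf ihg =>
    exact (φ.map_comp (KPre.mk f) (KPre.mk g) e).trans
      (congrArg₂ (fun s t => GrCat.comp s t e) ihf ihg)
  | tHom f g e ihf ihg =>
    exact (h.map_tHom (KPre.mk f) (KPre.mk g) e).trans
      (congrArg₂ (fun s t => GrMonCat.tHom s t e) ihf ihg)
  | aHom X Y Z => exact h.map_aHom X Y Z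
  | aInv X Y Z => exact map_inv_eq φ _ _ (aInv_aHom (C := KPre) X Y Z _) _ (h.map_aHom X Y Z) _ (aHom_aInv _ _ _ _)
  | lHom X => exact h.map_lHom X
  | lInv X => exact map_inv_eq φ _ _ (lInv_lHom (C := KPre) X _) _ (h.map_lHom X) _ (lHom_lInv _ _)
  | rHom X => exact h.map_rHom X
  | rInv X => exact map_inv_eq φ _ _ (rInv_rHom (C := KPre) X _) _ (h.map_rHom X) _ (rHom_rInv _ _)
  | zero X Y d => exact map_map_zero φ X Y d
  | add f g ihf ihg =>
    exact (map_map_add φ (KPre.mk f) (KPre.mk g)).trans (congrArg₂ (fun s t => s + t) ihf ihg)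
  | smul a f ih =>
    exact (map_map_smul φ a (KPre.mk f)).trans (congrArg (fun s => a • s) ih)

theorem IsPhi.eq_phi (h : IsPhi K φ) : φ = phi := by
  have h1 : ∀ {X Y : KPre} {d : ℤ} (f : Hom K X Y d), φ.map f = phi.map f := by
    rintro X Y d ⟨f⟩
    exact h.map_mk f
  obtain ⟨m, h2, h3⟩ := φ
  have h4 : @m = @phi.map := by
    funext X Y d
    exact LinearMap.ext h1
  subst h4
  rfl

end IsPhi

end DTL

end

noncomputable section

namespace DTL

open Tot GrCat GrMonCat CategoryTheory.MonoidalCategory KPre TLGen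

variable {K : Type u} [Field K] [CharZero K]

theorem component_Jt_comp {X Y : DTL} {T : KPre} {l m k : ℤ} (D : ob K X ⟶ ob K Y)
    (p : Hom K (J Y) T l) (h : m + l = k) :
    component (C := KPre) k (Jt D ≫ hom (C := KPre) p) =
      comp (Jm (component (K := K) (C := DTL) m D)) p h := by
  induction D using hom_ind with
  | h0 =>
    have h1 : Jt (0 : ob K X ⟶ ob K Y) ≫ hom (C := KPre) p = 0 := by
      rw [map_zero, Limits.zero_comp]
    rw [map_zero]
    refine (congrArg (component (C := KPre) k) h1).trans
      ((LinearMap.map_zero (component (K := K) (C := KPre) (X := J X) (Y := T) k)).trans ?_)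
    exact ((congrArg (fun t => comp t p h) (map_zero (JmL X Y m))).trans
      (GrCat.zero_comp (C := KPre) p h)).symm
  | h1 d f =>
    rw [Jt_hom]
    refine (congrArg (component (C := KPre) k) (Tot.hom_comp (C := KPre) (Jm f) p rfl).symm).trans ?_
    by_cases hd : d = m
    · subst hd
      subst h
      rw [component_hom, component_hom]
    · rw [component_hom_ne _ (by omega), component_hom_ne _ (Ne.symm hd)]
      exact ((congrArg (fun t => comp t p h) (map_zero (JmL X Y m))).trans
        (GrCat.zero_comp (C := KPre) p h)).symm
  | h2 f g hf hg =>
    have h1 : Jt (f + g) ≫ hom (C := KPre) p = Jt f ≫ hom (C := KPre) p +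
        Jt g ≫ hom (C := KPre) p := by
      rw [map_add, Preadditive.add_comp]
    refine (congrArg (component (C := KPre) k) h1).trans
      ((LinearMap.map_add (component (K := K) (C := KPre) (X := J X) (Y := T) k) _ _).trans ?_)
    refine (congrArg₂ (fun s t : Hom K (J X) T k => s + t) hf hg).trans ?_
    rw [map_add (component (K := K) (C := DTL) m)]
    exact ((congrArg (fun t => comp t p h) (map_add (JmL X Y m) _ _)).trans
      (GrCat.add_comp (C := KPre) _ _ p h)).symm

/-- Every morphism with finite source factors through a canonical inclusion by a morphism of the
dotted Temperley-Lieb category. -/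
theorem exists_incl_factor {X : DTL} {T : KPre} {k : ℤ} (x : Hom K (J X) T k) :
    ∃ (b : Lev T) (e : ℤ) (D : Hom K X (dom T b) e) (h : e + deg T b = k),
      x = comp (Jm D) (incl T b) h := by
  obtain ⟨b, D, hD⟩ := jfac_all (hom (C := KPre) x)
  refine ⟨b, k - deg T b, component (K := K) (C := DTL) _ D, by omega, ?_⟩
  exact (component_hom x).symm.trans ((congrArg (component (C := KPre) k) hD).trans
    (component_Jt_comp D (incl T b) _))

theorem lev_surjective : ∀ S : KPre, Function.Surjective (lev K S)
  | .unit, _ => ⟨⟨()⟩, rfl⟩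
  | .of .c, _ => ⟨⟨()⟩, rfl⟩
  | .of (.κ i), n => ⟨(n.1 / 2 : ℕ), Subtype.ext (two_mul_half n.2)⟩
  | .tensor S T, (a, b) => by
    obtain ⟨s, hs⟩ := lev_surjective S a
    obtain ⟨t, ht⟩ := lev_surjective T b
    exact ⟨(s, t), Prod.ext hs ht⟩

theorem inI_unit (s) : inI (K := K) .unit s = GrCat.idm (C := DTLInd K) _ :=
  (GrCat.id_comp (C := DTLInd K) _ _).trans ((congrArg IndC.desc
    (IndC.idm_of (realize K .unit) s).symm).trans (IndC.desc_val (GrCat.idm (C := DTLInd K) _)))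

theorem inI_c (s) : inI (K := K) (.of .c) s = GrCat.idm (C := DTLInd K) _ :=
  (GrCat.id_comp (C := DTLInd K) _ _).trans ((congrArg IndC.desc
    (IndC.idm_of (realize K (.of .c)) s).symm).trans (IndC.desc_val (GrCat.idm (C := DTLInd K) _)))

theorem phi_incl (S : KPre) (s : (realize K S).I) : phi.map (incl S (lev K S s)) = inI S s := by
  induction S with
  | unit => exact (phi.map_id _).trans (inI_unit s).symm
  | of l =>
    cases l with
    | c => exact (phi.map_id _).trans (inI_c s).symm
    | κ i => exact zio_eq i s (lev K (.of (.κ i)) s).2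
  | tensor S T ih ih' =>
    exact (isPhi_phi.map_tHom (incl S _) (incl T _) rfl).trans
      ((congrArg₂ (fun f g => GrMonCat.tHom f g rfl) (ih s.1) (ih' s.2)).trans
      (inI_tensor S T s.1 s.2).symm)

theorem phi_factor {X : DTL} {T : KPre} {s : (realize K T).I} {e k : ℤ}
    (D : Hom K X (dom T (lev K T s)) e) (h : e + deg T (lev K T s) = k) :
    phi.map (comp (Jm D) (incl T (lev K T s)) h) = comp (jF.map D) (inI T s) h :=
  (phi.map_comp _ _ h).trans (congrArg₂ (fun f g => GrCat.comp f g h) (phi_Jm D) (phi_incl T s))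

theorem phi_eq_zero {X : DTL} {T : KPre} {k : ℤ} {x : Hom K (J X) T k} (hx : phi.map x = 0) :
    x = 0 := by
  obtain ⟨b, e, D, h, rfl⟩ := exists_incl_factor x
  obtain ⟨s, rfl⟩ := lev_surjective (K := K) T b
  rw [phi_factor] at hx
  obtain ⟨s', φ, d, w, hw, hD⟩ := exists_isTr_eq_zero hx
  have h1 : d + deg T (lev K T s') = deg T (lev K T s) := by
    have := hw.1
    omega
  have h2 := isTr_incl hw h1
  rw [← h2, ← assoc (Jm D) (Jm w) _ rfl (by omega) h1 h, ← Jm_comp, hD]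
  exact (congrArg (fun t => comp t _ _) (map_zero (JmL _ _ _))).trans
    (GrCat.zero_comp (C := KPre) _ _)

theorem phi_injective {X : DTL} {T : KPre} {k : ℤ} {x y : Hom K (J X) T k}
    (h : phi.map x = phi.map y) : x = y :=
  sub_eq_zero.1 (phi_eq_zero ((map_sub _ _ _).trans (sub_eq_zero.2 h)))

theorem phi_surjective {X : DTL} {T : KPre} {k : ℤ} (f : Hom K (ZZ K X) (realize K T) k) :
    ∃ x : Hom K (J X) T k, phi.map x = f := by
  obtain ⟨s, e, D, h, rfl⟩ := exists_inI_factor f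
  exact ⟨_, phi_factor D h⟩

end DTL

end

noncomputable section

namespace DTL

open GrCat GrMonCat KPre

section Completion

variable {K : Type u} [Field K] [CharZero K]

theorem exists_psi {S T : KPre} {d : ℤ} (F : KHom K S T d) :
    ∃ f : Hom K (realize K S) (realize K T) d, ∀ s,
      comp (inI S s) f rfl = phi.map (KHom.act (incl S (lev K S s)) F rfl) := by
  refine exists_desc (m := fun s => deg S (lev K S s) + d)
    (fun s => phi.map (KHom.act (incl S (lev K S s)) F rfl)) (fun s => rfl) ?_
  intro s s' φ e w hw h
  have h1 : e + deg S (lev K S s') = deg S (lev K S s) := by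
    have := hw.1
    omega
  refine (congrArg (fun t => comp t _ h) (phi_Jm w).symm).trans ?_
  refine (phi.map_comp _ _ h).symm.trans (congrArg phi.map ?_)
  rw [← KHom.act_comp_left F (Jm w) (incl S (lev K S s')) h1 rfl rfl h]
  exact congrArg (fun t => KHom.act t F rfl) (isTr_incl hw h1)

/-- The extension of the functor to formal sums. -/
def psi {S T : KPre} {d : ℤ} (F : KHom K S T d) : Hom K (realize K S) (realize K T) d :=
  (exists_psi F).choose

theorem inI_psi {S T : KPre} {d m : ℤ} (F : KHom K S T d) (s : (realize K S).I)
    (h : deg S (lev K S s) + d = m) :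
    comp (inI S s) (psi F) h = phi.map (KHom.act (incl S (lev K S s)) F h) := by
  subst h
  exact (exists_psi F).choose_spec s

theorem phi_psi {X : DTL} {S T : KPre} {k d m : ℤ} (x : Hom K (J X) S k) (F : KHom K S T d)
    (h : k + d = m) : comp (phi.map x) (psi F) h = phi.map (KHom.act x F h) := by
  obtain ⟨b, e, D, h1, rfl⟩ := exists_incl_factor x
  obtain ⟨s, rfl⟩ := lev_surjective (K := K) S b
  have h2 : e + (deg S (lev K S s) + d) = m := by omega
  rw [phi_factor, assoc (jF.map D) (inI S s) _ h1 h rfl h2, inI_psi,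
    KHom.act_comp_left F (Jm D) (incl S (lev K S s)) h1 h rfl h2]
  exact (congrArg (fun t => comp t _ h2) (phi_Jm D).symm).trans (phi.map_comp _ _ h2).symm

theorem psi_ext {S T : KPre} {d : ℤ} {F : KHom K S T d} {f : Hom K (realize K S) (realize K T) d}
    (h : ∀ s, comp (inI S s) f rfl = phi.map (KHom.act (incl S (lev K S s)) F rfl)) : psi F = f :=
  inI_ext fun s => (inI_psi F s rfl).trans (h s).symm

theorem psi_of {S T : KPre} {d : ℤ} (f : Hom K S T d) : psi (KHom.of f) = phi.map f :=
  psi_ext fun s => by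
    rw [KHom.act_of, phi.map_comp, phi_incl]

theorem psi_add {S T : KPre} {d : ℤ} (F G : KHom K S T d) : psi (F + G) = psi F + psi G :=
  psi_ext fun s => by
    rw [GrCat.comp_add, inI_psi, inI_psi, KHom.act_add, map_add]

theorem psi_zero {S T : KPre} {d : ℤ} : psi (0 : KHom K S T d) = 0 := by
  have h := psi_add (0 : KHom K S T d) 0
  rwa [add_zero, left_eq_add] at h

theorem psi_smul {S T : KPre} {d : ℤ} (a : K) (F : KHom K S T d) : psi (a • F) = a • psi F :=
  psi_ext fun s => by
    rw [GrCat.comp_smul, inI_psi, KHom.act_smul, map_smul]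

theorem psi_comp {S T R : KPre} {k l m : ℤ} (F : KHom K S T k) (G : KHom K T R l) (h : k + l = m) :
    psi (KHom.comp F G h) = comp (psi F) (psi G) h :=
  psi_ext fun s => by
    have h1 : deg S (lev K S s) + k + l = deg S (lev K S s) + m := by omega
    rw [← assoc (inI S s) (psi F) (psi G) rfl h1 h rfl, inI_psi, phi_psi,
      KHom.act_comp F G h _ rfl rfl h1]

theorem psi_tHom {S T S' T' : KPre} {k l m : ℤ} (F : KHom K S T k) (G : KHom K S' T' l)
    (h : k + l = m) : psi (KHom.tHom F G h) = tHom (psi F) (psi G) h := by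
  refine psi_ext fun s => ?_
  have h1 : deg S (lev K S s.1) + k + (deg S' (lev K S' s.2) + l) =
      deg S (lev K S s.1) + deg S' (lev K S' s.2) + m := by omega
  refine (congrArg (fun t => comp t (tHom (psi F) (psi G) h) rfl)
    (inI_tensor S S' s.1 s.2)).trans ?_
  refine (tHom_comp (inI S s.1) (psi F) (inI S' s.2) (psi G) rfl rfl h1 rfl h rfl).symm.trans ?_
  rw [inI_psi, inI_psi]
  refine (isPhi_phi.map_tHom _ _ h1).symm.trans (congrArg phi.map ?_)
  exact (KHom.act_tHom F G h (incl S (lev K S s.1)) (incl S' (lev K S' s.2)) rfl rfl rfl rfl h1).symm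

theorem psi_injective {S T : KPre} {d : ℤ} {F G : KHom K S T d} (h : psi F = psi G) : F = G := by
  refine KHom.ext fun a m e => ?_
  obtain ⟨s, rfl⟩ := lev_surjective (K := K) S a
  refine phi_injective ?_
  rw [← inI_psi, ← inI_psi, h]

/-- The extension to the completion as a functor. -/
def psiF : GrFunctor K (C := KdTL) (realize K) where
  map {S T d} :=
    { toFun := psi
      map_add' := psi_add
      map_smul' := psi_smul }
  map_id S := (psi_of (GrCat.idm (K := K) (C := KPre) S)).trans (phi.map_id S)
  map_comp F G h := psi_comp F G h

end Completion

section Surjective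

variable {K : Type u} [Field K] [CharZero K]

/-- A cofinal sequence of indices. -/
def diag : ∀ S : KPre, ℕ → (realize K S).I
  | .unit, _ => ⟨()⟩
  | .of .c, _ => ⟨()⟩
  | .of (.κ _), n => n
  | .tensor S T, n => (diag S n, diag T n)

theorem exists_to_diag : ∀ (S : KPre) (s : (realize K S).I),
    ∃ N, ∀ n, N ≤ n → Nonempty (s ⟶ diag S n)
  | .unit, ⟨()⟩ => ⟨0, fun _ _ => ⟨𝟙 _⟩⟩
  | .of .c, ⟨()⟩ => ⟨0, fun _ _ => ⟨𝟙 _⟩⟩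
  | .of (.κ i), (s : ℕ) => ⟨s, fun (n : ℕ) hn => ⟨(homOfLE hn : s ⟶ n)⟩⟩
  | .tensor S T, (s, t) => by
    obtain ⟨N, hN⟩ := exists_to_diag S s
    obtain ⟨M, hM⟩ := exists_to_diag T t
    refine ⟨max N M, fun n hn => ?_⟩
    obtain ⟨φ⟩ := hN n (le_of_max_le_left hn)
    obtain ⟨ψ⟩ := hM n (le_of_max_le_right hn)
    exact ⟨(φ, ψ)⟩

theorem deg_nonpos : ∀ (S : KPre) (a : Lev S), deg S a ≤ 0
  | .unit, _ => le_rfl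
  | .of .c, _ => le_rfl
  | .of (.κ i), n => neg_nonpos.2 (Int.natCast_nonneg _)
  | .tensor S T, (a, b) => add_nonpos (deg_nonpos S a) (deg_nonpos T b)

theorem deg_diag_le : ∀ (S : KPre), HasKirby S → ∀ n, deg S (lev K S (diag S n)) ≤ -n
  | .unit, h, _ => h.elim
  | .of .c, h, _ => h.elim
  | .of (.κ i), _, n => by
    change -((i.val + 2 * n : ℕ) : ℤ) ≤ -n
    omega
  | .tensor S T, h, n => by
    change deg S (lev K S (diag S n)) + deg T (lev K T (diag T n)) ≤ -n
    have h1 := deg_nonpos S (lev K S (diag S n))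
    have h2 := deg_nonpos T (lev K T (diag T n))
    rcases h with h | h
    · have := deg_diag_le S h n
      omega
    · have := deg_diag_le T h n
      omega

theorem deg_eq_zero : ∀ (S : KPre), ¬ HasKirby S → ∀ a, deg S a = 0
  | .unit, _, _ => rfl
  | .of .c, _, _ => rfl
  | .of (.κ i), h, _ => (h trivial).elim
  | .tensor S T, h, (a, b) => by
    change deg S a + deg T b = 0
    rw [deg_eq_zero S (fun h' => h (Or.inl h')), deg_eq_zero T (fun h' => h (Or.inr h')), add_zero]

/-- The components of a morphism between evaluations are compatible. -/
theorem jF_comp_inI {S : KPre} {s s' : (realize K S).I} {φ : s ⟶ s'} {e d : ℤ} {β : DTLInd K}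
    {w : Hom K (dom S (lev K S s)) (dom S (lev K S s')) e} (hw : IsTr S φ w)
    (f : Hom K (realize K S) β d) (h : e + (deg S (lev K S s') + d) = deg S (lev K S s) + d) :
    comp (jF.map w) (comp (inI S s') f rfl) h = comp (inI S s) f rfl := by
  have h1 : e + deg S (lev K S s') = deg S (lev K S s) := by omega
  rw [← assoc _ (inI S s') f h1 rfl rfl h, isTr_inI hw h1]

theorem eq_zero_of_source {S T : KPre} (hS : HasKirby S) (hT : ¬ HasKirby T) {d : ℤ}
    (f : Hom K (realize K S) (realize K T) d) : f = 0 := by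
  refine inI_ext fun s => ?_
  obtain ⟨N, hN⟩ := exists_to_diag S s
  obtain ⟨n, hn, hd⟩ : ∃ n : ℕ, N ≤ n ∧ d < n := ⟨max N (d.toNat + 1), le_max_left _ _, by omega⟩
  obtain ⟨φ⟩ := hN n hn
  obtain ⟨e, w, hw⟩ := exists_isTr (K := K) S φ
  have h1 := hw.1
  have h2 : comp (inI S (diag S n)) f rfl = 0 := by
    obtain ⟨t, k, D, h, hD⟩ := exists_inI_factor (comp (inI S (diag S n)) f rfl)
    have h3 := deg_diag_le (K := K) S hS n
    rw [deg_eq_zero T hT] at h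
    rw [← hD, eq_zero_of_neg (by omega) D, jF_zero, GrCat.zero_comp]
  rw [← jF_comp_inI hw f (by omega), h2, GrCat.comp_zero, GrCat.comp_zero]

theorem psi_surjective {S T : KPre} {d : ℤ} (f : Hom K (realize K S) (realize K T) d) :
    ∃ F : KHom K S T d, psi F = f := by
  by_cases hST : HasKirby T ∨ ¬ HasKirby S
  swap
  · have h := eq_zero_of_source (by tauto) (by tauto) f
    exact ⟨0, psi_zero.trans h.symm⟩
  choose t ht using fun s => phi_surjective (comp (inI S s) f rfl)
  have htr : ∀ {s s' : (realize K S).I} {φ : s ⟶ s'} {e : ℤ}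
      {w : Hom K (dom S (lev K S s)) (dom S (lev K S s')) e} (hw : IsTr S φ w)
      (h : e + (deg S (lev K S s') + d) = deg S (lev K S s) + d), comp (Jm w) (t s') h = t s := by
    intro s s' φ e w hw h
    refine phi_injective ?_
    rw [phi.map_comp, phi_Jm, ht, ht]
    exact jF_comp_inI hw f h
  choose G hG using fun n => exists_extension hST (lev K S (diag S n)) (t (diag S n)) rfl
  have hG' : ∀ s, ∃ N, ∀ n, N ≤ n → comp (incl S (lev K S s)) (G n) rfl = t s := by
    intro s
    obtain ⟨N, hN⟩ := exists_to_diag S s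
    refine ⟨N, fun n hn => ?_⟩
    obtain ⟨φ⟩ := hN n hn
    obtain ⟨e, w, hw⟩ := exists_isTr (K := K) S φ
    have h1 := hw.1
    have h2 : e + deg S (lev K S (diag S n)) = deg S (lev K S s) := by omega
    have h3 : e + (deg S (lev K S (diag S n)) + d) = deg S (lev K S s) + d := by omega
    rw [← isTr_incl hw h2, assoc (Jm w) _ (G n) h2 rfl rfl h3, ← hG, htr (isTr_id S _), htr hw]
  let D : ℕ → Hom K S T d := fun n => Nat.casesOn n (G 0) fun n => G (n + 1) - G n
  have hD : ∀ s n, comp (incl S (lev K S s)) (D (n + 1)) rfl =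
      comp (incl S (lev K S s)) (G (n + 1)) rfl - comp (incl S (lev K S s)) (G n) rfl :=
    fun s n => map_sub (compL rfl (incl S (lev K S s))) _ _
  have hD' : ∀ s, ∃ N, comp (incl S (lev K S s)) (G N) rfl = t s ∧
      ∀ n, N < n → comp (incl S (lev K S s)) (D n) rfl = 0 := by
    intro s
    obtain ⟨N, hN⟩ := hG' s
    refine ⟨N, hN N le_rfl, fun n hn => ?_⟩
    obtain ⟨n, rfl⟩ := Nat.exists_eq_add_of_lt hn
    rw [hD, hN _ (by omega), hN _ (by omega), sub_self]
  let F : FSum K S T d :=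
    { I := ℕ
      D := D
      fin := fun a => by
        obtain ⟨s, rfl⟩ := lev_surjective (K := K) S a
        obtain ⟨N, -, hN⟩ := hD' s
        refine (Set.finite_Iic N).subset fun n hn => ?_
        by_contra h
        exact hn (hN n (not_le.1 h)) }
  refine ⟨KHom.mk F, psi_ext fun s => ?_⟩
  obtain ⟨N, h1, h2⟩ := hD' s
  rw [← ht, ← h1]
  refine congrArg phi.map (Eq.symm ?_)
  refine (finsum_eq_sum_of_support_subset (s := Finset.range (N + 1))
    (fun n => comp (incl S (lev K S s)) (D n) rfl) fun n hn => ?_).trans ?_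
  · rw [Finset.coe_range, Set.mem_Iio]
    by_contra h
    exact hn (h2 n (by omega))
  · rw [Finset.sum_range_succ', Finset.sum_congr rfl fun n _ => hD s n, Finset.sum_range_sub
      (fun n => comp (incl S (lev K S s)) (G n) rfl)]
    exact sub_add_cancel _ _

end Surjective

end DTL

end

theorem mainTheorem5 (K : Type u) [Field K] [CharZero K] :
    (∃! φ' : GrFunctor K (C := KPre) (DTL.realize K), DTL.IsPhi K φ') ∧
    ∀ φ' : GrFunctor K (C := KPre) (DTL.realize K), DTL.IsPhi K φ' →
      ∃ φ : GrFunctor K (C := KdTL) (DTL.realize K),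
        (∀ (S T : KPre) (d : ℤ) (f : GrCat.Hom K S T d), φ.map (KHom.of f) = φ'.map f) ∧
        (∀ (S T S' T' : KdTL) (k l m : ℤ) (f : GrCat.Hom K S T k) (g : GrCat.Hom K S' T' l)
          (h : k + l = m),
          φ.map (GrMonCat.tHom f g h) = GrMonCat.tHom (φ.map f) (φ.map g) h) ∧
        ∀ (S T : KdTL) (d : ℤ), Function.Bijective
          (φ.map : GrCat.Hom K S T d → GrCat.Hom K (DTL.realize K S) (DTL.realize K T) d) := by
  refine ⟨⟨DTL.phi, DTL.isPhi_phi, fun φ' h => h.eq_phi⟩, fun φ' h => ?_⟩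
  obtain rfl := h.eq_phi
  refine ⟨DTL.psiF, fun S T d f => DTL.psi_of f, fun S T S' T' k l m f g h => DTL.psi_tHom f g h,
    fun S T d => ⟨fun F G h => DTL.psi_injective h, fun f => ?_⟩⟩
  obtain ⟨F, hF⟩ := DTL.psi_surjective f
  exact ⟨F, hF⟩
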